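/- Let $p$ be a prime, $G$ a compact $p$-adic Lie group and $H$ a closed normal subgroup such that $\Gamma=G/H$ is topologically isomorphic to $\mathbb Z_p$. Fix a topological generator $\gamma$ of $\Gamma$ and let $\theta:G\to\Gamma\to\mathbb Z_p$ be the continuous homomorphism with $\theta(\gamma)=1$. Let $\Lambda(G)=\varprojlim_U\mathbb Z_p[G/U]$ be the Iwasawa algebra, $S=\{\lambda\in\Lambda(G):\Lambda(G)/\Lambda(G)\lambda \text{ is finitely generated over }\Lambda(H)\}$, $S^*=\bigcup_{i\ge0}p^iS$, and let $\Lambda(G)_{S^*}$ be the localization. Let $L/\mathbb Q_p$ be a finite extension with valuation ring $\mathcal O$, and $\rho:G\to GL_n(\mathcal O)$ a continuous representation; view $\mathcal O^n$ (row vectors) as a right $\Lambda(G)$-module via $\rho$. Identify $\Lambda_{\mathcal O}(\Gamma)=\mathcal O[[T]]$ with $T=\gamma-1$, and let $Q_{\mathcal O}(\Gamma)$ be its quotient field. Let $A$ be a bounded complex of finitely generated projective left $\Lambda(G)$-modules such that $\Lambda(G)_{S^*}\otimes_{\Lambda(G)}A$ is acyclic, let $a:\mathbf 1\to \mathbf d_{\Lambda(G)}(A)$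 be a morphism in the Picard category of virtual objects of $\Lambda(G)$, where $\mathbf d$ is the determinant functor, and put $\mathcal L=[A,a]$. * The Bockstein maps $\mathfrak B:H^i(\mathcal O^n\otimes_{\Lambda(G)}A)\to H^{i+1}(\mathcal O^n\otimes_{\Lambda(G)}A)$ are the connecting maps of the exact sequence induced by the extension $0\to\mathbb Z_p\to E_\theta\to\mathbb Z_p\to0$, where $E_\theta=\mathbb Z_p^2$ with $G$ acting by $\begin{pmatrix}1&\theta\\0&1\end{pmatrix}$. The complex $A$ is *semisimple at* $\rho$ if the cohomology of $(H^\bullet(\mathcal O^n\otimes_{\Lambda(G)}A),\mathfrak B)$ is $\mathbb Z_p$-torsion, and *finite at* $\rho$ if $H^i(\mathcal O^n\otimes_{\Lambda(G)}A)$ is $\mathbb Z_p$-torsion for all $i$. * Let $A_\rho=(\Lambda_{\mathcal O}(\Gamma)\otimes_{\mathcal O}\mathcal O^n)\otimes_{\Lambda(G)}A$, where $g\in G$ acts on the right of $\Lambda_{\mathcal O}(\Gamma)\otimes_{\mathcal O}\mathcal O^n$ through $\rho(g)\bar g$. Its cohomology $H^{-i}(A_\rho)$ is the hyperhomology $\mathbb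 H_i(H,A(\rho^*))$. Put $r_G(A)(\rho)=\sum_i(-1)^{i+1}\dim_L\big(\mathbb H_i(H,A(\rho^*))^\Gamma\otimes_{\mathcal O}L\big)$. * If $A$ is semisimple at $\rho$, the *leading term* $\mathcal L^*(\rho)\in L^\times$ is $(-1)^{r_G(A)(\rho)}$ times the element of $L^\times=\mathrm{Aut}(\mathbf 1_L)$ given by $\mathbf 1_L\to\mathbf d_L(L^n\otimes_{\Lambda(G)}A)\to\mathbf 1_L$, where the first arrow is induced by $a$ and the second is $\mathbf d_L(L^n\otimes A)\cong\mathbf d_L(H(L^n\otimes A),0)=\mathbf d_L(H(L^n\otimes A),\mathfrak B)\cong\mathbf 1_L$. If $A$ is finite at $\rho$, this is also called the value of $\mathcal L$ at $\rho$ and denoted by $\mathcal L(\rho)$. * Let $\mathrm{ch}(\mathcal L)\in K_1(\Lambda(G)_{S^*})$ be the class of $\mathbf 1\to\mathbf d(\Lambda(G)_{S^*}\otimes A)\to\mathbf 1$, where the first arrow is induced by $a$ and the second by acyclicity. Let $f_\rho(T)\in Q_{\mathcal O}(\Gamma)^\times$ be its image under the homomorphism $K_1(\Lambda(G)_{S^*})\to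 K_1(M_n(Q_{\mathcal O}(\Gamma)))\cong Q_{\mathcal O}(\Gamma)^\times$ that is induced by $g\mapsto\rho(g)\bar g$. Let $\chi:G\to\Gamma\to\mathbb Z_p^\times$ be a continuous character of infinite order, put $c_{\chi,\gamma}=\log_p(\chi(\gamma))$, and consider the $p$-adic meromorphic function $s\mapsto f_{\mathcal L}(\rho\chi^s):=f_\rho(\chi(\gamma)^s-1)$ on $\mathbb Z_p$. Then: (i) For all $s\neq0$ in a sufficiently small neighbourhood of $0$ in $\mathbb Z_p$, the complex $A$ is finite at $\rho\chi^s$ and $\mathcal L^*(\rho\chi^s)=\mathcal L(\rho\chi^s)=f_{\mathcal L}(\rho\chi^s)$. Suppose moreover that $A$ is semisimple at $\rho$, and put $r=r_G(A)(\rho)$. Then: (ii) The function $f_{\mathcal L}(\rho\chi^s)$ has order $r$ at $s=0$, and its leading coefficient there is $c_{\chi,\gamma}^r\,\mathcal L^*(\rho)$. (iii) If $r\ge0$, then $f_{\mathcal L}(\rho\chi^s)$ is analytic at $s=0$ and $$c_{\chi,\gamma}^r\,\mathcal L^*(\rho)=\frac1{r!}\,\frac{d^r}{ds^r}f_{\mathcal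 L}(\rho\chi^s)\Big|_{s=0}.$$ -/

import Mathlib

open scoped TensorProduct Topology Manifold ContDiff PowerSeries.WithPiTopology

noncomputable section

namespace IwasawaDescent

/-! ### The Iwasawa algebra, its subalgebra `Λ(H)` and the canonical Ore set -/

section IwasawaAlgebra

variable (p : ℕ) [Fact p.Prime] (G : Type*) [Group G] [TopologicalSpace G]

/-- The projection `ℤ_p[G/U] → ℤ_p[G/V]` for open normal subgroups `U ≤ V`. -/
def transition {U V : OpenNormalSubgroup G} (h : U ≤ V) :
    MonoidAlgebra ℤ_[p] (G ⧸ U.toSubgroup) →+* MonoidAlgebra ℤ_[p] (G ⧸ V.toSubgroup) :=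
  MonoidAlgebra.mapDomainRingHom ℤ_[p]
    (QuotientGroup.map U.toSubgroup V.toSubgroup (MonoidHom.id G) h)

/-- `Λ(G) = lim_U ℤ_p[G/U]`, the limit over the open normal subgroups `U` of `G`, realised as the
ring of compatible families. -/
def iwasawaAlgebra :
    Subring (∀ U : OpenNormalSubgroup G, MonoidAlgebra ℤ_[p] (G ⧸ U.toSubgroup)) :=
  ⨅ (U : OpenNormalSubgroup G) (V : OpenNormalSubgroup G) (h : U ≤ V),
    RingHom.eqLocus
      ((transition p G h).comp
        (Pi.evalRingHom (fun W : OpenNormalSubgroup G => MonoidAlgebra ℤ_[p] (G ⧸ W.toSubgroup)) U))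
      (Pi.evalRingHom (fun W : OpenNormalSubgroup G => MonoidAlgebra ℤ_[p] (G ⧸ W.toSubgroup)) V)

/-- `Λ(G)` as a type. -/
abbrev Lam : Type _ := ↥(iwasawaAlgebra p G)

variable {G}

/-- The component `Λ(G) → ℤ_p[G/U]`. -/
def lamProj (U : OpenNormalSubgroup G) :
    Lam p G →+* MonoidAlgebra ℤ_[p] (G ⧸ U.toSubgroup) :=
  (Pi.evalRingHom (fun W : OpenNormalSubgroup G => MonoidAlgebra ℤ_[p] (G ⧸ W.toSubgroup)) U).comp
    (iwasawaAlgebra p G).subtype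

/-- `Λ(H)` as a subring of `Λ(G)`, for a closed subgroup `H` of the compact group `G`: the elements
all of whose components in `ℤ_p[G/U]` come from `ℤ_p[H]`, that is, lie in
`ℤ_p[HU/U] = ℤ_p[H/(H ∩ U)]`. -/
def lamSub (H : Subgroup G) : Subring (Lam p G) :=
  ⨅ U : OpenNormalSubgroup G,
    ((MonoidAlgebra.mapDomainRingHom ℤ_[p]
      ((QuotientGroup.mk' U.toSubgroup).comp H.subtype)).range).comap (lamProj p U)

/-- The elements `x` of a ring `R` such that the left module `R/Rx` is finitely generated over the
subring `T`. -/
def finiteOverSet {R : Type*} [Ring R] (T : Subring R) : Set R :=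
  {x | Module.Finite T (R ⧸ Submodule.span R {x})}

/-- The set `S` of all `x ∈ Λ(G)` such that `Λ(G)/Λ(G)x` is finitely generated over `Λ(H)`. -/
def oreSet (H : Subgroup G) : Set (Lam p G) := finiteOverSet (lamSub p H)

/-- `S^* = ⋃_i p^i S`. -/
def oreSetStar (H : Subgroup G) : Set (Lam p G) :=
  {x | ∃ i : ℕ, ∃ y ∈ oreSet p H, x = (p : Lam p G) ^ i * y}

/-- The continuous `ℤ_p`-linear extension to `Λ(G)` of a continuous representation `σ : G → B`
(typically `B` is a matrix ring over a profinite ring): the limit over `U` of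
the Riemann sums `∑_{c ∈ G/U} x_U(c) σ(g_c)`, with `g_c` a representative of the coset `c`. -/
def lamEval {B : Type*} [Ring B] [TopologicalSpace B] [Module ℤ_[p] B] (σ : G → B)
    (x : Lam p G) : B :=
  Filter.limUnder (Filter.atBot : Filter (OpenNormalSubgroup G)) fun U =>
    Finsupp.sum (lamProj p U x).coeff fun c z => z • σ (Quotient.out c)

end IwasawaAlgebra

/-! ### Universal localization -/

section Localization

variable {R : Type*} [Ring R]

/-- The relations that define the ring of fractions in which the elements of `S` are inverted. -/
inductive LocRel (S : Set R) : FreeAlgebra ℤ (R ⊕ S) → FreeAlgebra ℤ (R ⊕ S) → Prop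
  | add (a b : R) : LocRel S (FreeAlgebra.ι ℤ (Sum.inl (a + b)))
      (FreeAlgebra.ι ℤ (Sum.inl a) + FreeAlgebra.ι ℤ (Sum.inl b))
  | mul (a b : R) : LocRel S (FreeAlgebra.ι ℤ (Sum.inl (a * b)))
      (FreeAlgebra.ι ℤ (Sum.inl a) * FreeAlgebra.ι ℤ (Sum.inl b))
  | one : LocRel S (FreeAlgebra.ι ℤ (Sum.inl 1)) 1
  | inv_mul (s : S) : LocRel S
      (FreeAlgebra.ι ℤ (Sum.inr s) * FreeAlgebra.ι ℤ (Sum.inl (s : R))) 1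
  | mul_inv (s : S) : LocRel S
      (FreeAlgebra.ι ℤ (Sum.inl (s : R)) * FreeAlgebra.ι ℤ (Sum.inr s)) 1

/-- The localization `R_S`, the universal ring under `R` in which the elements of `S` become
invertible. For a denominator set `S` it is the ring of fractions `S⁻¹R`. -/
abbrev Loc (S : Set R) : Type _ := RingQuot (LocRel S)

/-- The canonical ring homomorphism `R → R_S`. -/
def toLoc (S : Set R) : R →+* Loc S :=
  RingHom.mk'
    { toFun := fun a => RingQuot.mkRingHom (LocRel S) (FreeAlgebra.ι ℤ (Sum.inl a))
      map_one' := by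
        rw [RingQuot.mkRingHom_rel (LocRel.one (S := S)), map_one]
      map_mul' := fun a b => by
        rw [RingQuot.mkRingHom_rel (LocRel.mul (S := S) a b), map_mul] }
    (fun a b => by
      change RingQuot.mkRingHom (LocRel S) _ = _
      rw [RingQuot.mkRingHom_rel (LocRel.add (S := S) a b), map_add]
      rfl)

end Localization

/-! ### Tensor products over a non-commutative ring -/

section BalancedTensor

variable {R S Y : Type*} [Ring R] [Ring S] [AddCommGroup Y] [Module S Y]

/-- The relations `y·r ⊗ x = y ⊗ r·x`, where `y·r` is `act r y`. -/
def balSpan (act : R → Module.End S Y) (P : Type*) [AddCommGroup P] [Module R P] :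
    Submodule S (Y ⊗[ℤ] P) :=
  Submodule.span S {t | ∃ (y : Y) (r : R) (x : P), t = (act r y) ⊗ₜ[ℤ] x - y ⊗ₜ[ℤ] (r • x)}

/-- The `S`-module `Y ⊗_R P`, for an `(S, R)`-bimodule `Y` whose right action is `act` and a left
`R`-module `P`. -/
def BalTensor (act : R → Module.End S Y) (P : Type*) [AddCommGroup P] [Module R P] : Type _ :=
  (Y ⊗[ℤ] P) ⧸ balSpan act P

instance (act : R → Module.End S Y) (P : Type*) [AddCommGroup P] [Module R P] :
    AddCommGroup (BalTensor act P) :=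
  inferInstanceAs (AddCommGroup ((Y ⊗[ℤ] P) ⧸ balSpan act P))

instance (act : R → Module.End S Y) (P : Type*) [AddCommGroup P] [Module R P] :
    Module S (BalTensor act P) :=
  inferInstanceAs (Module S ((Y ⊗[ℤ] P) ⧸ balSpan act P))

/-- The projection `Y ⊗_ℤ P → Y ⊗_R P`. -/
def BalTensor.mk (act : R → Module.End S Y) (P : Type*) [AddCommGroup P] [Module R P] :
    (Y ⊗[ℤ] P) →ₗ[S] BalTensor act P :=
  (balSpan act P).mkQ

/-- `Y ⊗_ℤ f : Y ⊗_ℤ P → Y ⊗_ℤ P'`. -/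
def preMap (S : Type*) [Ring S] (Y : Type*) [AddCommGroup Y] [Module S Y]
    {P P' : Type*} [AddCommGroup P] [Module R P] [AddCommGroup P'] [Module R P']
    (f : P →ₗ[R] P') : (Y ⊗[ℤ] P) →ₗ[S] (Y ⊗[ℤ] P') :=
  TensorProduct.AlgebraTensorModule.lTensor S Y f.toAddMonoidHom.toIntLinearMap

/-- `Y ⊗_R f : Y ⊗_R P → Y ⊗_R P'`. -/
def BalTensor.map (act : R → Module.End S Y)
    {P P' : Type*} [AddCommGroup P] [Module R P] [AddCommGroup P'] [Module R P']
    (f : P →ₗ[R] P') : BalTensor act P →ₗ[S] BalTensor act P' :=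
  Submodule.mapQ (balSpan act P) (balSpan act P') (preMap S Y f) (by
    refine Submodule.span_le.2 ?_
    rintro _ ⟨y, r, x, rfl⟩
    refine Submodule.subset_span ⟨y, r, f x, ?_⟩
    simp [preMap])

/-- `S^m`, as row vectors, with right `R`-action through `φ : R → M_m(S)`. -/
def rowAct {S : Type*} [CommRing S] {m : Type*} [Fintype m] (φ : R → Matrix m m S) :
    R → Module.End S (m → S) :=
  fun r => Matrix.vecMulLinear (φ r)

/-- `S` as an `(S, R)`-bimodule, for a ring homomorphism `j : R → S`. -/
def ringAct (j : R →+* S) : R → Module.End S S :=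
  fun r => LinearMap.toSpanSingleton S S (j r)

end BalancedTensor

/-! ### Complexes and trivializations of their determinants -/

section Complexes

open CategoryTheory

universe u v

variable {R : Type u} [Ring R]

/-- `A` belongs to `C^p(R)`: a bounded complex of finitely generated projective left modules. -/
structure IsPerfect (A : CochainComplex (ModuleCat.{v} R) ℤ) : Prop where
  finite : ∀ i, Module.Finite R (A.X i)
  projective : ∀ i, Module.Projective R (A.X i)
  bounded : ∃ N : ℤ, ∀ i, N < |i| → Subsingleton (A.X i)

variable (A : CochainComplex (ModuleCat.{v} R) ℤ)

/-- The differential `A^i → A^j` (zero unless `j = i + 1`) as a linear map. -/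
abbrev diff (i j : ℤ) : A.X i →ₗ[R] A.X j := (A.d i j).hom

/-- `A^+ ⊕ R^k`, with `A^+` the sum of the terms in even degrees. -/
abbrev EvenPart (k : ℕ) : Type _ := (DirectSum {i : ℤ // Even i} fun i => A.X i) × (Fin k → R)

/-- `A^- ⊕ R^k`, with `A^-` the sum of the terms in odd degrees. -/
abbrev OddPart (k : ℕ) : Type _ := (DirectSum {i : ℤ // Odd i} fun i => A.X i) × (Fin k → R)

/-- The differential from odd to even degrees of the sum of `A` and the acyclic complex
`R^k = R^k` (placed in an odd and the next even degree). -/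
def dOdd (k : ℕ) : OddPart A k →ₗ[R] EvenPart A k :=
  (DirectSum.toModule R {i : ℤ // Odd i} (DirectSum {i : ℤ // Even i} fun i => A.X i) fun i =>
    (DirectSum.lof R {i : ℤ // Even i} (fun i => A.X i) ⟨(i : ℤ) + 1, i.2.add_one⟩) ∘ₗ
      diff A i ((i : ℤ) + 1)).prodMap LinearMap.id

/-- The differential from even to odd degrees of the sum of `A` and the acyclic complex
`R^k = R^k` (placed in an odd and the next even degree). -/
def dEven (k : ℕ) : EvenPart A k →ₗ[R] OddPart A k :=
  (DirectSum.toModule R {i : ℤ // Even i} (DirectSum {i : ℤ // Odd i} fun i => A.X i) fun i =>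
    (DirectSum.lof R {i : ℤ // Odd i} (fun i => A.X i) ⟨(i : ℤ) + 1, i.2.add_one⟩) ∘ₗ
      diff A i ((i : ℤ) + 1)).prodMap 0

/-- A morphism `1_R → d_R(A)` in the Picard category of virtual objects of `R`.
In that category `d_R(A)` is the pair `(A^+, A^-)`, and a morphism `1_R → (P, Q)` is an element of
`K_1(R) ×^{Aut(Q ⊕ M)} Isom(Q ⊕ M, P ⊕ M)` for `M` large. As elements of `K_1(R)` are represented by
automorphisms of free modules, each morphism is the class of an isomorphism
`A^- ⊕ R^k ≅ A^+ ⊕ R^k`; we work with these representatives. -/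
structure Trivialization where
  /-- the rank of the free module that is added -/
  k : ℕ
  /-- the isomorphism that represents the morphism -/
  iso : OddPart A k ≃ₗ[R] EvenPart A k

/-- `Y ⊗_R A` is acyclic. -/
def IsAcyclicAfter {S Y : Type*} [Ring S] [AddCommGroup Y] [Module S Y]
    (act : R → Module.End S Y) : Prop :=
  ∀ (i : ℤ) (x : BalTensor act (A.X i)), BalTensor.map act (diff A i (i + 1)) x = 0 →
    ∃ w : BalTensor act (A.X (i - 1)), BalTensor.map act (diff A (i - 1) i) w = x

end Complexes

/-! ### `K_1` and the characteristic element -/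

section KOne

variable (R : Type*) [Ring R]

/-- The block sum `g ⊕ 1_k`. -/
def stab {m : ℕ} (g : (Matrix (Fin m) (Fin m) R)ˣ) (k : ℕ) : Matrix (Fin (m + k)) (Fin (m + k)) R :=
  Matrix.reindex finSumFinEquiv finSumFinEquiv (Matrix.fromBlocks g.1 0 0 1)

/-- The defining relations of `K_1(R)` on the classes of invertible matrices. -/
def kOneRel : AddSubgroup (FreeAbelianGroup (Σ m : ℕ, (Matrix (Fin m) (Fin m) R)ˣ)) :=
  AddSubgroup.closure
    ({t | ∃ (m : ℕ) (g h : (Matrix (Fin m) (Fin m) R)ˣ),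
        t = FreeAbelianGroup.of ⟨m, g * h⟩ -
          (FreeAbelianGroup.of ⟨m, g⟩ + FreeAbelianGroup.of ⟨m, h⟩)} ∪
      {t | ∃ (m k : ℕ) (g : (Matrix (Fin m) (Fin m) R)ˣ)
          (h : (Matrix (Fin (m + k)) (Fin (m + k)) R)ˣ), h.1 = stab R g k ∧
        t = FreeAbelianGroup.of ⟨m + k, h⟩ - FreeAbelianGroup.of ⟨m, g⟩})

/-- `K_1(R) = colim_m GL_m(R)^ab`, written additively. -/
abbrev KOne : Type _ := FreeAbelianGroup (Σ m : ℕ, (Matrix (Fin m) (Fin m) R)ˣ) ⧸ kOneRel R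

variable {R}

/-- The class in `K_1(R)` of an invertible matrix. -/
def KOne.of {m : ℕ} (g : (Matrix (Fin m) (Fin m) R)ˣ) : KOne R :=
  QuotientAddGroup.mk' (kOneRel R) (FreeAbelianGroup.of ⟨m, g⟩)

/-- `g` represents the automorphism `f` of the finitely generated projective module `V`: for a
presentation of `V` as a direct summand of `R^m`, with inclusion `i` and projection `q`, it is the
matrix of `f` extended by the identity on the complement. -/
def Represents {V : Type*} [AddCommGroup V] [Module R V] (f : V →ₗ[R] V)
    (g : Σ m : ℕ, (Matrix (Fin m) (Fin m) R)ˣ) : Prop :=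
  ∃ (i : V →ₗ[R] (Fin g.1 → R)) (q : (Fin g.1 → R) →ₗ[R] V), q ∘ₗ i = LinearMap.id ∧
    LinearMap.toMatrixRight' (i ∘ₗ f ∘ₗ q + (LinearMap.id - i ∘ₗ q)) = g.2.1

open Classical in
/-- The class in `K_1(R)` of an automorphism of a finitely generated projective module. -/
def KOne.ofEnd {V : Type*} [AddCommGroup V] [Module R V] (f : V →ₗ[R] V) : KOne R :=
  if h : ∃ g, Represents f g then KOne.of h.choose.2 else 0

theorem det_stab {R : Type*} [Ring R] {Q : Type*} [CommRing Q] {n m : ℕ}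
    (Ψ : R →+* Matrix (Fin n) (Fin n) Q) (g : (Matrix (Fin m) (Fin m) R)ˣ) (k : ℕ) :
    (Matrix.compRingEquiv (Fin (m + k)) (Fin n) Q (Ψ.mapMatrix (stab R g k))).det =
      (Matrix.compRingEquiv (Fin m) (Fin n) Q (Ψ.mapMatrix g.1)).det := by
  let e : (Fin m × Fin n) ⊕ (Fin k × Fin n) ≃ Fin (m + k) × Fin n :=
    (Equiv.sumProdDistrib (Fin m) (Fin k) (Fin n)).symm.trans
      (finSumFinEquiv.prodCongr (Equiv.refl _))
  rw [← Matrix.det_submatrix_equiv_self e]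
  have h : (Matrix.compRingEquiv (Fin (m + k)) (Fin n) Q (Ψ.mapMatrix (stab R g k))).submatrix e e =
      Matrix.fromBlocks (Matrix.compRingEquiv (Fin m) (Fin n) Q (Ψ.mapMatrix g.1)) 0 0 1 := by
    ext (⟨a, b⟩ | ⟨a, b⟩) (⟨c, d⟩ | ⟨c, d⟩)
    · simp [e, stab, Matrix.compRingEquiv]
    · simp [e, stab, Matrix.compRingEquiv]
    · simp [e, stab, Matrix.compRingEquiv]
    · by_cases hac : a = c
      · subst hac
        simp [e, stab, Matrix.compRingEquiv, Matrix.one_apply]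
      · simp [e, stab, Matrix.compRingEquiv, hac]
  rw [h, Matrix.det_fromBlocks_zero₂₁, Matrix.det_one, mul_one]

/-- The homomorphism `K_1(R) → K_1(M_n(Q)) ≅ K_1(Q) ≅ Q^×` induced by a ring homomorphism
`Ψ : R → M_n(Q)`, for a commutative ring `Q`. -/
def KOne.detHom {Q : Type*} [CommRing Q] {n : ℕ} (Ψ : R →+* Matrix (Fin n) (Fin n) Q) :
    KOne R →+ Additive Qˣ :=
  QuotientAddGroup.lift (kOneRel R)
    (FreeAbelianGroup.lift fun g => Additive.ofMul
      (Units.map (Matrix.detMonoidHom.comp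
        ((Matrix.compRingEquiv (Fin g.1) (Fin n) Q).toRingHom.comp Ψ.mapMatrix).toMonoidHom) g.2))
    (by
      refine (AddSubgroup.closure_le _).2 ?_
      rintro _ (⟨m, g, h, rfl⟩ | ⟨m, k, g, h, hh, rfl⟩)
      · simp
      · refine (AddMonoidHom.mem_ker).2 ?_
        rw [map_sub, FreeAbelianGroup.lift_apply_of, FreeAbelianGroup.lift_apply_of, sub_eq_zero]
        refine congrArg Additive.ofMul (Units.ext ?_)
        have := det_stab Ψ g k
        rw [← hh] at this
        exact this)

end KOne

/-! ### The acyclic trivialization and `ch` -/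

section Char

variable {R : Type*} [Ring R]

/-- A contraction of an exact `ℤ/2`-graded complex of modules. The isomorphism `δ + s` from the odd
to the even part represents the canonical trivialization of the determinant of an acyclic
complex. -/
structure Contraction {Vo Ve : Type*} [AddCommGroup Vo] [Module R Vo] [AddCommGroup Ve] [Module R Ve]
    (δo : Vo →ₗ[R] Ve) (δe : Ve →ₗ[R] Vo) where
  so : Vo →ₗ[R] Ve
  se : Ve →ₗ[R] Vo
  odd : δe ∘ₗ so + se ∘ₗ δo = LinearMap.id
  even : δo ∘ₗ se + so ∘ₗ δe = LinearMap.id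
  sq_odd : se ∘ₗ so = 0
  sq_even : so ∘ₗ se = 0

variable {A : CochainComplex (ModuleCat R) ℤ}

open Classical in
/-- For a complex `A` such that `R' ⊗_R A` is acyclic, the element `θ_{A,a}` of `K_1(R')` that
corresponds to `1 → d(R' ⊗_R A) → 1`, the first arrow induced by `a` and the second by acyclicity. -/
def theta {R' : Type*} [Ring R'] (j : R →+* R') (a : Trivialization A) : KOne R' :=
  if h : Nonempty (Contraction (BalTensor.map (ringAct j) (dOdd A a.k))
      (BalTensor.map (ringAct j) (dEven A a.k))) then
    KOne.ofEnd ((BalTensor.map (ringAct j) (dEven A a.k) + h.some.se) ∘ₗ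
      BalTensor.map (ringAct j) a.iso.toLinearMap)
  else 0

end Char

/-! ### The coefficient ring -/

section Coefficients

variable (p : ℕ) [Fact p.Prime] (L : Type*) [NormedField L] [IsUltrametricDist L]

/-- The valuation ring of `L`. -/
abbrev IntRing : Subring L := (NormedField.valuation (K := L)).integer

variable [NormedAlgebra ℚ_[p] L]

/-- The structure map `ℤ_p → O_L`. -/
def padicToInt : ℤ_[p] →+* IntRing L :=
  ((algebraMap ℚ_[p] L).comp PadicInt.Coe.ringHom).codRestrict (IntRing L) (fun x => by
    have h : ‖algebraMap ℚ_[p] L (x : ℚ_[p])‖ ≤ 1 := by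
      rw [norm_algebraMap']; exact x.2
    exact h)

instance : Algebra ℤ_[p] (IntRing L) := (padicToInt p L).toAlgebra

/-- `Q_O(Γ)`, the quotient field of `Λ_O(Γ) = O[[T]]`, where `T = γ - 1`. -/
abbrev QField : Type _ := FractionRing (PowerSeries (IntRing L))

end Coefficients

/-! ### Representations, Bockstein maps and leading terms -/

section Bockstein

variable {R S : Type*} [Ring R] [CommRing S] {m : Type*}

/-- `S^m → S^m ⊗ E_θ = S^m e_1 ⊕ S^m e_2`, the inclusion of the submodule `S^m e_1`. -/
def inclE : (m → S) →ₗ[S] (m ⊕ m → S) := LinearMap.pi (Sum.elim LinearMap.proj fun _ => 0)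

/-- `S^m ⊗ E_θ = S^m e_1 ⊕ S^m e_2 → S^m`, the projection to the coordinate at `e_2`. -/
def projE : (m ⊕ m → S) →ₗ[S] (m → S) := LinearMap.funLeft S S Sum.inr

/-- The connecting map of `0 → Y ⊗_R P → Y_E ⊗_R P → Y ⊗_R P → 0`, along a differential
`f : P → P'`, as a relation: the Bockstein map sends the class of `x` to the class of `y` if `x` has a
lift `z` to `Y_E ⊗_R P` whose image under `f` is the image of `y`. Here `Y = S^m` and
`Y_E = S^m ⊗ E_θ`, with the right actions `act` and `actE`. -/
def BockRel (act : R → Module.End S (m → S)) (actE : R → Module.End S (m ⊕ m → S))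
    {P P' : Type*} [AddCommGroup P] [Module R P] [AddCommGroup P'] [Module R P']
    (f : P →ₗ[R] P') (x : BalTensor act P) (y : BalTensor act P') : Prop :=
  ∃ (z : (m ⊕ m → S) ⊗[ℤ] P) (y' : (m → S) ⊗[ℤ] P'),
    BalTensor.mk act P (TensorProduct.AlgebraTensorModule.map projE LinearMap.id z) = x ∧
    BalTensor.mk act P' y' = y ∧
    BalTensor.mk actE P' (preMap S (m ⊕ m → S) f z) =
      BalTensor.mk actE P' (TensorProduct.AlgebraTensorModule.map inclE LinearMap.id y')

/-- Data that compute the trivialization `d(V) ≅ d(H(V), 0) = d(H(V), B) ≅ 1` for a `ℤ/2`-graded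
complex of vector spaces `V` with maps `B` on its cohomology, given as the relations `Bo`, `Be` on
cocycles, for which `(H(V), B)` is acyclic. The maps `so`, `se` split `V` as the sum of
`ker δ ∩ ker s ≅ H(V)` and an acyclic complex; `bo`, `be` are the maps `B` transported to
`ker δ ∩ ker s`, extended by zero, and `co`, `ce` contract the complex `(ker δ ∩ ker s, b)`. The
isomorphism `δ + s + b + c` from the odd to the even part, which is its own inverse, represents
the inverse trivialization `1 → d(V)`. -/
structure BockSplitting {Vo Ve : Type*} [AddCommGroup Vo] [Module S Vo] [AddCommGroup Ve] [Module S Ve]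
    (δo : Vo →ₗ[S] Ve) (δe : Ve →ₗ[S] Vo) (Bo : Vo → Ve → Prop) (Be : Ve → Vo → Prop) where
  so : Vo →ₗ[S] Ve
  se : Ve →ₗ[S] Vo
  sq_so : se ∘ₗ so = 0
  sq_se : so ∘ₗ se = 0
  δsδ_o : δo ∘ₗ se ∘ₗ δo = δo
  δsδ_e : δe ∘ₗ so ∘ₗ δe = δe
  sδs_o : so ∘ₗ δe ∘ₗ so = so
  sδs_e : se ∘ₗ δo ∘ₗ se = se
  /-- the projection of the odd part to `ker δ ∩ ker s` -/
  πo : Vo →ₗ[S] Vo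
  /-- the projection of the even part to `ker δ ∩ ker s` -/
  πe : Ve →ₗ[S] Ve
  πo_eq : πo = LinearMap.id - (δe ∘ₗ so + se ∘ₗ δo)
  πe_eq : πe = LinearMap.id - (δo ∘ₗ se + so ∘ₗ δe)
  bo : Vo →ₗ[S] Ve
  be : Ve →ₗ[S] Vo
  bo_eq : πe ∘ₗ bo ∘ₗ πo = bo
  be_eq : πo ∘ₗ be ∘ₗ πe = be
  bo_rel : ∀ x, Bo (πo x) (bo x)
  be_rel : ∀ x, Be (πe x) (be x)
  co : Vo →ₗ[S] Ve
  ce : Ve →ₗ[S] Vo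
  co_eq : πe ∘ₗ co ∘ₗ πo = co
  ce_eq : πo ∘ₗ ce ∘ₗ πe = ce
  odd : be ∘ₗ co + ce ∘ₗ bo = πo
  even : bo ∘ₗ ce + co ∘ₗ be = πe
  sq_co : ce ∘ₗ co = 0
  sq_ce : co ∘ₗ ce = 0

end Bockstein

section Representations

universe v

variable {p : ℕ} [Fact p.Prime] {G : Type*} [Group G] [TopologicalSpace G]
  {H : Subgroup G} [H.Normal] (e : (G ⧸ H) ≃ₜ* Multiplicative ℤ_[p])
  {L : Type*} [NormedField L] [IsUltrametricDist L] [NormedAlgebra ℚ_[p] L]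
  {n : ℕ} (ρ : G → Matrix (Fin n) (Fin n) (IntRing L))
  (A : CochainComplex (ModuleCat.{v} (Lam p G)) ℤ)

/-- The homomorphism `θ : G → Γ ≅ ℤ_p` with `θ(γ) = 1`. -/
def thetaHom (g : G) : ℤ_[p] := (e (QuotientGroup.mk g)).toAdd

/-- `g ↦ ρ(g) (1 + T)^{θ(g)}`, that is, `g ↦ ρ(g) ḡ` with values in `M_n(Λ_O(Γ))`,
`Λ_O(Γ) = O[[T]]`. -/
def rhoGamma (g : G) : Matrix (Fin n) (Fin n) (PowerSeries (IntRing L)) :=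
  PowerSeries.binomialSeries (IntRing L) (thetaHom e g) • (ρ g).map PowerSeries.C

/-- The right action of `G` on `O^n ⊗ E_θ`. With `E_θ = ℤ_p e_1 ⊕ ℤ_p e_2`, `g e_1 = e_1` and
`g e_2 = e_2 + θ(g) e_1`, the element `g` acts on the right by `y ⊗ x ↦ y ρ(g) ⊗ g⁻¹ x`. -/
def rhoE (g : G) : Matrix (Fin n ⊕ Fin n) (Fin n ⊕ Fin n) (IntRing L) :=
  Matrix.fromBlocks (ρ g) 0 (-(thetaHom e g • ρ g)) (ρ g)

variable (p) in
/-- `O^n` as a right `Λ(G)`-module. -/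
def actO : Lam p G → Module.End (IntRing L) (Fin n → IntRing L) :=
  rowAct fun x => lamEval p ρ x

/-- `O^n ⊗ E_θ` as a right `Λ(G)`-module. -/
def actOE : Lam p G → Module.End (IntRing L) (Fin n ⊕ Fin n → IntRing L) :=
  rowAct fun x => lamEval p (rhoE e ρ) x

variable (p) in
/-- `L^n` as a right `Λ(G)`-module. -/
def actL : Lam p G → Module.End L (Fin n → L) :=
  rowAct fun x => (lamEval p ρ x).map (IntRing L).subtype

/-- `L^n ⊗ E_θ` as a right `Λ(G)`-module. -/
def actLE : Lam p G → Module.End L (Fin n ⊕ Fin n → L) :=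
  rowAct fun x => (lamEval p (rhoE e ρ) x).map (IntRing L).subtype

/-- `Λ_O(Γ) ⊗_O O^n` as a `(Λ_O(Γ), Λ(G))`-bimodule. -/
def actGamma :
    Lam p G → Module.End (PowerSeries (IntRing L)) (Fin n → PowerSeries (IntRing L)) :=
  rowAct fun x => lamEval p (rhoGamma e ρ) x

/-- `A` is semisimple at `ρ`: the cohomology of `(ℍ_•(G, A(ρ^*)), B_•)` is torsion, where
`ℍ_i(G, A(ρ^*)) = H^{-i}(O^n ⊗_{Λ(G)} A)`. -/
def IsSemisimpleAt : Prop :=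
  ∀ (i : ℤ) (x : BalTensor (actO p ρ) (A.X i)),
    BalTensor.map (actO p ρ) (diff A i (i + 1)) x = 0 →
    BockRel (actO p ρ) (actOE e ρ) (diff A i (i + 1)) x 0 →
    ∃ (N : ℕ) (w : BalTensor (actO p ρ) (A.X (i - 1))),
      BalTensor.map (actO p ρ) (diff A (i - 1) i) w = 0 ∧
      BockRel (actO p ρ) (actOE e ρ) (diff A (i - 1) i) w ((p : IntRing L) ^ N • x)

/-- `A` is finite at `ρ`: the groups `ℍ_i(G, A(ρ^*)) = H^{-i}(O^n ⊗_{Λ(G)} A)` are torsion. -/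
def IsFiniteAt : Prop :=
  ∀ (i : ℤ) (x : BalTensor (actO p ρ) (A.X i)),
    BalTensor.map (actO p ρ) (diff A i (i + 1)) x = 0 →
    ∃ (N : ℕ) (w : BalTensor (actO p ρ) (A.X (i - 1))),
      BalTensor.map (actO p ρ) (diff A (i - 1) i) w = (p : IntRing L) ^ N • x

/-- `H^i(A_ρ)`, where `A_ρ = (Λ_O(Γ) ⊗_O O^n) ⊗_{Λ(G)} A`. This is the hyperhomology group
`ℍ_{-i}(H, A(ρ^*))`, with its action of `Λ_O(Γ)`. -/
abbrev CohGamma (i : ℤ) : Type _ :=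
  ↥(LinearMap.ker (BalTensor.map (actGamma e ρ) (diff A i (i + 1)))) ⧸
    (LinearMap.range (BalTensor.map (actGamma e ρ) (diff A (i - 1) i))).submoduleOf
      (LinearMap.ker (BalTensor.map (actGamma e ρ) (diff A i (i + 1))))

/-- The invariants `ℍ_{-i}(H, A(ρ^*))^Γ`, the kernel of `T = γ - 1`. -/
abbrev CohGammaInv (i : ℤ) : Type _ :=
  ↥(Submodule.torsionBy (PowerSeries (IntRing L)) (CohGamma e ρ A i) PowerSeries.X)

instance (i : ℤ) : Module (IntRing L) (CohGammaInv e ρ A i) :=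
  Module.compHom _ (PowerSeries.C : IntRing L →+* PowerSeries (IntRing L))

/-- `r_G(A)(ρ) = ∑_i (-1)^{i+1} dim_L (ℍ_i(H, A(ρ^*))^Γ ⊗_O L)`. -/
def rankAt : ℤ :=
  ∑ᶠ i : ℤ, (Int.negOnePow (i + 1) : ℤ) *
    (Module.finrank L (L ⊗[IntRing L] CohGammaInv e ρ A (-i)) : ℤ)

variable {A}

open Classical in
/-- The leading term `(A, a)^*(ρ)`: the sign `(-1)^{r_G(A)(ρ)}` times the element of `L^×` given by
`1 → d_L(L^n ⊗_{Λ(G)} A) → 1`, the first arrow induced by `a` and the second one the trivialization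
given by the Bockstein maps. -/
def leadingTerm (a : Trivialization A) : L :=
  if h : Nonempty (BockSplitting
      (BalTensor.map (actL p ρ) (dOdd A a.k)) (BalTensor.map (actL p ρ) (dEven A a.k))
      (BockRel (actL p ρ) (actLE e ρ) (dOdd A a.k))
      (BockRel (actL p ρ) (actLE e ρ) (dEven A a.k))) then
    (-1) ^ rankAt e ρ A *
      LinearMap.det ((BalTensor.map (actL p ρ) (dEven A a.k) + h.some.se + h.some.be + h.some.ce) ∘ₗ
        BalTensor.map (actL p ρ) a.iso.toLinearMap)
  else 0

open Classical in
/-- `ρ_* : K_1(Λ(G)_{S^*}) → K_1(M_n(Q_O(Γ))) ≅ Q_O(Γ)^×`, induced by the ring homomorphism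
`Λ(G)_{S^*} → M_n(Q_O(Γ))` that sends `g` to `ρ(g) ḡ`. This homomorphism exists because the elements
of `S^*` become invertible in `M_n(Q_O(Γ))`, and it is unique by the universal property of the
localization. -/
def rhoStar : KOne (Loc (oreSetStar p H)) →+ Additive (QField L)ˣ :=
  if h : ∃ Ψ : Loc (oreSetStar p H) →+* Matrix (Fin n) (Fin n) (QField L),
      ∀ x, Ψ (toLoc (oreSetStar p H) x) =
        (lamEval p (rhoGamma e ρ) x).map (algebraMap (PowerSeries (IntRing L)) (QField L)) then
    KOne.detHom h.choose
  else 0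

/-- `f_ρ(T) = ρ_*(ch_{G,A}([A, a])) ∈ Q_O(Γ)^×`. -/
def charElt (a : Trivialization A) : (QField L)ˣ :=
  (rhoStar e ρ (theta (toLoc (oreSetStar p H)) a)).toMul

/-- The value at `t ∈ L`, `|t| < 1`, of a power series with coefficients in `O`. -/
def evalSeries (g : PowerSeries (IntRing L)) (t : L) : L :=
  ∑' k : ℕ, ((PowerSeries.coeff k g : IntRing L) : L) * t ^ k

open Classical in
/-- The value at `t ∈ L`, `|t| < 1`, of an element of `Q_O(Γ)`, regarded as a quotient of power
series; it is set to `0` at the poles. -/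
def evalQ (f : QField L) (t : L) : L :=
  if h : ∃ gh : PowerSeries (IntRing L) × PowerSeries (IntRing L), evalSeries gh.2 t ≠ 0 ∧
      f * algebraMap _ (QField L) gh.2 = algebraMap _ (QField L) gh.1 then
    evalSeries h.choose.1 t / evalSeries h.choose.2 t
  else 0

/-- `χ^s`, evaluated at `g`, for a continuous character `χ` of `Γ ≅ ℤ_p` and `s ∈ ℤ_p`: it is
`χ(γ)^{s θ(g)} = χ(γ^{s θ(g)})`. -/
def charPow (χ : (G ⧸ H) →* ℤ_[p]ˣ) (s : ℤ_[p]) (g : G) : ℤ_[p]ˣ :=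
  χ (e.symm (Multiplicative.ofAdd (s * thetaHom e g)))

/-- `χ(γ)^s` for `s ∈ ℤ_p`. -/
def charGammaPow (χ : (G ⧸ H) →* ℤ_[p]ˣ) (s : ℤ_[p]) : ℤ_[p]ˣ :=
  χ (e.symm (Multiplicative.ofAdd s))

/-- The representation `ρ χ^s`. -/
def twist (χ : (G ⧸ H) →* ℤ_[p]ˣ) (s : ℤ_[p]) (g : G) : Matrix (Fin n) (Fin n) (IntRing L) :=
  (charPow e χ s g : ℤ_[p]) • ρ g

open Classical in
/-- The function `s ↦ f_L(ρ χ^s) = f_ρ(χ(γ)^s - 1)` on `ℤ_p`, extended by zero to `ℚ_p`. -/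
def fL (χ : (G ⧸ H) →* ℤ_[p]ˣ) (a : Trivialization A) (s : ℚ_[p]) : L :=
  if h : ‖s‖ ≤ 1 then
    evalQ (charElt e ρ a : QField L)
      (algebraMap ℚ_[p] L (((charGammaPow e χ ⟨s, h⟩ : ℤ_[p]ˣ) : ℤ_[p]) : ℚ_[p]) - 1)
  else 0

end Representations

/-- The `p`-adic logarithm `log_p(u) = ∑_{k ≥ 1} (-1)^{k-1} (u - 1)^k / k` on `1 + pℤ_p`. -/
def padicLog {p : ℕ} [Fact p.Prime] (u : ℤ_[p]) : ℚ_[p] :=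
  ∑' k : ℕ, (-1) ^ k * ((u : ℚ_[p]) - 1) ^ (k + 1) / ((k : ℚ_[p]) + 1)

end IwasawaDescent

end

noncomputable section

namespace IwasawaDescent

/-! ### Balanced tensor products -/

section BalancedTensorTheory

variable {R S S' Y Y' : Type*} [Ring R] [Ring S] [Ring S'] [AddCommGroup Y] [Module S Y]
  [AddCommGroup Y'] [Module S' Y']
  {P P' P'' : Type*} [AddCommGroup P] [Module R P] [AddCommGroup P'] [Module R P']
  [AddCommGroup P''] [Module R P'']
  {X : Type*} [AddCommGroup X] [Module S' X]

/-! The map g ↦ ρ(g)(1+X)^θ(g) extends to a ring homomorphism Φ : Λ(G) → M_n(𝒪⟦X⟧), and every object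
of the theorem is a specialization of the one complex 𝒪⟦X⟧^n ⊗ A. At X = 0 it is 𝒪^n ⊗ A; modulo X²
it is the tensor product with 𝒪^n ⊗ E_θ, so that the Bockstein map is "lift a cocycle, apply the
differential, divide by X"; at X = χ(γ)^s − 1 it belongs to ρχ^s; over the fraction field it
computes f_ρ. Since 𝒪⟦X⟧ is local, the odd and even parts become free. A basis of the odd part,
transported through the trivialization `a`, turns `a` into the identity matrix and A into two square
matrices Do, De with De·Do = Do·De = 0 (`exists_folded_bases`).

Elements of S become invertible in M_n(Q_𝒪(Γ)) by a determinant trick (`IsGammaHom.det_ne_zero`). So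
the complex is contractible over Q_𝒪(Γ), and f_ρ = det(De + Se) for any contraction (So, Se),
because this determinant does not depend on the contraction (`IsContraction.det_eq`). After clearing
a denominator D ∈ 𝒪⟦X⟧, the contraction consists of matrix identities over 𝒪⟦X⟧, which may be
evaluated at any t with D(t) ≠ 0. There the cohomology is torsion and the leading term is the value
of f_ρ. As D(χ(γ)^s − 1) does not vanish for small s ≠ 0, this gives (i).

For (ii), write the differential as δ + Xβ + ⋯. Over L, δ has a splitting s with projection π to the
cohomology; the Bockstein map is b = −πβπ, and semisimplicity provides a contraction c of b. The
model complex with differential d = δ − Xb is contracted by h = s − X⁻¹c, and its determinant is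
that of δ + s + b + c times powers of −X and −X⁻¹ whose exponents are ranks of idempotents. With 𝒟
the full differential, 𝒟h + hd intertwines 𝒟 and d, has entries in L⟦X⟧, and its components have
determinants with constant term 1. So f_ρ is (−X)^(r₁−r₂)·det(δ + s + b + c) times a power series
with constant term 1 (`IsContraction.det_leading`). The classes killed by X map, up to torsion, onto
the image of b, so r₁ − r₂ = r_G(A)(ρ) (`altRank_eq_rank_sub_rank`), and the sign is the one in the
definition of the leading term.

It remains to substitute X = χ(γ)^s − 1. A continuous character of ℤ_p is analytic near 0 with
derivative log_p χ(γ) (`charFun_eventuallyEq`), which is nonzero if the order is infinite. Thus X is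
s times an analytic function with value c_{χ,γ} at 0, and orders and leading coefficients in X
become those in s. -/

/-- The class of `y ⊗ x` in `Y ⊗_R P`. -/
def BalTensor.tmul (act : R → Module.End S Y) (y : Y) (x : P) : BalTensor act P :=
  BalTensor.mk act P (y ⊗ₜ[ℤ] x)

namespace BalTensor

variable (act : R → Module.End S Y)

theorem mk_surjective : Function.Surjective (BalTensor.mk act P) :=
  Submodule.mkQ_surjective _

theorem add_tmul (y y' : Y) (x : P) : tmul act (y + y') x = tmul act y x + tmul act y' x := by
  simp only [tmul, TensorProduct.add_tmul, map_add]

theorem tmul_add (y : Y) (x x' : P) : tmul act y (x + x') = tmul act y x + tmul act y x' := by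
  simp only [tmul, TensorProduct.tmul_add, map_add]

theorem smul_tmul (s : S) (y : Y) (x : P) : tmul act (s • y) x = s • tmul act y x := by
  simp only [tmul, ← map_smul, TensorProduct.smul_tmul']

theorem act_tmul (r : R) (y : Y) (x : P) : tmul act (act r y) x = tmul act y (r • x) :=
  (Submodule.Quotient.eq _).2 (Submodule.subset_span ⟨y, r, x, rfl⟩)

/-- `y ⊗ x` as a function that is linear in `y` and additive in `x`. -/
def tmulHom : Y →ₗ[S] P →+ BalTensor act P where
  toFun y := AddMonoidHom.mk' (tmul act y) (tmul_add act y)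
  map_add' y y' := by ext x; exact add_tmul act y y' x
  map_smul' s y := by ext x; exact smul_tmul act s y x

@[simp]
theorem tmulHom_apply (y : Y) (x : P) : tmulHom act y x = tmul act y x := rfl

theorem tmul_zero (y : Y) : tmul act y (0 : P) = 0 := by
  rw [← tmulHom_apply, map_zero]

theorem sum_tmul {ι : Type*} (s : Finset ι) (y : ι → Y) (x : P) :
    tmul act (∑ i ∈ s, y i) x = ∑ i ∈ s, tmul act (y i) x := by
  simp only [← tmulHom_apply, map_sum, AddMonoidHom.finsetSum_apply]

theorem tmul_sum {ι : Type*} (s : Finset ι) (y : Y) (x : ι → P) :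
    tmul act y (∑ i ∈ s, x i) = ∑ i ∈ s, tmul act y (x i) := by
  simp only [← tmulHom_apply, map_sum]

variable {act}

@[elab_as_elim]
theorem induction_on {motive : BalTensor act P → Prop} (t : BalTensor act P)
    (zero : motive 0) (tmul : ∀ y x, motive (tmul act y x))
    (add : ∀ t t', motive t → motive t' → motive (t + t')) : motive t := by
  obtain ⟨t, rfl⟩ := mk_surjective act t
  induction t with
  | zero => simpa using zero
  | tmul y x => exact tmul y x
  | add t u ht hu => rw [map_add]; exact add _ _ ht hu

/-- The (semi)linear map out of `Y ⊗_R P` given by a balanced map. -/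
def lift {φ : S →+* S'} (β : Y →ₛₗ[φ] P →+ X)
    (h : ∀ r y x, β (act r y) x = β y (r • x)) : BalTensor act P →ₛₗ[φ] X :=
  Submodule.liftQ (balSpan act P)
    { toFun := TensorProduct.liftAddHom β.toAddMonoidHom (fun r m n => by
        rw [map_zsmul, map_zsmul]; rfl)
      map_add' := map_add _
      map_smul' := fun s t => by
        induction t with
        | zero => simp
        | tmul y x => simp [TensorProduct.smul_tmul']
        | add t t' h h' => simp only [smul_add, map_add, h, h'] }
    (by
      refine Submodule.span_le.2 ?_
      rintro _ ⟨y, r, x, rfl⟩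
      simp [h])

@[simp]
theorem lift_tmul {φ : S →+* S'} (β : Y →ₛₗ[φ] P →+ X)
    (h : ∀ r y x, β (act r y) x = β y (r • x)) (y : Y) (x : P) :
    lift β h (tmul act y x) = β y x := by
  rfl

theorem hom_ext {φ : S →+* S'} {f g : BalTensor act P →ₛₗ[φ] X}
    (h : ∀ y x, f (tmul act y x) = g (tmul act y x)) : f = g := by
  ext t
  induction t using induction_on with
  | zero => simp
  | tmul y x => exact h y x
  | add t t' h h' => simp only [map_add, h, h']

@[simp]
theorem map_tmul (f : P →ₗ[R] P') (y : Y) (x : P) :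
    BalTensor.map act f (tmul act y x) = tmul act y (f x) := by
  rfl

theorem map_mk (f : P →ₗ[R] P') (z : Y ⊗[ℤ] P) :
    BalTensor.map act f (BalTensor.mk act P z) = BalTensor.mk act P' (preMap S Y f z) := by
  rfl

variable (act)

theorem map_id : BalTensor.map act (LinearMap.id : P →ₗ[R] P) = LinearMap.id :=
  hom_ext fun y x => by simp

theorem map_comp (g : P' →ₗ[R] P'') (f : P →ₗ[R] P') :
    BalTensor.map act (g ∘ₗ f) = BalTensor.map act g ∘ₗ BalTensor.map act f :=
  hom_ext fun y x => by simp

theorem map_zero : BalTensor.map act (0 : P →ₗ[R] P') = 0 :=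
  hom_ext fun y x => by simp [tmul_zero]

theorem map_add (f g : P →ₗ[R] P') :
    BalTensor.map act (f + g) = BalTensor.map act f + BalTensor.map act g :=
  hom_ext fun y x => by simp [tmul_add]

theorem map_sum {ι : Type*} (s : Finset ι) (f : ι → P →ₗ[R] P') :
    BalTensor.map act (∑ i ∈ s, f i) = ∑ i ∈ s, BalTensor.map act (f i) :=
  hom_ext fun y x => by simp [tmul_sum]

theorem map_map (g : P' →ₗ[R] P'') (f : P →ₗ[R] P') (t : BalTensor act P) :
    BalTensor.map act g (BalTensor.map act f t) = BalTensor.map act (g ∘ₗ f) t := by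
  rw [map_comp]; rfl

/-- The isomorphism `Y ⊗_R P ≅ Y ⊗_R P'` induced by `P ≅ P'`. -/
def congr (f : P ≃ₗ[R] P') : BalTensor act P ≃ₗ[S] BalTensor act P' :=
  LinearEquiv.ofLinearMap (BalTensor.map act f.toLinearMap) (BalTensor.map act f.symm.toLinearMap)
    (by rw [← map_comp]; simpa using map_id act) (by rw [← map_comp]; simpa using map_id act)

end BalTensor

/-- `act` is the right action of a ring. -/
structure IsRightAction (act : R → Module.End S Y) : Prop where
  add : ∀ r s, act (r + s) = act r + act s
  mul : ∀ r s, act (r * s) = act s * act r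
  one : act 1 = 1

theorem isRightAction_ringAct (j : R →+* S) : IsRightAction (ringAct j) where
  add r s := by ext; simp [ringAct]
  mul r s := by ext; simp [ringAct]
  one := by ext; simp [ringAct]

theorem isRightAction_rowAct {W : Type*} [CommRing W] {m : Type*} [Fintype m] [DecidableEq m]
    (φ : R →+* Matrix m m W) : IsRightAction (rowAct φ) where
  add r s := by
    refine LinearMap.ext fun v => ?_
    simp [rowAct]
  mul r s := by
    refine LinearMap.ext fun v => ?_
    simp [rowAct, Matrix.vecMul_vecMul]
  one := by
    refine LinearMap.ext fun v => ?_
    simp [rowAct]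

theorem IsRightAction.zero {act : R → Module.End S Y} (h : IsRightAction act) : act 0 = 0 := by
  have := h.add 0 0
  simpa using this

namespace BalTensor

/-- `Y ⊗_R R^m ≅ Y^m`. -/
def piEquiv {act : R → Module.End S Y} (hact : IsRightAction act) (m : Type*) [Fintype m]
    [DecidableEq m] : BalTensor act (m → R) ≃ₗ[S] (m → Y) :=
  LinearEquiv.ofLinearMap
    (lift (X := m → Y)
      { toFun := fun y => AddMonoidHom.mk' (fun x k => act (x k) y) (fun x x' => by
          ext k; simp [hact.add])
        map_add' := fun y y' => by ext; simp
        map_smul' := fun s y => by ext; simp }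
      (fun r y x => by ext k; simp [hact.mul]))
    (∑ k, { toFun := fun v => tmul act (v k) (Pi.single k 1)
            map_add' := fun v v' => add_tmul act _ _ _
            map_smul' := fun s v => smul_tmul act _ _ _ })
    (by
      refine LinearMap.ext fun v => funext fun k => ?_
      simp only [LinearMap.coe_comp, Function.comp_apply, LinearMap.sum_apply, LinearMap.coe_mk,
        AddHom.coe_mk, _root_.map_sum, lift_tmul, LinearMap.id_coe, id_eq]
      rw [Finset.sum_apply, Finset.sum_eq_single k]
      · simp [hact.one]
      · intro b _ hb
        simp [Pi.single_eq_of_ne' hb, hact.zero]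
      · simp)
    (hom_ext fun y x => by
      simp only [LinearMap.coe_comp, Function.comp_apply, lift_tmul, LinearMap.coe_mk,
        AddHom.coe_mk, LinearMap.sum_apply, AddMonoidHom.mk'_apply, LinearMap.id_coe, id_eq,
        act_tmul, ← tmul_sum]
      congr 1
      ext k
      simp [Finset.sum_apply, Pi.single_apply])

theorem piEquiv_tmul {act : R → Module.End S Y} (hact : IsRightAction act) {m : Type*} [Fintype m]
    [DecidableEq m] (y : Y) (x : m → R) (k : m) :
    piEquiv hact m (tmul act y x) k = act (x k) y := by
  simp [piEquiv]

/-- `P` is a retract of some R^m, and Y ⊗ – turns the retraction into one of Y^m. -/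
theorem finite_projective {act : R → Module.End S Y} (hact : IsRightAction act)
    [Module.Finite S Y] [Module.Free S Y] [Module.Finite R P] [Module.Projective R P] :
    Module.Finite S (BalTensor act P) ∧ Module.Projective S (BalTensor act P) := by
  obtain ⟨m, f, hf⟩ := Module.Finite.exists_fin' R P
  obtain ⟨g, hg⟩ := Module.projective_lifting_property f LinearMap.id hf
  have hfg : BalTensor.map act f ∘ₗ BalTensor.map act g = LinearMap.id := by
    rw [← map_comp, hg, map_id]
  have h1 : Module.Finite S (BalTensor act (Fin m → R)) :=
    Module.Finite.equiv (piEquiv hact (Fin m)).symm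
  have h2 : Module.Projective S (BalTensor act (Fin m → R)) :=
    Module.Projective.of_equiv (piEquiv hact (Fin m)).symm
  refine ⟨Module.Finite.of_surjective (BalTensor.map act f) fun x => ⟨BalTensor.map act g x, ?_⟩,
    Module.Projective.of_split _ _ hfg⟩
  exact LinearMap.congr_fun hfg x

/-- Change of scalars `Y ⊗_R P → Y' ⊗_R P`. -/
def baseMap {φ : S →+* S'} {act : R → Module.End S Y} {act' : R → Module.End S' Y'}
    (θ : Y →ₛₗ[φ] Y') (h : ∀ r y, act' r (θ y) = θ (act r y)) (P : Type*) [AddCommGroup P]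
    [Module R P] : BalTensor act P →ₛₗ[φ] BalTensor act' P :=
  lift ((tmulHom act').comp θ) (fun r y x => by simp [← h, act_tmul])

@[simp]
theorem baseMap_tmul {φ : S →+* S'} {act : R → Module.End S Y} {act' : R → Module.End S' Y'}
    (θ : Y →ₛₗ[φ] Y') (h : ∀ r y, act' r (θ y) = θ (act r y)) (y : Y) (x : P) :
    baseMap θ h P (tmul act y x) = tmul act' (θ y) x :=
  rfl

theorem baseMap_map {φ : S →+* S'} {act : R → Module.End S Y} {act' : R → Module.End S' Y'}
    (θ : Y →ₛₗ[φ] Y') (h : ∀ r y, act' r (θ y) = θ (act r y)) (f : P →ₗ[R] P')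
    (t : BalTensor act P) :
    baseMap θ h P' (BalTensor.map act f t) = BalTensor.map act' f (baseMap θ h P t) := by
  induction t using induction_on with
  | zero => simp
  | tmul y x => simp
  | add t t' h h' => simp only [_root_.map_add, h, h']

end BalTensor

end BalancedTensorTheory

/-! ### Specializations of a matrix representation -/

namespace BalTensor

section LiftAdd

variable {R S Y : Type*} [Ring R] [Ring S] [AddCommGroup Y] [Module S Y]
  {P : Type*} [AddCommGroup P] [Module R P] {X : Type*} [AddCommGroup X]

/-- The additive map out of `Y ⊗_R P` given by a balanced biadditive map. -/
def liftAdd {act : R → Module.End S Y} (β : Y →+ P →+ X)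
    (h : ∀ r y x, β (act r y) x = β y (r • x)) : BalTensor act P →+ X :=
  QuotientAddGroup.lift (balSpan act P).toAddSubgroup
    (TensorProduct.liftAddHom β (fun r m n => by rw [map_zsmul, map_zsmul]; rfl)) (by
      intro t ht
      -- The relations span an S-submodule while `β` is merely additive. Proving that all multiples
      -- of `t` vanish makes the scalar step of the induction harmless.
      have key : ∀ s : S, TensorProduct.liftAddHom β
          (fun r m n => by rw [map_zsmul, map_zsmul]; rfl) (s • t) = 0 := by
        change t ∈ balSpan act P at ht
        unfold balSpan at ht
        induction ht using Submodule.span_induction with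
        | mem t ht =>
          obtain ⟨y, r, x, rfl⟩ := ht
          intro s
          rw [smul_sub, TensorProduct.smul_tmul', TensorProduct.smul_tmul', ← map_smul,
            _root_.map_sub, sub_eq_zero]
          exact h r (s • y) x
        | zero => simp
        | add t t' _ _ h h' => intro s; rw [smul_add, _root_.map_add, h, h', add_zero]
        | smul c t _ h => intro s; rw [smul_smul]; exact h _
      simpa using key 1)

end LiftAdd

end BalTensor

section Specialization

variable {R : Type*} [Ring R] {W W' : Type*} [CommRing W] [CommRing W'] {P P' : Type*}
  [AddCommGroup P] [Module R P] [AddCommGroup P'] [Module R P'] {m : Type*} [Fintype m]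
  [DecidableEq m]

/-- The right action of `R` on `W'^m` obtained from `Φ : R → M_m(W)` and `φ : W → W'`. -/
def specAct (Φ : R →+* Matrix m m W) (φ : W →+* W') : R → Module.End W' (m → W') :=
  rowAct fun x => (Φ x).map φ

/-- The coordinatewise application of a ring homomorphism. -/
def vecMap (m : Type*) (φ : W →+* W') : (m → W) →ₛₗ[φ] (m → W') where
  toFun v i := φ (v i)
  map_add' v w := by ext; simp
  map_smul' c v := by ext; simp

@[simp]
theorem vecMap_apply {m : Type*} (φ : W →+* W') (v : m → W) (i : m) : vecMap m φ v i = φ (v i) := rfl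

theorem specAct_vecMap (Φ : R →+* Matrix m m W) (φ : W →+* W') (r : R) (v : m → W) :
    specAct Φ φ r (vecMap m φ v) = vecMap m φ (rowAct Φ r v) := by
  ext j
  simp [specAct, rowAct, Matrix.vecMul, dotProduct]

/-- The specialization map `W^m ⊗_R P → W'^m ⊗_R P`. -/
def specMap (Φ : R →+* Matrix m m W) (φ : W →+* W') (P : Type*) [AddCommGroup P] [Module R P] :
    BalTensor (rowAct Φ) P →ₛₗ[φ] BalTensor (specAct Φ φ) P :=
  BalTensor.baseMap (vecMap m φ) (specAct_vecMap Φ φ) P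

@[simp]
theorem specMap_tmul (Φ : R →+* Matrix m m W) (φ : W →+* W') (y : m → W) (x : P) :
    specMap Φ φ P (BalTensor.tmul _ y x) = BalTensor.tmul _ (vecMap m φ y) x := rfl

theorem specMap_map (Φ : R →+* Matrix m m W) (φ : W →+* W') (f : P →ₗ[R] P')
    (t : BalTensor (rowAct Φ) P) :
    specMap Φ φ P' (BalTensor.map _ f t) = BalTensor.map _ f (specMap Φ φ P t) :=
  BalTensor.baseMap_map _ _ f t

theorem rowAct_single (Φ : R →+* Matrix m m W) (r : R) (i : m) :
    rowAct Φ r (Pi.single i 1) = ∑ j, Φ r i j • (Pi.single j 1 : m → W) := by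
  ext j
  simp [rowAct, Pi.single_apply]

section Basis

variable {ι : Type*} [Fintype ι]

/-- The coordinates of `e_j ⊗ x` in a specialization. -/
def specCoordAux {Φ : R →+* Matrix m m W} (B : Module.Basis ι W (BalTensor (rowAct Φ) P))
    (φ : W →+* W') (j : m) : P →+ (ι → W') :=
  (vecMap ι φ).toAddMonoidHom.comp (B.equivFun.toLinearMap.toAddMonoidHom.comp
    (BalTensor.tmulHom (rowAct Φ) (Pi.single j 1)))

theorem specCoordAux_apply {Φ : R →+* Matrix m m W}
    (B : Module.Basis ι W (BalTensor (rowAct Φ) P)) (φ : W →+* W') (j : m) (x : P) :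
    specCoordAux B φ j x = vecMap ι φ (B.equivFun (BalTensor.tmul _ (Pi.single j 1) x)) := rfl

/-- The coordinates of a specialization with respect to a basis of `W^m ⊗_R P`. -/
def specCoord {Φ : R →+* Matrix m m W} (B : Module.Basis ι W (BalTensor (rowAct Φ) P))
    (φ : W →+* W') : BalTensor (specAct Φ φ) P →ₗ[W'] (ι → W') :=
  BalTensor.lift (φ := RingHom.id W')
    { toFun := fun y => ∑ j, y j • specCoordAux B φ j
      map_add' := fun y y' => by simp [add_smul, Finset.sum_add_distrib]
      map_smul' := fun c y => by simp [smul_smul, Finset.smul_sum] }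
    -- Moving `r` from `x` to e_j expands e_j·r along row j of Φ(r); applying `φ` to this expansion
    -- gives the balance relation for the specialized action.
    (fun r y x => by
      simp only [LinearMap.coe_mk, AddHom.coe_mk, AddMonoidHom.finsetSum_apply,
        AddMonoidHom.smul_apply, specCoordAux_apply, ← BalTensor.act_tmul,
        rowAct_single, BalTensor.sum_tmul, BalTensor.smul_tmul, map_sum, map_smul,
        LinearMap.map_smulₛₗ, Finset.smul_sum, smul_smul]
      rw [Finset.sum_comm]
      refine Finset.sum_congr rfl fun j _ => ?_
      rw [← Finset.sum_smul]
      rfl)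

theorem specCoord_tmul {Φ : R →+* Matrix m m W}
    (B : Module.Basis ι W (BalTensor (rowAct Φ) P)) (φ : W →+* W') (y : m → W') (x : P) :
    specCoord B φ (BalTensor.tmul _ y x) = ∑ j, y j • specCoordAux B φ j x := by
  simp [specCoord]

theorem specCoord_specMap {Φ : R →+* Matrix m m W}
    (B : Module.Basis ι W (BalTensor (rowAct Φ) P)) (φ : W →+* W')
    (t : BalTensor (rowAct Φ) P) :
    specCoord B φ (specMap Φ φ P t) = vecMap ι φ (B.equivFun t) := by
  induction t using BalTensor.induction_on with
  | zero => simp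
  | tmul y x =>
    have hy : y = ∑ j, y j • (Pi.single j 1 : m → W) := by
      ext j; simp [Pi.single_apply]
    conv_rhs => rw [hy, BalTensor.sum_tmul]
    simp only [BalTensor.smul_tmul, map_sum, map_smul, LinearMap.map_smulₛₗ]
    rw [specMap_tmul, specCoord_tmul]
    rfl
  | add t u ht hu => simp only [map_add, ht, hu]

/-- A basis of `W^m ⊗_R P` specializes to a basis. -/
def specBasis {Φ : R →+* Matrix m m W} (B : Module.Basis ι W (BalTensor (rowAct Φ) P))
    (φ : W →+* W') : Module.Basis ι W' (BalTensor (specAct Φ φ) P) :=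
  Module.Basis.ofEquivFun (LinearEquiv.ofLinearMap (specCoord B φ)
    (Fintype.linearCombination W' fun i => specMap Φ φ P (B i))
    (by
      classical
      ext i j
      simp only [LinearMap.coe_comp, Function.comp_apply, LinearMap.coe_single,
        Fintype.linearCombination_apply_single, one_smul, LinearMap.id_comp]
      rw [specCoord_specMap]
      simp [Finsupp.single_apply, Pi.single_apply, eq_comm])
    (BalTensor.hom_ext fun y x => by
      have hy : y = ∑ j, y j • (Pi.single j 1 : m → W') := by
        ext j; simp [Pi.single_apply]
      rw [hy, BalTensor.sum_tmul]
      simp only [map_sum]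
      refine Finset.sum_congr rfl fun j _ => ?_
      rw [BalTensor.smul_tmul, map_smul, map_smul]
      congr 1
      have h1 : BalTensor.tmul (specAct Φ φ) (Pi.single j 1) x =
          specMap Φ φ P (BalTensor.tmul _ (Pi.single j 1) x) := by
        rw [specMap_tmul]
        congr 1
        ext i
        simp [Pi.single_apply, apply_ite φ]
      rw [h1]
      simp only [LinearMap.coe_comp, Function.comp_apply, LinearMap.id_coe, id_eq]
      rw [specCoord_specMap, Fintype.linearCombination_apply]
      conv_rhs => rw [← B.sum_equivFun (BalTensor.tmul _ (Pi.single j 1) x)]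
      simp only [map_sum, LinearMap.map_smulₛₗ]
      rfl))

theorem specBasis_equivFun {Φ : R →+* Matrix m m W}
    (B : Module.Basis ι W (BalTensor (rowAct Φ) P)) (φ : W →+* W')
    (t : BalTensor (rowAct Φ) P) :
    (specBasis B φ).equivFun (specMap Φ φ P t) = vecMap ι φ (B.equivFun t) := by
  rw [specBasis, Module.Basis.equivFun_ofEquivFun]
  exact specCoord_specMap B φ t

@[simp]
theorem specBasis_apply {Φ : R →+* Matrix m m W}
    (B : Module.Basis ι W (BalTensor (rowAct Φ) P)) (φ : W →+* W') (i : ι) :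
    specBasis B φ i = specMap Φ φ P (B i) := by
  classical
  simp [specBasis]

/-- One matrix over `W` thus governs all specializations; this is how X = 0, the points χ(γ)^s − 1
and the generic point are compared. -/
theorem specBasis_toMatrix [DecidableEq ι] {ι' : Type*} [Fintype ι'] {Φ : R →+* Matrix m m W}
    (B : Module.Basis ι W (BalTensor (rowAct Φ) P))
    (B' : Module.Basis ι' W (BalTensor (rowAct Φ) P')) (φ : W →+* W') (f : P →ₗ[R] P') :
    LinearMap.toMatrix (specBasis B φ) (specBasis B' φ) (BalTensor.map _ f) =
      (LinearMap.toMatrix B B' (BalTensor.map _ f)).map φ := by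
  ext i j
  rw [LinearMap.toMatrix_apply, specBasis_apply, ← specMap_map, ← Module.Basis.equivFun_apply,
    specBasis_equivFun, Matrix.map_apply, LinearMap.toMatrix_apply]
  rfl

end Basis

end Specialization

/-! ### The Bockstein relation over a power series ring -/

section BockRelation

open PowerSeries

variable {R : Type*} [Ring R] {S : Type*} [CommRing S] {m : Type*} [Fintype m] [DecidableEq m]
  {P P' : Type*} [AddCommGroup P] [Module R P] [AddCommGroup P'] [Module R P']
  (Φ : R →+* Matrix m m S⟦X⟧)

/-- The reduction `S[[X]]^m ⊗_R P → S^m ⊗_R P` modulo `X`. -/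
abbrev redX (P : Type*) [AddCommGroup P] [Module R P] :
    BalTensor (rowAct Φ) P →ₛₗ[constantCoeff (R := S)]
      BalTensor (specAct Φ (constantCoeff (R := S))) P :=
  specMap Φ (constantCoeff (R := S)) P

/-- The matrix of the right action on `S^m ⊗ E_θ`, in which `X` acts by `e_2 ↦ -e_1`. -/
def epsMatrix (M : Matrix m m S⟦X⟧) : Matrix (m ⊕ m) (m ⊕ m) S :=
  Matrix.fromBlocks (M.map (constantCoeff (R := S))) 0 (-(M.map (coeff (R := S) 1)))
    (M.map (constantCoeff (R := S)))

/-- The right action on `S^m ⊗ E_θ`. -/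
def epsAct : R → Module.End S (m ⊕ m → S) := rowAct fun x => epsMatrix (Φ x)

theorem vec_eq_C_add {m : Type*} (y : m → S⟦X⟧) :
    ∃ w : m → S⟦X⟧, y = vecMap m (C (R := S)) (vecMap m constantCoeff y) + (X : S⟦X⟧) • w := by
  have h : ∀ i, ∃ w : S⟦X⟧, y i = C (constantCoeff (y i)) + X * w := fun i => by
    obtain ⟨w, hw⟩ := X_dvd_iff.2 (show constantCoeff (y i - C (constantCoeff (y i))) = 0 by simp)
    exact ⟨w, by rw [← hw]; ring⟩
  choose w hw using h
  exact ⟨w, by ext1 i; simpa using hw i⟩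

theorem redX_surjective : Function.Surjective (redX Φ P) := fun t => by
  induction t using BalTensor.induction_on with
  | zero => exact ⟨0, map_zero _⟩
  | tmul y x =>
    refine ⟨BalTensor.tmul _ (vecMap m C y) x, ?_⟩
    rw [specMap_tmul]
    congr 1
  | add t t' h h' =>
    obtain ⟨u, rfl⟩ := h
    obtain ⟨u', rfl⟩ := h'
    exact ⟨u + u', map_add _ _ _⟩

theorem redX_smul_X (t : BalTensor (rowAct Φ) P) : redX Φ P ((X : S⟦X⟧) • t) = 0 := by
  rw [LinearMap.map_smulₛₗ]; simp

/-- The multiples of `c`. -/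
abbrev multiples {A M : Type*} [CommRing A] [AddCommGroup M] [Module A M] (c : A) :
    Submodule A M := LinearMap.range (LinearMap.lsmul A M c)

/-- The map `S^m ⊗_R P → (S[[X]]^m ⊗_R P) / X`. -/
def redXInv (P : Type*) [AddCommGroup P] [Module R P] :
    BalTensor (specAct Φ (constantCoeff (R := S))) P →ₛₗ[C (R := S)]
      (BalTensor (rowAct Φ) P ⧸ (multiples (X : S⟦X⟧) : Submodule _ (BalTensor (rowAct Φ) P))) :=
  BalTensor.lift (φ := C (R := S))
    { toFun := fun y => (Submodule.mkQ _).toAddMonoidHom.comp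
        (BalTensor.tmulHom (rowAct Φ) (vecMap m C y))
      map_add' := fun y y' => by ext; simp
      map_smul' := fun c y => by ext; simp }
    (fun r y x => by
      simp only [LinearMap.coe_mk, AddHom.coe_mk, AddMonoidHom.coe_comp, Function.comp_apply,
        BalTensor.tmulHom_apply, ← BalTensor.act_tmul]
      -- Lifting by constants does not commute with the action of `r`; the error is a multiple of X
      -- and dies in the quotient.
      obtain ⟨w, hw⟩ := vec_eq_C_add (rowAct Φ r (vecMap m C y))
      rw [hw, ← specAct_vecMap, BalTensor.add_tmul, BalTensor.smul_tmul]
      have h0 : vecMap m (constantCoeff (R := S)) (vecMap m C y) = y := by ext; simp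
      rw [h0]
      refine (Submodule.Quotient.eq _).2 ⟨-BalTensor.tmul _ w x, ?_⟩
      simp)

/-- No flatness is needed: lifting coefficients by constants gives a map back to the quotient by X,
and reduction followed by this map is the quotient map. -/
theorem exists_eq_X_smul {t : BalTensor (rowAct Φ) P} (h : redX Φ P t = 0) :
    ∃ u, t = (X : S⟦X⟧) • u := by
  have key : ∀ t, redXInv Φ P (redX Φ P t) = Submodule.mkQ _ t := fun t => by
    induction t using BalTensor.induction_on with
    | zero => simp
    | tmul y x =>
      rw [specMap_tmul, redXInv, BalTensor.lift_tmul]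
      obtain ⟨w, hw⟩ := vec_eq_C_add y
      conv_rhs => rw [hw, BalTensor.add_tmul, BalTensor.smul_tmul]
      refine (Submodule.Quotient.eq _).2 ⟨-BalTensor.tmul _ w x, ?_⟩
      simp
    | add t t' h h' => simp only [map_add, h, h']
  have h1 := key t
  rw [h, map_zero] at h1
  obtain ⟨u, hu⟩ := (Submodule.Quotient.mk_eq_zero _).1 h1.symm
  exact ⟨u, hu.symm⟩

end BockRelation

section BockRelationEps

open PowerSeries

variable {R : Type*} [Ring R] {S : Type*} [CommRing S] {m : Type*} [Fintype m] [DecidableEq m]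
  {P P' : Type*} [AddCommGroup P] [Module R P] [AddCommGroup P'] [Module R P']
  (Φ : R →+* Matrix m m S⟦X⟧)

/-- Reduction modulo `X^2` as a map to `S^m ⊗ E_θ`. -/
def epsVec (m : Type*) : (m → S⟦X⟧) →+ (m ⊕ m → S) where
  -- The minus sign comes from the inverse in the right action y ⊗ x ↦ yρ(g) ⊗ g⁻¹x.
  toFun v := Sum.elim (fun i => -coeff 1 (v i)) (fun i => constantCoeff (v i))
  map_zero' := by ext (i | i) <;> simp
  map_add' v w := by ext (i | i) <;> simp [add_comm]

theorem epsVec_rowAct (r : R) (v : m → S⟦X⟧) :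
    epsVec m (rowAct Φ r v) = epsAct Φ r (epsVec m v) := by
  ext (i | i)
  · simp [epsVec, epsAct, rowAct, epsMatrix, Matrix.vecMul, dotProduct, coeff_mul,
      Finset.Nat.antidiagonal_succ, add_comm, Finset.sum_add_distrib]
  · simp [epsVec, epsAct, rowAct, epsMatrix, Matrix.vecMul, dotProduct]

/-- A section of the reduction modulo `X^2`. -/
def epsVecInv (m : Type*) : (m ⊕ m → S) →ₛₗ[C (R := S)] (m → S⟦X⟧) where
  toFun y i := C (y (Sum.inr i)) - X * C (y (Sum.inl i))
  map_add' v w := by ext1 i; simp; ring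
  map_smul' c v := by ext1 i; simp; ring

theorem epsVecInv_epsVec {m : Type*} (v : m → S⟦X⟧) :
    ∃ w : m → S⟦X⟧, v = epsVecInv m (epsVec m v) + (X ^ 2 : S⟦X⟧) • w := by
  have h : ∀ i, ∃ w : S⟦X⟧, v i = epsVecInv m (epsVec m v) i + X ^ 2 * w := fun i => by
    obtain ⟨w, hw⟩ : (X : S⟦X⟧) ^ 2 ∣ v i - epsVecInv m (epsVec m v) i := by
      refine X_pow_dvd_iff.2 fun k hk => ?_
      interval_cases k
      · simp [epsVecInv, epsVec]
      · simp only [epsVecInv, epsVec, AddMonoidHom.coe_mk, ZeroHom.coe_mk, LinearMap.coe_mk,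
          AddHom.coe_mk, Sum.elim_inr, Sum.elim_inl, map_sub, map_neg]
        rw [show (1 : ℕ) = 0 + 1 from rfl]
        simp [coeff_succ_X_mul, coeff_C]
    exact ⟨w, by rw [← hw]; ring⟩
  choose w hw using h
  exact ⟨w, by ext1 i; simpa using hw i⟩

theorem epsVec_epsVecInv {m : Type*} (y : m ⊕ m → S) : epsVec m (epsVecInv m y) = y := by
  ext (i | i)
  · simp only [epsVecInv, epsVec, AddMonoidHom.coe_mk, ZeroHom.coe_mk, LinearMap.coe_mk,
      AddHom.coe_mk, Sum.elim_inl, map_sub]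
    rw [show (1 : ℕ) = 0 + 1 from rfl]
    simp [coeff_succ_X_mul, coeff_C]
  · simp [epsVecInv, epsVec]

/-- The map `S[[X]]^m ⊗_R P → (S^m ⊗ E_θ) ⊗_R P`. -/
def epsMap (P : Type*) [AddCommGroup P] [Module R P] :
    BalTensor (rowAct Φ) P →+ BalTensor (epsAct Φ) P :=
  BalTensor.liftAdd ((BalTensor.tmulHom (epsAct Φ)).toAddMonoidHom.comp (epsVec m))
    (fun r y x => by
      simp only [AddMonoidHom.coe_comp, Function.comp_apply, LinearMap.toAddMonoidHom_coe,
        BalTensor.tmulHom_apply, epsVec_rowAct, BalTensor.act_tmul])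

@[simp]
theorem epsMap_tmul (y : m → S⟦X⟧) (x : P) :
    epsMap Φ P (BalTensor.tmul _ y x) = BalTensor.tmul _ (epsVec m y) x := rfl

theorem epsMap_map (f : P →ₗ[R] P') (t : BalTensor (rowAct Φ) P) :
    epsMap Φ P' (BalTensor.map _ f t) = BalTensor.map _ f (epsMap Φ P t) := by
  induction t using BalTensor.induction_on with
  | zero => simp
  | tmul y x => simp
  | add t u ht hu => simp only [map_add, ht, hu]

/-- The map `(S^m ⊗ E_θ) ⊗_R P → (S[[X]]^m ⊗_R P) / X^2`. -/
def epsMapInv (P : Type*) [AddCommGroup P] [Module R P] :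
    BalTensor (epsAct Φ) P →ₛₗ[C (R := S)]
      (BalTensor (rowAct Φ) P ⧸
        (multiples (X ^ 2 : S⟦X⟧) : Submodule _ (BalTensor (rowAct Φ) P))) :=
  BalTensor.lift (φ := C (R := S))
    { toFun := fun y => (Submodule.mkQ _).toAddMonoidHom.comp
        (BalTensor.tmulHom (rowAct Φ) (epsVecInv m y))
      map_add' := fun y y' => by ext; simp
      map_smul' := fun c y => by ext; simp }
    (fun r y x => by
      simp only [LinearMap.coe_mk, AddHom.coe_mk, AddMonoidHom.coe_comp, Function.comp_apply,
        BalTensor.tmulHom_apply, ← BalTensor.act_tmul]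
      obtain ⟨w, hw⟩ := epsVecInv_epsVec (rowAct Φ r (epsVecInv m y))
      rw [hw, epsVec_rowAct, epsVec_epsVecInv, BalTensor.add_tmul, BalTensor.smul_tmul]
      refine (Submodule.Quotient.eq _).2 ⟨-BalTensor.tmul _ w x, ?_⟩
      simp)

theorem exists_eq_X_sq_smul {t : BalTensor (rowAct Φ) P} (h : epsMap Φ P t = 0) :
    ∃ u, t = (X ^ 2 : S⟦X⟧) • u := by
  have key : ∀ t, epsMapInv Φ P (epsMap Φ P t) = Submodule.mkQ _ t := fun t => by
    induction t using BalTensor.induction_on with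
    | zero => simp
    | tmul y x =>
      rw [epsMap_tmul, epsMapInv, BalTensor.lift_tmul]
      obtain ⟨w, hw⟩ := epsVecInv_epsVec y
      conv_rhs => rw [hw, BalTensor.add_tmul, BalTensor.smul_tmul]
      refine (Submodule.Quotient.eq _).2 ⟨-BalTensor.tmul _ w x, ?_⟩
      simp
    | add t t' h h' => simp only [map_add, h, h']
  have h1 := key t
  rw [h, map_zero] at h1
  obtain ⟨u, hu⟩ := (Submodule.Quotient.mk_eq_zero _).1 h1.symm
  exact ⟨u, hu.symm⟩

theorem epsMap_surjective : Function.Surjective (epsMap Φ P) := fun t => by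
  induction t using BalTensor.induction_on with
  | zero => exact ⟨0, map_zero _⟩
  | tmul y x =>
    exact ⟨BalTensor.tmul _ (epsVecInv m y) x, by rw [epsMap_tmul, epsVec_epsVecInv]⟩
  | add t t' h h' =>
    obtain ⟨u, rfl⟩ := h
    obtain ⟨u', rfl⟩ := h'
    exact ⟨u + u', map_add _ _ _⟩

theorem projE_epsAct (r : R) (y : m ⊕ m → S) :
    specAct Φ (constantCoeff (R := S)) r (projE y) = projE (epsAct Φ r y) := by
  ext j
  simp [specAct, rowAct, Matrix.vecMul, dotProduct, projE, epsAct, epsMatrix,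
    LinearMap.funLeft]

theorem inclE_epsAct (r : R) (y : m → S) :
    epsAct Φ r (inclE y) = inclE (specAct Φ (constantCoeff (R := S)) r y) := by
  ext (j | j) <;>
  simp [specAct, rowAct, Matrix.vecMul, dotProduct, inclE, epsAct, epsMatrix]

/-- The projection `(S^m ⊗ E_θ) ⊗_R P → S^m ⊗_R P`. -/
def projEMap (P : Type*) [AddCommGroup P] [Module R P] :
    BalTensor (epsAct Φ) P →ₗ[S] BalTensor (specAct Φ (constantCoeff (R := S))) P :=
  BalTensor.baseMap (φ := RingHom.id S) projE (projE_epsAct Φ) P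

/-- The inclusion `S^m ⊗_R P → (S^m ⊗ E_θ) ⊗_R P`. -/
def inclEMap (P : Type*) [AddCommGroup P] [Module R P] :
    BalTensor (specAct Φ (constantCoeff (R := S))) P →ₗ[S] BalTensor (epsAct Φ) P :=
  BalTensor.baseMap (φ := RingHom.id S) inclE (inclE_epsAct Φ) P

theorem mk_map_projE (z : (m ⊕ m → S) ⊗[ℤ] P) :
    BalTensor.mk (specAct Φ (constantCoeff (R := S))) P
      (TensorProduct.AlgebraTensorModule.map projE LinearMap.id z) =
      projEMap Φ P (BalTensor.mk (epsAct Φ) P z) := by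
  induction z with
  | zero => simp
  | tmul y x => rfl
  | add t t' h h' => simp only [map_add, h, h']

theorem mk_map_inclE (z : (m → S) ⊗[ℤ] P) :
    BalTensor.mk (epsAct Φ) P (TensorProduct.AlgebraTensorModule.map inclE LinearMap.id z) =
      inclEMap Φ P (BalTensor.mk (specAct Φ (constantCoeff (R := S))) P z) := by
  induction z with
  | zero => simp
  | tmul y x => rfl
  | add t t' h h' => simp only [map_add, h, h']

theorem projEMap_epsMap (t : BalTensor (rowAct Φ) P) :
    projEMap Φ P (epsMap Φ P t) = redX Φ P t := by
  induction t using BalTensor.induction_on with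
  | zero => simp
  | tmul y x => rfl
  | add t t' h h' => simp only [map_add, h, h']

theorem epsMap_X_smul (t : BalTensor (rowAct Φ) P) :
    epsMap Φ P ((X : S⟦X⟧) • t) = -inclEMap Φ P (redX Φ P t) := by
  induction t using BalTensor.induction_on with
  | zero => simp
  | tmul y x =>
    rw [← BalTensor.smul_tmul, epsMap_tmul, specMap_tmul, inclEMap, BalTensor.baseMap_tmul,
      ← BalTensor.tmulHom_apply, ← BalTensor.tmulHom_apply, ← AddMonoidHom.neg_apply, ← map_neg]
    congr 2
    ext (i | i)
    · simp only [epsVec, AddMonoidHom.coe_mk, ZeroHom.coe_mk, Sum.elim_inl, Pi.smul_apply,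
        smul_eq_mul]
      rw [show (1 : ℕ) = 0 + 1 from rfl, coeff_succ_X_mul]
      simp [inclE]
    · simp [epsVec, inclE]
  | add t t' h h' => simp only [smul_add, map_add, h, h', neg_add]

/-- Since S^m ⊗ E_θ is S⟦X⟧^m modulo X², with the submodule S^m e_1 equal to the multiples of X, the
connecting map lifts an element, applies `f` and divides by −X. -/
theorem bockRel_iff (f : P →ₗ[R] P') (x : BalTensor (specAct Φ (constantCoeff (R := S))) P)
    (y : BalTensor (specAct Φ (constantCoeff (R := S))) P') :
    BockRel (specAct Φ (constantCoeff (R := S))) (epsAct Φ) f x y ↔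
      ∃ t u, redX Φ P t = x ∧ redX Φ P' u = y ∧ BalTensor.map _ f t = -((X : S⟦X⟧) • u) := by
  constructor
  · rintro ⟨z, y', hz, hy, h⟩
    rw [mk_map_projE] at hz
    rw [mk_map_inclE, hy, ← BalTensor.map_mk] at h
    obtain ⟨t, ht⟩ := epsMap_surjective Φ (BalTensor.mk (epsAct Φ) P z)
    obtain ⟨u, hu⟩ := redX_surjective Φ y
    rw [← ht, ← epsMap_map] at h
    have h0 : epsMap Φ P' (BalTensor.map _ f t + (X : S⟦X⟧) • u) = 0 := by
      rw [map_add, h, epsMap_X_smul, hu, add_neg_cancel]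
    obtain ⟨v, hv⟩ := exists_eq_X_sq_smul Φ h0
    -- The equation for `t` and `u` holds only modulo X². Subtracting X·v from `u` absorbs the error
    -- and leaves the reduction of `u` unchanged.
    refine ⟨t, u - (X : S⟦X⟧) • v, ?_, ?_, ?_⟩
    · rw [← projEMap_epsMap, ht, hz]
    · rw [map_sub, redX_smul_X, sub_zero, hu]
    · rw [smul_sub, smul_smul, ← pow_two, ← hv]
      abel
  · rintro ⟨t, u, rfl, rfl, h⟩
    obtain ⟨z, hz⟩ := BalTensor.mk_surjective (epsAct Φ) (epsMap Φ P t)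
    obtain ⟨y', hy'⟩ := BalTensor.mk_surjective (specAct Φ (constantCoeff (R := S))) (redX Φ P' u)
    refine ⟨z, y', ?_, hy', ?_⟩
    · rw [mk_map_projE, hz, projEMap_epsMap]
    · rw [mk_map_inclE, hy', ← BalTensor.map_mk, hz, ← epsMap_map, h, map_neg, epsMap_X_smul,
        neg_neg]

end BockRelationEps

/-! ### Associativity of base change along R → R' → M_m(Q) -/

section Iterated

variable {R R' : Type*} [Ring R] [Ring R'] {Q : Type*} [CommRing Q] {P P' : Type*}
  [AddCommGroup P] [Module R P] [AddCommGroup P'] [Module R P'] {m : Type*} [Fintype m]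
  [DecidableEq m]

/-- The map `l ⊗ x ↦ y l ⊗ x`. -/
def assocAux (j : R →+* R') (Ψ : R' →+* Matrix m m Q) (P : Type*) [AddCommGroup P] [Module R P]
    (y : m → Q) : BalTensor (ringAct j) P →+ BalTensor (rowAct (Ψ.comp j)) P :=
  BalTensor.liftAdd
    (AddMonoidHom.mk' (fun l => BalTensor.tmulHom (rowAct (Ψ.comp j)) (rowAct Ψ l y))
      (fun l l' => by rw [(isRightAction_rowAct Ψ).add, LinearMap.add_apply, map_add]))
    (fun r l x => by
      have : rowAct Ψ (ringAct j r l) y = rowAct (Ψ.comp j) r (rowAct Ψ l y) := by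
        simp only [ringAct, LinearMap.toSpanSingleton_apply, smul_eq_mul,
          (isRightAction_rowAct Ψ).mul]
        rfl
      simp only [AddMonoidHom.mk'_apply, this, BalTensor.tmulHom_apply, BalTensor.act_tmul])

theorem assocAux_tmul (j : R →+* R') (Ψ : R' →+* Matrix m m Q) (y : m → Q) (l : R') (x : P) :
    assocAux j Ψ P y (BalTensor.tmul _ l x) = BalTensor.tmul _ (rowAct Ψ l y) x := rfl

/-- The map `Q^m ⊗_{R'} (R' ⊗_R P) → Q^m ⊗_R P`. -/
def assocHom (j : R →+* R') (Ψ : R' →+* Matrix m m Q) (P : Type*) [AddCommGroup P] [Module R P] :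
    BalTensor (rowAct Ψ) (BalTensor (ringAct j) P) →ₗ[Q] BalTensor (rowAct (Ψ.comp j)) P :=
  BalTensor.lift (φ := RingHom.id Q)
    { toFun := assocAux j Ψ P
      map_add' := fun y y' => by
        ext t
        induction t using BalTensor.induction_on with
        | zero => simp
        | tmul l x =>
          rw [AddMonoidHom.add_apply, assocAux_tmul, assocAux_tmul, assocAux_tmul, map_add,
            BalTensor.add_tmul]
        | add t t' h h' => rw [map_add, h, h', map_add]
      map_smul' := fun c y => by
        ext t
        induction t using BalTensor.induction_on with
        | zero => simp
        | tmul l x =>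
          rw [AddMonoidHom.smul_apply, assocAux_tmul, assocAux_tmul, map_smul,
            BalTensor.smul_tmul]
          rfl
        | add t t' h h' => rw [map_add, h, h', map_add] }
    (fun r y t => by
      induction t using BalTensor.induction_on with
      | zero => simp
      | tmul l x =>
        simp only [LinearMap.coe_mk, AddHom.coe_mk, assocAux_tmul, ← BalTensor.smul_tmul,
          smul_eq_mul, (isRightAction_rowAct Ψ).mul, Module.End.mul_apply]
      | add t t' h h' => rw [map_add, h, h', smul_add, map_add])

theorem assocHom_tmul (j : R →+* R') (Ψ : R' →+* Matrix m m Q) (y : m → Q) (l : R') (x : P) :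
    assocHom j Ψ P (BalTensor.tmul _ y (BalTensor.tmul _ l x)) =
      BalTensor.tmul _ (rowAct Ψ l y) x := rfl

/-- The map `Q^m ⊗_R P → Q^m ⊗_{R'} (R' ⊗_R P)`. -/
def assocInv (j : R →+* R') (Ψ : R' →+* Matrix m m Q) (P : Type*) [AddCommGroup P] [Module R P] :
    BalTensor (rowAct (Ψ.comp j)) P →ₗ[Q] BalTensor (rowAct Ψ) (BalTensor (ringAct j) P) :=
  BalTensor.lift (φ := RingHom.id Q)
    { toFun := fun y => (BalTensor.tmulHom (rowAct Ψ) y).comp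
        (BalTensor.tmulHom (ringAct j) (1 : R'))
      map_add' := fun y y' => by ext; simp
      map_smul' := fun c y => by ext; simp }
    (fun r y x => by
      simp only [LinearMap.coe_mk, AddHom.coe_mk, AddMonoidHom.coe_comp, Function.comp_apply,
        BalTensor.tmulHom_apply, ← BalTensor.act_tmul (ringAct j)]
      rw [show rowAct (Ψ.comp j) r y = rowAct Ψ (j r) y from rfl, BalTensor.act_tmul,
        ← BalTensor.smul_tmul]
      simp [ringAct])

theorem assocInv_tmul (j : R →+* R') (Ψ : R' →+* Matrix m m Q) (y : m → Q) (x : P) :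
    assocInv j Ψ P (BalTensor.tmul _ y x) =
      BalTensor.tmul _ y (BalTensor.tmul _ 1 x) := rfl

/-- `Q^m ⊗_{R'} (R' ⊗_R P) ≅ Q^m ⊗_R P`. -/
def assocEquiv (j : R →+* R') (Ψ : R' →+* Matrix m m Q) (P : Type*) [AddCommGroup P] [Module R P] :
    BalTensor (rowAct Ψ) (BalTensor (ringAct j) P) ≃ₗ[Q] BalTensor (rowAct (Ψ.comp j)) P :=
  LinearEquiv.ofLinearMap (assocHom j Ψ P) (assocInv j Ψ P)
    (BalTensor.hom_ext fun y x => by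
      rw [LinearMap.comp_apply, assocInv_tmul, assocHom_tmul, (isRightAction_rowAct Ψ).one]
      rfl)
    (BalTensor.hom_ext fun y t => by
      induction t using BalTensor.induction_on with
      | zero => simp [BalTensor.tmul_zero]
      | tmul l x =>
        rw [LinearMap.comp_apply, assocHom_tmul, assocInv_tmul, BalTensor.act_tmul,
          ← BalTensor.smul_tmul, smul_eq_mul, mul_one]
        rfl
      | add t t' h h' => simp only [BalTensor.tmul_add, map_add, h, h'])

theorem assocEquiv_tmul (j : R →+* R') (Ψ : R' →+* Matrix m m Q) (y : m → Q) (l : R') (x : P) :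
    assocEquiv j Ψ P (BalTensor.tmul _ y (BalTensor.tmul _ l x)) =
      BalTensor.tmul _ (rowAct Ψ l y) x := rfl

theorem assocEquiv_map (j : R →+* R') (Ψ : R' →+* Matrix m m Q) (f : P →ₗ[R] P')
    (t : BalTensor (rowAct Ψ) (BalTensor (ringAct j) P)) :
    assocEquiv j Ψ P' (BalTensor.map _ (BalTensor.map _ f) t) =
      BalTensor.map _ f (assocEquiv j Ψ P t) := by
  induction t using BalTensor.induction_on with
  | zero => simp
  | tmul y t =>
    induction t using BalTensor.induction_on with
    | zero => simp [BalTensor.tmul_zero]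
    | tmul l x =>
      rw [BalTensor.map_tmul, BalTensor.map_tmul, assocEquiv_tmul, assocEquiv_tmul,
        BalTensor.map_tmul]
    | add t t' h h' => simp only [BalTensor.tmul_add, map_add, h, h']
  | add t t' h h' => simp only [map_add, h, h']

end Iterated

/-! ### The components of the even and odd parts of a complex -/

theorem sum_lcomp {R M M' M'' ι : Type*} [Ring R] [AddCommGroup M] [AddCommGroup M']
    [AddCommGroup M''] [Module R M] [Module R M'] [Module R M''] (s : Finset ι)
    (f : ι → M' →ₗ[R] M'') (g : M →ₗ[R] M') : (∑ i ∈ s, f i) ∘ₗ g = ∑ i ∈ s, f i ∘ₗ g := by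
  ext; simp

section Fold

open CategoryTheory

variable {R : Type*} [Ring R] (A : CochainComplex (ModuleCat R) ℤ) (k : ℕ)

open Classical in
/-- The inclusion of `A^i` into the odd part, zero for even `i`. -/
def oddIn (i : ℤ) : A.X i →ₗ[R] OddPart A k :=
  if h : Odd i then LinearMap.inl R _ _ ∘ₗ
    DirectSum.lof R {i : ℤ // Odd i} (fun i => A.X i) ⟨i, h⟩ else 0

open Classical in
/-- The inclusion of `A^i` into the even part, zero for odd `i`. -/
def evenIn (i : ℤ) : A.X i →ₗ[R] EvenPart A k :=
  if h : Even i then LinearMap.inl R _ _ ∘ₗ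
    DirectSum.lof R {i : ℤ // Even i} (fun i => A.X i) ⟨i, h⟩ else 0

open Classical in
/-- The projection of the odd part to `A^i`, zero for even `i`. -/
def oddPr (i : ℤ) : OddPart A k →ₗ[R] A.X i :=
  if h : Odd i then DirectSum.component R {i : ℤ // Odd i} (fun i => A.X i) ⟨i, h⟩ ∘ₗ
    LinearMap.fst R _ _ else 0

open Classical in
/-- The projection of the even part to `A^i`, zero for odd `i`. -/
def evenPr (i : ℤ) : EvenPart A k →ₗ[R] A.X i :=
  if h : Even i then DirectSum.component R {i : ℤ // Even i} (fun i => A.X i) ⟨i, h⟩ ∘ₗ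
    LinearMap.fst R _ _ else 0

/-- The inclusion of the free summand into the odd part. -/
def oddInFree : (Fin k → R) →ₗ[R] OddPart A k := LinearMap.inr R _ _

/-- The inclusion of the free summand into the even part. -/
def evenInFree : (Fin k → R) →ₗ[R] EvenPart A k := LinearMap.inr R _ _

/-- The projection of the odd part to the free summand. -/
def oddPrFree : OddPart A k →ₗ[R] (Fin k → R) := LinearMap.snd R _ _

/-- The projection of the even part to the free summand. -/
def evenPrFree : EvenPart A k →ₗ[R] (Fin k → R) := LinearMap.snd R _ _

theorem odd_hom_ext {M : Type*} [AddCommGroup M] [Module R M] {f g : OddPart A k →ₗ[R] M}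
    (h : ∀ i, Odd i → f ∘ₗ oddIn A k i = g ∘ₗ oddIn A k i)
    (hk : f ∘ₗ oddInFree A k = g ∘ₗ oddInFree A k) : f = g := by
  refine LinearMap.prod_ext (DirectSum.linearMap_ext _ fun i => ?_) hk
  have := h i.1 i.2
  simpa only [oddIn, dif_pos i.2, ← LinearMap.comp_assoc] using this

theorem even_hom_ext {M : Type*} [AddCommGroup M] [Module R M] {f g : EvenPart A k →ₗ[R] M}
    (h : ∀ i, Even i → f ∘ₗ evenIn A k i = g ∘ₗ evenIn A k i)
    (hk : f ∘ₗ evenInFree A k = g ∘ₗ evenInFree A k) : f = g := by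
  refine LinearMap.prod_ext (DirectSum.linearMap_ext _ fun i => ?_) hk
  have := h i.1 i.2
  simpa only [evenIn, dif_pos i.2, ← LinearMap.comp_assoc] using this

variable {A k}

/-- Both sides vanish when `i` is even, so this relation and its companions hold in all degrees and
later arguments need no parity distinctions. -/
theorem dOdd_oddIn {i j : ℤ} (h : i + 1 = j) :
    dOdd A k ∘ₗ oddIn A k i = evenIn A k j ∘ₗ diff A i j := by
  subst h
  by_cases hi : Odd i
  · ext x
    · simp [dOdd, oddIn, evenIn, hi, hi.add_one]
    · simp [dOdd, oddIn, evenIn, hi, hi.add_one]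
  · have : ¬ Even (i + 1) := by simpa [Int.even_add_one] using hi
    simp [oddIn, evenIn, hi, this]

theorem dEven_evenIn {i j : ℤ} (h : i + 1 = j) :
    dEven A k ∘ₗ evenIn A k i = oddIn A k j ∘ₗ diff A i j := by
  subst h
  by_cases hi : Even i
  · ext x
    · simp [dEven, oddIn, evenIn, hi, hi.add_one]
    · simp [dEven, oddIn, evenIn, hi, hi.add_one]
  · have : ¬ Odd (i + 1) := by rw [Int.odd_iff]; rw [Int.even_iff] at hi; omega
    simp [oddIn, evenIn, hi, this]

theorem dOdd_oddInFree : dOdd A k ∘ₗ oddInFree A k = evenInFree A k := by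
  ext x <;> simp [dOdd, oddInFree, evenInFree]

theorem dEven_evenInFree : dEven A k ∘ₗ evenInFree A k = 0 := by
  ext x <;> simp [dEven, evenInFree]

theorem oddPr_oddIn_self {i : ℤ} (h : Odd i) : oddPr A k i ∘ₗ oddIn A k i = LinearMap.id := by
  ext x
  simp [oddPr, oddIn, h, DirectSum.component.lof_self]

theorem evenPr_evenIn_self {i : ℤ} (h : Even i) :
    evenPr A k i ∘ₗ evenIn A k i = LinearMap.id := by
  ext x
  simp [evenPr, evenIn, h, DirectSum.component.lof_self]

theorem oddPr_oddIn_of_ne {i j : ℤ} (h : i ≠ j) : oddPr A k i ∘ₗ oddIn A k j = 0 := by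
  by_cases hi : Odd i
  · by_cases hj : Odd j
    · ext x
      simp only [oddPr, hi, dif_pos, oddIn, hj, LinearMap.coe_comp, Function.comp_apply,
        LinearMap.coe_inl, LinearMap.coe_fst, LinearMap.zero_apply, DirectSum.apply_eq_component]
      rw [← DirectSum.apply_eq_component, DirectSum.lof_eq_of, DirectSum.of_eq_of_ne]
      intro h'
      exact h (congrArg Subtype.val h')
    · simp [oddIn, hj]
  · simp [oddPr, hi]

theorem evenPr_evenIn_of_ne {i j : ℤ} (h : i ≠ j) : evenPr A k i ∘ₗ evenIn A k j = 0 := by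
  by_cases hi : Even i
  · by_cases hj : Even j
    · ext x
      simp only [evenPr, hi, dif_pos, evenIn, hj, LinearMap.coe_comp, Function.comp_apply,
        LinearMap.coe_inl, LinearMap.coe_fst, LinearMap.zero_apply, DirectSum.apply_eq_component]
      rw [← DirectSum.apply_eq_component, DirectSum.lof_eq_of, DirectSum.of_eq_of_ne]
      intro h'
      exact h (congrArg Subtype.val h')
    · simp [evenIn, hj]
  · simp [evenPr, hi]

theorem oddPr_oddInFree (i : ℤ) : oddPr A k i ∘ₗ oddInFree A k = 0 := by
  by_cases hi : Odd i
  · ext x; simp [oddPr, oddInFree, hi]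
  · simp [oddPr, hi]

theorem evenPr_evenInFree (i : ℤ) : evenPr A k i ∘ₗ evenInFree A k = 0 := by
  by_cases hi : Even i
  · ext x; simp [evenPr, evenInFree, hi]
  · simp [evenPr, hi]

theorem oddPrFree_oddIn (i : ℤ) : oddPrFree A k ∘ₗ oddIn A k i = 0 := by
  by_cases hi : Odd i
  · ext x; simp [oddIn, oddPrFree, hi]
  · simp [oddIn, hi]

theorem evenPrFree_evenIn (i : ℤ) : evenPrFree A k ∘ₗ evenIn A k i = 0 := by
  by_cases hi : Even i
  · ext x; simp [evenIn, evenPrFree, hi]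
  · simp [evenIn, hi]

theorem oddPrFree_oddInFree : oddPrFree A k ∘ₗ oddInFree A k = LinearMap.id := by
  ext; simp [oddPrFree, oddInFree]

theorem evenPrFree_evenInFree : evenPrFree A k ∘ₗ evenInFree A k = LinearMap.id := by
  ext; simp [evenPrFree, evenInFree]

theorem evenPr_dOdd {i j : ℤ} (h : i + 1 = j) :
    evenPr A k j ∘ₗ dOdd A k = diff A i j ∘ₗ oddPr A k i := by
  refine odd_hom_ext A k (fun l hl => ?_) ?_
  · rw [LinearMap.comp_assoc, dOdd_oddIn rfl, LinearMap.comp_assoc, ← LinearMap.comp_assoc]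
    rcases eq_or_ne l i with rfl | hli
    · subst h
      rw [evenPr_evenIn_self hl.add_one, oddPr_oddIn_self hl]; rfl
    · rw [evenPr_evenIn_of_ne (by omega), oddPr_oddIn_of_ne hli.symm]; simp
  · rw [LinearMap.comp_assoc, dOdd_oddInFree, evenPr_evenInFree, LinearMap.comp_assoc,
      oddPr_oddInFree, LinearMap.comp_zero]

theorem oddPr_dEven {i j : ℤ} (h : i + 1 = j) :
    oddPr A k j ∘ₗ dEven A k = diff A i j ∘ₗ evenPr A k i := by
  refine even_hom_ext A k (fun l hl => ?_) ?_
  · rw [LinearMap.comp_assoc, dEven_evenIn rfl, LinearMap.comp_assoc, ← LinearMap.comp_assoc]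
    rcases eq_or_ne l i with rfl | hli
    · subst h
      rw [oddPr_oddIn_self hl.add_one, evenPr_evenIn_self hl]; rfl
    · rw [oddPr_oddIn_of_ne (by omega), evenPr_evenIn_of_ne hli.symm]; simp
  · rw [LinearMap.comp_assoc, dEven_evenInFree, LinearMap.comp_assoc,
      evenPr_evenInFree, LinearMap.comp_zero, LinearMap.comp_zero]

theorem evenPrFree_dOdd : evenPrFree A k ∘ₗ dOdd A k = oddPrFree A k := by
  refine odd_hom_ext A k (fun l hl => ?_) ?_
  · rw [LinearMap.comp_assoc, dOdd_oddIn rfl, ← LinearMap.comp_assoc, evenPrFree_evenIn,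
      oddPrFree_oddIn, LinearMap.zero_comp]
  · rw [LinearMap.comp_assoc, dOdd_oddInFree, evenPrFree_evenInFree, oddPrFree_oddInFree]

theorem oddPrFree_dEven : oddPrFree A k ∘ₗ dEven A k = 0 := by
  refine even_hom_ext A k (fun l hl => ?_) ?_
  · rw [LinearMap.comp_assoc, dEven_evenIn rfl, ← LinearMap.comp_assoc, oddPrFree_oddIn,
      LinearMap.zero_comp, LinearMap.zero_comp]
  · rw [LinearMap.comp_assoc, dEven_evenInFree, LinearMap.zero_comp, LinearMap.comp_zero]

theorem diff_comp_diff (i j l : ℤ) : diff A j l ∘ₗ diff A i j = 0 := by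
  rw [← ModuleCat.hom_comp, A.d_comp_d]; rfl

theorem dEven_comp_dOdd : dEven A k ∘ₗ dOdd A k = 0 := by
  refine odd_hom_ext A k (fun l hl => ?_) ?_
  · rw [LinearMap.comp_assoc, dOdd_oddIn rfl, ← LinearMap.comp_assoc, dEven_evenIn rfl,
      LinearMap.comp_assoc, diff_comp_diff, LinearMap.comp_zero, LinearMap.zero_comp]
  · rw [LinearMap.comp_assoc, dOdd_oddInFree, dEven_evenInFree, LinearMap.zero_comp]

theorem dOdd_comp_dEven : dOdd A k ∘ₗ dEven A k = 0 := by
  refine even_hom_ext A k (fun l hl => ?_) ?_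
  · rw [LinearMap.comp_assoc, dEven_evenIn rfl, ← LinearMap.comp_assoc, dOdd_oddIn rfl,
      LinearMap.comp_assoc, diff_comp_diff, LinearMap.comp_zero, LinearMap.zero_comp]
  · rw [LinearMap.comp_assoc, dEven_evenInFree, LinearMap.comp_zero, LinearMap.zero_comp]

/-- Even degrees contribute zero to the sum, and boundedness removes the degrees outside the range.
-/
theorem sum_oddIn_oddPr {N : ℤ} (hN : ∀ i, N < |i| → Subsingleton (A.X i)) :
    ∑ i ∈ Finset.Icc (-N) N, oddIn A k i ∘ₗ oddPr A k i + oddInFree A k ∘ₗ oddPrFree A k =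
      LinearMap.id := by
  refine odd_hom_ext A k (fun l hl => ?_) ?_
  · rw [LinearMap.add_comp, LinearMap.comp_assoc _ _ (oddInFree A k), oddPrFree_oddIn,
      LinearMap.comp_zero, add_zero, sum_lcomp, LinearMap.id_comp]
    by_cases hlN : l ∈ Finset.Icc (-N) N
    · rw [Finset.sum_eq_single_of_mem l hlN, LinearMap.comp_assoc, oddPr_oddIn_self hl,
        LinearMap.comp_id]
      intro i _ hi
      rw [LinearMap.comp_assoc, oddPr_oddIn_of_ne hi, LinearMap.comp_zero]
    · have : Subsingleton (A.X l) := hN l (by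
        rw [Finset.mem_Icc, ← abs_le] at hlN
        exact not_le.1 hlN)
      ext1 x
      rw [Subsingleton.elim x 0, map_zero, map_zero]
  · rw [LinearMap.add_comp, LinearMap.comp_assoc _ _ (oddInFree A k), oddPrFree_oddInFree,
      sum_lcomp, Finset.sum_eq_zero, zero_add]
    · rfl
    · intro i _
      rw [LinearMap.comp_assoc, oddPr_oddInFree, LinearMap.comp_zero]

theorem sum_evenIn_evenPr {N : ℤ} (hN : ∀ i, N < |i| → Subsingleton (A.X i)) :
    ∑ i ∈ Finset.Icc (-N) N, evenIn A k i ∘ₗ evenPr A k i + evenInFree A k ∘ₗ evenPrFree A k =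
      LinearMap.id := by
  refine even_hom_ext A k (fun l hl => ?_) ?_
  · rw [LinearMap.add_comp, LinearMap.comp_assoc _ _ (evenInFree A k), evenPrFree_evenIn,
      LinearMap.comp_zero, add_zero, sum_lcomp, LinearMap.id_comp]
    by_cases hlN : l ∈ Finset.Icc (-N) N
    · rw [Finset.sum_eq_single_of_mem l hlN, LinearMap.comp_assoc, evenPr_evenIn_self hl,
        LinearMap.comp_id]
      intro i _ hi
      rw [LinearMap.comp_assoc, evenPr_evenIn_of_ne hi, LinearMap.comp_zero]
    · have : Subsingleton (A.X l) := hN l (by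
        rw [Finset.mem_Icc, ← abs_le] at hlN
        exact not_le.1 hlN)
      ext1 x
      rw [Subsingleton.elim x 0, map_zero, map_zero]
  · rw [LinearMap.add_comp, LinearMap.comp_assoc _ _ (evenInFree A k), evenPrFree_evenInFree,
      sum_lcomp, Finset.sum_eq_zero, zero_add]
    · rfl
    · intro i _
      rw [LinearMap.comp_assoc, evenPr_evenInFree, LinearMap.comp_zero]

theorem finite_oddPart (hA : IsPerfect A) : Module.Finite R (OddPart A k) := by
  obtain ⟨N, hN⟩ := hA.bounded
  have := hA.finite
  have hsurj : Function.Surjective ((∑ i : Finset.Icc (-N) N,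
      oddIn A k i ∘ₗ LinearMap.proj (R := R) (φ := fun i : Finset.Icc (-N) N => A.X i) i).coprod
        (oddInFree A k)) := fun x => by
    refine ⟨(fun i => oddPr A k i x, oddPrFree A k x), ?_⟩
    have h := LinearMap.congr_fun (sum_oddIn_oddPr (k := k) hN) x
    rw [← Finset.sum_coe_sort] at h
    simpa using h
  exact Module.Finite.of_surjective _ hsurj

theorem finite_evenPart (hA : IsPerfect A) : Module.Finite R (EvenPart A k) := by
  obtain ⟨N, hN⟩ := hA.bounded
  have := hA.finite
  have hsurj : Function.Surjective ((∑ i : Finset.Icc (-N) N,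
      evenIn A k i ∘ₗ LinearMap.proj (R := R) (φ := fun i : Finset.Icc (-N) N => A.X i) i).coprod
        (evenInFree A k)) := fun x => by
    refine ⟨(fun i => evenPr A k i x, evenPrFree A k x), ?_⟩
    have h := LinearMap.congr_fun (sum_evenIn_evenPr (k := k) hN) x
    rw [← Finset.sum_coe_sort] at h
    simpa using h
  exact Module.Finite.of_surjective _ hsurj

theorem projective_oddPart (hA : IsPerfect A) : Module.Projective R (OddPart A k) := by
  have := hA.projective
  infer_instance

theorem projective_evenPart (hA : IsPerfect A) : Module.Projective R (EvenPart A k) := by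
  have := hA.projective
  infer_instance

end Fold

/-! ### Contractions -/

/-- A bounded exact complex of projectives is contractible. Exactness of a ℤ/2-graded complex would
not suffice, so the ℤ-grading of the total module is recorded by the projections `pr i`; `q`
projects to the acyclic free summand, where the homotopy `h₀` is given. The homotopy is built by
descending induction on the degree. -/
theorem exists_homotopy {S V : Type*} [Ring S] [AddCommGroup V] [Module S V]
    [Module.Projective S V] {δ : Module.End S V} (hδδ : δ * δ = 0)
    (hexact : ∀ x, δ x = 0 → ∃ y, δ y = x) {pr : ℤ → Module.End S V} {q h₀ : Module.End S V}
    (hpr : ∀ i j, i ≠ j → pr i * pr j = 0) (hδ : ∀ i, pr (i + 1) * δ = δ * pr i)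
    (hq : ∀ i, pr i * q = 0) (hδq : δ * q = q * δ) (h₀q : (δ * h₀ + h₀ * δ) * q = q) {N : ℤ}
    (hsum : ∑ i ∈ Finset.Icc (-N) N, pr i + q = 1) :
    ∃ h : Module.End S V, δ * h + h * δ = 1 := by
  have hlast : pr (N + 1) = 0 := by
    have h := congrArg (pr (N + 1) * ·) hsum
    simp only [mul_add, hq, add_zero, mul_one, Finset.mul_sum] at h
    rw [← h]
    refine Finset.sum_eq_zero fun i hi => hpr _ _ ?_
    have := (Finset.mem_Icc.1 hi).2
    omega
  -- The induction starts in degree N + 1, whose projection is zero, and each step settles one lower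
  -- degree.
  have key : ∀ m : ℕ, ∃ h : Module.End S V, (δ * h + h * δ) * q = q ∧
      ∀ i, N - m < i → i ≤ N + 1 → (δ * h + h * δ) * pr i = pr i := by
    intro m
    induction m with
    | zero =>
      refine ⟨h₀, h₀q, fun i h1 h2 => ?_⟩
      obtain rfl : i = N + 1 := by push_cast at h1; omega
      rw [hlast, mul_zero]
    | succ m ih =>
      obtain ⟨h, hhq, hh⟩ := ih
      set i₀ : ℤ := N - m with hi₀
      -- Degree i₀ + 1 being settled, the defect 1 − (δh + hδ) in degree i₀ takes values in
      -- cocycles; by exactness and projectivity it factors as δ·w, and adding w·pr i₀ to `h`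
      -- repairs it.
      have hcoc : δ * ((1 - (δ * h + h * δ)) * pr i₀) = 0 := by
        have h3 := hh (i₀ + 1) (by omega) (by omega)
        have h4 : (δ * h + h * δ) * (δ * pr i₀) = δ * pr i₀ := by
          rw [← hδ, ← mul_assoc, h3]
        have h5 : δ * (h * (δ * pr i₀)) = δ * pr i₀ := by
          have : h * δ * (δ * pr i₀) = h * (δ * δ) * pr i₀ := by simp only [mul_assoc]
          rw [add_mul, this, hδδ, mul_zero, zero_mul, add_zero] at h4
          simpa only [mul_assoc] using h4
        have h6 : δ * (δ * (h * pr i₀)) = 0 := by rw [← mul_assoc, hδδ, zero_mul]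
        simp only [sub_mul, add_mul, mul_sub, mul_add, one_mul, mul_assoc, h5, h6, zero_add,
          sub_self]
      obtain ⟨w, hw⟩ : ∃ w : Module.End S V, δ * w = (1 - (δ * h + h * δ)) * pr i₀ := by
        let f : V →ₗ[S] LinearMap.range δ := ((1 - (δ * h + h * δ)) * pr i₀).codRestrict _
          fun x => LinearMap.mem_range.2 (hexact _ (LinearMap.congr_fun hcoc x))
        obtain ⟨w, hw⟩ := Module.projective_lifting_property δ.rangeRestrict f
          δ.surjective_rangeRestrict
        refine ⟨w, LinearMap.ext fun x => ?_⟩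
        exact congrArg Subtype.val (LinearMap.congr_fun hw x)
      have hexp : ∀ y, (δ * (h + w * pr i₀) + (h + w * pr i₀) * δ) * y =
          (δ * h + h * δ) * y + δ * w * (pr i₀ * y) + w * (pr i₀ * δ * y) := fun y => by
        noncomm_ring
      have hprδ : pr i₀ * δ = δ * pr (i₀ - 1) := by
        have := hδ (i₀ - 1)
        rwa [sub_add_cancel] at this
      refine ⟨h + w * pr i₀, ?_, fun i h1 h2 => ?_⟩
      · rw [hexp, hhq, hq, mul_zero, add_zero, hprδ, mul_assoc, hq, mul_zero, mul_zero, add_zero]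
      · rw [hexp, hprδ, mul_assoc δ (pr (i₀ - 1)), hpr (i₀ - 1) i (by push_cast at h1; omega),
          mul_zero, mul_zero, add_zero]
        rcases eq_or_ne i₀ i with rfl | hi
        · rw [hw, mul_assoc (1 - (δ * h + h * δ))]
          have hidem : pr i₀ * pr i₀ = pr i₀ := by
            by_cases hi : i₀ ∈ Finset.Icc (-N) N
            · have h := congrArg (pr i₀ * ·) hsum
              simp only [mul_add, hq, add_zero, mul_one, Finset.mul_sum] at h
              rwa [Finset.sum_eq_single_of_mem i₀ hi] at h
              exact fun j _ hj => hpr _ _ hj.symm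
            · have h := congrArg (pr i₀ * ·) hsum
              simp only [mul_add, hq, add_zero, mul_one, Finset.mul_sum] at h
              rw [Finset.sum_eq_zero] at h
              · rw [← h, mul_zero]
              · exact fun j hj => hpr _ _ (fun hji => hi (hji ▸ hj))
          rw [hidem, hidem]
          noncomm_ring
        · rw [hpr i₀ i hi, mul_zero, add_zero, hh i (by push_cast at h1; omega) h2]
  -- These are the steps needed to descend from N to −N.
  obtain ⟨h, hhq, hh⟩ := key (2 * N + 1).toNat
  refine ⟨h, ?_⟩
  rw [← mul_one (δ * h + h * δ), ← hsum, mul_add, hhq, Finset.mul_sum]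
  congr 1
  refine Finset.sum_congr rfl fun i hi => hh i ?_ ?_
  · have := Finset.mem_Icc.1 hi; omega
  · have := Finset.mem_Icc.1 hi; omega

section FoldExact

open CategoryTheory

variable {R : Type*} [Ring R] {A : CochainComplex (ModuleCat R) ℤ} {k : ℕ}
  {S Y : Type*} [Ring S] [AddCommGroup Y] [Module S Y] {act : R → Module.End S Y}

theorem eq_sum_oddIn {N : ℤ} (hN : ∀ i, N < |i| → Subsingleton (A.X i))
    (x : BalTensor act (OddPart A k)) :
    x = ∑ i ∈ Finset.Icc (-N) N,
      BalTensor.map act (oddIn A k i) (BalTensor.map act (oddPr A k i) x) +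
      BalTensor.map act (oddInFree A k) (BalTensor.map act (oddPrFree A k) x) := by
  have h := congrArg (BalTensor.map act) (sum_oddIn_oddPr (k := k) hN)
  rw [BalTensor.map_add, BalTensor.map_sum, BalTensor.map_id] at h
  have := LinearMap.congr_fun h x
  simp only [BalTensor.map_map]
  simpa using this.symm

theorem eq_sum_evenIn {N : ℤ} (hN : ∀ i, N < |i| → Subsingleton (A.X i))
    (x : BalTensor act (EvenPart A k)) :
    x = ∑ i ∈ Finset.Icc (-N) N,
      BalTensor.map act (evenIn A k i) (BalTensor.map act (evenPr A k i) x) +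
      BalTensor.map act (evenInFree A k) (BalTensor.map act (evenPrFree A k) x) := by
  have h := congrArg (BalTensor.map act) (sum_evenIn_evenPr (k := k) hN)
  rw [BalTensor.map_add, BalTensor.map_sum, BalTensor.map_id] at h
  have := LinearMap.congr_fun h x
  simp only [BalTensor.map_map]
  simpa using this.symm

theorem exact_odd (hA : IsPerfect A) (hAS : IsAcyclicAfter A act)
    (x : BalTensor act (OddPart A k)) (hx : BalTensor.map act (dOdd A k) x = 0) :
    ∃ y, BalTensor.map act (dEven A k) y = x := by
  obtain ⟨N, hN⟩ := hA.bounded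
  have h : ∀ i : ℤ, ∃ w : BalTensor act (A.X (i - 1)),
      BalTensor.map act (diff A (i - 1) i) w = BalTensor.map act (oddPr A k i) x := fun i => by
    refine hAS i _ ?_
    rw [BalTensor.map_map, ← evenPr_dOdd rfl, ← BalTensor.map_map, hx, map_zero]
  choose w hw using h
  refine ⟨∑ i ∈ Finset.Icc (-N) N, BalTensor.map act (evenIn A k (i - 1)) (w i), ?_⟩
  conv_rhs => rw [eq_sum_oddIn hN x]
  rw [← evenPrFree_dOdd (A := A) (k := k), ← BalTensor.map_map act (evenPrFree A k), hx, map_zero,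
    map_zero, add_zero, map_sum]
  refine Finset.sum_congr rfl fun i _ => ?_
  rw [BalTensor.map_map, dEven_evenIn (sub_add_cancel i 1), ← BalTensor.map_map, hw]

theorem exact_even (hA : IsPerfect A) (hAS : IsAcyclicAfter A act)
    (x : BalTensor act (EvenPart A k)) (hx : BalTensor.map act (dEven A k) x = 0) :
    ∃ y, BalTensor.map act (dOdd A k) y = x := by
  obtain ⟨N, hN⟩ := hA.bounded
  have h : ∀ i : ℤ, ∃ w : BalTensor act (A.X (i - 1)),
      BalTensor.map act (diff A (i - 1) i) w = BalTensor.map act (evenPr A k i) x := fun i => by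
    refine hAS i _ ?_
    rw [BalTensor.map_map, ← oddPr_dEven rfl, ← BalTensor.map_map, hx, map_zero]
  choose w hw using h
  refine ⟨∑ i ∈ Finset.Icc (-N) N, BalTensor.map act (oddIn A k (i - 1)) (w i) +
    BalTensor.map act (oddInFree A k) (BalTensor.map act (evenPrFree A k) x), ?_⟩
  conv_rhs => rw [eq_sum_evenIn hN x]
  rw [map_add, map_sum, BalTensor.map_map act (dOdd A k), dOdd_oddInFree]
  congr 1
  refine Finset.sum_congr rfl fun i _ => ?_
  rw [BalTensor.map_map, dOdd_oddIn (sub_add_cancel i 1), ← BalTensor.map_map, hw]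

/-- A homotopy `h` from the identity to zero gives the contraction `hδh`, of square zero. -/
def contractionOfHomotopy {Vo Ve : Type*} [AddCommGroup Vo] [Module S Vo] [AddCommGroup Ve]
    [Module S Ve] {δo : Vo →ₗ[S] Ve} {δe : Ve →ₗ[S] Vo} (hoe : δe ∘ₗ δo = 0) (heo : δo ∘ₗ δe = 0)
    {ho : Vo →ₗ[S] Ve} {he : Ve →ₗ[S] Vo} (h1 : δe ∘ₗ ho + he ∘ₗ δo = LinearMap.id)
    (h2 : δo ∘ₗ he + ho ∘ₗ δe = LinearMap.id) : Contraction δo δe :=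
  have h1' : ∀ x, he (δo x) = x - δe (ho x) := fun x => by
    have := LinearMap.congr_fun h1 x
    simp only [LinearMap.add_apply, LinearMap.comp_apply, LinearMap.id_apply] at this
    rw [eq_sub_iff_add_eq, add_comm]; exact this
  have h2' : ∀ x, ho (δe x) = x - δo (he x) := fun x => by
    have := LinearMap.congr_fun h2 x
    simp only [LinearMap.add_apply, LinearMap.comp_apply, LinearMap.id_apply] at this
    rw [eq_sub_iff_add_eq, add_comm]; exact this
  have hoe' : ∀ x, δe (δo x) = 0 := LinearMap.congr_fun hoe
  have heo' : ∀ x, δo (δe x) = 0 := LinearMap.congr_fun heo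
  { so := ho ∘ₗ δe ∘ₗ ho
    se := he ∘ₗ δo ∘ₗ he
    odd := by ext x; simp [h1', h2', hoe', heo']
    even := by ext x; simp [h1', h2', hoe', heo']
    sq_odd := by ext x; simp [h1', h2', hoe', heo']
    sq_even := by ext x; simp [h1', h2', hoe', heo'] }

/-- Both parts are packed into V = odd × even, to which `exists_homotopy` applies. On the free
summands the homotopy is the identification of the even copy with the odd copy. -/
theorem nonempty_contraction [Module.Finite S Y] [Module.Free S Y] (hact : IsRightAction act)
    (hA : IsPerfect A) (hAS : IsAcyclicAfter A act) :
    Nonempty (Contraction (BalTensor.map act (dOdd A k)) (BalTensor.map act (dEven A k))) := by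
  obtain ⟨N, hN⟩ := hA.bounded
  have := finite_oddPart (k := k) hA
  have := finite_evenPart (k := k) hA
  have := projective_oddPart (k := k) hA
  have := projective_evenPart (k := k) hA
  have := (BalTensor.finite_projective (P := OddPart A k) hact).2
  have := (BalTensor.finite_projective (P := EvenPart A k) hact).2
  let V := BalTensor act (OddPart A k) × BalTensor act (EvenPart A k)
  let δo := BalTensor.map act (dOdd A k)
  let δe := BalTensor.map act (dEven A k)
  have hoe : δe ∘ₗ δo = 0 := by rw [← BalTensor.map_comp, dEven_comp_dOdd, BalTensor.map_zero]
  have heo : δo ∘ₗ δe = 0 := by rw [← BalTensor.map_comp, dOdd_comp_dEven, BalTensor.map_zero]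
  let δ : Module.End S V := (δe ∘ₗ LinearMap.snd _ _ _).prod (δo ∘ₗ LinearMap.fst _ _ _)
  let pr : ℤ → Module.End S V := fun i =>
    (BalTensor.map act (oddIn A k i ∘ₗ oddPr A k i)).prodMap
      (BalTensor.map act (evenIn A k i ∘ₗ evenPr A k i))
  let q : Module.End S V := (BalTensor.map act (oddInFree A k ∘ₗ oddPrFree A k)).prodMap
      (BalTensor.map act (evenInFree A k ∘ₗ evenPrFree A k))
  let h₀ : Module.End S V :=
    (BalTensor.map act (oddInFree A k ∘ₗ evenPrFree A k) ∘ₗ LinearMap.snd _ _ _).prod 0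
  have hpe : ∀ i, (evenIn A k (i + 1) ∘ₗ evenPr A k (i + 1)) ∘ₗ dOdd A k =
      dOdd A k ∘ₗ (oddIn A k i ∘ₗ oddPr A k i) := fun i => by
    rw [LinearMap.comp_assoc, evenPr_dOdd rfl, ← LinearMap.comp_assoc, ← LinearMap.comp_assoc,
      dOdd_oddIn rfl]
  have hpo : ∀ i, (oddIn A k (i + 1) ∘ₗ oddPr A k (i + 1)) ∘ₗ dEven A k =
      dEven A k ∘ₗ (evenIn A k i ∘ₗ evenPr A k i) := fun i => by
    rw [LinearMap.comp_assoc, oddPr_dEven rfl, ← LinearMap.comp_assoc, ← LinearMap.comp_assoc,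
      dEven_evenIn rfl]
  obtain ⟨h, hh⟩ := exists_homotopy (S := S) (V := V) (δ := δ) (pr := pr) (q := q) (h₀ := h₀)
    (N := N) (by
      refine LinearMap.ext fun x => Prod.ext ?_ ?_
      · exact LinearMap.congr_fun hoe x.1
      · exact LinearMap.congr_fun heo x.2)
    (fun x hx => by
      obtain ⟨y, hy⟩ := exact_odd hA hAS x.1 (congrArg Prod.snd hx)
      obtain ⟨y', hy'⟩ := exact_even hA hAS x.2 (congrArg Prod.fst hx)
      exact ⟨(y', y), Prod.ext hy hy'⟩)
    (fun i j hij => by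
      refine LinearMap.ext fun x => Prod.ext ?_ ?_
      · change BalTensor.map act _ (BalTensor.map act _ x.1) = 0
        rw [BalTensor.map_map, LinearMap.comp_assoc, ← LinearMap.comp_assoc (oddPr A k j),
          oddPr_oddIn_of_ne hij, LinearMap.zero_comp, LinearMap.comp_zero, BalTensor.map_zero,
          LinearMap.zero_apply]
      · change BalTensor.map act _ (BalTensor.map act _ x.2) = 0
        rw [BalTensor.map_map, LinearMap.comp_assoc, ← LinearMap.comp_assoc (evenPr A k j),
          evenPr_evenIn_of_ne hij, LinearMap.zero_comp, LinearMap.comp_zero, BalTensor.map_zero,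
          LinearMap.zero_apply])
    (fun i => by
      refine LinearMap.ext fun x => Prod.ext ?_ ?_
      · change BalTensor.map act _ (BalTensor.map act _ x.2) =
          BalTensor.map act _ (BalTensor.map act _ x.2)
        rw [BalTensor.map_map, BalTensor.map_map, hpo]
      · change BalTensor.map act _ (BalTensor.map act _ x.1) =
          BalTensor.map act _ (BalTensor.map act _ x.1)
        rw [BalTensor.map_map, BalTensor.map_map, hpe])
    (fun i => by
      refine LinearMap.ext fun x => Prod.ext ?_ ?_
      · change BalTensor.map act _ (BalTensor.map act _ x.1) = 0
        rw [BalTensor.map_map, LinearMap.comp_assoc, ← LinearMap.comp_assoc (oddPrFree A k),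
          oddPr_oddInFree, LinearMap.zero_comp, LinearMap.comp_zero, BalTensor.map_zero,
          LinearMap.zero_apply]
      · change BalTensor.map act _ (BalTensor.map act _ x.2) = 0
        rw [BalTensor.map_map, LinearMap.comp_assoc, ← LinearMap.comp_assoc (evenPrFree A k),
          evenPr_evenInFree, LinearMap.zero_comp, LinearMap.comp_zero, BalTensor.map_zero,
          LinearMap.zero_apply])
    (by
      refine LinearMap.ext fun x => Prod.ext ?_ ?_
      · change BalTensor.map act _ (BalTensor.map act _ x.2) =
          BalTensor.map act _ (BalTensor.map act _ x.2)
        rw [BalTensor.map_map, BalTensor.map_map, LinearMap.comp_assoc, oddPrFree_dEven,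
          ← LinearMap.comp_assoc, dEven_evenInFree, LinearMap.comp_zero, LinearMap.zero_comp]
      · change BalTensor.map act _ (BalTensor.map act _ x.1) =
          BalTensor.map act _ (BalTensor.map act _ x.1)
        rw [BalTensor.map_map, BalTensor.map_map, LinearMap.comp_assoc, evenPrFree_dOdd,
          ← LinearMap.comp_assoc, dOdd_oddInFree])
    (by
      refine LinearMap.ext fun x => Prod.ext ?_ ?_
      · change BalTensor.map act _ 0 + BalTensor.map act _ (BalTensor.map act _
          (BalTensor.map act _ x.1)) = BalTensor.map act _ x.1
        rw [map_zero, zero_add, BalTensor.map_map, BalTensor.map_map,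
          LinearMap.comp_assoc (dOdd A k), evenPrFree_dOdd, LinearMap.comp_assoc,
          ← LinearMap.comp_assoc (oddPrFree A k) (oddInFree A k), oddPrFree_oddInFree,
          LinearMap.id_comp]
      · change BalTensor.map act _ (BalTensor.map act _ (BalTensor.map act _ x.2)) + 0 =
          BalTensor.map act _ x.2
        rw [add_zero, BalTensor.map_map, BalTensor.map_map,
          ← LinearMap.comp_assoc _ (oddInFree A k), dOdd_oddInFree, LinearMap.comp_assoc,
          ← LinearMap.comp_assoc (evenPrFree A k) (evenInFree A k), evenPrFree_evenInFree,
          LinearMap.id_comp])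
    (by
      refine LinearMap.ext fun x => Prod.ext ?_ ?_
      · refine Eq.trans ?_ (eq_sum_oddIn hN x.1).symm
        change LinearMap.fst S _ _ ((∑ i ∈ Finset.Icc (-N) N, pr i + q) x) = _
        rw [LinearMap.add_apply, LinearMap.sum_apply, map_add, map_sum]
        simp only [BalTensor.map_map]
        rfl
      · refine Eq.trans ?_ (eq_sum_evenIn hN x.2).symm
        change LinearMap.snd S _ _ ((∑ i ∈ Finset.Icc (-N) N, pr i + q) x) = _
        rw [LinearMap.add_apply, LinearMap.sum_apply, map_add, map_sum]
        simp only [BalTensor.map_map]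
        rfl)
  -- Only the components of `h` that exchange the parities are kept: the diagonal components of δh +
  -- hδ = 1 involve no others.
  refine ⟨contractionOfHomotopy hoe heo
    (ho := LinearMap.snd S _ _ ∘ₗ h ∘ₗ LinearMap.inl S _ _)
    (he := LinearMap.fst S _ _ ∘ₗ h ∘ₗ LinearMap.inr S _ _) ?_ ?_⟩
  · refine LinearMap.ext fun x => ?_
    have : δe (h (x, 0)).2 + (h (δe 0, δo x)).1 = x :=
      congrArg Prod.fst (LinearMap.congr_fun hh (x, 0))
    rw [map_zero] at this
    exact this
  · refine LinearMap.ext fun x => ?_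
    have : δo (h (0, x)).1 + (h (δe x, δo 0)).2 = x :=
      congrArg Prod.snd (LinearMap.congr_fun hh (0, x))
    rw [map_zero] at this
    exact this

end FoldExact

/-! ### Determinants of contractions -/

section Determinants

variable {ι : Type*} [Fintype ι] [DecidableEq ι]

/-- Over a field the characteristic polynomial of the nilpotent matrix −n is a power of the
variable; it is evaluated at 1. -/
theorem det_one_add_of_mul_self_eq_zero {K : Type*} [Field K] {n : Matrix ι ι K}
    (hn : n * n = 0) : (1 + n).det = 1 := by
  have h := Matrix.isNilpotent_charpoly_sub_pow_of_isNilpotent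
    (M := -n) ⟨2, by rw [pow_two, neg_mul_neg, hn]⟩
  have h1 := congrArg (Polynomial.eval 1) (sub_eq_zero.1 h.eq_zero)
  rw [Matrix.eval_charpoly] at h1
  simpa using h1

/-- The matrices `so`, `se` contract the `ℤ/2`-graded complex with differentials `δo`, `δe`. -/
structure IsContraction {K : Type*} [CommRing K] (δo δe so se : Matrix ι ι K) : Prop where
  odd : δe * so + se * δo = 1
  even : δo * se + so * δe = 1
  sq_odd : se * so = 0
  sq_even : so * se = 0

/-- The mixed expressions δe·so + se'·δo and δo·se + so'·δe are both of the form 1 + n with n² = 0,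
hence have determinant 1, and they intertwine δe + se with δe + se'. -/
theorem IsContraction.det_eq {K : Type*} [Field K] {δo δe so se so' se' : Matrix ι ι K}
    (hoe : δe * δo = 0) (heo : δo * δe = 0) (h : IsContraction δo δe so se)
    (h' : IsContraction δo δe so' se') : (δe + se).det = (δe + se').det := by
  have ho : δe * so * δe = δe := by
    have := congrArg (δe * ·) h.even
    simpa only [mul_add, ← mul_assoc, hoe, zero_mul, zero_add, mul_one] using this
  have ho' : δe * so' * δe = δe := by
    have := congrArg (δe * ·) h'.even
    simpa only [mul_add, ← mul_assoc, hoe, zero_mul, zero_add, mul_one] using this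
  have he : δo * se * δo = δo := by
    have := congrArg (δo * ·) h.odd
    simpa only [mul_add, ← mul_assoc, heo, zero_mul, zero_add, mul_one] using this
  have he' : δo * se' * δo = δo := by
    have := congrArg (δo * ·) h'.odd
    simpa only [mul_add, ← mul_assoc, heo, zero_mul, zero_add, mul_one] using this
  have huo : δe * so + se' * δo = 1 + (se' - se) * δo := by
    rw [← h.odd]; noncomm_ring
  have hue : δo * se + so' * δe = 1 + (so' - so) * δe := by
    rw [← h.even]; noncomm_ring
  have h1 : (δe * so + se' * δo).det = 1 := by
    rw [huo]
    refine det_one_add_of_mul_self_eq_zero ?_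
    have : (se' - se) * δo * ((se' - se) * δo) = (se' - se) * (δo * se' * δo - δo * se * δo) := by
      noncomm_ring
    rw [this, he, he', sub_self, mul_zero]
  have h2 : (δo * se + so' * δe).det = 1 := by
    rw [hue]
    refine det_one_add_of_mul_self_eq_zero ?_
    have : (so' - so) * δe * ((so' - so) * δe) = (so' - so) * (δe * so' * δe - δe * so * δe) := by
      noncomm_ring
    rw [this, ho, ho', sub_self, mul_zero]
  have h3 : (δe * so + se' * δo) * (δe + se) = (δe + se') * (δo * se + so' * δe) := by
    have e1 : (δe * so + se' * δo) * (δe + se) = δe * so * δe + δe * (so * se) +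
      se' * (δo * δe) + se' * δo * se := by noncomm_ring
    have e2 : (δe + se') * (δo * se + so' * δe) = δe * δo * se + δe * so' * δe +
      se' * δo * se + se' * so' * δe := by noncomm_ring
    rw [e1, e2, ho, ho', h.sq_even, h'.sq_odd, hoe, heo]
    simp
  have h4 := congrArg Matrix.det h3
  rw [Matrix.det_mul, Matrix.det_mul, h1, h2] at h4
  simpa using h4

/-- Factoring `P` = UV through its range, with VU = 1, Sylvester's identity replaces 1 + y·UV by the
scalar matrix 1 + y on the range. -/
theorem det_one_add_smul_idempotent {L K : Type*} [Field L] [CommRing K] (σ : L →+* K)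
    {P : Matrix ι ι L} (hP : P * P = P) (y : K) :
    (1 + y • P.map σ).det = (1 + y) ^ P.rank := by
  let f := Matrix.toLin' P
  have hf : ∀ x, f (f x) = f x := fun x => by
    have := congrArg (fun M => Matrix.toLin' M x) hP
    simpa [f, Matrix.toLin'_mul] using this
  let bR := Module.finBasis L (LinearMap.range f)
  let std := Pi.basisFun L ι
  let U := LinearMap.toMatrix bR std (LinearMap.range f).subtype
  let V := LinearMap.toMatrix std bR f.rangeRestrict
  have hUV : U * V = P := by
    rw [← LinearMap.toMatrix_comp]
    change LinearMap.toMatrix' f = P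
    exact LinearMap.toMatrix'_toLin' P
  have hVU : V * U = 1 := by
    rw [← LinearMap.toMatrix_comp, ← LinearMap.toMatrix_id bR]
    congr 1
    ext1 ⟨x, z, hz⟩
    refine Subtype.ext ?_
    change f x = x
    rw [← hz, hf]
  have h1 : y • P.map σ = (y • U.map σ) * V.map σ := by
    rw [← hUV, Matrix.map_mul, Matrix.smul_mul]
  rw [h1, Matrix.det_one_add_mul_comm, Matrix.mul_smul, ← Matrix.map_mul, hVU,
    Matrix.map_one _ (map_zero σ) (map_one σ)]
  have h2 : (1 : Matrix (Fin (Module.finrank L (LinearMap.range f)))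
      (Fin (Module.finrank L (LinearMap.range f))) K) + y • 1 = (1 + y) • 1 := by
    rw [add_smul, one_smul]
  rw [h2, Matrix.det_smul, Matrix.det_one, mul_one, Fintype.card_fin]
  congr 1

end Determinants

/-! ### The algebra of a split differential with a contracted Bockstein map -/

section SplittingAlgebra

variable {A : Type*} [Ring A]

/-- The relations between the maps that split a differential `δ` and contract `b`. -/
structure SplittingRel (δ s π b c : A) : Prop where
  δδ : δ * δ = 0
  ss : s * s = 0
  δsδ : δ * s * δ = δ
  sδs : s * δ * s = s
  π_eq : π = 1 - (δ * s + s * δ)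
  πbπ : π * b * π = b
  πcπ : π * c * π = c
  bccb : b * c + c * b = π
  cc : c * c = 0
  bb : b * b = 0

namespace SplittingRel

variable {δ s π b c : A}

theorem δπ (h : SplittingRel δ s π b c) : δ * π = 0 := by
  rw [h.π_eq, mul_sub, mul_add, ← mul_assoc, h.δδ, ← mul_assoc, h.δsδ]; simp

theorem πδ (h : SplittingRel δ s π b c) : π * δ = 0 := by
  rw [h.π_eq, sub_mul, add_mul, mul_assoc s, h.δδ, h.δsδ]; simp

theorem sπ (h : SplittingRel δ s π b c) : s * π = 0 := by
  rw [h.π_eq, mul_sub, mul_add, ← mul_assoc, h.sδs, ← mul_assoc, h.ss]; simp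

theorem πs (h : SplittingRel δ s π b c) : π * s = 0 := by
  rw [h.π_eq, sub_mul, add_mul, mul_assoc δ, h.ss, h.sδs]; simp

theorem ππ (h : SplittingRel δ s π b c) : π * π = π := by
  nth_rw 1 [h.π_eq]
  rw [sub_mul, add_mul, mul_assoc, mul_assoc, h.sπ, h.δπ]; simp

theorem πb (h : SplittingRel δ s π b c) : π * b = b := by
  nth_rw 1 [← h.πbπ]; rw [← mul_assoc, ← mul_assoc, h.ππ, h.πbπ]

theorem bπ (h : SplittingRel δ s π b c) : b * π = b := by
  nth_rw 1 [← h.πbπ]; rw [mul_assoc, h.ππ, h.πbπ]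

theorem πc (h : SplittingRel δ s π b c) : π * c = c := by
  nth_rw 1 [← h.πcπ]; rw [← mul_assoc, ← mul_assoc, h.ππ, h.πcπ]

theorem cπ (h : SplittingRel δ s π b c) : c * π = c := by
  nth_rw 1 [← h.πcπ]; rw [mul_assoc, h.ππ, h.πcπ]

theorem δb (h : SplittingRel δ s π b c) : δ * b = 0 := by rw [← h.πb, ← mul_assoc, h.δπ, zero_mul]
theorem bδ (h : SplittingRel δ s π b c) : b * δ = 0 := by rw [← h.bπ, mul_assoc, h.πδ, mul_zero]
theorem δc (h : SplittingRel δ s π b c) : δ * c = 0 := by rw [← h.πc, ← mul_assoc, h.δπ, zero_mul]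
theorem cδ (h : SplittingRel δ s π b c) : c * δ = 0 := by rw [← h.cπ, mul_assoc, h.πδ, mul_zero]
theorem sb (h : SplittingRel δ s π b c) : s * b = 0 := by rw [← h.πb, ← mul_assoc, h.sπ, zero_mul]
theorem bs (h : SplittingRel δ s π b c) : b * s = 0 := by rw [← h.bπ, mul_assoc, h.πs, mul_zero]
theorem sc (h : SplittingRel δ s π b c) : s * c = 0 := by rw [← h.πc, ← mul_assoc, h.sπ, zero_mul]
theorem cs (h : SplittingRel δ s π b c) : c * s = 0 := by rw [← h.cπ, mul_assoc, h.πs, mul_zero]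

theorem bcb (h : SplittingRel δ s π b c) : b * (c * b) = b := by
  have := congrArg (b * ·) h.bccb
  simpa only [mul_add, ← mul_assoc, h.bb, zero_mul, zero_add, h.bπ] using this

theorem cbc (h : SplittingRel δ s π b c) : c * (b * c) = c := by
  have := congrArg (c * ·) h.bccb
  simpa only [mul_add, ← mul_assoc, h.cc, zero_mul, add_zero, h.cπ] using this

theorem map (h : SplittingRel δ s π b c) {B : Type*} [Ring B] (σ : A →+* B) : SplittingRel (σ δ) (σ s) (σ π) (σ b) (σ c) where
  δδ := by rw [← map_mul, h.δδ, map_zero]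
  ss := by rw [← map_mul, h.ss, map_zero]
  δsδ := by rw [← map_mul, ← map_mul, h.δsδ]
  sδs := by rw [← map_mul, ← map_mul, h.sδs]
  π_eq := by rw [h.π_eq]; simp
  πbπ := by rw [← map_mul, ← map_mul, h.πbπ]
  πcπ := by rw [← map_mul, ← map_mul, h.πcπ]
  bccb := by rw [← map_mul, ← map_mul, ← map_add, h.bccb]
  cc := by rw [← map_mul, h.cc, map_zero]
  bb := by rw [← map_mul, h.bb, map_zero]

variable {K : Type*} [Field K] [Algebra K A] {x : K}

theorem deform_sq (h : SplittingRel δ s π b c) : (δ - x • b) * (δ - x • b) = 0 := by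
  simp [mul_sub, sub_mul, h.δδ, h.δb, h.bδ, h.bb]

theorem deform_contr_sq (h : SplittingRel δ s π b c) : (s - x⁻¹ • c) * (s - x⁻¹ • c) = 0 := by
  simp [mul_sub, sub_mul, h.ss, h.sc, h.cs, h.cc]

/-- The pair (δ, s) contracts the complement of the image of π and (b, c) contracts that image. The
mixed products vanish, and the scalars x and x⁻¹ cancel in bc + cb. -/
theorem deform_contr (h : SplittingRel δ s π b c) (hx : x ≠ 0) :
    (δ - x • b) * (s - x⁻¹ • c) + (s - x⁻¹ • c) * (δ - x • b) = 1 := by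
  have h1 : (δ - x • b) * (s - x⁻¹ • c) + (s - x⁻¹ • c) * (δ - x • b) =
      (δ * s + s * δ) + (b * c + c * b) := by
    simp only [mul_sub, sub_mul, smul_mul_assoc, mul_smul_comm, h.δc, h.bs, h.sb, h.cδ, smul_smul,
      mul_inv_cancel₀ hx, inv_mul_cancel₀ hx, one_smul, smul_zero, smul_sub, zero_sub, sub_zero, smul_neg, sub_neg_eq_add]
    abel
  rw [h1, h.bccb, h.π_eq]; abel

/-- The right-hand factor is 1 where π vanishes, −x on the image of cb and −x⁻¹ on the image of bc.
This isolates the power of −x in the determinant of the deformed complex. -/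
theorem deform_add (h : SplittingRel δ s π b c) :
    (δ - x • b) + (s - x⁻¹ • c) =
      (δ + s + b + c) * (1 - π - x • (c * b) - x⁻¹ • (b * c)) := by
  have e1 : (δ + s + b + c) * π = b + c := by
    simp [add_mul, h.δπ, h.sπ, h.bπ, h.cπ]
  have e2 : (δ + s + b + c) * (c * b) = b := by
    simp only [add_mul, ← mul_assoc, h.δc, h.sc, h.cc, zero_mul, zero_add, add_zero]
    rw [mul_assoc, h.bcb]
  have e3 : (δ + s + b + c) * (b * c) = c := by
    simp only [add_mul, ← mul_assoc, h.δb, h.sb, h.bb, zero_mul, zero_add]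
    rw [mul_assoc, h.cbc]
  rw [mul_sub, mul_sub, mul_sub, mul_one, mul_smul_comm, mul_smul_comm, e1, e2, e3]
  abel

end SplittingRel

end SplittingAlgebra

/-! ### The determinant of a complex over L⟦X⟧ and its leading term -/

section LeadingDeterminant

open PowerSeries

/-- The perturbation `β` of a split differential squares to zero on cohomology. -/
theorem transfer_mul_self {A : Type*} [Ring A] {δ s π β β₂ b : A} (δδ : δ * δ = 0)
    (δsδ : δ * s * δ = δ) (π_eq : π = 1 - (δ * s + s * δ)) (hβ : δ * β + β * δ = 0)
    (hβ₂ : δ * β₂ + β * β + β₂ * δ = 0) (hb : b = -(π * β * π)) : b * b = 0 := by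
  have δπ : δ * π = 0 := by
    rw [π_eq, mul_sub, mul_add, ← mul_assoc, δδ, ← mul_assoc, δsδ]; simp
  have πδ : π * δ = 0 := by
    rw [π_eq, sub_mul, add_mul, mul_assoc s, δδ, δsδ]; simp
  have ππ : π * π = π - (π * δ * s + π * s * δ) := by
    nth_rw 2 [π_eq]; noncomm_ring
  have h1 : π * β * δ = 0 := by
    rw [mul_assoc, ← neg_eq_of_add_eq_zero_right hβ, mul_neg, ← mul_assoc, πδ, zero_mul, neg_zero]
  have h2 : δ * β * π = 0 := by
    rw [← neg_eq_of_add_eq_zero_left hβ, neg_mul, mul_assoc, δπ, mul_zero, neg_zero]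
  -- By the coefficient of X² in the square of the differential, β² = −δβ₂ − β₂δ, and π kills δ from
  -- either side.
  have h3 : π * (β * β) * π = 0 := by
    have : β * β = -(δ * β₂) - β₂ * δ := by
      rw [eq_sub_iff_add_eq, eq_neg_iff_add_eq_zero, ← hβ₂]; abel
    rw [this, mul_sub, mul_neg, ← mul_assoc, πδ, sub_mul, mul_assoc, mul_assoc, δπ]
    simp
  have h4 : b * b = π * β * (π * π) * β * π := by rw [hb]; noncomm_ring
  have h5 : π * β * π * β * π = π * (β * β) * π - π * β * δ * s * β * π -
      π * β * s * (δ * β * π) := by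
    nth_rw 2 [π_eq]; noncomm_ring
  have h6 : π * β * (π * π) * β * π = π * β * π * β * π := by
    rw [ππ, πδ, mul_assoc, mul_assoc]
    have : π * s * δ * (β * π) = π * s * (δ * β * π) := by noncomm_ring
    rw [sub_mul, add_mul, this, h2]
    simp [mul_assoc]
  rw [h4, h6, h5, h1, h2, h3]
  simp

/-- Between two factors `c` = cπ = πc, the matrix β is only seen through πβπ = −b. It gives c(b +
β)c = 0, which makes the constant term of the intertwiner unipotent. -/
theorem SplittingRel.mul_transfer_mul {A : Type*} [Ring A] {δ s π b c β : A}
    (h : SplittingRel δ s π b c) (hb : b = -(π * β * π)) : c * (β * c) = -(c * (b * c)) := by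
  have h1 : c * (b * c) = -((c * π) * β * (π * c)) := by rw [hb]; noncomm_ring
  rw [h1, h.cπ, h.πc, neg_neg, mul_assoc]

variable {ι : Type*} [Fintype ι] [DecidableEq ι]

/-- The block matrix of an odd endomorphism of a `ℤ/2`-graded module. -/
def offDiag {K : Type*} [Zero K] (o e : Matrix ι ι K) : Matrix (ι ⊕ ι) (ι ⊕ ι) K :=
  Matrix.fromBlocks 0 e o 0

/-- The block matrix of an even endomorphism of a `ℤ/2`-graded module. -/
def onDiag {K : Type*} [Zero K] (o e : Matrix ι ι K) : Matrix (ι ⊕ ι) (ι ⊕ ι) K :=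
  Matrix.fromBlocks o 0 0 e

section Blocks

variable {K : Type*} [CommRing K] (o e o' e' : Matrix ι ι K)

theorem offDiag_mul : offDiag o e * offDiag o' e' = onDiag (e * o') (o * e') := by
  simp [offDiag, onDiag, Matrix.fromBlocks_multiply]

theorem onDiag_mul_offDiag : onDiag o e * offDiag o' e' = offDiag (e * o') (o * e') := by
  simp [offDiag, onDiag, Matrix.fromBlocks_multiply]

theorem offDiag_mul_onDiag : offDiag o e * onDiag o' e' = offDiag (o * o') (e * e') := by
  simp [offDiag, onDiag, Matrix.fromBlocks_multiply]

theorem onDiag_mul : onDiag o e * onDiag o' e' = onDiag (o * o') (e * e') := by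
  simp [onDiag, Matrix.fromBlocks_multiply]

theorem offDiag_add : offDiag o e + offDiag o' e' = offDiag (o + o') (e + e') := by
  simp [offDiag, Matrix.fromBlocks_add]

theorem onDiag_add : onDiag o e + onDiag o' e' = onDiag (o + o') (e + e') := by
  simp [onDiag, Matrix.fromBlocks_add]

theorem offDiag_neg : -offDiag o e = offDiag (-o) (-e) := by
  simp [offDiag, Matrix.fromBlocks_neg]

theorem onDiag_neg : -onDiag o e = onDiag (-o) (-e) := by
  simp [onDiag, Matrix.fromBlocks_neg]

theorem offDiag_smul (c : K) : c • offDiag o e = offDiag (c • o) (c • e) := by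
  simp [offDiag, Matrix.fromBlocks_smul]

theorem onDiag_smul (c : K) : c • onDiag o e = onDiag (c • o) (c • e) := by
  simp [onDiag, Matrix.fromBlocks_smul]

theorem offDiag_sub : offDiag o e - offDiag o' e' = offDiag (o - o') (e - e') := by
  rw [sub_eq_add_neg, offDiag_neg, offDiag_add, sub_eq_add_neg, sub_eq_add_neg]

theorem onDiag_sub : onDiag o e - onDiag o' e' = onDiag (o - o') (e - e') := by
  rw [sub_eq_add_neg, onDiag_neg, onDiag_add, sub_eq_add_neg, sub_eq_add_neg]

theorem onDiag_one : onDiag (1 : Matrix ι ι K) 1 = 1 := Matrix.fromBlocks_one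

variable {o e o' e'}

theorem offDiag_inj : offDiag o e = offDiag o' e' ↔ o = o' ∧ e = e' := by
  rw [offDiag, offDiag, Matrix.fromBlocks_inj]
  tauto

theorem onDiag_inj : onDiag o e = onDiag o' e' ↔ o = o' ∧ e = e' := by
  rw [onDiag, onDiag, Matrix.fromBlocks_inj]
  tauto

theorem onDiag_eq_zero : onDiag o e = 0 ↔ o = 0 ∧ e = 0 := by
  rw [← Matrix.fromBlocks_zero, onDiag, Matrix.fromBlocks_inj]
  tauto

theorem offDiag_map {K' : Type*} [CommRing K'] (σ : K →+* K') :
    σ.mapMatrix (offDiag o e) = offDiag (o.map σ) (e.map σ) := by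
  simp [offDiag, Matrix.fromBlocks_map, RingHom.mapMatrix_apply]

theorem onDiag_map {K' : Type*} [CommRing K'] (σ : K →+* K') :
    σ.mapMatrix (onDiag o e) = onDiag (o.map σ) (e.map σ) := by
  simp [onDiag, Matrix.fromBlocks_map, RingHom.mapMatrix_apply]

end Blocks

theorem exists_matrix_eq_X_smul {L : Type*} [CommRing L] {M : Matrix ι ι L⟦X⟧}
    (h : M.map (constantCoeff (R := L)) = 0) :
    ∃ Z : Matrix ι ι L⟦X⟧, M = (X : L⟦X⟧) • Z ∧
      Z.map (constantCoeff (R := L)) = M.map (coeff (R := L) 1) := by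
  have h1 : ∀ i j, ∃ z : L⟦X⟧, M i j = X * z := fun i j =>
    X_dvd_iff.2 (congrFun (congrFun h i) j)
  choose Z hZ using h1
  refine ⟨Matrix.of Z, ?_, ?_⟩
  · ext1 i j; simpa using hZ i j
  · ext i j
    rw [Matrix.map_apply, Matrix.map_apply, hZ, show (1 : ℕ) = 0 + 1 from rfl, coeff_succ_X_mul]
    simp

theorem coeff_one_mul_map_C {L : Type*} [CommRing L] (M : Matrix ι ι L⟦X⟧) (c : Matrix ι ι L) :
    (M * c.map (C (R := L))).map (coeff (R := L) 1) = M.map (coeff (R := L) 1) * c := by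
  ext i j
  simp [Matrix.mul_apply]

theorem constantCoeff_map_mul {L : Type*} [CommRing L] (M N : Matrix ι ι L⟦X⟧) :
    (M * N).map (constantCoeff (R := L)) =
      M.map (constantCoeff (R := L)) * N.map (constantCoeff (R := L)) :=
  Matrix.map_mul

theorem constantCoeff_map_C {L : Type*} [CommRing L] (M : Matrix ι ι L) :
    (M.map (C (R := L))).map (constantCoeff (R := L)) = M := by
  ext; simp

/-- The even component of the intertwiner `D h + h d` has power series entries. -/
theorem exists_integral_intertwiner {L K : Type*} [Field L] [Field K] (φ : L⟦X⟧ →+* K)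
    (hX : φ X ≠ 0) (D : Matrix ι ι L⟦X⟧) {s c t δ b c' : Matrix ι ι L}
    (hc : D.map (constantCoeff (R := L)) * c = 0) (htb : t * b = 0) (hcδ : c' * δ = 0) :
    ∃ U : Matrix ι ι L⟦X⟧,
      U.map φ = D.map φ * (s.map (φ.comp C) - (φ X)⁻¹ • c.map (φ.comp C)) +
        (t.map (φ.comp C) - (φ X)⁻¹ • c'.map (φ.comp C)) *
          (δ.map (φ.comp C) - φ X • b.map (φ.comp C)) ∧
      U.map (constantCoeff (R := L)) = D.map (constantCoeff (R := L)) * s + t * δ -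
        D.map (coeff (R := L) 1) * c + c' * b := by
  -- The only term with a possible pole is X⁻¹·D·c. It is integral because D(0)c = 0, and its
  -- constant term is the X-coefficient of D times c.
  obtain ⟨Z, hZ, hZ'⟩ := exists_matrix_eq_X_smul (M := D * c.map (C (R := L))) (by
    rw [constantCoeff_map_mul, constantCoeff_map_C, hc])
  rw [coeff_one_mul_map_C] at hZ'
  have hZφ : Z.map φ = (φ X)⁻¹ • (D.map φ * c.map (φ.comp C)) := by
    have h1 := congrArg (fun M : Matrix ι ι L⟦X⟧ => φ.mapMatrix M) hZ
    simp only [map_mul] at h1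
    rw [eq_inv_smul_iff₀ hX]
    ext i j
    have h2 := congrFun (congrFun h1 i) j
    simp only [RingHom.mapMatrix_apply, Matrix.map_apply, Matrix.smul_apply, smul_eq_mul,
      map_mul] at h2 ⊢
    rw [← h2]
    rfl
  have hCφ : ∀ M : Matrix ι ι L, (M.map (C (R := L))).map φ = M.map (φ.comp C) := fun M => rfl
  have e1 : t.map (φ.comp C) * b.map (φ.comp C) = 0 := by
    rw [← Matrix.map_mul, htb]; ext; simp
  have e2 : c'.map (φ.comp C) * δ.map (φ.comp C) = 0 := by
    rw [← Matrix.map_mul, hcδ]; ext; simp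
  refine ⟨D * s.map C + (t * δ).map C - Z + (c' * b).map C, ?_, ?_⟩
  · rw [← RingHom.mapMatrix_apply]
    simp only [map_add, map_sub, map_mul, RingHom.mapMatrix_apply, hCφ, hZφ]
    simp only [mul_sub, sub_mul, Matrix.mul_smul, Matrix.smul_mul, smul_smul, e1, e2, smul_zero,
      mul_inv_cancel₀ hX, inv_mul_cancel₀ hX, one_smul, sub_zero, zero_sub, sub_neg_eq_add,
      Matrix.map_mul, smul_sub, smul_neg]
    abel
  · rw [← RingHom.mapMatrix_apply]
    simp only [map_add, map_sub, map_mul, RingHom.mapMatrix_apply, constantCoeff_map_C, hZ']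

/-- The leading term of the determinant of a contraction: over the field of fractions, the
determinant of `δ + s` is, up to a power series with constant coefficient `1`, the product of a power
of `-X` and of the determinant of `δ + s + b + c` modulo `X`. -/
theorem IsContraction.det_leading {L K : Type*} [Field L] [Field K] (φ : L⟦X⟧ →+* K)
    (hφ : Function.Injective φ) {Do De : Matrix ι ι L⟦X⟧} (hoe : De * Do = 0) (heo : Do * De = 0)
    {so se πo πe bo be co ce : Matrix ι ι L}
    (h : SplittingRel (offDiag (Do.map (constantCoeff (R := L))) (De.map (constantCoeff (R := L))))
      (offDiag so se) (onDiag πo πe) (offDiag bo be) (offDiag co ce))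
    (hb : offDiag bo be = -(onDiag πo πe * offDiag (Do.map (coeff (R := L) 1))
      (De.map (coeff (R := L) 1)) * onDiag πo πe)) {So Se : Matrix ι ι K}
    (hS : IsContraction (Do.map φ) (De.map φ) So Se) :
    ∃ U U' : L⟦X⟧, constantCoeff U = 1 ∧ constantCoeff U' = 1 ∧
      (De.map φ + Se).det * φ (X ^ (bo * ce).rank * U) =
        φ (X ^ (co * be).rank * C ((-1) ^ ((co * be).rank + (bo * ce).rank) *
          (De.map (constantCoeff (R := L)) + se + be + ce).det) * U') := by
  have hX : φ X ≠ 0 := by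
    rw [Ne, map_eq_zero_iff φ hφ]; exact X_ne_zero
  set x := φ X with hx
  set δo := Do.map (constantCoeff (R := L)) with hδo
  set δe := De.map (constantCoeff (R := L)) with hδe
  set τ : L →+* K := φ.comp C with hτ
  -- componentwise relations
  obtain ⟨hδc_o, hδc_e⟩ := onDiag_eq_zero.1 (by simpa only [offDiag_mul] using h.δc)
  obtain ⟨hsb_o, hsb_e⟩ := onDiag_eq_zero.1 (by simpa only [offDiag_mul] using h.sb)
  obtain ⟨hcδ_o, hcδ_e⟩ := onDiag_eq_zero.1 (by simpa only [offDiag_mul] using h.cδ)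
  obtain ⟨Ue, hUe, hUe'⟩ := exists_integral_intertwiner φ hX Do (s := se) (c := ce) (t := so)
    (δ := δe) (b := be) (c' := co) hδc_e hsb_e hcδ_e
  obtain ⟨Uo, hUo, hUo'⟩ := exists_integral_intertwiner φ hX De (s := so) (c := co) (t := se)
    (δ := δo) (b := bo) (c' := ce) hδc_o hsb_o hcδ_o
  rw [← hx, ← hτ] at hUe hUo
  set do' := δo.map τ - x • bo.map τ with hdo'
  set de' := δe.map τ - x • be.map τ with hde'
  set ho := so.map τ - x⁻¹ • co.map τ with hho
  set he := se.map τ - x⁻¹ • ce.map τ with hhe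
  have h' := h.map (τ.mapMatrix (m := ι ⊕ ι))
  simp only [offDiag_map, onDiag_map] at h'
  have hdd := h'.deform_sq (x := x)
  have hdh := h'.deform_contr hX
  have hhh := h'.deform_contr_sq (x := x)
  have hadd := h'.deform_add (x := x)
  simp only [offDiag_smul, offDiag_sub, offDiag_mul, onDiag_add, onDiag_mul, onDiag_smul,
    onDiag_sub, offDiag_add, ← onDiag_one, offDiag_mul_onDiag] at hdd hdh hhh hadd
  obtain ⟨hdd_o, hdd_e⟩ := onDiag_eq_zero.1 hdd
  obtain ⟨hhh_o, hhh_e⟩ := onDiag_eq_zero.1 hhh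
  obtain ⟨hdh_o, hdh_e⟩ := onDiag_inj.1 hdh
  have hadd_e := (offDiag_inj.1 hadd).2
  rw [← hdo', ← hde'] at hdd_o hdd_e
  rw [← hho, ← hhe] at hhh_o hhh_e
  rw [← hdo', ← hde', ← hho, ← hhe] at hdh_o hdh_e
  rw [← hde', ← hhe] at hadd_e
  -- determinants of the intertwiners
  have hred : offDiag co ce * ((offDiag bo be + offDiag (Do.map (coeff (R := L) 1))
      (De.map (coeff (R := L) 1))) * offDiag co ce) = 0 := by
    have e1 : offDiag co ce * (offDiag (Do.map (coeff (R := L) 1))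
        (De.map (coeff (R := L) 1)) * offDiag co ce) = -(offDiag co ce * (offDiag bo be *
          offDiag co ce)) :=
      h.mul_transfer_mul hb
    rw [add_mul, mul_add, e1, add_neg_cancel]
  -- The constant term of the intertwiner is δs + sδ + cb − βc = 1 − (b + β)c, and y = (b + β)c has
  -- square zero since c(b + β)c = 0.
  have hdetU : ∀ {o e : Matrix ι ι L}, onDiag o e = 1 - (offDiag bo be +
      offDiag (Do.map (coeff (R := L) 1)) (De.map (coeff (R := L) 1))) * offDiag co ce →
      o.det = 1 ∧ e.det = 1 := by
    intro o e hoe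
    set y := (offDiag bo be + offDiag (Do.map (coeff (R := L) 1)) (De.map (coeff (R := L) 1))) *
      offDiag co ce with hy
    have hyy : y * y = 0 := by rw [hy, mul_assoc, hred, mul_zero]
    have hy' : y = onDiag (1 - o) (1 - e) := by
      rw [← onDiag_sub, onDiag_one, hoe]; abel
    rw [hy', onDiag_mul, onDiag_eq_zero] at hyy
    constructor
    · have := det_one_add_of_mul_self_eq_zero (n := o - 1) (by
        rw [← neg_sub, neg_mul_neg, hyy.1])
      simpa using this
    · have := det_one_add_of_mul_self_eq_zero (n := e - 1) (by
        rw [← neg_sub, neg_mul_neg, hyy.2])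
      simpa using this
  obtain ⟨hdet_o, hdet_e⟩ := hdetU (o := Uo.map (constantCoeff (R := L)))
    (e := Ue.map (constantCoeff (R := L))) (by
      have h1 : onDiag (Uo.map (constantCoeff (R := L))) (Ue.map (constantCoeff (R := L))) =
          (offDiag δo δe * offDiag so se + offDiag so se * offDiag δo δe) +
          offDiag co ce * offDiag bo be - offDiag (Do.map (coeff (R := L) 1))
            (De.map (coeff (R := L) 1)) * offDiag co ce := by
        rw [hUe', hUo']
        simp only [offDiag_mul, onDiag_add, onDiag_sub, ← hδo, ← hδe]
        refine onDiag_inj.2 ⟨?_, ?_⟩ <;> abel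
      have h2 := h.π_eq
      rw [← h.bccb, eq_sub_iff_add_eq] at h2
      rw [h1, ← h2]
      noncomm_ring)
  have hdetUo : constantCoeff Uo.det = 1 := by
    rw [RingHom.map_det]; exact hdet_o
  have hdetUe : constantCoeff Ue.det = 1 := by
    rw [RingHom.map_det]; exact hdet_e
  have hUo0 : (Uo.map φ).det ≠ 0 := by
    rw [← RingHom.mapMatrix_apply, ← RingHom.map_det, Ne, map_eq_zero_iff φ hφ]
    rintro h0
    rw [h0] at hdetUo
    simp at hdetUo
  have hUe0 : (Ue.map φ).det ≠ 0 := by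
    rw [← RingHom.mapMatrix_apply, ← RingHom.map_det, Ne, map_eq_zero_iff φ hφ]
    rintro h0
    rw [h0] at hdetUe
    simp at hdetUe
  -- the intertwining relations
  set Do' := Do.map φ with hDo'
  set De' := De.map φ with hDe'
  have hoe' : De' * Do' = 0 := by rw [← Matrix.map_mul, hoe]; ext; simp
  have heo' : Do' * De' = 0 := by rw [← Matrix.map_mul, heo]; ext; simp
  -- With 𝒟² = 0 and d² = 0 one has 𝒟(𝒟h + hd) = 𝒟hd = (𝒟h + hd)d.
  have hint_e : De' * Ue.map φ = Uo.map φ * de' := by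
    rw [hUe, hUo]
    simp only [mul_add, add_mul, ← mul_assoc, hoe', zero_mul, zero_add]
    rw [mul_assoc he, hdd_e, mul_zero, add_zero]
  have hint_o : Do' * Uo.map φ = Ue.map φ * do' := by
    rw [hUe, hUo]
    simp only [mul_add, add_mul, ← mul_assoc, heo', zero_mul, zero_add]
    rw [mul_assoc ho, hdd_o, mul_zero, add_zero]
  set uo := Uo.map φ with huo
  set ue := Ue.map φ with hue
  have hio : uo * uo⁻¹ = 1 := Matrix.mul_nonsing_inv _ (Ne.isUnit hUo0)
  have hio' : uo⁻¹ * uo = 1 := Matrix.nonsing_inv_mul _ (Ne.isUnit hUo0)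
  have hie : ue * ue⁻¹ = 1 := Matrix.mul_nonsing_inv _ (Ne.isUnit hUe0)
  have hie' : ue⁻¹ * ue = 1 := Matrix.nonsing_inv_mul _ (Ne.isUnit hUe0)
  have hDe : De' = uo * de' * ue⁻¹ := by rw [← hint_e, mul_assoc, hie, mul_one]
  have hDo : Do' = ue * do' * uo⁻¹ := by rw [← hint_o, mul_assoc, hio, mul_one]
  have hconj : ∀ {p q r y z : Matrix ι ι K}, q * r = 1 →
      p * y * q * (r * z) = p * (y * z) := fun {p q r y z} hqr => by
    rw [mul_assoc (p * y), ← mul_assoc q, hqr, one_mul, mul_assoc]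
  -- Conjugating the model contraction by the intertwiner contracts the given complex, so by
  -- independence of the contraction the determinant may be computed from it.
  have hS' : IsContraction Do' De' (ue * (ho * uo⁻¹)) (uo * (he * ue⁻¹)) := by
    refine ⟨?_, ?_, ?_, ?_⟩
    · nth_rw 1 [hDe]
      rw [hDo, mul_assoc ue do', ← mul_assoc uo he, hconj hie', hconj hie', ← mul_add,
        ← mul_assoc, ← mul_assoc, ← add_mul, hdh_o, one_mul, hio]
    · nth_rw 1 [hDo]
      rw [hDe, mul_assoc uo de', ← mul_assoc ue ho, hconj hio', hconj hio', ← mul_add,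
        ← mul_assoc, ← mul_assoc, ← add_mul, hdh_e, one_mul, hie]
    · rw [← mul_assoc uo he, hconj hie', ← mul_assoc he, hhh_o, zero_mul, mul_zero]
    · rw [← mul_assoc ue ho, hconj hio', ← mul_assoc ho, hhh_e, zero_mul, mul_zero]
  have hdet := hS.det_eq hoe' heo' hS'
  have hdet2 : (De' + uo * (he * ue⁻¹)) = uo * ((de' + he) * ue⁻¹) := by
    nth_rw 1 [hDe]
    rw [add_mul, mul_add, mul_assoc]
  -- the diagonal correction
  have hPP : (co * be) * (co * be) = co * be := by
    have h1 : (offDiag co ce * offDiag bo be) * (offDiag co ce * offDiag bo be) =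
      offDiag co ce * offDiag bo be := by rw [mul_assoc, h.bcb]
    simp only [offDiag_mul, onDiag_mul] at h1
    exact (onDiag_inj.1 h1).2
  have hQQ : (bo * ce) * (bo * ce) = bo * ce := by
    have h1 : (offDiag bo be * offDiag co ce) * (offDiag bo be * offDiag co ce) =
      offDiag bo be * offDiag co ce := by rw [mul_assoc, h.cbc]
    simp only [offDiag_mul, onDiag_mul] at h1
    exact (onDiag_inj.1 h1).2
  have hPQ : (co * be) * (bo * ce) = 0 := by
    have h1 : (offDiag co ce * offDiag bo be) * (offDiag bo be * offDiag co ce) = 0 := by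
      rw [mul_assoc, ← mul_assoc (offDiag bo be), h.bb, zero_mul, mul_zero]
    simp only [offDiag_mul, onDiag_mul] at h1
    exact (onDiag_eq_zero.1 h1).2
  have hπe : πe = bo * ce + co * be := by
    have h1 := h.bccb
    simp only [offDiag_mul, onDiag_add] at h1
    exact (onDiag_inj.1 h1).2.symm
  -- The correction factors because (cb)(bc) = 0, and each factor is 1 plus a multiple of an
  -- idempotent, so its determinant is a power with the rank as exponent.
  have hdiag : (1 - πe.map τ - x • (co.map τ * be.map τ) - x⁻¹ • (bo.map τ * ce.map τ)) =
      (1 + (-x - 1) • (co * be).map τ) * (1 + (-x⁻¹ - 1) • (bo * ce).map τ) := by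
    have e1 : (co * be).map τ * (bo * ce).map τ = 0 := by
      rw [← Matrix.map_mul, hPQ]; ext; simp
    simp only [mul_add, add_mul, Matrix.smul_mul, Matrix.mul_smul, e1, hπe]
    simp only [← Matrix.map_mul]
    rw [← RingHom.mapMatrix_apply τ (bo * ce + co * be), map_add]
    simp only [RingHom.mapMatrix_apply, smul_zero, add_zero, one_mul, mul_one, sub_smul, neg_smul,
      one_smul]
    abel
  refine ⟨Ue.det, Uo.det, hdetUe, hdetUo, ?_⟩
  rw [hdet, hdet2, Matrix.det_mul, Matrix.det_mul, hadd_e, Matrix.det_mul, hdiag, Matrix.det_mul,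
    det_one_add_smul_idempotent τ hPP, det_one_add_smul_idempotent τ hQQ]
  have hdetue : ue⁻¹.det * φ Ue.det = 1 := by
    rw [RingHom.map_det, RingHom.mapMatrix_apply, ← hue, ← Matrix.det_mul, hie', Matrix.det_one]
  have hdetuo : uo.det = φ Uo.det := by
    rw [RingHom.map_det, RingHom.mapMatrix_apply]
  have hdetl : (δe.map τ + se.map τ + be.map τ + ce.map τ).det =
      φ (C (δe + se + be + ce).det) := by
    change _ = τ _
    rw [RingHom.map_det]
    congr 1
    simp only [map_add, RingHom.mapMatrix_apply]
  rw [hdetl, hdetuo]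
  simp only [map_mul, map_pow, ← hx, map_neg, map_one]
  have hxx : (1 + (-x⁻¹ - 1)) ^ (bo * ce).rank * x ^ (bo * ce).rank = (-1) ^ (bo * ce).rank := by
    rw [← mul_pow]; congr 1; field_simp; ring
  have hx1 : (1 + (-x - 1)) ^ (co * be).rank = (-1) ^ (co * be).rank * x ^ (co * be).rank := by
    rw [← mul_pow]; congr 1; ring
  rw [hx1, pow_add]
  linear_combination (φ Uo.det * φ (C (δe + se + be + ce).det) * (-1) ^ (co * be).rank *
    x ^ (co * be).rank * ((1 + (-x⁻¹ - 1)) ^ (bo * ce).rank * x ^ (bo * ce).rank)) * hdetue +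
    (φ Uo.det * φ (C (δe + se + be + ce).det) * (-1) ^ (co * be).rank *
    x ^ (co * be).rank) * hxx

end LeadingDeterminant

/-! ### Existence of splittings over a field -/

section SplittingExistence

variable {ι : Type*} [Fintype ι] [DecidableEq ι]

theorem exists_matrix_pinv {L : Type*} [Field L] (M : Matrix ι ι L) :
    ∃ H : Matrix ι ι L, M * H * M = M := by
  let f := Matrix.toLin' M
  obtain ⟨r, hr⟩ := LinearMap.exists_rightInverse_of_surjective f.rangeRestrict
    (LinearMap.range_eq_top.2 f.surjective_rangeRestrict)
  obtain ⟨q, hq⟩ := LinearMap.exists_leftInverse_of_injective (LinearMap.range f).subtype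
    (Submodule.ker_subtype _)
  refine ⟨LinearMap.toMatrix' (r ∘ₗ q), Matrix.toLin'.injective (LinearMap.ext fun x => ?_)⟩
  simp only [Matrix.toLin'_mul, Matrix.toLin'_toMatrix', LinearMap.comp_apply]
  have h1 : q (f x) = f.rangeRestrict x := LinearMap.congr_fun hq (f.rangeRestrict x)
  have h2 : f.rangeRestrict (r (f.rangeRestrict x)) = f.rangeRestrict x :=
    LinearMap.congr_fun hr (f.rangeRestrict x)
  change f (r (q (f x))) = f x
  rw [h1]
  exact congrArg Subtype.val h2

/-- A `ℤ/2`-graded complex over a field splits, and the map on its cohomology that is given by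
`-β` can be contracted if it is exact. -/
theorem exists_splittingRel {L : Type*} [Field L] {δo δe βo βe : Matrix ι ι L}
    {β₂ : Matrix (ι ⊕ ι) (ι ⊕ ι) L}
    (hδδ : offDiag δo δe * offDiag δo δe = 0)
    (hβ : offDiag δo δe * offDiag βo βe + offDiag βo βe * offDiag δo δe = 0)
    (hβ₂ : offDiag δo δe * β₂ + offDiag βo βe * offDiag βo βe + β₂ * offDiag δo δe = 0)
    (hex : ∀ x : ι ⊕ ι → L, (offDiag δo δe).mulVec x = 0 →
      (∃ x₁, (offDiag βo βe).mulVec x = (offDiag δo δe).mulVec x₁) →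
      ∃ w w₁, x = (offDiag βo βe).mulVec w + (offDiag δo δe).mulVec w₁ ∧
        (offDiag δo δe).mulVec w = 0) :
    ∃ so se πo πe bo be co ce : Matrix ι ι L,
      SplittingRel (offDiag δo δe) (offDiag so se) (onDiag πo πe) (offDiag bo be)
        (offDiag co ce) ∧
      offDiag bo be = -(onDiag πo πe * offDiag βo βe * onDiag πo πe) := by
  obtain ⟨ho, hho⟩ := exists_matrix_pinv δe
  obtain ⟨he, hhe⟩ := exists_matrix_pinv δo
  set δ := offDiag δo δe with hδ
  set β := offDiag βo βe with hβ'
  set h := offDiag ho he with hh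
  have hδhδ : δ * h * δ = δ := by
    simp only [hδ, hh, offDiag_mul, onDiag_mul_offDiag, hho, hhe]
  -- The matrix h is only an inner inverse of δ. Passing to hδh gives sδs = s, and the factor 1 − hδ
  -- gives s² = 0 because (1 − hδ)hδ = 0.
  obtain ⟨so, se, hs⟩ : ∃ so se, offDiag so se = h * δ * h * (1 - h * δ) := by
    simp only [hδ, hh, offDiag_mul, ← onDiag_one, onDiag_sub, onDiag_mul_offDiag,
      offDiag_mul_onDiag]
    exact ⟨_, _, rfl⟩
  set s := offDiag so se with hs'
  have hss : s * s = 0 := by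
    have h1 : s * s = h * δ * h * ((1 - h * δ) * (h * δ)) * h * (1 - h * δ) := by
      rw [hs]; noncomm_ring
    have h2 : (1 - h * δ) * (h * δ) = h * δ - h * (δ * h * δ) := by noncomm_ring
    rw [h1, h2, hδhδ, sub_self]; simp
  have hδsδ : δ * s * δ = δ := by
    have h1 : δ * s * δ = δ * h * δ * h * δ - δ * h * δ * h * h * (δ * δ) := by
      rw [hs]; noncomm_ring
    rw [h1, hδδ, hδhδ, mul_zero, sub_zero, hδhδ]
  have hsδs : s * δ * s = s := by
    have h1 : s * δ * s = h * (δ * h * δ * h * δ) * h * (1 - h * δ) -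
        h * δ * h * h * (δ * δ) * h * δ * h * (1 - h * δ) := by
      rw [hs]; noncomm_ring
    rw [h1, hδδ, hδhδ, hδhδ, hs]; simp
  obtain ⟨πo, πe, hπ⟩ : ∃ πo πe, onDiag πo πe = 1 - (δ * s + s * δ) := by
    simp only [hδ, hs', offDiag_mul, ← onDiag_one, onDiag_add, onDiag_sub]
    exact ⟨_, _, rfl⟩
  set π := onDiag πo πe with hπ'
  obtain ⟨bo, be, hb⟩ : ∃ bo be, offDiag bo be = -(π * β * π) := by
    simp only [hπ', hβ', onDiag_mul_offDiag, offDiag_mul_onDiag, offDiag_neg]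
    exact ⟨_, _, rfl⟩
  set b := offDiag bo be with hb'
  have hbb : b * b = 0 := transfer_mul_self hδδ hδsδ hπ hβ hβ₂ hb
  have hδπ : δ * π = 0 := by
    rw [hπ, mul_sub, mul_add, ← mul_assoc, hδδ, ← mul_assoc, hδsδ]; simp
  have hπδ : π * δ = 0 := by
    rw [hπ, sub_mul, add_mul, mul_assoc s, hδδ, hδsδ]; simp
  have hsπ : s * π = 0 := by
    rw [hπ, mul_sub, mul_add, ← mul_assoc, hsδs, ← mul_assoc, hss]; simp
  have hππ : π * π = π := by
    nth_rw 1 [hπ]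
    rw [sub_mul, add_mul, mul_assoc, mul_assoc, hsπ, hδπ]; simp
  have hπb : π * b = b := by
    rw [hb, mul_neg, ← mul_assoc, ← mul_assoc, hππ]
  have hbπ : b * π = b := by
    rw [hb, neg_mul, mul_assoc, hππ]
  obtain ⟨ko, hko⟩ := exists_matrix_pinv be
  obtain ⟨ke, hke⟩ := exists_matrix_pinv bo
  set k := offDiag ko ke with hk
  have hbkb : b * k * b = b := by
    simp only [hb', hk, offDiag_mul, onDiag_mul_offDiag, hko, hke]
  -- The columns w of π − πkbπ satisfy πw = w and bw = 0. The exactness hypothesis puts them in the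
  -- image of b, where bk is the identity.
  have hkey : b * k * (π - π * k * b * π) = π - π * k * b * π := by
    have h1 : b * (π - π * k * b * π) = 0 := by
      have : b * (π - π * k * b * π) = b * π - b * π * k * (b * π) := by noncomm_ring
      rw [this, hbπ, hbkb, sub_self]
    have h2 : π * (π - π * k * b * π) = π - π * k * b * π := by
      have : π * (π - π * k * b * π) = π * π - π * π * k * b * π := by noncomm_ring
      rw [this, hππ]
    refine Matrix.ext_of_mulVec_single fun j => ?_
    set v : ι ⊕ ι → L := Pi.single j 1
    rw [← Matrix.mulVec_mulVec]
    set w := (π - π * k * b * π).mulVec v with hw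
    have hπw : π.mulVec w = w := by rw [hw, Matrix.mulVec_mulVec, h2]
    have hbw : b.mulVec w = 0 := by rw [hw, Matrix.mulVec_mulVec, h1, Matrix.zero_mulVec]
    obtain ⟨y, z, hyz, hδy⟩ := hex w
      (by rw [← hπw, Matrix.mulVec_mulVec, hδπ, Matrix.zero_mulVec])
      ⟨(s * β).mulVec w, by
        rw [Matrix.mulVec_mulVec]
        have h3 : β * π = δ * (s * β) * π + π * β * π + s * (δ * β * π) := by
          have : β * π = (δ * s + s * δ + π) * (β * π) := by rw [hπ]; noncomm_ring
          rw [this]; noncomm_ring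
        have h4 : δ * β * π = 0 := by
          rw [← neg_eq_of_add_eq_zero_left hβ, neg_mul, mul_assoc, hδπ, mul_zero, neg_zero]
        have h5 : π * β * π = -b := by rw [hb, neg_neg]
        rw [h4, h5, mul_zero, add_zero] at h3
        have h6 := congrArg (fun M => M.mulVec w) h3
        simp only [← Matrix.mulVec_mulVec, Matrix.add_mulVec, Matrix.neg_mulVec, hbw, hπw,
          neg_zero, add_zero] at h6
        simpa only [← Matrix.mulVec_mulVec] using h6⟩
    -- Applying π to w = βy + δz removes δz, and δy = 0 reduces πβy to πβπy = −by.
    have hwb : w = b.mulVec (-y) := by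
      have h3 : π * β = π * β * π + π * β * δ * s + π * β * s * δ := by
        have : π * β = π * β * (δ * s + s * δ + π) := by rw [hπ]; noncomm_ring
        exact this.trans (by noncomm_ring)
      have h4 : π * β * δ = 0 := by
        rw [mul_assoc, ← neg_eq_of_add_eq_zero_right hβ, mul_neg, ← mul_assoc, hπδ, zero_mul,
          neg_zero]
      have h5 : π * β * π = -b := by rw [hb, neg_neg]
      rw [h4, h5, zero_mul, add_zero] at h3
      rw [← hπw, hyz, Matrix.mulVec_add, Matrix.mulVec_mulVec, Matrix.mulVec_mulVec, hπδ,
        Matrix.zero_mulVec, add_zero, h3, Matrix.add_mulVec, Matrix.neg_mulVec,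
        ← Matrix.mulVec_mulVec, hδy, Matrix.mulVec_zero, add_zero, Matrix.mulVec_neg]
    nth_rw 1 [hwb]
    rw [Matrix.mulVec_mulVec, hbkb, ← hwb]
  set c₀ := π * k * (π - π * k * b * π) with hc₀
  have hbc₀ : b * c₀ + c₀ * b = π := by
    have h1 : b * c₀ = (b * π) * k * (π - π * k * b * π) := by rw [hc₀]; noncomm_ring
    have h2 : c₀ * b = π * k * (π * b) - π * k * π * k * b * (π * b) := by rw [hc₀]; noncomm_ring
    have h3 : π * k * π * k * b * b = 0 := by rw [mul_assoc, hbb, mul_zero]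
    have h4 : π * k * b * π = π * k * b := by rw [mul_assoc, hbπ]
    rw [h1, hbπ, hkey, h2, hπb, h3, h4]; abel
  have hc₀π : c₀ * π = c₀ := by
    have h1 : c₀ * π = π * k * (π * π - π * k * b * (π * π)) := by rw [hc₀]; noncomm_ring
    rw [h1, hππ]
  have hπc₀ : π * c₀ = c₀ := by
    have h1 : π * c₀ = (π * π) * k * (π - π * k * b * π) := by rw [hc₀]; noncomm_ring
    rw [h1, hππ]
  have hbcb : b * c₀ * b = b := by
    have h1 : b * (b * c₀ + c₀ * b) = b * b * c₀ + b * c₀ * b := by noncomm_ring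
    rw [hbc₀, hbb, hbπ, zero_mul, zero_add] at h1
    exact h1.symm
  -- The matrix c₀ already satisfies bc₀ + c₀b = π; replacing it by c₀bc₀ keeps this and makes the
  -- square zero.
  obtain ⟨co, ce, hc⟩ : ∃ co ce, offDiag co ce = c₀ * b * c₀ := by
    simp only [hc₀, hb', hk, hπ', offDiag_mul, onDiag_mul, onDiag_sub, onDiag_mul_offDiag,
      offDiag_mul_onDiag]
    exact ⟨_, _, rfl⟩
  refine ⟨so, se, πo, πe, bo, be, co, ce, ⟨hδδ, hss, hδsδ, hsδs, hπ, ?_, ?_, ?_, ?_, hbb⟩, hb⟩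
  · rw [hπb, hbπ]
  · have h1 : π * (c₀ * b * c₀) * π = (π * c₀) * b * (c₀ * π) := by noncomm_ring
    rw [hc, h1, hπc₀, hc₀π]
  · have h1 : b * (c₀ * b * c₀) + c₀ * b * c₀ * b = b * c₀ * b * c₀ + c₀ * (b * c₀ * b) := by
      noncomm_ring
    rw [hc, h1, hbcb, hbc₀]
  · have h1 : c₀ * b * c₀ * (c₀ * b * c₀) = c₀ * (b * c₀) * (c₀ * b) * c₀ := by noncomm_ring
    have h2 : c₀ * b = π - b * c₀ := by rw [← hbc₀]; abel
    have h3 : c₀ * (b * c₀) * (π - b * c₀) = c₀ * b * (c₀ * π) - c₀ * (b * c₀ * b) * c₀ := by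
      noncomm_ring
    rw [hc, h1, h2, h3, hc₀π, hbcb, sub_self, zero_mul]

end SplittingExistence

/-! ### Contractions with a denominator and their specializations -/

section ClearDenominators

variable {ι : Type*} [Fintype ι] [DecidableEq ι]

/-- The matrices `Xo`, `Xe` contract a `ℤ/2`-graded complex up to the factor `D`. -/
structure IsContractionUpTo {Λ : Type*} [CommRing Λ] (D : Λ) (Do De Xo Xe : Matrix ι ι Λ) :
    Prop where
  odd : De * Xo + Xe * Do = D • 1
  even : Do * Xe + Xo * De = D • 1
  sq_odd : Xe * Xo = 0
  sq_even : Xo * Xe = 0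

/-- A common denominator of all entries of the contraction turns its relations into identities over
Λ, which survive any specialization. -/
theorem IsContraction.exists_denominator {Λ Q : Type*} [CommRing Λ] [IsDomain Λ] [Field Q]
    [Algebra Λ Q] [IsFractionRing Λ Q] {Do De : Matrix ι ι Λ} {So Se : Matrix ι ι Q}
    (h : IsContraction (Do.map (algebraMap Λ Q)) (De.map (algebraMap Λ Q)) So Se) :
    ∃ (D : Λ) (Xo Xe : Matrix ι ι Λ), D ≠ 0 ∧ IsContractionUpTo D Do De Xo Xe ∧
      (De.map (algebraMap Λ Q) + Se).det * algebraMap Λ Q (D ^ Fintype.card ι) =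
        algebraMap Λ Q (D • De + Xe).det := by
  obtain ⟨⟨D, hD⟩, hmul⟩ := IsLocalization.exist_integer_multiples_of_finite (nonZeroDivisors Λ)
    (Sum.elim (fun ij : ι × ι => So ij.1 ij.2) (fun ij : ι × ι => Se ij.1 ij.2))
  have ho : ∀ i j, ∃ z, algebraMap Λ Q z = algebraMap Λ Q D * So i j := fun i j => by
    obtain ⟨z, hz⟩ := hmul (Sum.inl (i, j))
    exact ⟨z, by rw [hz]; simp [Algebra.smul_def]⟩
  have he : ∀ i j, ∃ z, algebraMap Λ Q z = algebraMap Λ Q D * Se i j := fun i j => by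
    obtain ⟨z, hz⟩ := hmul (Sum.inr (i, j))
    exact ⟨z, by rw [hz]; simp [Algebra.smul_def]⟩
  choose Xo hXo using ho
  choose Xe hXe using he
  have hinj : Function.Injective (fun M : Matrix ι ι Λ => M.map (algebraMap Λ Q)) :=
    Matrix.map_injective (IsFractionRing.injective Λ Q)
  have hXo' : (Matrix.of Xo).map (algebraMap Λ Q) = algebraMap Λ Q D • So := by
    ext i j; simpa using hXo i j
  have hXe' : (Matrix.of Xe).map (algebraMap Λ Q) = algebraMap Λ Q D • Se := by
    ext i j; simpa using hXe i j
  have hD1 : (D • (1 : Matrix ι ι Λ)).map (algebraMap Λ Q) = algebraMap Λ Q D • 1 := by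
    ext i j; simp [Matrix.one_apply, apply_ite (algebraMap Λ Q)]
  have hadd : ∀ M N : Matrix ι ι Λ, (M + N).map (algebraMap Λ Q) =
      M.map (algebraMap Λ Q) + N.map (algebraMap Λ Q) := fun M N => by ext; simp
  refine ⟨D, Matrix.of Xo, Matrix.of Xe, nonZeroDivisors.ne_zero hD, ⟨?_, ?_, ?_, ?_⟩, ?_⟩
  · apply hinj
    simp only [hadd, Matrix.map_mul, hXo', hXe', hD1, Matrix.mul_smul, Matrix.smul_mul, ← smul_add,
      h.odd]
  · apply hinj
    simp only [hadd, Matrix.map_mul, hXo', hXe', hD1, Matrix.mul_smul, Matrix.smul_mul, ← smul_add,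
      h.even]
  · apply hinj
    simp only [Matrix.map_mul, hXo', hXe', Matrix.mul_smul, Matrix.smul_mul, h.sq_odd, smul_zero]
    ext; simp
  · apply hinj
    simp only [Matrix.map_mul, hXo', hXe', Matrix.mul_smul, Matrix.smul_mul, h.sq_even, smul_zero]
    ext; simp
  · rw [RingHom.map_det, RingHom.mapMatrix_apply, hadd, hXe']
    have : (D • De).map (algebraMap Λ Q) = algebraMap Λ Q D • De.map (algebraMap Λ Q) := by
      ext; simp
    rw [this, ← smul_add, Matrix.det_smul, map_pow, mul_comm]

/-- The generic and the special determinant are both quotients of images of the same elements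
det(D·De + Xe) and D^card; hence the special determinant is the value of the generic one. -/
theorem IsContractionUpTo.specialize {Λ k : Type*} [CommRing Λ] [Field k] {D : Λ}
    {Do De Xo Xe : Matrix ι ι Λ} (h : IsContractionUpTo D Do De Xo Xe) (φ : Λ →+* k)
    (hD : φ D ≠ 0) :
    IsContraction (Do.map φ) (De.map φ) ((φ D)⁻¹ • Xo.map φ) ((φ D)⁻¹ • Xe.map φ) ∧
      (De.map φ + (φ D)⁻¹ • Xe.map φ).det * φ (D ^ Fintype.card ι) = φ (D • De + Xe).det := by
  have hadd : ∀ M N : Matrix ι ι Λ, M.map φ + N.map φ = (M + N).map φ := fun M N => by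
    ext; simp
  have hD1 : (D • (1 : Matrix ι ι Λ)).map φ = φ D • 1 := by
    ext i j; simp [Matrix.one_apply, apply_ite φ]
  have h0 : (0 : Matrix ι ι Λ).map φ = 0 := by ext; simp
  refine ⟨⟨?_, ?_, ?_, ?_⟩, ?_⟩
  · simp only [Matrix.mul_smul, Matrix.smul_mul, ← smul_add, ← Matrix.map_mul, hadd, h.odd, hD1]
    rw [inv_smul_smul₀ hD]
  · simp only [Matrix.mul_smul, Matrix.smul_mul, ← smul_add, ← Matrix.map_mul, hadd, h.even, hD1]
    rw [inv_smul_smul₀ hD]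
  · simp only [Matrix.mul_smul, Matrix.smul_mul, ← Matrix.map_mul, h.sq_odd, h0, smul_zero]
  · simp only [Matrix.mul_smul, Matrix.smul_mul, ← Matrix.map_mul, h.sq_even, h0, smul_zero]
  · rw [RingHom.map_det, RingHom.mapMatrix_apply, ← hadd]
    have : (D • De).map φ + Xe.map φ = φ D • (De.map φ + (φ D)⁻¹ • Xe.map φ) := by
      rw [smul_add, smul_inv_smul₀ hD]
      ext; simp
    rw [this, Matrix.det_smul, map_pow, mul_comm]

end ClearDenominators

/-! ### The extension of a continuous representation to the Iwasawa algebra -/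

section LamEval

open Filter

variable {p : ℕ} [Fact p.Prime] {G : Type*} [Group G] [TopologicalSpace G]

theorem transition_lamProj {U V : OpenNormalSubgroup G} (h : U ≤ V) (x : Lam p G) :
    transition p G h (lamProj p U x) = lamProj p V x := by
  have hx := x.2
  simp only [iwasawaAlgebra, Subring.mem_iInf] at hx
  exact hx U V h

/-- The Riemann sum of level `U` that approximates `lamEval p σ x`. -/
def riemannSum {B : Type*} [Ring B] [Module ℤ_[p] B] (σ : G → B) (x : Lam p G)
    (U : OpenNormalSubgroup G) : B :=
  Finsupp.sum (lamProj p U x).coeff fun c z => z • σ (Quotient.out c)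

theorem map_riemannSum {B B' : Type*} [Ring B] [Module ℤ_[p] B] [Ring B'] [Module ℤ_[p] B']
    (f : B →+ B') (hf : ∀ (z : ℤ_[p]) b, f (z • b) = z • f b) {σ : G → B} {σ' : G → B'}
    (h : ∀ g, f (σ g) = σ' g) (x : Lam p G) (U : OpenNormalSubgroup G) :
    f (riemannSum σ x U) = riemannSum σ' x U := by
  simp only [riemannSum, Finsupp.sum, map_sum, hf, h]

instance : (atBot : Filter (OpenNormalSubgroup G)).NeBot :=
  haveI : Nonempty (OpenNormalSubgroup G) := ⟨{ toSubgroup := ⊤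
                                                isOpen' := isOpen_univ
                                                isNormal' := inferInstance }⟩
  atBot_neBot

theorem lamEval_eq_of_tendsto {B : Type*} [Ring B] [TopologicalSpace B] [T2Space B]
    [Module ℤ_[p] B] {σ : G → B} {x : Lam p G} {b : B}
    (h : Tendsto (riemannSum σ x) atBot (𝓝 b)) : lamEval p σ x = b :=
  h.limUnder_eq

/-- The extension to `Λ(G)` of a representation of `G` with open kernel. -/
def discreteEval {B C : Type*} [Ring B] [Algebra ℤ_[p] B] [Ring C] (π : B →+* C) (σ : G →* B)
    (U : OpenNormalSubgroup G) (hU : ∀ g ∈ U.toSubgroup, π (σ g) = 1) : Lam p G →+* C :=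
  (MonoidAlgebra.liftNCRingHom (π.comp (algebraMap ℤ_[p] B))
    (QuotientGroup.lift U.toSubgroup (π.toMonoidHom.comp σ) hU) (fun z c => by
      induction c using QuotientGroup.induction_on with
      | H g =>
        change Commute (π (algebraMap ℤ_[p] B z)) (π (σ g))
        exact Commute.map (show Commute _ _ from Algebra.commutes z (σ g)) π)).comp (lamProj p U)

/-- Where σ factors through G/U, the representatives chosen in a Riemann sum are immaterial, and the
sums are constant from level U on. -/
theorem map_riemannSum_eq_discreteEval {B C : Type*} [Ring B] [Algebra ℤ_[p] B] [Ring C]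
    (π : B →+* C) (σ : G →* B) {U V : OpenNormalSubgroup G}
    (hU : ∀ g ∈ U.toSubgroup, π (σ g) = 1) (h : V ≤ U) (x : Lam p G) :
    π (riemannSum σ x V) = discreteEval π σ U hU x := by
  rw [discreteEval, RingHom.comp_apply, ← transition_lamProj h, riemannSum, Finsupp.sum, map_sum]
  generalize lamProj p V x = y
  induction y using MonoidAlgebra.induction_linear with
  | zero => simp
  | add f g hf hg =>
    rw [map_add, map_add, ← hf, ← hg]
    simp only [← map_sum]
    rw [← map_add]
    congr 1
    exact Finsupp.sum_add_index' (h := fun c z => z • σ (Quotient.out c)) (fun _ => zero_smul _ _)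
      (fun _ _ _ => add_smul _ _ _)
  | single c z =>
    rw [← map_sum]
    have h1 : (∑ a ∈ (MonoidAlgebra.single c z).coeff.support,
        (MonoidAlgebra.single c z).coeff a • σ (Quotient.out a)) = z • σ (Quotient.out c) :=
      Finsupp.sum_single_index (h := fun c z => z • σ (Quotient.out c)) (zero_smul _ _)
    have h2 : transition p G h (MonoidAlgebra.single c z) = MonoidAlgebra.single
        (QuotientGroup.map V.toSubgroup U.toSubgroup (MonoidHom.id G) h c) z := by
      simp [transition, MonoidAlgebra.mapDomain_single]
    rw [h1, h2]
    have h3 : c = QuotientGroup.mk (Quotient.out c) := (QuotientGroup.out_eq' c).symm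
    conv_rhs => rw [h3]
    rw [Algebra.smul_def, map_mul]
    refine Eq.trans ?_ (MonoidAlgebra.liftNC_single (π.comp (algebraMap ℤ_[p] B)).toAddMonoidHom
      (QuotientGroup.lift U.toSubgroup (π.toMonoidHom.comp σ) hU)
      (QuotientGroup.map V.toSubgroup U.toSubgroup (MonoidHom.id G) h
        (QuotientGroup.mk (Quotient.out c))) z).symm
    rfl

theorem exists_openNormalSubgroup_le_ker {B C : Type*} [Ring B] [TopologicalSpace B] [Ring C]
    (π : B →+* C) (hπ : IsOpen {b | π b = 1}) (σ : G →* B) (hσ : Continuous σ) :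
    ∃ U : OpenNormalSubgroup G, ∀ g ∈ U.toSubgroup, π (σ g) = 1 := by
  have hker : ∀ g, g ∈ (π.toMonoidHom.comp σ).toHomUnits.ker ↔ π (σ g) = 1 := fun g => by
    rw [MonoidHom.mem_ker, Units.ext_iff]; rfl
  refine ⟨{ toSubgroup := (π.toMonoidHom.comp σ).toHomUnits.ker
            isOpen' := ?_
            isNormal' := inferInstance }, fun g hg => (hker g).1 hg⟩
  convert hπ.preimage hσ using 1
  ext g
  exact hker g

/-- A continuous representation on a profinite ring extends to the Iwasawa algebra. -/
theorem exists_tendsto_riemannSum {B : Type*} [Ring B] [TopologicalSpace B] [CompactSpace B]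
    [T2Space B] [Algebra ℤ_[p] B] {ι : Type*} {C : ι → Type*} [∀ i, Ring (C i)]
    (π : ∀ i, B →+* C i) (hinj : ∀ x y, (∀ i, π i x = π i y) → x = y)
    (hclosed : ∀ i y, IsClosed {b | π i b = y}) (hopen : ∀ i, IsOpen {b | π i b = 1})
    (σ : G →* B) (hσ : Continuous σ) :
    ∃ Φ : Lam p G →+* B, ∀ x, Tendsto (riemannSum σ x) atBot (𝓝 (Φ x)) := by
  choose U hU using fun i => exists_openNormalSubgroup_le_ker (π i) (hopen i) σ hσ
  -- Every cluster point has prescribed images under all the π i. Compactness gives a cluster point,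
  -- joint injectivity makes it unique, and the ring laws can be checked after applying each π i.
  have hcl : ∀ (x : Lam p G) b, ClusterPt b (map (riemannSum σ x) atBot) →
      ∀ i, π i b = discreteEval (π i) σ (U i) (hU i) x := fun x b hb i => by
    have hmem : {b | π i b = discreteEval (π i) σ (U i) (hU i) x} ∈
        map (riemannSum σ x) atBot := by
      refine mem_map.2 ?_
      filter_upwards [Iic_mem_atBot (U i)] with V hV
      exact map_riemannSum_eq_discreteEval (π i) σ (hU i) hV x
    have h := mem_closure_iff_clusterPt.2 (hb.mono (le_principal_iff.2 hmem))
    rwa [(hclosed i _).closure_eq] at h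
  have hex : ∀ x, ∃ b, ClusterPt b (map (riemannSum (p := p) σ x) atBot) := fun x =>
    exists_clusterPt_of_compactSpace _
  choose Φ hΦ using hex
  have hΦ' := fun x => hcl x (Φ x) (hΦ x)
  refine ⟨{ toFun := Φ
            map_one' := hinj _ _ fun i => by rw [hΦ', map_one, map_one]
            map_mul' := fun x y => hinj _ _ fun i => by rw [map_mul, hΦ', hΦ', hΦ', map_mul]
            map_zero' := hinj _ _ fun i => by rw [hΦ', map_zero, map_zero]
            map_add' := fun x y => hinj _ _ fun i => by
              rw [map_add, hΦ', hΦ', hΦ', map_add] }, fun x => ?_⟩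
  refine le_nhds_of_unique_clusterPt fun b hb => hinj _ _ fun i => ?_
  rw [hcl x b hb i]
  exact (hΦ' x i).symm

/-- It lets ρ, its twists and the action on E_θ inherit their limits from `rhoGamma`. Only
additivity is required, since the passage to the matrix over E_θ is used as an additive map. -/
theorem tendsto_riemannSum_map {B B' : Type*} [Ring B] [Module ℤ_[p] B] [Ring B'] [Module ℤ_[p] B']
    [TopologicalSpace B] [TopologicalSpace B'] (f : B →+ B') (hfc : Continuous f)
    (hf : ∀ (z : ℤ_[p]) b, f (z • b) = z • f b) {σ : G → B} {σ' : G → B'}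
    (h : ∀ g, f (σ g) = σ' g) {x : Lam p G} {b : B}
    (hb : Tendsto (riemannSum σ x) atBot (𝓝 b)) :
    Tendsto (riemannSum σ' x) atBot (𝓝 (f b)) := by
  refine ((hfc.tendsto b).comp hb).congr fun U => ?_
  exact map_riemannSum f hf h x U

end LamEval

/-! ### Matrix representations over profinite commutative rings -/

section MatrixReps

open Filter PowerSeries

variable {p : ℕ} [Fact p.Prime] {G : Type*} [Group G] [TopologicalSpace G]

theorem isOpen_setOf_mk_eq {W : Type*} [CommRing W] [TopologicalSpace W] [IsTopologicalRing W]
    {J : Ideal W} (hJ : IsOpen (J : Set W)) (z : W ⧸ J) :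
    IsOpen {w | Ideal.Quotient.mk J w = z} := by
  obtain ⟨w₀, rfl⟩ := Ideal.Quotient.mk_surjective z
  have : {w | Ideal.Quotient.mk J w = Ideal.Quotient.mk J w₀} = (fun w => w - w₀) ⁻¹' J := by
    ext w; exact Ideal.Quotient.mk_eq_mk_iff_sub_mem _ _
  rw [this]
  exact hJ.preimage (continuous_id.sub continuous_const)

theorem isClosed_setOf_mk_eq {W : Type*} [CommRing W] [TopologicalSpace W] [IsTopologicalRing W]
    {J : Ideal W} (hJ : IsOpen (J : Set W)) (z : W ⧸ J) :
    IsClosed {w | Ideal.Quotient.mk J w = z} := by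
  rw [← isOpen_compl_iff]
  have : {w | Ideal.Quotient.mk J w = z}ᶜ =
      ⋃ z' : {z' : W ⧸ J // z' ≠ z}, {w | Ideal.Quotient.mk J w = z'} := by
    ext w; simp
  rw [this]
  exact isOpen_iUnion fun z' => isOpen_setOf_mk_eq hJ _

theorem setOf_mapMatrix_eq {W W' : Type*} [CommRing W] [CommRing W'] {m : Type*} [Fintype m]
    [DecidableEq m] (φ : W →+* W') (y : Matrix m m W') :
    {b : Matrix m m W | φ.mapMatrix b = y} =
      ⋂ i : m, ⋂ j : m, (fun b : Matrix m m W => b i j) ⁻¹' {w | φ w = y i j} := by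
  ext b
  simp [← Matrix.ext_iff]

/-- A continuous matrix representation over a profinite commutative ring extends to the Iwasawa
algebra. -/
theorem exists_tendsto_riemannSum_matrix {W : Type*} [CommRing W] [TopologicalSpace W]
    [IsTopologicalRing W] [CompactSpace W] [T2Space W] [Algebra ℤ_[p] W] {ι : Type*}
    (J : ι → Ideal W) (hJ : ∀ i, IsOpen (J i : Set W)) (hJ0 : ∀ w, (∀ i, w ∈ J i) → w = 0)
    {m : Type*} [Fintype m] [DecidableEq m] (σ : G →* Matrix m m W) (hσ : Continuous σ) :
    ∃ Φ : Lam p G →+* Matrix m m W, ∀ x, Tendsto (riemannSum σ x) atBot (𝓝 (Φ x)) := by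
  haveI : CompactSpace (Matrix m m W) := inferInstanceAs (CompactSpace (m → m → W))
  refine exists_tendsto_riemannSum (fun i => (Ideal.Quotient.mk (J i)).mapMatrix) ?_ ?_ ?_ σ hσ
  · intro x y h
    ext a b
    refine sub_eq_zero.1 (hJ0 _ fun i => (Ideal.Quotient.mk_eq_mk_iff_sub_mem _ _).1 ?_)
    exact congrFun (congrFun (h i) a) b
  · intro i y
    rw [setOf_mapMatrix_eq]
    exact isClosed_iInter fun a => isClosed_iInter fun b =>
      (isClosed_setOf_mk_eq (hJ i) _).preimage (continuous_id.matrix_elem a b)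
  · intro i
    rw [setOf_mapMatrix_eq]
    exact isOpen_iInter_of_finite fun a => isOpen_iInter_of_finite fun b =>
      (isOpen_setOf_mk_eq (hJ i) _).preimage (continuous_id.matrix_elem a b)

end MatrixReps

/-! ### The topology of 𝒪 and of 𝒪⟦X⟧ -/

section IntegerRing

open PowerSeries

variable (p : ℕ) [Fact p.Prime] {L : Type*} [NormedField L] [IsUltrametricDist L]
  [NormedAlgebra ℚ_[p] L]

theorem norm_intRing_le_one (x : IntRing L) : ‖(x : L)‖ ≤ 1 := x.2

theorem coe_algebraMap_intRing (z : ℤ_[p]) :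
    ((algebraMap ℤ_[p] (IntRing L) z : IntRing L) : L) = algebraMap ℚ_[p] L z := rfl

theorem continuous_algebraMap_intRing : Continuous (algebraMap ℤ_[p] (IntRing L)) :=
  Continuous.subtype_mk ((algebraMapCLM ℚ_[p] L).continuous.comp continuous_subtype_val) _

variable (L) in
theorem norm_natCast_prime : ‖(p : L)‖ = (p : ℝ)⁻¹ := by
  rw [← map_natCast (algebraMap ℚ_[p] L) p, norm_algebraMap']
  exact Padic.norm_p

variable (L) in
theorem prime_ne_zero : (p : L) ≠ 0 := by
  rw [← norm_ne_zero_iff, norm_natCast_prime]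
  have := (Fact.out : p.Prime).pos
  positivity

theorem mem_span_pow_iff (k : ℕ) (x : IntRing L) :
    x ∈ Ideal.span {(p : IntRing L) ^ k} ↔ ‖(x : L)‖ ≤ ‖(p : L) ^ k‖ := by
  have hp : (p : L) ^ k ≠ 0 := pow_ne_zero _ (prime_ne_zero p L)
  rw [Ideal.mem_span_singleton]
  constructor
  · rintro ⟨y, rfl⟩
    push_cast
    rw [norm_mul]
    exact mul_le_of_le_one_right (norm_nonneg _) (norm_intRing_le_one y)
  · intro h
    refine ⟨⟨(x : L) / (p : L) ^ k, ?_⟩, Subtype.ext ?_⟩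
    · change ‖(x : L) / (p : L) ^ k‖ ≤ 1
      rw [norm_div]
      exact div_le_one_of_le₀ h (norm_nonneg _)
    · push_cast
      rw [mul_div_cancel₀ _ hp]

theorem isOpen_span_pow (k : ℕ) :
    IsOpen ((Ideal.span {(p : IntRing L) ^ k} : Ideal (IntRing L)) : Set (IntRing L)) := by
  have hp : (p : L) ^ k ≠ 0 := pow_ne_zero _ (prime_ne_zero p L)
  refine AddSubgroup.isOpen_of_mem_nhds
    (Ideal.span {(p : IntRing L) ^ k} : Ideal (IntRing L)).toAddSubgroup (g := 0) ?_
  have : Filter.Tendsto (fun x : IntRing L => ‖(x : L)‖) (𝓝 0) (𝓝 0) := by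
    have h : Continuous fun x : IntRing L => ‖(x : L)‖ := continuous_subtype_val.norm
    simpa using h.tendsto 0
  filter_upwards [this.eventually_lt_const (norm_pos_iff.2 hp)] with x hx
  exact (mem_span_pow_iff p k x).2 hx.le

theorem eq_zero_of_forall_mem_span_pow (x : IntRing L)
    (h : ∀ᶠ k in Filter.atTop, x ∈ Ideal.span {(p : IntRing L) ^ k}) : x = 0 := by
  have ht : Filter.Tendsto (fun k : ℕ => ‖(p : L) ^ k‖) Filter.atTop (𝓝 0) := by
    simp only [norm_pow]
    refine tendsto_pow_atTop_nhds_zero_of_lt_one (norm_nonneg _) ?_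
    rw [norm_natCast_prime]
    exact inv_lt_one_of_one_lt₀ (by exact_mod_cast (Fact.out : p.Prime).one_lt)
  have h0 : ‖(x : L)‖ ≤ 0 := ge_of_tendsto ht (h.mono fun k hk => (mem_span_pow_iff p k x).1 hk)
  exact Subtype.ext (norm_le_zero_iff.1 h0)

variable (L) in
theorem compactSpace_intRing [FiniteDimensional ℚ_[p] L] : CompactSpace (IntRing L) := by
  haveI := FiniteDimensional.proper ℚ_[p] L
  have : ((IntRing L : Subring L) : Set L) = Metric.closedBall 0 1 := by
    ext x
    rw [mem_closedBall_zero_iff]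
    rfl
  refine isCompact_iff_compactSpace.1 ?_
  rw [this]
  exact isCompact_closedBall _ _

theorem compactSpace_powerSeries (W : Type*) [TopologicalSpace W] [CompactSpace W] :
    CompactSpace W⟦X⟧ :=
  inferInstanceAs (CompactSpace ((Unit →₀ ℕ) → W))

variable (L) in
/-- The power series that are congruent to `0` modulo `(p ^ k, X ^ k)`. -/
def truncIdeal (k : ℕ) : Ideal (IntRing L)⟦X⟧ where
  carrier := {f | ∀ i < k, coeff i f ∈ Ideal.span {(p : IntRing L) ^ k}}
  zero_mem' i _ := by simp
  add_mem' hf hg i hi := by rw [map_add]; exact Ideal.add_mem _ (hf i hi) (hg i hi)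
  smul_mem' c f hf i hi := by
    rw [smul_eq_mul, coeff_mul]
    refine Ideal.sum_mem _ fun ab hab => Ideal.mul_mem_left _ _ (hf _ ?_)
    have := Finset.HasAntidiagonal.mem_antidiagonal.1 hab
    omega

theorem mem_truncIdeal {k : ℕ} {f : (IntRing L)⟦X⟧} :
    f ∈ truncIdeal p L k ↔ ∀ i < k, coeff i f ∈ Ideal.span {(p : IntRing L) ^ k} := Iff.rfl

theorem isOpen_truncIdeal (k : ℕ) : IsOpen (truncIdeal p L k : Set (IntRing L)⟦X⟧) := by
  have : (truncIdeal p L k : Set (IntRing L)⟦X⟧) = ⋂ i ∈ Finset.range k,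
      coeff i ⁻¹' (Ideal.span {(p : IntRing L) ^ k} : Ideal (IntRing L)) := by
    ext f
    simp [mem_truncIdeal]
  rw [this]
  exact isOpen_biInter_finset fun i _ =>
    (isOpen_span_pow p k).preimage (WithPiTopology.continuous_coeff _ i)

theorem eq_zero_of_forall_mem_truncIdeal (f : (IntRing L)⟦X⟧) (h : ∀ k, f ∈ truncIdeal p L k) :
    f = 0 := by
  ext1 i
  refine eq_zero_of_forall_mem_span_pow p _ ?_
  filter_upwards [Filter.eventually_gt_atTop i] with k hk
  exact h k i hk

end IntegerRing

/-! ### Evaluation of power series and specialization of representations -/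

section Evaluation

open PowerSeries

variable {L : Type*} [NormedField L] [IsUltrametricDist L]

theorem norm_coeff_mul_pow_le (g : (IntRing L)⟦X⟧) (t : L) (k : ℕ) :
    ‖((coeff k g : IntRing L) : L) * t ^ k‖ ≤ ‖t‖ ^ k := by
  rw [norm_mul, norm_pow]
  exact mul_le_of_le_one_left (by positivity) (norm_intRing_le_one _)

theorem summable_norm_evalSeries (g : (IntRing L)⟦X⟧) {t : L} (ht : ‖t‖ < 1) :
    Summable fun k => ‖((coeff k g : IntRing L) : L) * t ^ k‖ :=
  Summable.of_nonneg_of_le (fun _ => norm_nonneg _) (norm_coeff_mul_pow_le g t)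
    (summable_geometric_of_lt_one (norm_nonneg t) ht)

/-- Integral coefficients give a geometric bound that is uniform in the series. -/
theorem continuous_evalSeries [CompleteSpace L] {t : L} (ht : ‖t‖ < 1) :
    Continuous fun g : (IntRing L)⟦X⟧ => evalSeries g t :=
  continuous_tsum (fun k => (continuous_subtype_val.comp
      (WithPiTopology.continuous_coeff _ k)).mul continuous_const)
    (summable_geometric_of_lt_one (norm_nonneg t) ht) (fun k g => norm_coeff_mul_pow_le g t k)

variable [CompleteSpace L]

/-- Evaluation at `t`, `|t| < 1`, as a ring homomorphism. -/
def evalHom (t : L) (ht : ‖t‖ < 1) : (IntRing L)⟦X⟧ →+* L where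
  toFun g := evalSeries g t
  map_zero' := by simp [evalSeries]
  map_one' := by
    rw [evalSeries, tsum_eq_single 0]
    · simp
    · intro k hk; simp [coeff_one, hk]
  map_add' f g := by
    rw [evalSeries, evalSeries, evalSeries, ← (summable_norm_evalSeries f ht).of_norm.tsum_add
      (summable_norm_evalSeries g ht).of_norm]
    simp [add_mul]
  map_mul' f g := by
    rw [evalSeries, evalSeries, evalSeries, tsum_mul_tsum_eq_tsum_sum_antidiagonal_of_summable_norm
      (summable_norm_evalSeries f ht) (summable_norm_evalSeries g ht)]
    congr 1
    ext1 k
    rw [coeff_mul]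
    push_cast
    rw [Finset.sum_mul]
    refine Finset.sum_congr rfl fun ab hab => ?_
    rw [← Finset.HasAntidiagonal.mem_antidiagonal.1 hab, pow_add]
    ring

@[simp]
theorem evalHom_apply (t : L) (ht : ‖t‖ < 1) (g : (IntRing L)⟦X⟧) :
    evalHom t ht g = evalSeries g t := rfl

theorem evalSeries_C (t : L) (c : IntRing L) : evalSeries (C c) t = c := by
  rw [evalSeries, tsum_eq_single 0]
  · simp
  · intro k hk; simp [coeff_C, hk]

theorem evalSeries_X (t : L) : evalSeries (X : (IntRing L)⟦X⟧) t = t := by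
  rw [evalSeries, tsum_eq_single 1]
  · simp
  · intro k hk; simp [coeff_X, hk]

theorem norm_evalSeries_le_one (g : (IntRing L)⟦X⟧) {t : L} (ht : ‖t‖ < 1) :
    ‖evalSeries g t‖ ≤ 1 := by
  have h := (summable_norm_evalSeries g ht).of_norm.hasSum.tendsto_sum_nat
  have hmem : ∀ N, (∑ k ∈ Finset.range N, ((coeff k g : IntRing L) : L) * t ^ k) ∈
      (IntRing L : Subring L) := fun N =>
    Subring.sum_mem _ fun k _ => Subring.mul_mem _ (coeff k g).2
      (Subring.pow_mem _ (show ‖t‖ ≤ 1 from ht.le) k)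
  exact le_of_tendsto h.norm (Filter.Eventually.of_forall fun N => hmem N)

/-- Evaluation at `t`, `|t| < 1`, as a ring homomorphism to the valuation ring. -/
def evalInt (t : L) (ht : ‖t‖ < 1) : (IntRing L)⟦X⟧ →+* IntRing L :=
  (evalHom t ht).codRestrict (IntRing L) fun g => norm_evalSeries_le_one g ht

theorem coe_evalInt (t : L) (ht : ‖t‖ < 1) (g : (IntRing L)⟦X⟧) :
    ((evalInt t ht g : IntRing L) : L) = evalSeries g t := rfl

theorem continuous_evalInt (t : L) (ht : ‖t‖ < 1) : Continuous (evalInt t ht) :=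
  Continuous.subtype_mk (continuous_evalSeries ht) _

theorem evalInt_smul {p : ℕ} [Fact p.Prime] [NormedAlgebra ℚ_[p] L] (t : L) (ht : ‖t‖ < 1)
    (z : ℤ_[p]) (g : (IntRing L)⟦X⟧) : evalInt t ht (z • g) = z • evalInt t ht g := by
  have h : z • g = C (algebraMap ℤ_[p] (IntRing L) z) * g := by
    ext1 k
    rw [coeff_C_mul, ← Algebra.smul_def]
    rfl
  rw [h, map_mul, Algebra.smul_def]
  congr 1
  exact Subtype.ext (evalSeries_C t _)

end Evaluation

theorem continuous_of_continuous_coeff {W Z : Type*} [Semiring W] [TopologicalSpace W]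
    [TopologicalSpace Z] {f : Z → PowerSeries W} (h : ∀ k, Continuous fun z => PowerSeries.coeff k (f z)) :
    Continuous f :=
  continuous_iff_continuousAt.2 fun z =>
    (PowerSeries.WithPiTopology.tendsto_iff_coeff_tendsto _ _ _ _).2 fun k => (h k).tendsto z

/-! ### Continuous characters of ℤ_p and binomial series -/

section Characters

open PowerSeries Filter

variable {p : ℕ} [Fact p.Prime]

theorem continuous_padicInt_coe : Continuous fun z : ℤ_[p] => (z : ℚ_[p]) :=
  continuous_subtype_val

/-- A continuous homomorphism from `ℤ_p` to `ℤ_p^×` takes values in `1 + pℤ_p`. -/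
theorem norm_char_sub_one_lt_one (ψ : Multiplicative ℤ_[p] →* ℤ_[p]ˣ) (hψ : Continuous ψ)
    (z : Multiplicative ℤ_[p]) : ‖((ψ z : ℤ_[p]ˣ) : ℤ_[p]) - 1‖ < 1 := by
  have h1 : Tendsto (fun m : ℕ => Multiplicative.ofAdd ((p : ℤ_[p]) ^ m * z.toAdd)) atTop
      (𝓝 1) := by
    have hp : Tendsto (fun m : ℕ => (p : ℤ_[p]) ^ m) atTop (𝓝 0) :=
      tendsto_pow_atTop_nhds_zero_of_norm_lt_one (by
        rw [PadicInt.norm_p]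
        exact inv_lt_one_of_one_lt₀ (by exact_mod_cast (Fact.out : p.Prime).one_lt))
    have := hp.mul_const z.toAdd
    rw [zero_mul] at this
    exact (continuous_ofAdd.tendsto _).comp this
  have h2 : ∀ m : ℕ, ψ (Multiplicative.ofAdd ((p : ℤ_[p]) ^ m * z.toAdd)) = ψ z ^ p ^ m :=
    fun m => by
      rw [← map_pow]
      congr 1
      rw [← Nat.cast_pow, ← nsmul_eq_mul]
      rfl
  have h3 : Tendsto (fun m : ℕ => ‖(((ψ z ^ p ^ m : ℤ_[p]ˣ)) : ℤ_[p]) - 1‖) atTop (𝓝 0) := by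
    have h := (hψ.tendsto 1).comp h1
    simp only [Function.comp_def, h2, map_one] at h
    have h' := (((Units.continuous_val.tendsto _).comp h).sub_const 1).norm
    simpa using h'
  obtain ⟨m, hm⟩ := (h3.eventually_lt_const one_pos).exists
  have key : ∀ u : ℤ_[p], ‖u‖ < 1 ↔ PadicInt.toZMod u = 0 := fun u => by
    rw [← RingHom.mem_ker, PadicInt.ker_toZMod, IsLocalRing.mem_maximalIdeal, PadicInt.mem_nonunits]
  rw [key] at hm ⊢
  -- Raising to the power p^m is the identity on the residue field 𝔽_p, so ψ(z) has the same residue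
  -- as ψ(p^m z), which is close to 1.
  have hpow : ∀ (x : ZMod p) (m : ℕ), x ^ p ^ m = x := fun x m => by
    induction m with
    | zero => simp
    | succ m ih => rw [pow_succ, pow_mul, ih, ZMod.pow_card]
  rw [Units.val_pow_eq_pow_val, map_sub, map_pow, hpow, ← map_sub] at hm
  exact hm

variable {L : Type*} [NormedField L] [IsUltrametricDist L] [NormedAlgebra ℚ_[p] L]
  [CompleteSpace L]

/-- The value of `(1 + X)^z` at `ψ(1) - 1` is `ψ(z)`. -/
theorem evalSeries_binomialSeries (ψ : Multiplicative ℤ_[p] →* ℤ_[p]ˣ) (hψ : Continuous ψ)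
    {t : L} (ht : ‖t‖ < 1)
    (hψt : algebraMap ℚ_[p] L ((ψ (Multiplicative.ofAdd 1) : ℤ_[p]) : ℚ_[p]) = 1 + t)
    (z : ℤ_[p]) :
    evalSeries (binomialSeries (IntRing L) z) t =
      algebraMap ℚ_[p] L ((ψ (Multiplicative.ofAdd z) : ℤ_[p]) : ℚ_[p]) := by
  have hb : Continuous fun z : ℤ_[p] => binomialSeries (IntRing L) z := by
    refine continuous_of_continuous_coeff fun k => ?_
    simp only [binomialSeries_coeff, ← Algebra.algebraMap_eq_smul_one]
    exact (continuous_algebraMap_intRing p).comp (PadicInt.continuous_choose k)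
  have h1 : Continuous fun z : ℤ_[p] => evalSeries (binomialSeries (IntRing L) z) t :=
    (continuous_evalSeries ht).comp hb
  have h2 : Continuous fun z : ℤ_[p] =>
      algebraMap ℚ_[p] L ((ψ (Multiplicative.ofAdd z) : ℤ_[p]) : ℚ_[p]) :=
    (algebraMapCLM ℚ_[p] L).continuous.comp ((continuous_padicInt_coe (p := p)).comp
      (Units.continuous_val.comp (hψ.comp continuous_ofAdd)))
  -- Both sides are continuous in `z`, and natural numbers are dense; for them the identity reads (1
  -- + t)^d = ψ(1)^d.
  refine congrFun (PadicInt.denseRange_natCast.equalizer h1 h2 (funext fun d => ?_)) z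
  simp only [Function.comp_apply]
  rw [binomialSeries_nat, ← evalHom_apply t ht, map_pow, map_add, map_one, evalHom_apply,
    evalSeries_X]
  have h3 : Multiplicative.ofAdd (d : ℤ_[p]) = Multiplicative.ofAdd (1 : ℤ_[p]) ^ d := by
    rw [← ofAdd_nsmul, nsmul_one]
  rw [h3, map_pow, ← hψt, Units.val_pow_eq_pow_val, PadicInt.coe_pow, map_pow]

end Characters

/-! ### The homomorphism Φ : Λ(G) → M_n(𝒪⟦X⟧) and its specializations -/

section GammaHom

open PowerSeries Filter

variable {p : ℕ} [Fact p.Prime] {G : Type*} [Group G] [TopologicalSpace G]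
  {H : Subgroup G} [H.Normal] (e : (G ⧸ H) ≃ₜ* Multiplicative ℤ_[p])
  {L : Type*} [NormedField L] [IsUltrametricDist L] [NormedAlgebra ℚ_[p] L]
  {n : ℕ}

theorem thetaHom_mul (g h : G) : thetaHom e (g * h) = thetaHom e g + thetaHom e h := by
  rw [thetaHom, QuotientGroup.mk_mul, map_mul, toAdd_mul]; rfl

theorem thetaHom_one : thetaHom e (1 : G) = 0 := by
  rw [thetaHom, QuotientGroup.mk_one, map_one, toAdd_one]

theorem thetaHom_eq_zero {g : G} (hg : g ∈ H) : thetaHom e g = 0 := by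
  rw [thetaHom, (QuotientGroup.eq_one_iff g).2 hg, map_one, toAdd_one]

theorem continuous_thetaHom : Continuous (thetaHom e) :=
  continuous_toAdd.comp (e.continuous.comp QuotientGroup.continuous_mk)

/-- `g ↦ ρ(g) ḡ` as a homomorphism. -/
def rhoGammaHom (ρ : G →* Matrix (Fin n) (Fin n) (IntRing L)) :
    G →* Matrix (Fin n) (Fin n) (IntRing L)⟦X⟧ where
  toFun := rhoGamma e ρ
  map_one' := by
    rw [rhoGamma, thetaHom_one, binomialSeries_zero, one_smul, map_one,
      Matrix.map_one _ (map_zero _) (map_one _)]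
  map_mul' g h := by
    rw [rhoGamma, rhoGamma, rhoGamma, thetaHom_mul, binomialSeries_add, map_mul, Matrix.map_mul,
      Matrix.smul_mul, Matrix.mul_smul, smul_smul]

theorem continuous_rhoGamma {ρ : G → Matrix (Fin n) (Fin n) (IntRing L)} (hρ : Continuous ρ) :
    Continuous (rhoGamma e ρ) := by
  refine continuous_matrix fun i j => continuous_of_continuous_coeff fun k => ?_
  have h : ∀ g, coeff k (rhoGamma e ρ g i j) =
      algebraMap ℤ_[p] (IntRing L) (Ring.choose (thetaHom e g) k) * ρ g i j := fun g => by
    rw [rhoGamma, Matrix.smul_apply, Matrix.map_apply, smul_eq_mul, coeff_mul_C,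
      binomialSeries_coeff, Algebra.algebraMap_eq_smul_one]
  simp only [h]
  exact ((continuous_algebraMap_intRing p).comp
    ((PadicInt.continuous_choose k).comp (continuous_thetaHom e))).mul (hρ.matrix_elem i j)

/-- `Φ` is the continuous linear extension to `Λ(G)` of `g ↦ ρ(g) ḡ`. -/
def IsGammaHom (ρ : G → Matrix (Fin n) (Fin n) (IntRing L))
    (Φ : Lam p G →+* Matrix (Fin n) (Fin n) (IntRing L)⟦X⟧) : Prop :=
  ∀ x, Tendsto (riemannSum (rhoGamma e ρ) x) atBot (𝓝 (Φ x))

/-- 𝒪⟦X⟧ is compact and the open ideals `truncIdeal` have zero intersection, so the general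
extension result for profinite coefficients applies. -/
theorem exists_isGammaHom [FiniteDimensional ℚ_[p] L]
    (ρ : G →* Matrix (Fin n) (Fin n) (IntRing L)) (hρ : Continuous ρ) :
    ∃ Φ, IsGammaHom e ρ Φ := by
  haveI := compactSpace_intRing p L
  haveI := compactSpace_powerSeries (IntRing L)
  haveI := WithPiTopology.instT2Space (IntRing L)
  haveI := WithPiTopology.instIsTopologicalRing (IntRing L)
  exact exists_tendsto_riemannSum_matrix (truncIdeal p L) (isOpen_truncIdeal p)
    (eq_zero_of_forall_mem_truncIdeal p) (rhoGammaHom e ρ) (continuous_rhoGamma e hρ)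

variable {e} {ρ : G → Matrix (Fin n) (Fin n) (IntRing L)}
  {Φ : Lam p G →+* Matrix (Fin n) (Fin n) (IntRing L)⟦X⟧}

theorem IsGammaHom.lamEval_rhoGamma (h : IsGammaHom e ρ Φ) (x : Lam p G) :
    lamEval p (rhoGamma e ρ) x = Φ x := by
  haveI := WithPiTopology.instT2Space (IntRing L)
  exact lamEval_eq_of_tendsto (h x)

theorem powerSeries_smul_eq (z : ℤ_[p]) (f : (IntRing L)⟦X⟧) (k : ℕ) :
    coeff k (z • f) = z • coeff k f := rfl

theorem IsGammaHom.lamEval_eq_map {ρ' : G → Matrix (Fin n) (Fin n) (IntRing L)}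
    (h : IsGammaHom e ρ Φ) (φ : (IntRing L)⟦X⟧ →+* IntRing L) (hφ : Continuous φ)
    (hφz : ∀ (z : ℤ_[p]) f, φ (z • f) = z • φ f)
    (hρ' : ∀ g, (rhoGamma e ρ g).map φ = ρ' g) (x : Lam p G) :
    lamEval p ρ' x = (Φ x).map φ :=
  lamEval_eq_of_tendsto (tendsto_riemannSum_map φ.mapMatrix.toAddMonoidHom
    (continuous_id.matrix_map hφ) (fun z b => Matrix.ext fun i j => hφz z (b i j)) hρ' (h x))

theorem IsGammaHom.lamEval_rho (h : IsGammaHom e ρ Φ) (x : Lam p G) :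
    lamEval p ρ x = (Φ x).map (constantCoeff (R := IntRing L)) := by
  refine h.lamEval_eq_map _ (WithPiTopology.continuous_constantCoeff _) ?_ ?_ x
  · intro z f
    rw [← coeff_zero_eq_constantCoeff_apply, powerSeries_smul_eq, coeff_zero_eq_constantCoeff_apply]
  · intro g
    ext1 i j
    rw [rhoGamma, Matrix.map_apply, Matrix.smul_apply, smul_eq_mul, map_mul,
      binomialSeries_constantCoeff, one_mul, Matrix.map_apply, constantCoeff_C]

/-- The X-coefficient of (1 + X)^θ(g) is θ(g), so the action on E_θ is Φ modulo X². -/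
theorem IsGammaHom.lamEval_rhoE (h : IsGammaHom e ρ Φ) (x : Lam p G) :
    lamEval p (rhoE e ρ) x = epsMatrix (Φ x) := by
  refine lamEval_eq_of_tendsto (tendsto_riemannSum_map
    { toFun := epsMatrix
      map_zero' := by ext (i | i) (j | j) <;> simp [epsMatrix]
      map_add' := fun M N => by
        ext (i | i) (j | j) <;> simp [epsMatrix, add_comm] } ?_ ?_ ?_ (h x))
  · refine Continuous.matrix_fromBlocks ?_ continuous_const ?_ ?_
    · exact continuous_id.matrix_map (WithPiTopology.continuous_constantCoeff _)
    · exact (continuous_id.matrix_map (WithPiTopology.continuous_coeff _ 1)).neg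
    · exact continuous_id.matrix_map (WithPiTopology.continuous_constantCoeff _)
  · intro z M
    have h0 : ∀ f : (IntRing L)⟦X⟧, constantCoeff (z • f) = z • constantCoeff f := fun f => by
      rw [← coeff_zero_eq_constantCoeff_apply, powerSeries_smul_eq,
        coeff_zero_eq_constantCoeff_apply]
    have h1 : ∀ f : (IntRing L)⟦X⟧, coeff 1 (z • f) = z • coeff 1 f := fun f => rfl
    ext (i | i) (j | j) : 2 <;>
      simp [epsMatrix, Matrix.smul_apply, h0, h1]
  · intro g
    ext (i | i) (j | j) : 2 <;>
      simp [epsMatrix, rhoE, rhoGamma, Matrix.smul_apply, binomialSeries_coeff]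

theorem charPow_eq (χ : (G ⧸ H) →* ℤ_[p]ˣ) (s : ℤ_[p]) (g : G) :
    charPow e χ s g = charGammaPow e χ (s * thetaHom e g) := rfl

variable (e) in
/-- The homomorphism `z ↦ χ(γ)^{s z}`. -/
def charHom (χ : (G ⧸ H) →* ℤ_[p]ˣ) (s : ℤ_[p]) : Multiplicative ℤ_[p] →* ℤ_[p]ˣ where
  toFun z := charGammaPow e χ (s * z.toAdd)
  map_one' := by simp [charGammaPow]
  map_mul' z w := by simp [charGammaPow, mul_add]

theorem charHom_ofAdd_one (χ : (G ⧸ H) →* ℤ_[p]ˣ) (s : ℤ_[p]) :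
    charHom e χ s (Multiplicative.ofAdd 1) = charGammaPow e χ s :=
  congrArg (charGammaPow e χ) (mul_one s)

theorem continuous_charHom {χ : (G ⧸ H) →* ℤ_[p]ˣ} (hχ : Continuous χ) (s : ℤ_[p]) :
    Continuous (charHom e χ s) :=
  hχ.comp (e.symm.continuous.comp (continuous_ofAdd.comp
    (continuous_const.mul continuous_toAdd)))

/-- `χ(γ)^s - 1` as an element of `L`. -/
def charPt (e : (G ⧸ H) ≃ₜ* Multiplicative ℤ_[p]) (L : Type*) [NormedField L]
    [NormedAlgebra ℚ_[p] L] (χ : (G ⧸ H) →* ℤ_[p]ˣ) (s : ℤ_[p]) : L :=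
  algebraMap ℚ_[p] L (((charGammaPow e χ s : ℤ_[p]ˣ) : ℤ_[p]) : ℚ_[p]) - 1

theorem norm_charPt_lt_one {χ : (G ⧸ H) →* ℤ_[p]ˣ} (hχ : Continuous χ) (s : ℤ_[p]) :
    ‖charPt e L χ s‖ < 1 := by
  have h := norm_char_sub_one_lt_one _ (continuous_charHom (e := e) hχ s) (Multiplicative.ofAdd 1)
  rw [charPt, ← map_one (algebraMap ℚ_[p] L), ← map_sub, norm_algebraMap']
  rw [charHom_ofAdd_one, PadicInt.norm_def] at h
  exact_mod_cast h

/-- At X = χ(γ)^s − 1 the series (1 + X)^θ(g) takes the value χ(γ)^(sθ(g)), the factor by which ρχ^s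
differs from ρ at g. -/
theorem IsGammaHom.lamEval_twist [CompleteSpace L] (h : IsGammaHom e ρ Φ)
    {χ : (G ⧸ H) →* ℤ_[p]ˣ} (hχ : Continuous χ) (s : ℤ_[p]) (x : Lam p G) :
    lamEval p (twist e ρ χ s) x =
      (Φ x).map (evalInt (charPt e L χ s) (norm_charPt_lt_one hχ s)) := by
  refine h.lamEval_eq_map _ (continuous_evalInt _ _) (evalInt_smul _ _) ?_ x
  intro g
  ext1 i j
  rw [rhoGamma, twist, Matrix.map_apply, Matrix.smul_apply, smul_eq_mul, map_mul, Matrix.smul_apply,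
    Matrix.map_apply, Algebra.smul_def]
  congr 1
  · refine Subtype.ext ?_
    rw [coe_evalInt, coe_algebraMap_intRing]
    refine (evalSeries_binomialSeries (charHom e χ s) (continuous_charHom hχ s)
      (norm_charPt_lt_one hχ s) ?_ (thetaHom e g)).trans rfl
    rw [charHom_ofAdd_one, charPt, add_sub_cancel]
  · exact Subtype.ext (evalSeries_C _ _)

/-- The representation `ρ χ^s` as a homomorphism. -/
def twistHom (e : (G ⧸ H) ≃ₜ* Multiplicative ℤ_[p]) (ρ : G →* Matrix (Fin n) (Fin n) (IntRing L))
    (χ : (G ⧸ H) →* ℤ_[p]ˣ) (s : ℤ_[p]) : G →* Matrix (Fin n) (Fin n) (IntRing L) where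
  toFun := twist e ρ χ s
  map_one' := by
    rw [twist, charPow_eq, thetaHom_one, mul_zero, map_one]
    simp [charGammaPow]
  map_mul' g h := by
    have : charPow e χ s (g * h) = charPow e χ s g * charPow e χ s h := by
      rw [charPow_eq, charPow_eq, charPow_eq, thetaHom_mul, mul_add, charGammaPow, ofAdd_add,
        map_mul, map_mul]
      rfl
    rw [twist, twist, twist, this, Units.val_mul, map_mul, smul_mul_smul_comm]

theorem continuous_twist {χ : (G ⧸ H) →* ℤ_[p]ˣ} (hχ : Continuous χ) (hρ : Continuous ρ)
    (s : ℤ_[p]) : Continuous (twist e ρ χ s) := by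
  have h : Continuous fun g => ((charPow e χ s g : ℤ_[p]ˣ) : ℤ_[p]) :=
    Units.continuous_val.comp (hχ.comp (e.symm.continuous.comp (continuous_ofAdd.comp
      (continuous_const.mul (continuous_thetaHom e)))))
  refine continuous_matrix fun i j => ?_
  simp only [twist, Matrix.smul_apply, Algebra.smul_def]
  exact ((continuous_algebraMap_intRing p).comp h).mul (hρ.matrix_elem i j)

end GammaHom

/-! ### The canonical Ore set becomes invertible over `Q_O(Γ)` -/

section OreSet

open PowerSeries Filter

variable {p : ℕ} [Fact p.Prime] {G : Type*} [Group G] [TopologicalSpace G]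

variable (p) in
/-- The element of `Λ(G)` given by an element of `G`. -/
def lamOf (g : G) : Lam p G :=
  ⟨fun U => MonoidAlgebra.single (QuotientGroup.mk g) 1, by
    simp only [iwasawaAlgebra, Subring.mem_iInf]
    intro U V h
    change transition p G h (MonoidAlgebra.single _ _) = MonoidAlgebra.single _ _
    simp only [transition, MonoidAlgebra.mapDomainRingHom_apply, MonoidAlgebra.mapDomain_single]
    rfl⟩

theorem lamProj_lamOf (g : G) (U : OpenNormalSubgroup G) :
    lamProj p U (lamOf p g) = MonoidAlgebra.single (QuotientGroup.mk g) 1 := rfl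

theorem discreteEval_lamOf {B C : Type*} [Ring B] [Algebra ℤ_[p] B] [Ring C] (π : B →+* C)
    (σ : G →* B) (U : OpenNormalSubgroup G) (hU : ∀ g ∈ U.toSubgroup, π (σ g) = 1) (g : G) :
    discreteEval π σ U hU (lamOf p g) = π (σ g) := by
  rw [discreteEval, RingHom.comp_apply, lamProj_lamOf]
  refine (MonoidAlgebra.liftNC_single (π.comp (algebraMap ℤ_[p] B)).toAddMonoidHom
      (QuotientGroup.lift U.toSubgroup (π.toMonoidHom.comp σ) hU) (QuotientGroup.mk g) 1).trans ?_
  change π (algebraMap ℤ_[p] B 1) * π (σ g) = _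
  rw [map_one, map_one, one_mul]

variable {H : Subgroup G} [H.Normal] {e : (G ⧸ H) ≃ₜ* Multiplicative ℤ_[p]}
  {L : Type*} [NormedField L] [IsUltrametricDist L] [NormedAlgebra ℚ_[p] L]
  {n : ℕ} {ρ : G →* Matrix (Fin n) (Fin n) (IntRing L)}
  {Φ : Lam p G →+* Matrix (Fin n) (Fin n) (IntRing L)⟦X⟧}

/-- Modulo each open ideal, Φ factors through a group ring ℤ_p[G/U], where statements can be checked
on group elements. -/
theorem IsGammaHom.exists_discreteEval (h : IsGammaHom e ρ Φ) (hρ : Continuous ρ) (k : ℕ) :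
    ∃ (U : OpenNormalSubgroup G)
      (hU : ∀ g ∈ U.toSubgroup,
        (Ideal.Quotient.mk (truncIdeal p L k)).mapMatrix (rhoGammaHom e ρ g) = 1),
      ∀ x, (Ideal.Quotient.mk (truncIdeal p L k)).mapMatrix (Φ x) =
        discreteEval (Ideal.Quotient.mk (truncIdeal p L k)).mapMatrix (rhoGammaHom e ρ) U hU x := by
  haveI := WithPiTopology.instIsTopologicalRing (IntRing L)
  have hopen : ∀ y, IsOpen {b : Matrix (Fin n) (Fin n) (IntRing L)⟦X⟧ |
      (Ideal.Quotient.mk (truncIdeal p L k)).mapMatrix b = y} := fun y => by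
    rw [setOf_mapMatrix_eq]
    exact isOpen_iInter_of_finite fun a => isOpen_iInter_of_finite fun b =>
      (isOpen_setOf_mk_eq (isOpen_truncIdeal p k) _).preimage (continuous_id.matrix_elem a b)
  obtain ⟨U, hU⟩ := exists_openNormalSubgroup_le_ker
    (Ideal.Quotient.mk (truncIdeal p L k)).mapMatrix (hopen 1) (rhoGammaHom e ρ)
    (continuous_rhoGamma e hρ)
  refine ⟨U, hU, fun x => ?_⟩
  obtain ⟨V, hV1, hV2⟩ := (((h x).eventually ((hopen _).mem_nhds rfl)).and
    (Iic_mem_atBot U)).exists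
  rw [← map_riemannSum_eq_discreteEval _ _ hU hV2 x]
  exact hV1.symm

theorem eq_of_forall_mapMatrix_truncIdeal {M N : Matrix (Fin n) (Fin n) (IntRing L)⟦X⟧}
    (h : ∀ k, (Ideal.Quotient.mk (truncIdeal p L k)).mapMatrix M =
      (Ideal.Quotient.mk (truncIdeal p L k)).mapMatrix N) : M = N := by
  ext1 a b
  refine sub_eq_zero.1 (eq_zero_of_forall_mem_truncIdeal p _ fun k => ?_)
  exact (Ideal.Quotient.mk_eq_mk_iff_sub_mem _ _).1 (congrFun (congrFun (h k) a) b)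

theorem IsGammaHom.apply_lamOf (h : IsGammaHom e ρ Φ) (hρ : Continuous ρ) (g : G) :
    Φ (lamOf p g) = rhoGamma e ρ g := by
  refine eq_of_forall_mapMatrix_truncIdeal (p := p) fun k => ?_
  obtain ⟨U, hU, hx⟩ := h.exists_discreteEval hρ k
  rw [hx, discreteEval_lamOf]
  rfl

/-- θ vanishes on H, so elements of H act by matrices without X. -/
theorem IsGammaHom.exists_eq_map_C (h : IsGammaHom e ρ Φ) (hρ : Continuous ρ) {x : Lam p G}
    (hx : x ∈ lamSub p H) : ∃ M : Matrix (Fin n) (Fin n) (IntRing L), Φ x = M.map C := by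
  have key : ∀ k, ∃ M : Matrix (Fin n) (Fin n) (IntRing L),
      (Ideal.Quotient.mk (truncIdeal p L k)).mapMatrix (Φ x) =
        (Ideal.Quotient.mk (truncIdeal p L k)).mapMatrix (M.map C) := fun k => by
    obtain ⟨U, hU, hΦ⟩ := h.exists_discreteEval hρ k
    rw [lamSub, Subring.mem_iInf] at hx
    obtain ⟨y, hy⟩ := hx U
    rw [hΦ, discreteEval, RingHom.comp_apply, ← hy]
    clear hy
    induction y using MonoidAlgebra.induction_linear with
    | zero => exact ⟨0, by simp [Matrix.map_zero]⟩
    | add f g hf hg =>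
      obtain ⟨M, hM⟩ := hf
      obtain ⟨N, hN⟩ := hg
      refine ⟨M + N, ?_⟩
      rw [map_add, map_add, hM, hN, ← map_add]
      congr 1
      ext1 i j
      simp
    | single g z =>
      refine ⟨z • ρ g, ?_⟩
      have h2 : MonoidAlgebra.mapDomainRingHom ℤ_[p]
          ((QuotientGroup.mk' U.toSubgroup).comp H.subtype) (MonoidAlgebra.single g z) =
          MonoidAlgebra.single (QuotientGroup.mk (g : G)) z := by
        simp [MonoidAlgebra.mapDomain_single]
      rw [h2]
      refine (MonoidAlgebra.liftNC_single (((Ideal.Quotient.mk (truncIdeal p L k)).mapMatrix).comp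
        (algebraMap ℤ_[p] (Matrix (Fin n) (Fin n) (IntRing L)⟦X⟧))).toAddMonoidHom
        (QuotientGroup.lift U.toSubgroup
          ((Ideal.Quotient.mk (truncIdeal p L k)).mapMatrix.toMonoidHom.comp (rhoGammaHom e ρ)) hU)
        (QuotientGroup.mk (g : G)) z).trans ?_
      change (Ideal.Quotient.mk (truncIdeal p L k)).mapMatrix (algebraMap ℤ_[p] _ z) *
        (Ideal.Quotient.mk (truncIdeal p L k)).mapMatrix (rhoGamma e ρ g) = _
      rw [← map_mul, ← Algebra.smul_def]
      congr 1
      ext i j k : 3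
      rw [rhoGamma, thetaHom_eq_zero e g.2, binomialSeries_zero, one_smul, Matrix.smul_apply,
        powerSeries_smul_eq, Matrix.map_apply, Matrix.map_apply, Matrix.smul_apply, coeff_C, coeff_C]
      split_ifs
      · rfl
      · rw [smul_zero]
  -- The constant matrices found so far depend on the level. They still show that each coefficient
  -- of positive degree lies in all ideals (p^l) with l large, hence vanishes.
  refine ⟨(Φ x).map (constantCoeff (R := IntRing L)), ?_⟩
  ext i j k : 2
  rw [Matrix.map_apply, Matrix.map_apply, coeff_C]
  split_ifs with hk
  · rw [hk, coeff_zero_eq_constantCoeff_apply]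
  · refine eq_zero_of_forall_mem_span_pow (L := L) p _ ?_
    filter_upwards [eventually_gt_atTop k] with l hl
    obtain ⟨M, hM⟩ := key l
    have h1 : Φ x i j - M.map C i j ∈ truncIdeal p L l :=
      (Ideal.Quotient.mk_eq_mk_iff_sub_mem _ _).1 (congrFun (congrFun hM i) j)
    have h2 := h1 k hl
    rwa [map_sub, Matrix.map_apply, coeff_C, if_neg hk, sub_zero] at h2

theorem exists_of_mem_finiteOverSet {R : Type*} [Ring R] {T : Subring R} {x : R}
    (h : x ∈ finiteOverSet T) : ∃ (k : ℕ) (m : Fin k → R), ∀ r, ∃ (t : Fin k → T) (r' : R),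
      r = ∑ i, (t i : R) * m i + r' * x := by
  have hfin : Module.Finite T (R ⧸ Submodule.span R {x}) := h
  obtain ⟨k, v, hv⟩ := Module.Finite.exists_fin (R := T) (M := R ⧸ Submodule.span R {x})
  choose m hm using fun i => Submodule.Quotient.mk_surjective _ (v i)
  refine ⟨k, m, fun r => ?_⟩
  have hr : Submodule.Quotient.mk r ∈ Submodule.span T (Set.range v) := by
    rw [hv]; trivial
  obtain ⟨t, ht⟩ := (Submodule.mem_span_range_iff_exists_fun _).1 hr
  have h1 : (Submodule.Quotient.mk (r - ∑ i, (t i : R) * m i) :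
      R ⧸ Submodule.span R {x}) = 0 := by
    rw [Submodule.Quotient.mk_sub, ← ht, sub_eq_zero, ← Submodule.mkQ_apply, map_sum]
    refine Finset.sum_congr rfl fun i _ => ?_
    rw [← hm i]
    rfl
  obtain ⟨r', hr'⟩ := Submodule.mem_span_singleton.1 ((Submodule.Quotient.mk_eq_zero _).1 h1)
  exact ⟨t, r', by rw [← smul_eq_mul r' x, hr']; abel⟩

/-- This is the characteristic polynomial of `P`, which is monic. -/
theorem det_X_smul_sub_map_C_ne_zero {W κ : Type*} [CommRing W] [Nontrivial W] [Fintype κ]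
    [DecidableEq κ] (P : Matrix κ κ W) : ((X : W⟦X⟧) • (1 : Matrix κ κ W⟦X⟧) - P.map C).det ≠ 0 := by
  have h : (X : W⟦X⟧) • (1 : Matrix κ κ W⟦X⟧) - P.map C =
      (Polynomial.coeToPowerSeries.ringHom (R := W)).mapMatrix P.charmatrix := by
    ext1 i j
    by_cases hij : i = j
    · subst hij; simp [Matrix.charmatrix_apply_eq]
    · simp [Matrix.charmatrix_apply_ne _ _ _ hij, hij]
  rw [h, ← RingHom.map_det, Ne, Polynomial.coeToPowerSeries.ringHom_apply,
    Polynomial.coe_eq_zero_iff]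
  exact P.charpoly_monic.ne_zero

/-- A determinant trick. Generators of Λ(G)/Λ(G)s over Λ(H) give, through Φ, finitely many rows
(collected in E) that generate all rows over 𝒪 modulo multiples of Φ(s). Multiplication by X on them
is a matrix over 𝒪, so its characteristic polynomial, evaluated at X, multiplies every row into the
multiples of Φ(s). This polynomial is a nonzero power series. -/
theorem IsGammaHom.det_ne_zero (h : IsGammaHom e ρ Φ) (hρ : Continuous ρ) {s : Lam p G}
    (hs : s ∈ oreSet p H) : (Φ s).det ≠ 0 := by
  obtain ⟨k, m, hm⟩ := exists_of_mem_finiteOverSet hs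
  let E : Matrix (Fin k × Fin n) (Fin n) (IntRing L)⟦X⟧ := fun a j => Φ (m a.1) a.2 j
  have hR : ∀ r, ∃ (c : Matrix (Fin n) (Fin k × Fin n) (IntRing L))
      (D : Matrix (Fin n) (Fin n) (IntRing L)⟦X⟧), Φ r = c.map C * E + D * Φ s := fun r => by
    obtain ⟨t, r', hr'⟩ := hm r
    choose M hM using fun i => h.exists_eq_map_C hρ (t i).2
    refine ⟨fun a b => M b.1 a b.2, Φ r', ?_⟩
    rw [hr', map_add, map_sum, map_mul Φ r' s]
    have h2 : ∑ i, Φ (↑(t i) * m i) =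
        (Matrix.of fun a (b : Fin k × Fin n) => M b.1 a b.2).map C * E := by
      ext1 a j
      rw [Matrix.sum_apply, Matrix.mul_apply, Fintype.sum_prod_type]
      refine Finset.sum_congr rfl fun i _ => ?_
      rw [map_mul, hM, Matrix.mul_apply]
      rfl
    rw [h2]
    rfl
  obtain ⟨g, hg⟩ : ∃ g : G, thetaHom e g = 1 := by
    obtain ⟨g, hg⟩ := QuotientGroup.mk_surjective (e.symm (Multiplicative.ofAdd 1))
    exact ⟨g, by rw [thetaHom, hg, ContinuousMulEquiv.apply_symm_apply, toAdd_ofAdd]⟩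
  -- For g above γ, multiplication by 1 + X is Φ(r) ↦ ρ(g)⁻¹Φ(gr), so it preserves the rows
  -- generated over 𝒪 modulo Φ(s).
  have hX : ∀ r, ∃ (c : Matrix (Fin n) (Fin k × Fin n) (IntRing L))
      (D : Matrix (Fin n) (Fin n) (IntRing L)⟦X⟧),
      (1 + X : (IntRing L)⟦X⟧) • Φ r = c.map C * E + D * Φ s := fun r => by
    obtain ⟨c, D, hcD⟩ := hR (lamOf p g * r)
    refine ⟨ρ g⁻¹ * c, (ρ g⁻¹).map C * D, ?_⟩
    have h1 : (1 + X : (IntRing L)⟦X⟧) • Φ r = (ρ g⁻¹).map C * Φ (lamOf p g * r) := by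
      have h2 : binomialSeries (IntRing L) (1 : ℤ_[p]) = 1 + X := by
        have := binomialSeries_nat (R := ℤ_[p]) (A := IntRing L) 1
        rwa [Nat.cast_one, pow_one] at this
      rw [map_mul, h.apply_lamOf hρ, rhoGamma, hg, h2, Matrix.smul_mul, Matrix.mul_smul,
        ← mul_assoc, ← Matrix.map_mul, ← map_mul, inv_mul_cancel, map_one,
        Matrix.map_one _ (map_zero _) (map_one _), one_mul]
    rw [h1, hcD, Matrix.mul_add, Matrix.map_mul]
    simp only [Matrix.mul_assoc]
  choose c D hcD using fun i => hX (m i)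
  let P : Matrix (Fin k × Fin n) (Fin k × Fin n) (IntRing L) := fun a b => c a.1 a.2 b
  let D' : Matrix (Fin k × Fin n) (Fin n) (IntRing L)⟦X⟧ := fun a j => D a.1 a.2 j
  have hXE : (1 + X : (IntRing L)⟦X⟧) • E = P.map C * E + D' * Φ s := by
    ext1 a j
    exact congrFun (congrFun (hcD a.1) a.2) j
  set F := ((X : (IntRing L)⟦X⟧) • (1 : Matrix (Fin k × Fin n) (Fin k × Fin n) _) -
    (P - 1).map C) with hF
  have hFE : F * E = D' * Φ s := by
    have h1 : (P - 1).map C = P.map C - (1 : Matrix _ _ (IntRing L)⟦X⟧) := by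
      ext1 i j
      rw [Matrix.map_apply, Matrix.sub_apply, Matrix.sub_apply, map_sub, Matrix.map_apply,
        Matrix.one_apply, Matrix.one_apply, apply_ite C, map_one, map_zero]
    have h2 : F * E = (1 + X : (IntRing L)⟦X⟧) • E - P.map C * E := by
      rw [hF, h1, Matrix.sub_mul, Matrix.sub_mul, Matrix.smul_mul, add_smul, Matrix.one_mul, one_smul]
      abel
    rw [h2, hXE, add_sub_cancel_left]
  obtain ⟨c₁, D₁, h1⟩ := hR 1
  rw [map_one] at h1
  -- The adjugate of F turns F·E = D'·Φ(s) into det F · E; the expression of 1 through E then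
  -- exhibits det F · 1 as a left multiple of Φ(s).
  have h2 : F.det • (1 : Matrix (Fin n) (Fin n) (IntRing L)⟦X⟧) =
      (c₁.map C * F.adjugate * D' + F.det • D₁) * Φ s := by
    have h3 : F.adjugate * (F * E) = F.det • E := by
      rw [← Matrix.mul_assoc, Matrix.adjugate_mul, Matrix.smul_mul, Matrix.one_mul]
    nth_rw 1 [h1]
    rw [smul_add, ← Matrix.mul_smul, ← h3, hFE, add_mul, Matrix.smul_mul]
    simp only [Matrix.mul_assoc]
  have h3 := congrArg Matrix.det h2
  rw [Matrix.det_smul, Matrix.det_one, mul_one, Matrix.det_mul] at h3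
  intro h0
  rw [h0, mul_zero] at h3
  exact det_X_smul_sub_map_C_ne_zero (P - 1) (eq_zero_of_pow_eq_zero h3)

theorem exists_loc_lift {R B : Type*} [Ring R] [Ring B] {S : Set R} (f : R →+* B)
    (hf : ∀ s ∈ S, IsUnit (f s)) : ∃ Ψ : Loc S →+* B, ∀ x, Ψ (toLoc S x) = f x := by
  choose u hu using fun s : S => hf s s.2
  let F : FreeAlgebra ℤ (R ⊕ S) →ₐ[ℤ] B :=
    FreeAlgebra.lift ℤ (Sum.elim f fun s => ((u s)⁻¹ : Bˣ))
  have hl : ∀ a, F (FreeAlgebra.ι ℤ (Sum.inl a)) = f a := fun a => by simp [F]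
  have hr : ∀ s, F (FreeAlgebra.ι ℤ (Sum.inr s)) = ((u s)⁻¹ : Bˣ) := fun s => by simp [F]
  refine ⟨RingQuot.lift ⟨F.toRingHom, fun x y hxy => ?_⟩, fun x => ?_⟩
  · change F x = F y
    cases hxy with
    | add a b => rw [map_add, hl, hl, hl, map_add]
    | mul a b => rw [map_mul, hl, hl, hl, map_mul]
    | one => rw [hl, map_one, map_one]
    | inv_mul s => rw [map_mul, hl, hr, map_one, ← hu, Units.inv_mul]
    | mul_inv s => rw [map_mul, hl, hr, map_one, ← hu, Units.mul_inv]
  · refine (RingQuot.lift_mkRingHom_apply _ _ _).trans ?_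
    exact hl x

/-- The homomorphism `Λ(G)_{S^*} → M_n(Q_O(Γ))`. -/
theorem IsGammaHom.exists_locHom (h : IsGammaHom e ρ Φ) (hρ : Continuous ρ) :
    ∃ Ψ : Loc (oreSetStar p H) →+* Matrix (Fin n) (Fin n) (QField L),
      ∀ x, Ψ (toLoc (oreSetStar p H) x) =
        (Φ x).map (algebraMap (PowerSeries (IntRing L)) (QField L)) := by
  refine exists_loc_lift ((algebraMap (PowerSeries (IntRing L)) (QField L)).mapMatrix.comp Φ) ?_
  rintro _ ⟨i, y, hy, rfl⟩
  rw [map_mul, map_pow, map_natCast]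
  have hp : (p : QField L) ≠ 0 := by
    rw [← map_natCast (algebraMap (PowerSeries (IntRing L)) (QField L)), Ne,
      FaithfulSMul.algebraMap_eq_zero_iff, ← map_natCast (C (R := IntRing L)),
      map_eq_zero_iff _ C_injective]
    exact fun h0 => prime_ne_zero p L (by simpa using congrArg Subtype.val h0)
  refine IsUnit.mul (IsUnit.pow _ ?_) ?_
  · rw [← map_natCast (algebraMap (QField L) (Matrix (Fin n) (Fin n) (QField L)))]
    exact (isUnit_iff_ne_zero.2 hp).map _
  · rw [Matrix.isUnit_iff_isUnit_det, RingHom.comp_apply, ← RingHom.map_det, isUnit_iff_ne_zero, Ne,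
      FaithfulSMul.algebraMap_eq_zero_iff]
    exact h.det_ne_zero hρ hy

end OreSet

/-! ### Determinants of classes in `K_1` -/

section DetHom

variable {R : Type*} [Ring R] {Q : Type*} [Field Q] {n : ℕ}

theorem det_vecMulLinear {Q : Type*} [CommRing Q] {κ : Type*} [Fintype κ] [DecidableEq κ]
    (M : Matrix κ κ Q) : LinearMap.det (Matrix.vecMulLinear M) = M.det := by
  have h : Matrix.vecMulLinear M = Matrix.toLin' M.transpose := by
    refine LinearMap.ext fun v => ?_
    rw [Matrix.toLin'_apply, Matrix.mulVec_transpose]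
    rfl
  rw [h, LinearMap.det_toLin', Matrix.det_transpose]

theorem det_one_add_comp_comm {V W : Type*} [AddCommGroup V] [Module Q V] [AddCommGroup W]
    [Module Q W] [Module.Finite Q V] [Module.Finite Q W] (f : V →ₗ[Q] W) (g : W →ₗ[Q] V) :
    LinearMap.det (LinearMap.id + f ∘ₗ g) = LinearMap.det (LinearMap.id + g ∘ₗ f) := by
  classical
  let b := Module.finBasis Q V
  let c := Module.finBasis Q W
  rw [← LinearMap.det_toMatrix c, ← LinearMap.det_toMatrix b, map_add, map_add,
    LinearMap.toMatrix_id, LinearMap.toMatrix_id, LinearMap.toMatrix_comp c b c,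
    LinearMap.toMatrix_comp b c b, Matrix.det_one_add_mul_comm]

theorem detHom_of (Ψ : R →+* Matrix (Fin n) (Fin n) Q) {m : ℕ} (g : (Matrix (Fin m) (Fin m) R)ˣ) :
    (((KOne.detHom Ψ (KOne.of g)).toMul : Qˣ) : Q) =
      (Matrix.compRingEquiv (Fin m) (Fin n) Q (Ψ.mapMatrix g.1)).det := by
  have : KOne.detHom Ψ (KOne.of g) = Additive.ofMul
      (Units.map (Matrix.detMonoidHom.comp
        ((Matrix.compRingEquiv (Fin m) (Fin n) Q).toRingHom.comp Ψ.mapMatrix).toMonoidHom) g) := by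
    rw [KOne.of, KOne.detHom]
    exact FreeAbelianGroup.lift_apply_of _ _
  rw [this]
  rfl

/-- `Q^n ⊗_R R^m` as the space of row vectors of length `m n`. -/
def rowEquiv (Ψ : R →+* Matrix (Fin n) (Fin n) Q) (m : ℕ) :
    BalTensor (rowAct Ψ) (Fin m → R) ≃ₗ[Q] (Fin m × Fin n → Q) :=
  (BalTensor.piEquiv (isRightAction_rowAct Ψ) (Fin m)).trans
    (LinearEquiv.curry Q Q (Fin m) (Fin n)).symm

theorem rowEquiv_tmul (Ψ : R →+* Matrix (Fin n) (Fin n) Q) {m : ℕ} (y : Fin n → Q)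
    (x : Fin m → R) (i : Fin m) (k : Fin n) :
    rowEquiv Ψ m (BalTensor.tmul _ y x) (i, k) = Matrix.vecMul y (Ψ (x i)) k :=
  congrFun (BalTensor.piEquiv_tmul (isRightAction_rowAct Ψ) y x i) k

/-- Row vectors match the left-module structure: applying Ψ entrywise to the matrix of `f` gives a
block matrix that acts on concatenated rows from the right. -/
theorem rowEquiv_map (Ψ : R →+* Matrix (Fin n) (Fin n) Q) {m : ℕ}
    (f : (Fin m → R) →ₗ[R] (Fin m → R)) (t : BalTensor (rowAct Ψ) (Fin m → R)) :
    rowEquiv Ψ m (BalTensor.map _ f t) = Matrix.vecMul (rowEquiv Ψ m t)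
      (Matrix.compRingEquiv (Fin m) (Fin n) Q (Ψ.mapMatrix (LinearMap.toMatrixRight' f))) := by
  induction t using BalTensor.induction_on with
  | zero => simp
  | tmul y x =>
    rw [BalTensor.map_tmul]
    ext1 ⟨j, l⟩
    have hf : f x j = ∑ i, x i * LinearMap.toMatrixRight' f i j := by
      have h := LinearEquiv.symm_apply_apply (LinearMap.toMatrixRight' (R := R)) f
      conv_lhs => rw [← h]
      exact congrFun (Matrix.toLinearMapRight'_apply (LinearMap.toMatrixRight' f) x) j
    rw [rowEquiv_tmul, hf, map_sum]
    change _ = ∑ ik : Fin m × Fin n, _ * _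
    rw [Fintype.sum_prod_type, Matrix.vecMul_sum, Finset.sum_apply]
    refine Finset.sum_congr rfl fun i _ => ?_
    rw [map_mul, ← Matrix.vecMul_vecMul]
    change ∑ k : Fin n, _ * _ = _
    refine Finset.sum_congr rfl fun k _ => ?_
    rw [rowEquiv_tmul]
    rfl
  | add t t' h h' => simp only [map_add, h, h', Matrix.add_vecMul]

theorem det_comp_toMatrixRight (Ψ : R →+* Matrix (Fin n) (Fin n) Q) {m : ℕ}
    (f : (Fin m → R) →ₗ[R] (Fin m → R)) :
    (Matrix.compRingEquiv (Fin m) (Fin n) Q (Ψ.mapMatrix (LinearMap.toMatrixRight' f))).det =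
      LinearMap.det (BalTensor.map (rowAct Ψ) f) := by
  rw [← det_vecMulLinear, ← LinearMap.det_conj (BalTensor.map (rowAct Ψ) f) (rowEquiv Ψ m)]
  congr 1
  refine LinearMap.ext fun v => ?_
  simp only [LinearMap.comp_apply, LinearEquiv.coe_coe]
  rw [rowEquiv_map, LinearEquiv.apply_symm_apply]
  rfl

/-- The representing matrix is that of 1 + i(f − 1)q. After base change Sylvester's identity and qi
= 1 remove the presentation, so the arbitrary choice in `KOne.ofEnd` does not affect the
determinant. -/
theorem detHom_of_represents (Ψ : R →+* Matrix (Fin n) (Fin n) Q) {V : Type*} [AddCommGroup V]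
    [Module R V] [Module.Finite R V] [Module.Projective R V] {f : V →ₗ[R] V}
    {g : Σ m : ℕ, (Matrix (Fin m) (Fin m) R)ˣ} (h : Represents f g) :
    (((KOne.detHom Ψ (KOne.of g.2)).toMul : Qˣ) : Q) =
      LinearMap.det (BalTensor.map (rowAct Ψ) f) := by
  obtain ⟨i, q, hqi, hg⟩ := h
  have := (BalTensor.finite_projective (P := V) (isRightAction_rowAct Ψ)).1
  have := (BalTensor.finite_projective (P := Fin g.1 → R) (isRightAction_rowAct Ψ)).1
  have hqi' : BalTensor.map (rowAct Ψ) q ∘ₗ BalTensor.map (rowAct Ψ) i = LinearMap.id := by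
    rw [← BalTensor.map_comp, hqi, BalTensor.map_id]
  have h1 : i ∘ₗ f ∘ₗ q + (LinearMap.id - i ∘ₗ q) = LinearMap.id + i ∘ₗ ((f - LinearMap.id) ∘ₗ q) := by
    refine LinearMap.ext fun x => ?_
    simp
    abel
  have h2 : f = LinearMap.id + (f - LinearMap.id) := by abel
  rw [detHom_of, ← hg, det_comp_toMatrixRight, h1, BalTensor.map_add, BalTensor.map_id,
    BalTensor.map_comp, BalTensor.map_comp, det_one_add_comp_comm, LinearMap.comp_assoc, hqi',
    LinearMap.comp_id]
  conv_rhs => rw [h2, BalTensor.map_add, BalTensor.map_id]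

theorem exists_represents {V : Type*} [AddCommGroup V] [Module R V] [Module.Finite R V]
    [Module.Projective R V] {f f' : V →ₗ[R] V} (h : f ∘ₗ f' = LinearMap.id)
    (h' : f' ∘ₗ f = LinearMap.id) : ∃ g, Represents f g := by
  obtain ⟨m, q, hq⟩ := Module.Finite.exists_fin' R V
  obtain ⟨i, hi⟩ := Module.projective_lifting_property q LinearMap.id hq
  -- Matrices acting on the right multiply in the opposite order to the maps, which is why f' comes
  -- first.
  have key : ∀ f f' : V →ₗ[R] V, f ∘ₗ f' = LinearMap.id →
      LinearMap.toMatrixRight' (i ∘ₗ f' ∘ₗ q + (LinearMap.id - i ∘ₗ q)) *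
      LinearMap.toMatrixRight' (i ∘ₗ f ∘ₗ q + (LinearMap.id - i ∘ₗ q)) = 1 := fun f f' h => by
    apply (LinearMap.toMatrixRight' (R := R)).symm.injective
    have h1 := Matrix.toLinearMapRight'_mul
      (LinearMap.toMatrixRight' (i ∘ₗ f' ∘ₗ q + (LinearMap.id - i ∘ₗ q)))
      (LinearMap.toMatrixRight' (i ∘ₗ f ∘ₗ q + (LinearMap.id - i ∘ₗ q)))
    refine h1.trans ?_
    have h2 : ∀ u : (Fin m → R) →ₗ[R] (Fin m → R),
        Matrix.toLinearMapRight' (LinearMap.toMatrixRight' u) = u := fun u =>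
      LinearEquiv.symm_apply_apply (LinearMap.toMatrixRight' (R := R)) u
    rw [h2, h2]
    refine Eq.trans ?_ Matrix.toLinearMapRight'_one.symm
    refine LinearMap.ext fun x => ?_
    have hq' : ∀ v, q (i v) = v := fun v => LinearMap.congr_fun hi v
    have hf : ∀ v, f (f' v) = v := fun v => LinearMap.congr_fun h v
    simp [hq', hf]
  exact ⟨⟨m, ⟨_, _, key _ _ h', key _ _ h⟩⟩, i, q, hi, rfl⟩

theorem detHom_ofEnd (Ψ : R →+* Matrix (Fin n) (Fin n) Q) {V : Type*} [AddCommGroup V]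
    [Module R V] [Module.Finite R V] [Module.Projective R V] {f f' : V →ₗ[R] V}
    (h : f ∘ₗ f' = LinearMap.id) (h' : f' ∘ₗ f = LinearMap.id) :
    (((KOne.detHom Ψ (KOne.ofEnd f)).toMul : Qˣ) : Q) =
      LinearMap.det (BalTensor.map (rowAct Ψ) f) := by
  have hex := exists_represents h h'
  rw [KOne.ofEnd, dif_pos hex]
  exact detHom_of_represents Ψ hex.choose_spec

theorem Contraction.comp_add {Vo Ve : Type*} [AddCommGroup Vo] [Module R Vo] [AddCommGroup Ve]
    [Module R Ve] {δo : Vo →ₗ[R] Ve} {δe : Ve →ₗ[R] Vo} (c : Contraction δo δe)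
    (hoe : δe ∘ₗ δo = 0) (heo : δo ∘ₗ δe = 0) :
    (δe + c.se) ∘ₗ (δo + c.so) = LinearMap.id ∧ (δo + c.so) ∘ₗ (δe + c.se) = LinearMap.id := by
  constructor
  · rw [LinearMap.add_comp, LinearMap.comp_add, LinearMap.comp_add, hoe, c.sq_odd, zero_add,
      add_zero, c.odd]
  · rw [LinearMap.add_comp, LinearMap.comp_add, LinearMap.comp_add, heo, c.sq_even, zero_add,
      add_zero, c.even]

theorem map_eq_assocEquiv_conj {R' : Type*} [Ring R'] (j : R →+* R')
    (Ψ : R' →+* Matrix (Fin n) (Fin n) Q) {P P' : Type*} [AddCommGroup P] [Module R P]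
    [AddCommGroup P'] [Module R P'] (f : P →ₗ[R] P') :
    BalTensor.map (rowAct (Ψ.comp j)) f = (assocEquiv j Ψ P').toLinearMap ∘ₗ
      BalTensor.map (rowAct Ψ) (BalTensor.map (ringAct j) f) ∘ₗ
        (assocEquiv j Ψ P).symm.toLinearMap := by
  refine LinearMap.ext fun x => ?_
  rw [LinearMap.comp_apply, LinearMap.comp_apply, LinearEquiv.coe_coe, LinearEquiv.coe_coe,
    assocEquiv_map, LinearEquiv.apply_symm_apply]

/-- The contraction is the one chosen in the definition of `theta`. Nothing about it is retained,
since any contraction leads to the same determinant. The inverse of the automorphism is a⁻¹(δo +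
so). -/
theorem detHom_theta {R' : Type*} [Ring R'] {A : CochainComplex (ModuleCat R) ℤ}
    (j : R →+* R') (Ψ : R' →+* Matrix (Fin n) (Fin n) Q) (hA : IsPerfect A)
    (hAS : IsAcyclicAfter A (ringAct j)) (a : Trivialization A) :
    ∃ c : Contraction (BalTensor.map (ringAct j) (dOdd A a.k))
      (BalTensor.map (ringAct j) (dEven A a.k)),
      (((KOne.detHom Ψ (theta j a)).toMul : Qˣ) : Q) = LinearMap.det (BalTensor.map (rowAct Ψ)
        ((BalTensor.map (ringAct j) (dEven A a.k) + c.se) ∘ₗ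
          BalTensor.map (ringAct j) a.iso.toLinearMap)) := by
  have hne := nonempty_contraction (k := a.k) (isRightAction_ringAct j) hA hAS
  have := finite_oddPart (k := a.k) hA
  have := projective_oddPart (k := a.k) hA
  have hfp := BalTensor.finite_projective (P := OddPart A a.k) (isRightAction_ringAct j)
  have := hfp.1
  have := hfp.2
  refine ⟨hne.some, ?_⟩
  have hoe : BalTensor.map (ringAct j) (dEven A a.k) ∘ₗ
      BalTensor.map (ringAct j) (dOdd A a.k) = 0 := by
    rw [← BalTensor.map_comp, dEven_comp_dOdd, BalTensor.map_zero]
  have heo : BalTensor.map (ringAct j) (dOdd A a.k) ∘ₗ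
      BalTensor.map (ringAct j) (dEven A a.k) = 0 := by
    rw [← BalTensor.map_comp, dOdd_comp_dEven, BalTensor.map_zero]
  obtain ⟨h1, h2⟩ := hne.some.comp_add hoe heo
  have hiso : BalTensor.map (ringAct j) a.iso.toLinearMap ∘ₗ
      BalTensor.map (ringAct j) a.iso.symm.toLinearMap = LinearMap.id := by
    rw [← BalTensor.map_comp, LinearEquiv.comp_symm, BalTensor.map_id]
  have hiso' : BalTensor.map (ringAct j) a.iso.symm.toLinearMap ∘ₗ
      BalTensor.map (ringAct j) a.iso.toLinearMap = LinearMap.id := by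
    rw [← BalTensor.map_comp, LinearEquiv.symm_comp, BalTensor.map_id]
  rw [theta, dif_pos hne]
  generalize hne.some = c at *
  refine detHom_ofEnd Ψ (f' := BalTensor.map (ringAct j) a.iso.symm.toLinearMap ∘ₗ
    (BalTensor.map (ringAct j) (dOdd A a.k) + c.so)) ?_ ?_
  · refine LinearMap.ext fun x => ?_
    have h3 := LinearMap.congr_fun hiso ((BalTensor.map (ringAct j) (dOdd A a.k) + c.so) x)
    exact (congrArg (BalTensor.map (ringAct j) (dEven A a.k) + c.se) h3).trans
      (LinearMap.congr_fun h1 x)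
  · refine LinearMap.ext fun x => ?_
    have h3 := LinearMap.congr_fun h2 (BalTensor.map (ringAct j) a.iso.toLinearMap x)
    exact (congrArg (BalTensor.map (ringAct j) a.iso.symm.toLinearMap) h3).trans
      (LinearMap.congr_fun hiso' x)

/-- Contractions are transported by isomorphisms. -/
theorem Contraction.exists_conj {V₁ V₂ W₁ W₂ : Type*} [AddCommGroup V₁] [Module Q V₁]
    [AddCommGroup V₂] [Module Q V₂] [AddCommGroup W₁] [Module Q W₁] [AddCommGroup W₂] [Module Q W₂]
    (e₁ : V₁ ≃ₗ[Q] W₁) (e₂ : V₂ ≃ₗ[Q] W₂) {f : V₁ →ₗ[Q] V₂} {g : V₂ →ₗ[Q] V₁}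
    (c : Contraction f g) (i : V₁ →ₗ[Q] V₂) :
    ∃ c' : Contraction (e₂.toLinearMap ∘ₗ f ∘ₗ e₁.symm.toLinearMap)
      (e₁.toLinearMap ∘ₗ g ∘ₗ e₂.symm.toLinearMap),
      LinearMap.det ((g + c.se) ∘ₗ i) =
        LinearMap.det ((e₁.toLinearMap ∘ₗ g ∘ₗ e₂.symm.toLinearMap + c'.se) ∘ₗ
          (e₂.toLinearMap ∘ₗ i ∘ₗ e₁.symm.toLinearMap)) := by
  refine ⟨{ so := e₂.toLinearMap ∘ₗ c.so ∘ₗ e₁.symm.toLinearMap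
            se := e₁.toLinearMap ∘ₗ c.se ∘ₗ e₂.symm.toLinearMap
            odd := ?_
            even := ?_
            sq_odd := ?_
            sq_even := ?_ }, ?_⟩
  · refine LinearMap.ext fun x => ?_
    simpa [← map_add] using congrArg e₁ (LinearMap.congr_fun c.odd (e₁.symm x))
  · refine LinearMap.ext fun x => ?_
    simpa [← map_add] using congrArg e₂ (LinearMap.congr_fun c.even (e₂.symm x))
  · refine LinearMap.ext fun x => ?_
    simpa using LinearMap.congr_fun c.sq_odd (e₁.symm x)
  · refine LinearMap.ext fun x => ?_
    simpa using LinearMap.congr_fun c.sq_even (e₂.symm x)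
  · rw [← LinearMap.det_conj _ e₁]
    congr 1
    refine LinearMap.ext fun x => ?_
    simp

/-- The determinant of the characteristic element can be computed after the base change to `Q`. -/
theorem exists_detHom_theta {R' : Type*} [Ring R'] {A : CochainComplex (ModuleCat R) ℤ}
    (j : R →+* R') (Ψ : R' →+* Matrix (Fin n) (Fin n) Q) (hA : IsPerfect A)
    (hAS : IsAcyclicAfter A (ringAct j)) (a : Trivialization A) :
    ∃ c : Contraction (BalTensor.map (rowAct (Ψ.comp j)) (dOdd A a.k))
      (BalTensor.map (rowAct (Ψ.comp j)) (dEven A a.k)),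
      (((KOne.detHom Ψ (theta j a)).toMul : Qˣ) : Q) = LinearMap.det
        ((BalTensor.map (rowAct (Ψ.comp j)) (dEven A a.k) + c.se) ∘ₗ
          BalTensor.map (rowAct (Ψ.comp j)) a.iso.toLinearMap) := by
  obtain ⟨c, hc⟩ := detHom_theta j Ψ hA hAS a
  let c' : Contraction (BalTensor.map (rowAct Ψ) (BalTensor.map (ringAct j) (dOdd A a.k)))
      (BalTensor.map (rowAct Ψ) (BalTensor.map (ringAct j) (dEven A a.k))) :=
    { so := BalTensor.map (rowAct Ψ) c.so
      se := BalTensor.map (rowAct Ψ) c.se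
      odd := by
        rw [← BalTensor.map_comp, ← BalTensor.map_comp, ← BalTensor.map_add, c.odd,
          BalTensor.map_id]
      even := by
        rw [← BalTensor.map_comp, ← BalTensor.map_comp, ← BalTensor.map_add, c.even,
          BalTensor.map_id]
      sq_odd := by rw [← BalTensor.map_comp, c.sq_odd, BalTensor.map_zero]
      sq_even := by rw [← BalTensor.map_comp, c.sq_even, BalTensor.map_zero] }
  rw [BalTensor.map_comp, BalTensor.map_add] at hc
  rw [map_eq_assocEquiv_conj j Ψ (dOdd A a.k), map_eq_assocEquiv_conj j Ψ (dEven A a.k),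
    map_eq_assocEquiv_conj j Ψ a.iso.toLinearMap, hc]
  exact c'.exists_conj _ _ _

end DetHom

/-! ### Coordinates -/

section Coordinates

open PowerSeries

variable {R : Type*} [Ring R] {S : Type*} [CommRing S] {m : Type*} [Fintype m] [DecidableEq m]
  {P P' : Type*} [AddCommGroup P] [Module R P] [AddCommGroup P'] [Module R P']
  {ι ι' : Type*} [Fintype ι] [DecidableEq ι] [Fintype ι']

theorem constantCoeff_mulVec (D : Matrix ι' ι S⟦X⟧) (T : ι → S⟦X⟧) (i : ι') :
    constantCoeff (D.mulVec T i) =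
      (D.map (constantCoeff (R := S))).mulVec (fun k => constantCoeff (T k)) i := by
  simp [Matrix.mulVec, dotProduct]

theorem coeff_one_mulVec (D : Matrix ι' ι S⟦X⟧) (T : ι → S⟦X⟧) (i : ι') :
    coeff 1 (D.mulVec T i) =
      (D.map (coeff (R := S) 1)).mulVec (fun k => constantCoeff (T k)) i +
        (D.map (constantCoeff (R := S))).mulVec (fun k => coeff 1 (T k)) i := by
  simp [Matrix.mulVec, dotProduct, coeff_mul, Finset.Nat.antidiagonal_succ, Finset.sum_add_distrib,
    add_comm]

/-- The Bockstein relation in coordinates. -/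
theorem bockRel_iff_mulVec {Φ : R →+* Matrix m m S⟦X⟧}
    (B : Module.Basis ι S⟦X⟧ (BalTensor (rowAct Φ) P))
    (B' : Module.Basis ι' S⟦X⟧ (BalTensor (rowAct Φ) P')) (f : P →ₗ[R] P')
    (x : BalTensor (specAct Φ (constantCoeff (R := S))) P)
    (y : BalTensor (specAct Φ (constantCoeff (R := S))) P') :
    BockRel (specAct Φ (constantCoeff (R := S))) (epsAct Φ) f x y ↔
      ((LinearMap.toMatrix B B' (BalTensor.map _ f)).map (constantCoeff (R := S))).mulVec
        ((specBasis B constantCoeff).equivFun x) = 0 ∧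
      ∃ x₁, (specBasis B' constantCoeff).equivFun y =
        -(((LinearMap.toMatrix B B' (BalTensor.map _ f)).map (coeff (R := S) 1)).mulVec
            ((specBasis B constantCoeff).equivFun x) +
          ((LinearMap.toMatrix B B' (BalTensor.map _ f)).map (constantCoeff (R := S))).mulVec
            x₁) := by
  rw [bockRel_iff]
  set D := LinearMap.toMatrix B B' (BalTensor.map (rowAct Φ) f) with hD
  have hmap : ∀ t, B'.equivFun (BalTensor.map _ f t) = D.mulVec (B.equivFun t) := fun t =>
    (LinearMap.toMatrix_mulVec_repr B B' _ t).symm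
  constructor
  · rintro ⟨t, u, rfl, rfl, h⟩
    have h1 : D.mulVec (B.equivFun t) = -((X : S⟦X⟧) • B'.equivFun u) := by
      rw [← hmap, h, map_neg, map_smul]
    rw [specBasis_equivFun, specBasis_equivFun]
    refine ⟨funext fun i => ?_, fun k => coeff 1 (B.equivFun t k), funext fun i => ?_⟩
    · have h2 := congrArg constantCoeff (congrFun h1 i)
      rw [constantCoeff_mulVec] at h2
      refine h2.trans ?_
      simp
    · have h2 := congrArg (coeff 1) (congrFun h1 i)
      rw [coeff_one_mulVec] at h2
      refine neg_injective ?_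
      rw [Pi.neg_apply, neg_neg]
      refine Eq.trans ?_ h2.symm
      simp only [Pi.neg_apply, Pi.smul_apply, smul_eq_mul, map_neg, vecMap_apply]
      rw [show (1 : ℕ) = 0 + 1 from rfl, coeff_succ_X_mul, coeff_zero_eq_constantCoeff_apply]
  · rintro ⟨h0, x₁, h1⟩
    -- The vector x₁ is taken as the X-coefficient of a lift of x. Coefficients of higher degree do
    -- not affect the image modulo X².
    let T : ι → S⟦X⟧ := fun k => C ((specBasis B constantCoeff).equivFun x k) + X * C (x₁ k)
    have hT0 : (fun k => constantCoeff (T k)) = (specBasis B constantCoeff).equivFun x := by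
      ext k; simp [T]
    have hT1 : (fun k => coeff 1 (T k)) = x₁ := by
      ext k
      simp only [T, map_add]
      rw [show (1 : ℕ) = 0 + 1 from rfl, coeff_succ_X_mul]
      simp [coeff_C]
    have hdiv : ∀ i, ∃ q, D.mulVec T i = X * q := fun i => by
      refine X_dvd_iff.2 ?_
      rw [constantCoeff_mulVec, hT0, h0]
      rfl
    choose q hq using hdiv
    refine ⟨B.equivFun.symm T, B'.equivFun.symm (-q), ?_, ?_, ?_⟩
    · apply (specBasis B constantCoeff).equivFun.injective
      rw [specBasis_equivFun, LinearEquiv.apply_symm_apply]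
      exact hT0
    · apply (specBasis B' constantCoeff).equivFun.injective
      rw [specBasis_equivFun, LinearEquiv.apply_symm_apply, h1]
      ext i
      have h2 := congrArg (coeff 1) (hq i)
      rw [coeff_one_mulVec, hT0, hT1, show (1 : ℕ) = 0 + 1 from rfl, coeff_succ_X_mul,
        coeff_zero_eq_constantCoeff_apply] at h2
      rw [vecMap_apply, Pi.neg_apply, map_neg, ← h2]
      rfl
    · apply B'.equivFun.injective
      rw [hmap, LinearEquiv.apply_symm_apply, map_neg, map_smul, LinearEquiv.apply_symm_apply]
      ext1 i
      rw [hq]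
      simp

/-- The relations between the coefficients of two matrices of power series with product zero. -/
theorem coeff_relations {ι : Type*} [Fintype ι] {M N : Matrix ι ι S⟦X⟧} (h : M * N = 0) :
    M.map (constantCoeff (R := S)) * N.map (constantCoeff (R := S)) = 0 ∧
    M.map (constantCoeff (R := S)) * N.map (coeff (R := S) 1) +
      M.map (coeff (R := S) 1) * N.map (constantCoeff (R := S)) = 0 ∧
    M.map (constantCoeff (R := S)) * N.map (coeff (R := S) 2) +
      M.map (coeff (R := S) 1) * N.map (coeff (R := S) 1) +
      M.map (coeff (R := S) 2) * N.map (constantCoeff (R := S)) = 0 := by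
  refine ⟨?_, ?_, ?_⟩
  · ext i j
    have h0 := congrArg constantCoeff (congrFun (congrFun h i) j)
    simpa [Matrix.mul_apply] using h0
  · ext i j
    have h0 := congrArg (coeff 1) (congrFun (congrFun h i) j)
    simpa [Matrix.mul_apply, coeff_mul, Finset.Nat.antidiagonal_succ, Finset.sum_add_distrib]
      using h0
  · ext i j
    have h0 := congrArg (coeff 2) (congrFun (congrFun h i) j)
    simpa [Matrix.mul_apply, coeff_mul, Finset.Nat.antidiagonal_succ, Finset.sum_add_distrib,
      add_assoc] using h0

end Coordinates

/-! ### Contractions and Bockstein splittings in bases -/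

section SplittingCoordinates

open PowerSeries

variable {K : Type*} [Field K] {Vo Ve : Type*} [AddCommGroup Vo] [Module K Vo] [AddCommGroup Ve]
  [Module K Ve] {ι : Type*} [Fintype ι] [DecidableEq ι] (Bo : Module.Basis ι K Vo)
  (Be : Module.Basis ι K Ve)

theorem toMatrix_comp_eq {V₁ V₂ V₃ : Type*} [AddCommGroup V₁] [Module K V₁] [AddCommGroup V₂]
    [Module K V₂] [AddCommGroup V₃] [Module K V₃] (B₁ : Module.Basis ι K V₁)
    (B₂ : Module.Basis ι K V₂) (B₃ : Module.Basis ι K V₃) (g : V₂ →ₗ[K] V₃) (f : V₁ →ₗ[K] V₂) :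
    LinearMap.toMatrix B₁ B₃ (g ∘ₗ f) = LinearMap.toMatrix B₂ B₃ g * LinearMap.toMatrix B₁ B₂ f :=
  LinearMap.toMatrix_comp B₁ B₂ B₃ g f

variable {δo : Vo →ₗ[K] Ve} {δe : Ve →ₗ[K] Vo}

theorem Contraction.isContraction (c : Contraction δo δe) :
    IsContraction (LinearMap.toMatrix Bo Be δo) (LinearMap.toMatrix Be Bo δe)
      (LinearMap.toMatrix Bo Be c.so) (LinearMap.toMatrix Be Bo c.se) where
  odd := by
    rw [← toMatrix_comp_eq, ← toMatrix_comp_eq, ← map_add, c.odd, LinearMap.toMatrix_id]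
  even := by
    rw [← toMatrix_comp_eq, ← toMatrix_comp_eq, ← map_add, c.even, LinearMap.toMatrix_id]
  sq_odd := by rw [← toMatrix_comp_eq, c.sq_odd, map_zero]
  sq_even := by rw [← toMatrix_comp_eq, c.sq_even, map_zero]

theorem exists_contraction_of_isContraction {So Se : Matrix ι ι K}
    (h : IsContraction (LinearMap.toMatrix Bo Be δo) (LinearMap.toMatrix Be Bo δe) So Se) :
    ∃ c : Contraction δo δe, LinearMap.toMatrix Be Bo c.se = Se := by
  have ho : So = LinearMap.toMatrix Bo Be (Matrix.toLin Bo Be So) :=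
    (LinearMap.toMatrix_toLin Bo Be So).symm
  have he : Se = LinearMap.toMatrix Be Bo (Matrix.toLin Be Bo Se) :=
    (LinearMap.toMatrix_toLin Be Bo Se).symm
  rw [ho, he] at h
  refine ⟨{ so := Matrix.toLin Bo Be So
            se := Matrix.toLin Be Bo Se
            odd := (LinearMap.toMatrix Bo Bo).injective ?_
            even := (LinearMap.toMatrix Be Be).injective ?_
            sq_odd := (LinearMap.toMatrix Bo Bo).injective ?_
            sq_even := (LinearMap.toMatrix Be Be).injective ?_ }, he.symm⟩
  · rw [map_add, toMatrix_comp_eq Bo Be Bo, toMatrix_comp_eq Bo Be Bo, h.odd, LinearMap.toMatrix_id]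
  · rw [map_add, toMatrix_comp_eq Be Bo Be, toMatrix_comp_eq Be Bo Be, h.even,
      LinearMap.toMatrix_id]
  · rw [toMatrix_comp_eq Bo Be Bo, h.sq_odd, map_zero]
  · rw [toMatrix_comp_eq Be Bo Be, h.sq_even, map_zero]

theorem det_comp_eq_det_toMatrix (g : Ve →ₗ[K] Vo) {i : Vo →ₗ[K] Ve}
    (hi : LinearMap.toMatrix Bo Be i = 1) :
    LinearMap.det (g ∘ₗ i) = (LinearMap.toMatrix Be Bo g).det := by
  rw [← LinearMap.det_toMatrix Bo, toMatrix_comp_eq Bo Be Bo, hi, mul_one]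

/-- The relation b² = 0 is not among the fields of `BockSplitting`. It is supplied as `hbb` and
later derived from the coefficients of the differential. -/
theorem BockSplitting.splittingRel {ro : Vo → Ve → Prop} {re : Ve → Vo → Prop}
    (h : BockSplitting δo δe ro re) (hoe : δe ∘ₗ δo = 0) (heo : δo ∘ₗ δe = 0)
    (hbb : offDiag (LinearMap.toMatrix Bo Be h.bo) (LinearMap.toMatrix Be Bo h.be) *
      offDiag (LinearMap.toMatrix Bo Be h.bo) (LinearMap.toMatrix Be Bo h.be) = 0) :
    SplittingRel (offDiag (LinearMap.toMatrix Bo Be δo) (LinearMap.toMatrix Be Bo δe))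
      (offDiag (LinearMap.toMatrix Bo Be h.so) (LinearMap.toMatrix Be Bo h.se))
      (onDiag (LinearMap.toMatrix Bo Bo h.πo) (LinearMap.toMatrix Be Be h.πe))
      (offDiag (LinearMap.toMatrix Bo Be h.bo) (LinearMap.toMatrix Be Bo h.be))
      (offDiag (LinearMap.toMatrix Bo Be h.co) (LinearMap.toMatrix Be Bo h.ce)) := by
  constructor
  · rw [offDiag_mul, onDiag_eq_zero, ← toMatrix_comp_eq, ← toMatrix_comp_eq, hoe, heo, map_zero,
      map_zero]
    exact ⟨rfl, rfl⟩
  · rw [offDiag_mul, onDiag_eq_zero, ← toMatrix_comp_eq, ← toMatrix_comp_eq, h.sq_so, h.sq_se,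
      map_zero, map_zero]
    exact ⟨rfl, rfl⟩
  · rw [offDiag_mul, onDiag_mul_offDiag, offDiag_inj, mul_assoc, mul_assoc]
    simp only [← toMatrix_comp_eq, h.δsδ_o, h.δsδ_e, and_self]
  · rw [offDiag_mul, onDiag_mul_offDiag, offDiag_inj, mul_assoc, mul_assoc]
    simp only [← toMatrix_comp_eq, h.sδs_o, h.sδs_e, and_self]
  · rw [offDiag_mul, offDiag_mul, onDiag_add, ← onDiag_one, onDiag_sub, onDiag_inj]
    simp only [← toMatrix_comp_eq, ← map_add, h.πo_eq, h.πe_eq, map_sub, LinearMap.toMatrix_id,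
      and_self]
  · rw [onDiag_mul_offDiag, offDiag_mul_onDiag, offDiag_inj, mul_assoc, mul_assoc]
    simp only [← toMatrix_comp_eq, h.bo_eq, h.be_eq, and_self]
  · rw [onDiag_mul_offDiag, offDiag_mul_onDiag, offDiag_inj, mul_assoc, mul_assoc]
    simp only [← toMatrix_comp_eq, h.co_eq, h.ce_eq, and_self]
  · rw [offDiag_mul, offDiag_mul, onDiag_add, onDiag_inj]
    simp only [← toMatrix_comp_eq, ← map_add, h.odd, h.even, and_self]
  · rw [offDiag_mul, onDiag_eq_zero, ← toMatrix_comp_eq, ← toMatrix_comp_eq, h.sq_co, h.sq_ce,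
      map_zero, map_zero]
    exact ⟨rfl, rfl⟩
  · exact hbb

theorem exists_bockSplitting {ro : Vo → Ve → Prop} {re : Ve → Vo → Prop}
    {so se πo πe bo be co ce : Matrix ι ι K}
    (h : SplittingRel (offDiag (LinearMap.toMatrix Bo Be δo) (LinearMap.toMatrix Be Bo δe))
      (offDiag so se) (onDiag πo πe) (offDiag bo be) (offDiag co ce))
    (hro : ∀ x, ro (Matrix.toLin Bo Bo πo x) (Matrix.toLin Bo Be bo x))
    (hre : ∀ x, re (Matrix.toLin Be Be πe x) (Matrix.toLin Be Bo be x)) :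
    Nonempty (BockSplitting δo δe ro re) := by
  have e1 := h.ss
  have e2 := h.δsδ
  have e3 := h.sδs
  have e4 := h.π_eq
  have e5 := h.πbπ
  have e6 := h.πcπ
  have e7 := h.bccb
  have e8 := h.cc
  rw [offDiag_mul, onDiag_eq_zero] at e1 e8
  rw [offDiag_mul, onDiag_mul_offDiag, offDiag_inj, mul_assoc, mul_assoc] at e2 e3
  rw [offDiag_mul, offDiag_mul, onDiag_add, ← onDiag_one, onDiag_sub, onDiag_inj] at e4
  rw [onDiag_mul_offDiag, offDiag_mul_onDiag, offDiag_inj, mul_assoc, mul_assoc] at e5 e6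
  rw [offDiag_mul, offDiag_mul, onDiag_add, onDiag_inj] at e7
  refine ⟨{ so := Matrix.toLin Bo Be so
            se := Matrix.toLin Be Bo se
            πo := Matrix.toLin Bo Bo πo
            πe := Matrix.toLin Be Be πe
            bo := Matrix.toLin Bo Be bo
            be := Matrix.toLin Be Bo be
            co := Matrix.toLin Bo Be co
            ce := Matrix.toLin Be Bo ce
            sq_so := (LinearMap.toMatrix Bo Bo).injective ?_
            sq_se := (LinearMap.toMatrix Be Be).injective ?_
            δsδ_o := (LinearMap.toMatrix Bo Be).injective ?_
            δsδ_e := (LinearMap.toMatrix Be Bo).injective ?_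
            sδs_o := (LinearMap.toMatrix Bo Be).injective ?_
            sδs_e := (LinearMap.toMatrix Be Bo).injective ?_
            πo_eq := (LinearMap.toMatrix Bo Bo).injective ?_
            πe_eq := (LinearMap.toMatrix Be Be).injective ?_
            bo_eq := (LinearMap.toMatrix Bo Be).injective ?_
            be_eq := (LinearMap.toMatrix Be Bo).injective ?_
            bo_rel := hro
            be_rel := hre
            co_eq := (LinearMap.toMatrix Bo Be).injective ?_
            ce_eq := (LinearMap.toMatrix Be Bo).injective ?_
            odd := (LinearMap.toMatrix Bo Bo).injective ?_
            even := (LinearMap.toMatrix Be Be).injective ?_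
            sq_co := (LinearMap.toMatrix Bo Bo).injective ?_
            sq_ce := (LinearMap.toMatrix Be Be).injective ?_ }⟩ <;>
  simp only [map_add, map_sub, map_zero, toMatrix_comp_eq Bo Be Bo, toMatrix_comp_eq Be Bo Be,
    toMatrix_comp_eq Bo Bo Be, toMatrix_comp_eq Bo Be Be, toMatrix_comp_eq Be Be Bo,
    toMatrix_comp_eq Be Bo Bo, LinearMap.toMatrix_toLin, LinearMap.toMatrix_id]
  exacts [e1.1, e1.2, e2.1, e2.2, e3.1, e3.2, e4.1, e4.2, e5.1, e5.2, e6.1, e6.2, e7.1, e7.2, e8.1,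
    e8.2]

/-- If the complex is exact, the data that compute its trivialization consist of a contraction. -/
theorem BockSplitting.det_eq_of_contraction {ro : Vo → Ve → Prop} {re : Ve → Vo → Prop}
    (h : BockSplitting δo δe ro re) (c : Contraction δo δe) (hoe : δe ∘ₗ δo = 0)
    (heo : δo ∘ₗ δe = 0) {i : Vo →ₗ[K] Ve} (hi : LinearMap.toMatrix Bo Be i = 1) :
    LinearMap.det ((δe + h.se + h.be + h.ce) ∘ₗ i) = LinearMap.det ((δe + c.se) ∘ₗ i) := by
  have hδπ : δe ∘ₗ h.πe = 0 := by
    rw [h.πe_eq, LinearMap.comp_sub, LinearMap.comp_add, ← LinearMap.comp_assoc, hoe, h.δsδ_e,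
      LinearMap.zero_comp, zero_add, LinearMap.comp_id, sub_self]
  have hπδ : h.πe ∘ₗ δo = 0 := by
    rw [h.πe_eq, LinearMap.sub_comp, LinearMap.add_comp, LinearMap.comp_assoc, h.δsδ_o,
      LinearMap.comp_assoc, hoe, LinearMap.comp_zero, add_zero, LinearMap.id_comp, sub_self]
  have hππ : h.πe ∘ₗ h.πe = h.πe := by
    have hsπ : h.so ∘ₗ δe ∘ₗ h.πe = 0 := by rw [hδπ, LinearMap.comp_zero]
    have hsπ' : δo ∘ₗ h.se ∘ₗ h.πe = 0 := by
      rw [h.πe_eq, LinearMap.comp_sub, LinearMap.comp_add, h.sδs_e,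
        LinearMap.comp_id, ← LinearMap.comp_assoc δe, h.sq_so, LinearMap.zero_comp, add_zero, sub_self,
        LinearMap.comp_zero]
    nth_rw 1 [h.πe_eq]
    rw [LinearMap.sub_comp, LinearMap.add_comp, LinearMap.comp_assoc, LinearMap.comp_assoc, hsπ,
      hsπ', LinearMap.id_comp, add_zero, sub_zero]
  -- Sandwiching the contraction identity between two copies of π gives π = π(δs + sδ)π = 0, as δπ =
  -- πδ = 0. With π the maps b and c vanish too.
  have hπ : h.πe = 0 := by
    have h1 : h.πe ∘ₗ (δo ∘ₗ c.se + c.so ∘ₗ δe) ∘ₗ h.πe = 0 := by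
      rw [LinearMap.add_comp, LinearMap.comp_add, LinearMap.comp_assoc, LinearMap.comp_assoc, hδπ,
        ← LinearMap.comp_assoc, hπδ, LinearMap.zero_comp, LinearMap.comp_zero, LinearMap.comp_zero,
        add_zero]
    rwa [c.even, LinearMap.id_comp, hππ] at h1
  have hbe : h.be = 0 := by rw [← h.be_eq, hπ, LinearMap.comp_zero, LinearMap.comp_zero]
  have hce : h.ce = 0 := by rw [← h.ce_eq, hπ, LinearMap.comp_zero, LinearMap.comp_zero]
  have hπo : h.πo = 0 := by
    rw [← h.odd, hbe, hce, LinearMap.zero_comp, LinearMap.zero_comp, add_zero]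
  let c' : Contraction δo δe :=
    { so := h.so
      se := h.se
      odd := by
        have := h.πo_eq
        rw [hπo] at this
        exact (sub_eq_zero.1 this.symm).symm
      even := by
        have := h.πe_eq
        rw [hπ] at this
        exact (sub_eq_zero.1 this.symm).symm
      sq_odd := h.sq_so
      sq_even := h.sq_se }
  rw [hbe, hce, add_zero, add_zero, det_comp_eq_det_toMatrix Bo Be _ hi,
    det_comp_eq_det_toMatrix Bo Be _ hi, map_add, map_add]
  exact IsContraction.det_eq (by rw [← toMatrix_comp_eq, hoe, map_zero])
    (by rw [← toMatrix_comp_eq, heo, map_zero]) (c'.isContraction Bo Be) (c.isContraction Bo Be)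

/-- A contraction gives the data that compute the trivialization of an exact complex. -/
theorem Contraction.nonempty_bockSplitting {ro : Vo → Ve → Prop} {re : Ve → Vo → Prop}
    (c : Contraction δo δe) (hoe : δe ∘ₗ δo = 0) (heo : δo ∘ₗ δe = 0) (hro : ro 0 0)
    (hre : re 0 0) : Nonempty (BockSplitting δo δe ro re) := by
  have ho := fun x => LinearMap.congr_fun c.odd x
  have he := fun x => LinearMap.congr_fun c.even x
  have hso := fun x => LinearMap.congr_fun c.sq_odd x
  have hse := fun x => LinearMap.congr_fun c.sq_even x
  have hδo := fun x => LinearMap.congr_fun hoe x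
  have hδe := fun x => LinearMap.congr_fun heo x
  simp only [LinearMap.add_apply, LinearMap.comp_apply, LinearMap.id_apply,
    LinearMap.zero_apply] at ho he hso hse hδo hδe
  refine ⟨{ so := c.so
            se := c.se
            πo := 0
            πe := 0
            bo := 0
            be := 0
            co := 0
            ce := 0
            sq_so := c.sq_odd
            sq_se := c.sq_even
            δsδ_o := LinearMap.ext fun x => ?_
            δsδ_e := LinearMap.ext fun x => ?_
            sδs_o := LinearMap.ext fun x => ?_
            sδs_e := LinearMap.ext fun x => ?_
            πo_eq := by rw [c.odd, sub_self]
            πe_eq := by rw [c.even, sub_self]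
            bo_eq := by simp
            be_eq := by simp
            bo_rel := fun x => hro
            be_rel := fun x => hre
            co_eq := by simp
            ce_eq := by simp
            odd := by simp
            even := by simp
            sq_co := by simp
            sq_ce := by simp }⟩
  · have := he (δo x)
    rwa [hδo, map_zero, add_zero] at this
  · have := ho (δe x)
    rwa [hδe, map_zero, add_zero] at this
  · have := he (c.so x)
    rwa [hso, map_zero, zero_add] at this
  · have := ho (c.se x)
    rwa [hse, map_zero, zero_add] at this

end SplittingCoordinates

/-! ### The Bockstein map as the transfer of the X-coefficient -/

section BockSplittingMatrices

open PowerSeries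

theorem splitting_projection {A : Type*} [Ring A] {δ s π : A} (δδ : δ * δ = 0) (ss : s * s = 0)
    (δsδ : δ * s * δ = δ) (sδs : s * δ * s = s) (π_eq : π = 1 - (δ * s + s * δ)) :
    δ * π = 0 ∧ π * δ = 0 ∧ π * π = π := by
  have hδπ : δ * π = 0 := by
    rw [π_eq, mul_sub, mul_add, ← mul_assoc, δδ, ← mul_assoc, δsδ]; simp
  have hπδ : π * δ = 0 := by
    rw [π_eq, sub_mul, add_mul, mul_assoc s, δδ, δsδ]; simp
  have hsπ : s * π = 0 := by
    rw [π_eq, mul_sub, mul_add, ← mul_assoc, sδs, ← mul_assoc, ss]; simp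
  refine ⟨hδπ, hπδ, ?_⟩
  nth_rw 1 [π_eq]
  rw [sub_mul, add_mul, mul_assoc, mul_assoc, hsπ, hδπ]; simp

/-- βπ takes values in cocycles, and projecting a cocycle by π changes it by the boundary δ(sβπ). -/
theorem transfer_eq {A : Type*} [Ring A] {δ s π β : A} (π_eq : π = 1 - (δ * s + s * δ))
    (hδπ : δ * π = 0) (hβ : δ * β + β * δ = 0) : π * β * π = β * π - δ * (s * β * π) := by
  have h : δ * β * π = 0 := by
    rw [← neg_eq_of_add_eq_zero_left hβ, neg_mul, mul_assoc, hδπ, mul_zero, neg_zero]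
  have h' : π * β * π = β * π - δ * (s * β * π) - s * (δ * β * π) := by
    nth_rw 1 [π_eq]; noncomm_ring
  rw [h', h, mul_zero, sub_zero]

variable {R : Type*} [Ring R] {L : Type*} [Field L] {m : Type*} [Fintype m] [DecidableEq m]
  {Po Pe : Type*} [AddCommGroup Po] [Module R Po] [AddCommGroup Pe] [Module R Pe]
  {ι : Type*} [Fintype ι] [DecidableEq ι] {Φ : R →+* Matrix m m L⟦X⟧}
  (Bo : Module.Basis ι L⟦X⟧ (BalTensor (rowAct Φ) Po))
  (Be : Module.Basis ι L⟦X⟧ (BalTensor (rowAct Φ) Pe)) {f : Po →ₗ[R] Pe} {g : Pe →ₗ[R] Po}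

theorem toMatrix_map_mul_eq_zero {W : Type*} [CommRing W] {Φ : R →+* Matrix m m W}
    (Bo : Module.Basis ι W (BalTensor (rowAct Φ) Po))
    (Be : Module.Basis ι W (BalTensor (rowAct Φ) Pe)) (h : g ∘ₗ f = 0) :
    LinearMap.toMatrix Be Bo (BalTensor.map (rowAct Φ) g) *
      LinearMap.toMatrix Bo Be (BalTensor.map (rowAct Φ) f) = 0 := by
  rw [← LinearMap.toMatrix_comp, ← BalTensor.map_comp, h, BalTensor.map_zero, map_zero]

theorem offDiag_coeff_relations {Do De : Matrix ι ι L⟦X⟧} (hoe : De * Do = 0) (heo : Do * De = 0) :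
    offDiag (Do.map (constantCoeff (R := L))) (De.map (constantCoeff (R := L))) *
      offDiag (Do.map (constantCoeff (R := L))) (De.map (constantCoeff (R := L))) = 0 ∧
    offDiag (Do.map (constantCoeff (R := L))) (De.map (constantCoeff (R := L))) *
      offDiag (Do.map (coeff (R := L) 1)) (De.map (coeff (R := L) 1)) +
    offDiag (Do.map (coeff (R := L) 1)) (De.map (coeff (R := L) 1)) *
      offDiag (Do.map (constantCoeff (R := L))) (De.map (constantCoeff (R := L))) = 0 ∧
    offDiag (Do.map (constantCoeff (R := L))) (De.map (constantCoeff (R := L))) *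
      offDiag (Do.map (coeff (R := L) 2)) (De.map (coeff (R := L) 2)) +
    offDiag (Do.map (coeff (R := L) 1)) (De.map (coeff (R := L) 1)) *
      offDiag (Do.map (coeff (R := L) 1)) (De.map (coeff (R := L) 1)) +
    offDiag (Do.map (coeff (R := L) 2)) (De.map (coeff (R := L) 2)) *
      offDiag (Do.map (constantCoeff (R := L))) (De.map (constantCoeff (R := L))) = 0 := by
  obtain ⟨h0, h1, h2⟩ := coeff_relations hoe
  obtain ⟨h0', h1', h2'⟩ := coeff_relations heo
  refine ⟨?_, ?_, ?_⟩
  · rw [offDiag_mul, onDiag_eq_zero]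
    exact ⟨h0, h0'⟩
  · rw [offDiag_mul, offDiag_mul, onDiag_add, onDiag_eq_zero]
    exact ⟨h1, h1'⟩
  · rw [offDiag_mul, offDiag_mul, offDiag_mul, onDiag_add, onDiag_add, onDiag_eq_zero]
    exact ⟨h2, h2'⟩

theorem toMatrix_mulVec_equivFun {K V W : Type*} [CommRing K] [AddCommGroup V] [Module K V]
    [AddCommGroup W] [Module K W] (B : Module.Basis ι K V) (B' : Module.Basis ι K W)
    (u : V →ₗ[K] W) (x : V) :
    B'.equivFun (u x) = (LinearMap.toMatrix B B' u).mulVec (B.equivFun x) :=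
  (LinearMap.toMatrix_mulVec_repr B B' u x).symm

/-- The matrices of the data that compute the trivialization by the Bockstein maps. -/
theorem BockSplitting.matrix_relations (hoe : g ∘ₗ f = 0) (heo : f ∘ₗ g = 0)
    (h : BockSplitting (BalTensor.map (specAct Φ (constantCoeff (R := L))) f)
      (BalTensor.map (specAct Φ (constantCoeff (R := L))) g)
      (BockRel (specAct Φ (constantCoeff (R := L))) (epsAct Φ) f)
      (BockRel (specAct Φ (constantCoeff (R := L))) (epsAct Φ) g)) :
    ∃ so se πo πe bo be co ce : Matrix ι ι L,
      SplittingRel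
        (offDiag ((LinearMap.toMatrix Bo Be (BalTensor.map _ f)).map (constantCoeff (R := L)))
          ((LinearMap.toMatrix Be Bo (BalTensor.map _ g)).map (constantCoeff (R := L))))
        (offDiag so se) (onDiag πo πe) (offDiag bo be) (offDiag co ce) ∧
      offDiag bo be = -(onDiag πo πe *
        offDiag ((LinearMap.toMatrix Bo Be (BalTensor.map _ f)).map (coeff (R := L) 1))
          ((LinearMap.toMatrix Be Bo (BalTensor.map _ g)).map (coeff (R := L) 1)) *
        onDiag πo πe) ∧
      se = LinearMap.toMatrix (specBasis Be constantCoeff) (specBasis Bo constantCoeff) h.se ∧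
      be = LinearMap.toMatrix (specBasis Be constantCoeff) (specBasis Bo constantCoeff) h.be ∧
      ce = LinearMap.toMatrix (specBasis Be constantCoeff) (specBasis Bo constantCoeff) h.ce := by
  set Do := LinearMap.toMatrix Bo Be (BalTensor.map (rowAct Φ) f) with hDo
  set De := LinearMap.toMatrix Be Bo (BalTensor.map (rowAct Φ) g) with hDe
  set bo' := specBasis Bo (constantCoeff (R := L)) with hbo'
  set be' := specBasis Be (constantCoeff (R := L)) with hbe'
  have hoe' : BalTensor.map (specAct Φ (constantCoeff (R := L))) g ∘ₗ
      BalTensor.map (specAct Φ (constantCoeff (R := L))) f = 0 := by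
    rw [← BalTensor.map_comp, hoe, BalTensor.map_zero]
  have heo' : BalTensor.map (specAct Φ (constantCoeff (R := L))) f ∘ₗ
      BalTensor.map (specAct Φ (constantCoeff (R := L))) g = 0 := by
    rw [← BalTensor.map_comp, heo, BalTensor.map_zero]
  have hδo : LinearMap.toMatrix bo' be' (BalTensor.map (specAct Φ (constantCoeff (R := L))) f) =
      Do.map (constantCoeff (R := L)) := specBasis_toMatrix Bo Be _ f
  have hδe : LinearMap.toMatrix be' bo' (BalTensor.map (specAct Φ (constantCoeff (R := L))) g) =
      De.map (constantCoeff (R := L)) := specBasis_toMatrix Be Bo _ g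
  obtain ⟨hrel0, hrel1, hrel2⟩ := offDiag_coeff_relations
    (toMatrix_map_mul_eq_zero Bo Be hoe) (toMatrix_map_mul_eq_zero Be Bo heo)
  rw [← hDo, ← hDe] at hrel0 hrel1 hrel2
  set so := LinearMap.toMatrix bo' be' h.so with hso
  set se := LinearMap.toMatrix be' bo' h.se with hse
  set πo := LinearMap.toMatrix bo' bo' h.πo with hπo
  set πe := LinearMap.toMatrix be' be' h.πe with hπe
  set bo := LinearMap.toMatrix bo' be' h.bo with hbo
  set be := LinearMap.toMatrix be' bo' h.be with hbe
  -- The relation b² = 0 is left open until b is identified with −πβπ.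
  have key : ∀ (hbb : offDiag bo be * offDiag bo be = 0), _ := fun hbb =>
    h.splittingRel bo' be' hoe' heo' hbb
  rw [hδo, hδe] at key
  have hπ_eq : onDiag πo πe = 1 - (offDiag (Do.map (constantCoeff (R := L)))
      (De.map (constantCoeff (R := L))) * offDiag so se + offDiag so se *
      offDiag (Do.map (constantCoeff (R := L))) (De.map (constantCoeff (R := L)))) := by
    rw [offDiag_mul, offDiag_mul, onDiag_add, ← onDiag_one, onDiag_sub, onDiag_inj, hπo, hπe,
      h.πo_eq, h.πe_eq, ← hδo, ← hδe]
    simp only [hso, hse, ← toMatrix_comp_eq, ← map_add, map_sub, LinearMap.toMatrix_id, and_self]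
  have hδsδ : offDiag (Do.map (constantCoeff (R := L))) (De.map (constantCoeff (R := L))) *
      offDiag so se * offDiag (Do.map (constantCoeff (R := L))) (De.map (constantCoeff (R := L))) =
      offDiag (Do.map (constantCoeff (R := L))) (De.map (constantCoeff (R := L))) := by
    rw [offDiag_mul, onDiag_mul_offDiag, offDiag_inj, mul_assoc, mul_assoc, ← hδo, ← hδe]
    simp only [hso, hse, ← toMatrix_comp_eq, h.δsδ_o, h.δsδ_e, and_self]
  have hsδs : offDiag so se *
      offDiag (Do.map (constantCoeff (R := L))) (De.map (constantCoeff (R := L))) *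
      offDiag so se = offDiag so se := by
    rw [offDiag_mul, onDiag_mul_offDiag, offDiag_inj, mul_assoc, mul_assoc, ← hδo, ← hδe]
    simp only [hso, hse, ← toMatrix_comp_eq, h.sδs_o, h.sδs_e, and_self]
  have hss : offDiag so se * offDiag so se = 0 := by
    rw [offDiag_mul, onDiag_eq_zero, hso, hse, ← toMatrix_comp_eq, ← toMatrix_comp_eq, h.sq_so,
      h.sq_se, map_zero, map_zero]
    exact ⟨rfl, rfl⟩
  obtain ⟨hδπ, hπδ, hππ⟩ := splitting_projection hrel0 hss hδsδ hsδs hπ_eq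
  have hb : offDiag bo be = -(onDiag πo πe * offDiag (Do.map (coeff (R := L) 1))
      (De.map (coeff (R := L) 1)) * onDiag πo πe) := by
    rw [onDiag_mul_offDiag, offDiag_mul_onDiag, offDiag_neg, offDiag_inj]
    rw [onDiag_mul, onDiag_inj] at hππ
    have hπδ' : πo * De.map (constantCoeff (R := L)) = 0 ∧
        πe * Do.map (constantCoeff (R := L)) = 0 := by
      rw [onDiag_mul_offDiag] at hπδ
      have h0 : (0 : Matrix (ι ⊕ ι) (ι ⊕ ι) L) = offDiag 0 0 := by simp [offDiag]
      rw [h0, offDiag_inj] at hπδ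
      exact ⟨hπδ.2, hπδ.1⟩
    constructor
    · have hbo_eq : πe * bo * πo = bo := by
        rw [mul_assoc, hπe, hbo, hπo, ← toMatrix_comp_eq, ← toMatrix_comp_eq, h.bo_eq]
      refine Matrix.ext_of_mulVec_single fun j => ?_
      set v : ι → L := Pi.single j 1
      obtain ⟨-, x₁, hx₁⟩ := (bockRel_iff_mulVec Bo Be f _ _).1
        (h.bo_rel (bo'.equivFun.symm (πo.mulVec v)))
      rw [← hbo', ← hbe', ← hDo, toMatrix_mulVec_equivFun bo' be', toMatrix_mulVec_equivFun bo' bo',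
        LinearEquiv.apply_symm_apply, ← hbo, ← hπo, Matrix.mulVec_mulVec v πo πo, hππ.1] at hx₁
      -- The Bockstein relation determines b only up to boundaries, and π removes them.
      have h2 := congrArg (fun w => πe.mulVec w) hx₁
      simp only [Matrix.mulVec_neg, Matrix.mulVec_add, Matrix.mulVec_mulVec, hπδ'.2,
        Matrix.zero_mulVec, add_zero] at h2
      rw [← mul_assoc, hbo_eq, ← mul_assoc] at h2
      rw [h2, Matrix.neg_mulVec]
    · have hbe_eq : πo * be * πe = be := by
        rw [mul_assoc, hπe, hbe, hπo, ← toMatrix_comp_eq, ← toMatrix_comp_eq, h.be_eq]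
      refine Matrix.ext_of_mulVec_single fun j => ?_
      set v : ι → L := Pi.single j 1
      obtain ⟨-, x₁, hx₁⟩ := (bockRel_iff_mulVec Be Bo g _ _).1
        (h.be_rel (be'.equivFun.symm (πe.mulVec v)))
      rw [← hbo', ← hbe', ← hDe, toMatrix_mulVec_equivFun be' bo', toMatrix_mulVec_equivFun be' be',
        LinearEquiv.apply_symm_apply, ← hbe, ← hπe, Matrix.mulVec_mulVec v πe πe, hππ.2] at hx₁
      have h2 := congrArg (fun w => πo.mulVec w) hx₁
      simp only [Matrix.mulVec_neg, Matrix.mulVec_add, Matrix.mulVec_mulVec, hπδ'.1,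
        Matrix.zero_mulVec, add_zero] at h2
      rw [← mul_assoc, hbe_eq, ← mul_assoc] at h2
      rw [h2, Matrix.neg_mulVec]
  exact ⟨so, se, πo, πe, bo, be, _, _, key (transfer_mul_self hrel0 hδsδ hπ_eq hrel1 hrel2 hb), hb,
    rfl, rfl, rfl⟩

/-- Matrices that split the complex and contract its Bockstein maps give the data that compute the
trivialization. -/
theorem nonempty_bockSplitting_of_splittingRel (hoe : g ∘ₗ f = 0) (heo : f ∘ₗ g = 0)
    {so se πo πe bo be co ce : Matrix ι ι L}
    (h : SplittingRel
      (offDiag ((LinearMap.toMatrix Bo Be (BalTensor.map _ f)).map (constantCoeff (R := L)))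
        ((LinearMap.toMatrix Be Bo (BalTensor.map _ g)).map (constantCoeff (R := L))))
      (offDiag so se) (onDiag πo πe) (offDiag bo be) (offDiag co ce))
    (hb : offDiag bo be = -(onDiag πo πe *
      offDiag ((LinearMap.toMatrix Bo Be (BalTensor.map _ f)).map (coeff (R := L) 1))
        ((LinearMap.toMatrix Be Bo (BalTensor.map _ g)).map (coeff (R := L) 1)) *
      onDiag πo πe)) :
    Nonempty (BockSplitting (BalTensor.map (specAct Φ (constantCoeff (R := L))) f)
      (BalTensor.map (specAct Φ (constantCoeff (R := L))) g)
      (BockRel (specAct Φ (constantCoeff (R := L))) (epsAct Φ) f)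
      (BockRel (specAct Φ (constantCoeff (R := L))) (epsAct Φ) g)) := by
  obtain ⟨hrel0, hrel1, -⟩ := offDiag_coeff_relations
    (toMatrix_map_mul_eq_zero Bo Be hoe) (toMatrix_map_mul_eq_zero Be Bo heo)
  rw [transfer_eq h.π_eq h.δπ hrel1] at hb
  have hδπ := h.δπ
  simp only [offDiag_mul_onDiag, offDiag_mul, onDiag_mul, offDiag_sub, offDiag_neg] at hb hδπ
  rw [offDiag_inj] at hb
  have h0 : (0 : Matrix (ι ⊕ ι) (ι ⊕ ι) L) = offDiag 0 0 := by simp [offDiag]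
  rw [h0, offDiag_inj] at hδπ
  have h' := h
  rw [← specBasis_toMatrix Bo Be, ← specBasis_toMatrix Be Bo] at h'
  refine exists_bockSplitting (specBasis Bo constantCoeff) (specBasis Be constantCoeff) h'
    (fun x => ?_) (fun x => ?_)
  · rw [bockRel_iff_mulVec Bo Be, toMatrix_mulVec_equivFun (specBasis Bo constantCoeff),
      toMatrix_mulVec_equivFun (specBasis Bo constantCoeff), LinearMap.toMatrix_toLin,
      LinearMap.toMatrix_toLin, Matrix.mulVec_mulVec, hδπ.1, Matrix.zero_mulVec]
    -- The correction −sβπx is the primitive supplied by `transfer_eq`.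
    refine ⟨rfl, -(se * (LinearMap.toMatrix Bo Be (BalTensor.map _ f)).map (coeff (R := L) 1) *
      πo).mulVec ((specBasis Bo constantCoeff).equivFun x), ?_⟩
    rw [hb.1, Matrix.neg_mulVec, Matrix.sub_mulVec, Matrix.mulVec_mulVec, Matrix.mulVec_neg,
      Matrix.mulVec_mulVec, sub_eq_add_neg]
  · rw [bockRel_iff_mulVec Be Bo, toMatrix_mulVec_equivFun (specBasis Be constantCoeff),
      toMatrix_mulVec_equivFun (specBasis Be constantCoeff), LinearMap.toMatrix_toLin,
      LinearMap.toMatrix_toLin, Matrix.mulVec_mulVec, hδπ.2, Matrix.zero_mulVec]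
    refine ⟨rfl, -(so * (LinearMap.toMatrix Be Bo (BalTensor.map _ g)).map (coeff (R := L) 1) *
      πe).mulVec ((specBasis Be constantCoeff).equivFun x), ?_⟩
    rw [hb.2, Matrix.neg_mulVec, Matrix.sub_mulVec, Matrix.mulVec_mulVec, Matrix.mulVec_neg,
      Matrix.mulVec_mulVec, sub_eq_add_neg]

end BockSplittingMatrices

/-! ### Classes killed by X and the image of the Bockstein map -/

section BocksteinRank

open PowerSeries

theorem exists_vec_eq_X_smul {ι W : Type*} [CommRing W] {v : ι → W⟦X⟧}
    (h : ∀ i, constantCoeff (v i) = 0) :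
    ∃ u : ι → W⟦X⟧, v = (X : W⟦X⟧) • u ∧ ∀ i, constantCoeff (u i) = coeff 1 (v i) := by
  choose u hu using fun i => X_dvd_iff.2 (h i)
  refine ⟨u, funext hu, fun i => ?_⟩
  rw [hu i, show (1 : ℕ) = 0 + 1 from rfl, coeff_succ_X_mul, coeff_zero_eq_constantCoeff_apply]

theorem X_smul_vec_injective {ι W : Type*} [CommRing W] :
    Function.Injective fun v : ι → W⟦X⟧ => (X : W⟦X⟧) • v := fun u v h =>
  funext fun i => X_mul_cancel (congrFun h i)

section Denominators

variable {ι W L : Type*} [Finite ι] [CommRing W] [IsDomain W] [Field L] [Algebra W L]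
  [IsFractionRing W L]

variable (W) in
theorem exists_vec_eq_smul (x : ι → L) :
    ∃ (a : W) (y : ι → W), a ≠ 0 ∧ vecMap ι (algebraMap W L) y = algebraMap W L a • x := by
  obtain ⟨a, ha⟩ := IsLocalization.exist_integer_multiples_of_finite (nonZeroDivisors W) x
  choose y hy using ha
  refine ⟨a, y, nonZeroDivisors.ne_zero a.2, funext fun i => ?_⟩
  rw [vecMap_apply, hy i, Pi.smul_apply, Algebra.smul_def, smul_eq_mul]

theorem vecMap_algebraMap_injective : Function.Injective (vecMap ι (algebraMap W L)) :=
  fun u v h => funext fun i => IsFractionRing.injective W L (congrFun h i)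

end Denominators

theorem vecMap_mulVec {ι ι' W W' : Type*} [Fintype ι] [CommRing W] [CommRing W'] (φ : W →+* W')
    (D : Matrix ι' ι W) (v : ι → W) :
    vecMap ι' φ (D.mulVec v) = (D.map φ).mulVec (vecMap ι φ v) :=
  funext fun i => RingHom.map_mulVec φ D v i

variable {ι W L : Type*} [Fintype ι] [DecidableEq ι] [CommRing W] [IsDomain W] [Field L] [Algebra W L]
  [IsFractionRing W L]

/-- The cocycles in the target of `D` that represent classes killed by `X`. -/
def torsionCocycles (D D' : Matrix ι ι W⟦X⟧) : AddSubgroup (ι → W⟦X⟧) where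
  carrier := {z | D'.mulVec z = 0 ∧ ∃ w, D.mulVec w = (X : W⟦X⟧) • z}
  zero_mem' := ⟨Matrix.mulVec_zero _, 0, by rw [Matrix.mulVec_zero, smul_zero]⟩
  add_mem' := by
    rintro z z' ⟨h, w, hw⟩ ⟨h', w', hw'⟩
    exact ⟨by rw [Matrix.mulVec_add, h, h', add_zero], w + w', by
      rw [Matrix.mulVec_add, hw, hw', smul_add]⟩
  neg_mem' := by
    rintro z ⟨h, w, hw⟩
    exact ⟨by rw [Matrix.mulVec_neg, h, neg_zero], -w, by rw [Matrix.mulVec_neg, hw, smul_neg]⟩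

/-- The exactness, up to torsion, of the Bockstein maps at the source of `D`, in coordinates. -/
def BockExact (D₂ D : Matrix ι ι W⟦X⟧) : Prop :=
  ∀ x : ι → W, (D.map (constantCoeff (R := W))).mulVec x = 0 →
    (∃ x₁, (D.map (coeff (R := W) 1)).mulVec x + (D.map (constantCoeff (R := W))).mulVec x₁ = 0) →
    ∃ (a : W) (w w₁ : ι → W), a ≠ 0 ∧ (D₂.map (constantCoeff (R := W))).mulVec w = 0 ∧
      (D₂.map (coeff (R := W) 1)).mulVec w + (D₂.map (constantCoeff (R := W))).mulVec w₁ = a • x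

variable {D D' : Matrix ι ι W⟦X⟧}

/-- The specialization at `X = 0` of a vector, over the fraction field. -/
def vecZero (ι : Type*) {W : Type*} (L : Type*) [CommRing W] [Field L] [Algebra W L] :
    (ι → W⟦X⟧) →+ (ι → L) :=
  (vecMap ι ((algebraMap W L).comp constantCoeff)).toAddMonoidHom

theorem vecZero_eq (z : ι → W⟦X⟧) :
    vecZero ι L z = vecMap ι (algebraMap W L) (vecMap ι constantCoeff z) := rfl

theorem vecZero_mulVec (D : Matrix ι ι W⟦X⟧) (z : ι → W⟦X⟧) :
    vecZero ι L (D.mulVec z) = ((D.map (constantCoeff (R := W))).map (algebraMap W L)).mulVec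
      (vecZero ι L z) := by
  rw [vecZero_eq, vecZero_eq, vecMap_mulVec, vecMap_mulVec]

theorem vecMap_C (t : ι → W) : vecMap ι (constantCoeff (R := W)) (vecMap ι C t) = t := by
  ext i; simp [vecMap_apply]

theorem constantCoeff_of_mulVec_eq {w z : ι → W⟦X⟧} (h : D.mulVec w = (X : W⟦X⟧) • z) :
    (D.map (constantCoeff (R := W))).mulVec (vecMap ι constantCoeff w) = 0 ∧
    vecMap ι constantCoeff z = (D.map (coeff (R := W) 1)).mulVec (vecMap ι constantCoeff w) +
      (D.map (constantCoeff (R := W))).mulVec (fun i => coeff 1 (w i)) := by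
  constructor
  · rw [← vecMap_mulVec, h]
    ext i
    simp [vecMap_apply]
  · ext i
    have h1 := coeff_one_mulVec D w i
    rw [h, Pi.smul_apply, smul_eq_mul, show (1 : ℕ) = 0 + 1 from rfl, coeff_succ_X_mul,
      coeff_zero_eq_constantCoeff_apply] at h1
    exact h1

theorem exists_mulVec_eq_X_smul {t t₁ : ι → W}
    (h : (D.map (constantCoeff (R := W))).mulVec t = 0) :
    ∃ u : ι → W⟦X⟧, D.mulVec (vecMap ι C t + (X : W⟦X⟧) • vecMap ι C t₁) = (X : W⟦X⟧) • u ∧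
      vecMap ι constantCoeff u = (D.map (coeff (R := W) 1)).mulVec t +
        (D.map (constantCoeff (R := W))).mulVec t₁ := by
  have h0 : vecMap ι (constantCoeff (R := W)) (vecMap ι C t + (X : W⟦X⟧) • vecMap ι C t₁) = t := by
    ext i; simp [vecMap_apply]
  have h1 : (fun i => coeff 1 ((vecMap ι C t + (X : W⟦X⟧) • vecMap ι C t₁) i)) = t₁ := by
    ext i
    simp [vecMap_apply, show coeff 1 (X * (C (t₁ i) : W⟦X⟧)) = t₁ i by
      rw [show (1 : ℕ) = 0 + 1 from rfl, coeff_succ_X_mul]; simp, coeff_C]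
  obtain ⟨u, hu, -⟩ := exists_vec_eq_X_smul
    (v := D.mulVec (vecMap ι C t + (X : W⟦X⟧) • vecMap ι C t₁)) (fun i => by
      have := congrFun (vecMap_mulVec (constantCoeff (R := W)) D
        (vecMap ι C t + (X : W⟦X⟧) • vecMap ι C t₁)) i
      rw [h0, h] at this
      exact this)
  refine ⟨u, hu, ?_⟩
  rw [(constantCoeff_of_mulVec_eq hu).2, h0, h1]

variable {π π' b : Matrix ι ι L}

/-- The specialization at `X = 0` of a matrix, over the fraction field. -/
abbrev zeroMat (L : Type*) [Field L] [Algebra W L] (D : Matrix ι ι W⟦X⟧) : Matrix ι ι L :=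
  (D.map (constantCoeff (R := W))).map (algebraMap W L)

/-- The Bockstein map on the classes killed by `X`. -/
theorem mulVec_vecZero_eq (hDD' : D * D' = 0) (hπδ : π * zeroMat L D = 0)
    (hcyc : ∀ w, (zeroMat L D).mulVec w = 0 → ∃ y, w = π'.mulVec w + (zeroMat L D').mulVec y)
    (hb : b = -(π * (D.map (coeff (R := W) 1)).map (algebraMap W L) * π'))
    {w z : ι → W⟦X⟧} (h : D.mulVec w = (X : W⟦X⟧) • z) :
    π.mulVec (vecZero ι L z) = -b.mulVec (vecZero ι L w) := by
  obtain ⟨h0, h1⟩ := constantCoeff_of_mulVec_eq h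
  have h0' : (zeroMat L D).mulVec (vecZero ι L w) = 0 := by
    rw [vecZero_eq, ← vecMap_mulVec, h0, map_zero]
  obtain ⟨y, hy⟩ := hcyc _ h0'
  have hrel : π * (D.map (coeff (R := W) 1)).map (algebraMap W L) * zeroMat L D' = 0 := by
    have h2 := congrArg (fun M : Matrix ι ι W => M.map (algebraMap W L)) (coeff_relations hDD').2.1
    have h3 : zeroMat L D * (D'.map (coeff (R := W) 1)).map (algebraMap W L) +
        (D.map (coeff (R := W) 1)).map (algebraMap W L) * zeroMat L D' = 0 := by
      simpa [Matrix.map_mul, Matrix.map_add] using h2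
    have h4 := congrArg (fun M => π * M) h3
    simp only [mul_add, ← mul_assoc, hπδ, zero_mul, zero_add, mul_zero] at h4
    exact h4
  have e1 : vecZero ι L z = ((D.map (coeff (R := W) 1)).map (algebraMap W L)).mulVec
      (vecZero ι L w) + (zeroMat L D).mulVec (vecMap ι (algebraMap W L) (fun i => coeff 1 (w i))) := by
    rw [vecZero_eq, h1, map_add, vecMap_mulVec, vecMap_mulVec, ← vecZero_eq]
  rw [e1, Matrix.mulVec_add, Matrix.mulVec_mulVec, Matrix.mulVec_mulVec, hπδ, Matrix.zero_mulVec,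
    add_zero, hb, Matrix.neg_mulVec, neg_neg]
  conv_lhs => rw [hy, Matrix.mulVec_add, Matrix.mulVec_mulVec, Matrix.mulVec_mulVec, hrel,
    Matrix.zero_mulVec, add_zero]

/-- If Dw = Xz, then z represents, up to sign, the Bockstein image of w(0), so πz(0) = −b·w(0).
Conversely every π'x, made integral by a scalar, is a cocycle at X = 0 and arises as such a w(0). -/
theorem span_range_torsionCocycles (hDD' : D * D' = 0) (hD'D : D' * D = 0)
    (hπδ : π * zeroMat L D = 0)
    (hcyc : ∀ w, (zeroMat L D).mulVec w = 0 → ∃ y, w = π'.mulVec w + (zeroMat L D').mulVec y)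
    (hδπ' : zeroMat L D * π' = 0) (hbπ' : b * π' = b)
    (hb : b = -(π * (D.map (coeff (R := W) 1)).map (algebraMap W L) * π')) :
    Submodule.span L (Set.range fun z : torsionCocycles D D' =>
      π.mulVec (vecZero ι L (z : ι → W⟦X⟧))) = LinearMap.range b.mulVecLin := by
  refine le_antisymm (Submodule.span_le.2 ?_) ?_
  · rintro _ ⟨⟨z, hz, w, hw⟩, rfl⟩
    refine ⟨-vecZero ι L w, ?_⟩
    simp only [Matrix.mulVecLin_apply]
    rw [mulVec_vecZero_eq hDD' hπδ hcyc hb hw, Matrix.mulVec_neg]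
  · rintro _ ⟨x, rfl⟩
    obtain ⟨a, y, ha, hy⟩ := exists_vec_eq_smul W (π'.mulVec x)
    have ha' : algebraMap W L a ≠ 0 := fun h0 =>
      ha (IsFractionRing.injective W L (h0.trans (map_zero _).symm))
    have hy0 : (D.map (constantCoeff (R := W))).mulVec y = 0 := by
      refine vecMap_algebraMap_injective (L := L) ?_
      rw [vecMap_mulVec, hy, Matrix.mulVec_smul, Matrix.mulVec_mulVec, hδπ', Matrix.zero_mulVec,
        smul_zero, map_zero]
    obtain ⟨z, hz, -⟩ := exists_mulVec_eq_X_smul (t₁ := 0) hy0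
    have hz' : D'.mulVec z = 0 := by
      refine X_smul_vec_injective ?_
      simp only
      rw [← Matrix.mulVec_smul, ← hz, Matrix.mulVec_mulVec, hD'D, Matrix.zero_mulVec, smul_zero]
    have h1 := mulVec_vecZero_eq hDD' hπδ hcyc hb hz
    have h2 : vecZero ι L (vecMap ι C y + (X : W⟦X⟧) • vecMap ι C 0) =
        algebraMap W L a • π'.mulVec x := by
      rw [← hy, map_zero, smul_zero, add_zero, vecZero_eq, vecMap_C]
    rw [h2, Matrix.mulVec_smul, Matrix.mulVec_mulVec, hbπ'] at h1
    have h3 : b.mulVecLin x = (-(algebraMap W L a)⁻¹) • π.mulVec (vecZero ι L z) := by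
      rw [h1, smul_neg, neg_smul, neg_neg, smul_smul, inv_mul_cancel₀ ha', one_smul,
        Matrix.mulVecLin_apply]
    rw [h3]
    exact Submodule.smul_mem _ _ (Submodule.subset_span ⟨⟨z, hz', _, hz⟩, rfl⟩)

/-- A class killed by `X` whose image vanishes is torsion. -/
theorem exists_smul_eq_mulVec (hDD' : D * D' = 0) (hD'D : D' * D = 0)
    (hcyc : ∀ z, (zeroMat L D').mulVec z = 0 → ∃ y, z = π.mulVec z + (zeroMat L D).mulVec y)
    (hex : BockExact D' D) {z : ι → W⟦X⟧} (hz : z ∈ torsionCocycles D D')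
    (h0 : π.mulVec (vecZero ι L z) = 0) :
    ∃ (a : W) (v : ι → W⟦X⟧), a ≠ 0 ∧ (C a : W⟦X⟧) • z = D.mulVec v := by
  obtain ⟨hz, w, hw⟩ := hz
  obtain ⟨y, hy⟩ := hcyc (vecZero ι L z) (by rw [← vecZero_mulVec, hz, map_zero])
  rw [h0, zero_add] at hy
  obtain ⟨a, v₀, ha, hv₀⟩ := exists_vec_eq_smul W y
  have hav : a • vecMap ι constantCoeff z = (D.map (constantCoeff (R := W))).mulVec v₀ := by
    refine vecMap_algebraMap_injective (L := L) ?_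
    rw [vecMap_mulVec, hv₀, Matrix.mulVec_smul, ← hy, vecZero_eq]
    exact LinearMap.map_smulₛₗ (vecMap ι (algebraMap W L)) a _
  obtain ⟨u, hu, -⟩ := exists_vec_eq_X_smul
    (v := (C a : W⟦X⟧) • z - D.mulVec (vecMap ι C v₀)) (fun i => by
      have h1 := congrFun hav i
      have h2 := congrFun (vecMap_mulVec (constantCoeff (R := W)) D (vecMap ι C v₀)) i
      rw [vecMap_C, ← h1, vecMap_apply] at h2
      rw [Pi.sub_apply, map_sub, h2]
      simp [vecMap_apply])
  -- After subtracting the constant primitive, D maps w' to a multiple of X². So w'(0) has trivial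
  -- Bockstein image, and exactness makes a multiple of it a Bockstein image itself.
  have hw' : D.mulVec ((C a : W⟦X⟧) • w - (X : W⟦X⟧) • vecMap ι C v₀) =
      (X : W⟦X⟧) • (X : W⟦X⟧) • u := by
    rw [← hu, Matrix.mulVec_sub, Matrix.mulVec_smul, Matrix.mulVec_smul, hw, smul_sub, smul_comm]
  set w' := (C a : W⟦X⟧) • w - (X : W⟦X⟧) • vecMap ι C v₀
  obtain ⟨hw0, hw1⟩ := constantCoeff_of_mulVec_eq hw'
  obtain ⟨a', t₀, t₁, ha', ht₀, ht₁⟩ := hex _ hw0 ⟨_, hw1.symm.trans (by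
    ext i; simp [vecMap_apply])⟩
  obtain ⟨u₂, hu₂, hu₂'⟩ := exists_mulVec_eq_X_smul (t₁ := t₁) ht₀
  -- The cocycle u₂ has the same constant term as a'·w'. Dividing the difference by X gives q with
  -- Dq = a'Xu, the missing part of the primitive of a'a·z.
  obtain ⟨q, hq, -⟩ := exists_vec_eq_X_smul (v := (C a' : W⟦X⟧) • w' - u₂) (fun i => by
    have h1 := congrFun (hu₂'.trans ht₁) i
    rw [vecMap_apply] at h1
    rw [Pi.sub_apply, map_sub, h1]
    simp [vecMap_apply])
  have hDu₂ : D.mulVec u₂ = 0 := by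
    refine X_smul_vec_injective ?_
    simp only
    rw [← Matrix.mulVec_smul, ← hu₂, Matrix.mulVec_mulVec, hDD', Matrix.zero_mulVec, smul_zero]
  have hDq : D.mulVec q = (C a' : W⟦X⟧) • (X : W⟦X⟧) • u := by
    refine X_smul_vec_injective ?_
    simp only
    rw [← Matrix.mulVec_smul, ← hq, Matrix.mulVec_sub, Matrix.mulVec_smul, hw', hDu₂, sub_zero,
      smul_comm]
  refine ⟨a' * a, (C a' : W⟦X⟧) • vecMap ι C v₀ + q, mul_ne_zero ha' ha, ?_⟩
  rw [Matrix.mulVec_add, Matrix.mulVec_smul, hDq, ← hu, ← smul_add, add_sub_cancel, smul_smul,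
    ← map_mul]

end BocksteinRank

/-! ### Ranks after tensoring with the fraction field -/

section TensorRank

variable {W L : Type*} [CommRing W] [IsDomain W] [Field L] [Algebra W L] [IsFractionRing W L]

/-- Up to a nonzero scalar every element of L ⊗ N has the form 1 ⊗ n, so injectivity only concerns
the kernel of κ, and torsion dies in the tensor product. -/
theorem tensor_injective_of_ker_torsion {N V : Type*} [AddCommGroup N] [Module W N]
    [AddCommGroup V] [Module L V] [Module W V] [IsScalarTower W L V] (κ : N →ₗ[W] V)
    (h : ∀ n, κ n = 0 → ∃ a : W, a ≠ 0 ∧ a • n = 0) :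
    Function.Injective (LinearMap.liftBaseChange L κ) := by
  rw [injective_iff_map_eq_zero]
  intro t ht
  obtain ⟨⟨n, a⟩, hna⟩ := IsLocalizedModule.surj (nonZeroDivisors W)
    (TensorProduct.mk W L N 1) t
  have ha : algebraMap W L (a : W) ≠ 0 :=
    IsFractionRing.to_map_ne_zero_of_mem_nonZeroDivisors a.2
  have hna' : algebraMap W L (a : W) • t = (1 : L) ⊗ₜ[W] n := by
    rw [algebraMap_smul]; exact hna
  have h1 : κ n = 0 := by
    have := congrArg (LinearMap.liftBaseChange L κ) hna'
    rw [map_smul, ht, smul_zero, LinearMap.liftBaseChange_tmul, one_smul] at this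
    exact this.symm
  obtain ⟨c, hc, hcn⟩ := h n h1
  have hc' : algebraMap W L c ≠ 0 := fun h0 =>
    hc (IsFractionRing.injective W L (h0.trans (map_zero _).symm))
  have h2 : algebraMap W L c • algebraMap W L (a : W) • t = 0 := by
    rw [hna', algebraMap_smul, ← TensorProduct.tmul_smul, hcn, TensorProduct.tmul_zero]
  exact (smul_eq_zero_iff_right ha).1 ((smul_eq_zero_iff_right hc').1 h2)

/-- The rank of a module `N` over a domain, computed through a group `M` that maps onto `N` and
maps to a vector space with the same kernel up to torsion. -/
theorem finrank_tensor_eq {M N V : Type*} [AddCommGroup M] [AddCommGroup N] [Module W N]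
    [AddCommGroup V] [Module L V] [Module.Finite L V] (μ : M →+ N) (κ : M →+ V)
    (hμ : Function.Surjective μ)
    (hsmul : ∀ (a : W) (m : M), ∃ m', μ m' = a • μ m ∧ κ m' = algebraMap W L a • κ m)
    (hker : ∀ m, μ m = 0 → κ m = 0) (htors : ∀ m, κ m = 0 → ∃ a : W, a ≠ 0 ∧ a • μ m = 0) :
    Module.Finite L (L ⊗[W] N) ∧
      Module.finrank L (L ⊗[W] N) = Module.finrank L (Submodule.span L (Set.range κ)) := by
  let _ : Module W V := Module.compHom V (algebraMap W L)
  have : IsScalarTower W L V := IsScalarTower.of_algebraMap_smul fun a v => rfl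
  -- By `hker`, κ depends only on the image under μ, so an arbitrary section of μ yields a linear
  -- map.
  choose σ hσ using hμ
  have hκσ : ∀ m, κ (σ (μ m)) = κ m := fun m => by
    rw [← sub_eq_zero, ← map_sub]
    exact hker _ (by rw [map_sub, hσ, sub_self])
  let κ' : N →ₗ[W] V :=
    { toFun := fun n => κ (σ n)
      map_add' := fun n n' => by
        rw [← map_add, ← hκσ (σ n + σ n'), map_add μ, hσ, hσ]
      map_smul' := fun a n => by
        obtain ⟨m', h1, h2⟩ := hsmul a (σ n)
        rw [hσ] at h1
        rw [← h1, hκσ, h2, RingHom.id_apply]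
        rfl }
  have hinj : Function.Injective (LinearMap.liftBaseChange L κ') :=
    tensor_injective_of_ker_torsion κ' fun n hn => by
      obtain ⟨a, ha, h⟩ := htors (σ n) hn
      exact ⟨a, ha, by rwa [hσ] at h⟩
  have hrange : LinearMap.range (LinearMap.liftBaseChange L κ') =
      Submodule.span L (Set.range κ) := by
    refine le_antisymm ?_ (Submodule.span_le.2 ?_)
    · rintro _ ⟨t, rfl⟩
      induction t using TensorProduct.induction_on with
      | zero => rw [map_zero]; exact Submodule.zero_mem _
      | tmul x n =>
        rw [LinearMap.liftBaseChange_tmul]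
        exact Submodule.smul_mem _ _ (Submodule.subset_span ⟨σ n, rfl⟩)
      | add t t' h h' => rw [map_add]; exact Submodule.add_mem _ h h'
    · rintro _ ⟨m, rfl⟩
      exact ⟨1 ⊗ₜ μ m, by rw [LinearMap.liftBaseChange_tmul, one_smul]; exact hκσ m⟩
  refine ⟨Module.Finite.of_injective _ hinj, ?_⟩
  rw [← hrange, LinearMap.finrank_range_of_inj hinj]

theorem finrank_tensor_pi {J : Type*} [Fintype J] (N : J → Type*) [∀ j, AddCommGroup (N j)]
    [∀ j, Module W (N j)] [Module.Finite L (L ⊗[W] (∀ j, N j))] :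
    Module.finrank L (L ⊗[W] (∀ j, N j)) = ∑ j, Module.finrank L (L ⊗[W] N j) := by
  classical
  have : ∀ j, Module.Finite L (L ⊗[W] N j) := fun j => by
    refine Module.Finite.of_surjective ((LinearMap.proj j : (∀ j, N j) →ₗ[W] N j).baseChange L) ?_
    refine LinearMap.lTensor_surjective L (g := (LinearMap.proj j : (∀ j, N j) →ₗ[W] N j)) ?_
    exact LinearMap.proj_surjective j
  rw [(TensorProduct.piRight W L L N).finrank_eq, Module.finrank_pi_fintype]

end TensorRank

/-! ### A common description of the odd and the even part -/

section Folding

open CategoryTheory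

variable {R : Type*} [Ring R]

/-- One parity of the folding of a complex: `T` is the sum of the terms of one parity and of a free
module, with the differentials `d : S → T` and `d' : T → S`. -/
structure Folding (A : CochainComplex (ModuleCat R) ℤ) {S T : Type*} [AddCommGroup S] [Module R S]
    [AddCommGroup T] [Module R T] (par : ℤ → Prop) (N : ℤ) (d : S →ₗ[R] T) (d' : T →ₗ[R] S) where
  inS (i : ℤ) : A.X i →ₗ[R] S
  prS (i : ℤ) : S →ₗ[R] A.X i
  inT (i : ℤ) : A.X i →ₗ[R] T
  prT (i : ℤ) : T →ₗ[R] A.X i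
  prT_inT (i : ℤ) : par i → prT i ∘ₗ inT i = LinearMap.id
  prT_inT_of_ne (i j : ℤ) : i ≠ j → prT i ∘ₗ inT j = 0
  inT_eq_zero (i : ℤ) : ¬ par i → inT i = 0
  d_inS (i j : ℤ) : i + 1 = j → d ∘ₗ inS i = inT j ∘ₗ diff A i j
  d'_inT (i j : ℤ) : i + 1 = j → d' ∘ₗ inT i = inS j ∘ₗ diff A i j
  prT_d (i j : ℤ) : i + 1 = j → prT j ∘ₗ d = diff A i j ∘ₗ prS i
  prS_d' (i j : ℤ) : i + 1 = j → prS j ∘ₗ d' = diff A i j ∘ₗ prT i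
  -- The free summand is acyclic: it enters the decomposition either as a boundary d∘u or through
  -- v∘d', which vanishes on cocycles.
  u : T →ₗ[R] S
  v : S →ₗ[R] T
  decomp : ∑ i ∈ Finset.Icc (-N) N, inT i ∘ₗ prT i + d ∘ₗ u + v ∘ₗ d' = LinearMap.id

variable {A : CochainComplex (ModuleCat R) ℤ} {k : ℕ} {N : ℤ}

/-- The odd part. -/
def oddFolding (hN : ∀ i, N < |i| → Subsingleton (A.X i)) :
    Folding A Odd N (dEven A k) (dOdd A k) where
  inS := evenIn A k
  prS := evenPr A k
  inT := oddIn A k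
  prT := oddPr A k
  prT_inT i h := oddPr_oddIn_self h
  prT_inT_of_ne i j h := oddPr_oddIn_of_ne h
  inT_eq_zero i h := by simp [oddIn, h]
  d_inS i j h := dEven_evenIn h
  d'_inT i j h := dOdd_oddIn h
  prT_d i j h := oddPr_dEven h
  prS_d' i j h := evenPr_dOdd h
  u := 0
  v := oddInFree A k ∘ₗ evenPrFree A k
  decomp := by
    rw [LinearMap.comp_zero, add_zero, LinearMap.comp_assoc, evenPrFree_dOdd, sum_oddIn_oddPr hN]

/-- The even part. -/
def evenFolding (hN : ∀ i, N < |i| → Subsingleton (A.X i)) :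
    Folding A Even N (dOdd A k) (dEven A k) where
  inS := oddIn A k
  prS := oddPr A k
  inT := evenIn A k
  prT := evenPr A k
  prT_inT i h := evenPr_evenIn_self h
  prT_inT_of_ne i j h := evenPr_evenIn_of_ne h
  inT_eq_zero i h := by simp [evenIn, h]
  d_inS i j h := dOdd_oddIn h
  d'_inT i j h := dEven_evenIn h
  prT_d i j h := evenPr_dOdd h
  prS_d' i j h := oddPr_dEven h
  u := oddInFree A k ∘ₗ evenPrFree A k
  v := 0
  decomp := by
    rw [LinearMap.zero_comp, add_zero, ← LinearMap.comp_assoc, dOdd_oddInFree,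
      sum_evenIn_evenPr hN]

end Folding

/-! ### From the Bockstein condition in each degree to the folded complex -/

section FoldedBockstein

open PowerSeries CategoryTheory

variable {R : Type*} [Ring R] {W : Type*} [CommRing W] {m : Type*} [Fintype m] [DecidableEq m]
  (Φ : R →+* Matrix m m W⟦X⟧)

section Properties

variable {Φ} {P P' M M' : Type*} [AddCommGroup P] [Module R P] [AddCommGroup P'] [Module R P']
  [AddCommGroup M] [Module R M] [AddCommGroup M'] [Module R M']

local notation "Bock" => BockRel (specAct Φ (constantCoeff (R := W))) (epsAct Φ)

theorem bockRel_naturality {f : P →ₗ[R] P'} {g : M →ₗ[R] M'} {α : P →ₗ[R] M} {α' : P' →ₗ[R] M'}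
    (hα : α' ∘ₗ f = g ∘ₗ α) {x : BalTensor (specAct Φ (constantCoeff (R := W))) P}
    {y : BalTensor (specAct Φ (constantCoeff (R := W))) P'} (h : Bock f x y) :
    Bock g (BalTensor.map _ α x) (BalTensor.map _ α' y) := by
  rw [bockRel_iff] at h ⊢
  obtain ⟨t, u, rfl, rfl, h⟩ := h
  refine ⟨BalTensor.map _ α t, BalTensor.map _ α' u, specMap_map _ _ _ _, specMap_map _ _ _ _, ?_⟩
  rw [BalTensor.map_map, ← hα, ← BalTensor.map_map, h, map_neg, map_smul]

theorem bockRel_add {f : P →ₗ[R] P'} {x x' : BalTensor (specAct Φ (constantCoeff (R := W))) P}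
    {y y' : BalTensor (specAct Φ (constantCoeff (R := W))) P'} (h : Bock f x y)
    (h' : Bock f x' y') : Bock f (x + x') (y + y') := by
  rw [bockRel_iff] at h h' ⊢
  obtain ⟨t, u, rfl, rfl, h⟩ := h
  obtain ⟨t', u', rfl, rfl, h'⟩ := h'
  exact ⟨t + t', u + u', map_add _ _ _, map_add _ _ _, by rw [map_add, h, h', smul_add, neg_add]⟩

theorem bockRel_smul (c : W) {f : P →ₗ[R] P'}
    {x : BalTensor (specAct Φ (constantCoeff (R := W))) P}
    {y : BalTensor (specAct Φ (constantCoeff (R := W))) P'} (h : Bock f x y) :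
    Bock f (c • x) (c • y) := by
  rw [bockRel_iff] at h ⊢
  obtain ⟨t, u, rfl, rfl, h⟩ := h
  refine ⟨(C c : W⟦X⟧) • t, (C c : W⟦X⟧) • u, ?_, ?_, ?_⟩
  · rw [LinearMap.map_smulₛₗ, constantCoeff_C]
  · rw [LinearMap.map_smulₛₗ, constantCoeff_C]
  · rw [map_smul, h, smul_neg, smul_comm]

theorem bockRel_map (f : P →ₗ[R] P') (x : BalTensor (specAct Φ (constantCoeff (R := W))) P) :
    Bock f 0 (BalTensor.map _ f x) := by
  rw [bockRel_iff]
  obtain ⟨t, rfl⟩ := redX_surjective Φ x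
  refine ⟨-((X : W⟦X⟧) • t), BalTensor.map _ f t, ?_, specMap_map _ _ _ _, ?_⟩
  · rw [map_neg, redX_smul_X, neg_zero]
  · rw [map_neg, map_smul]

theorem bockRel_zero (f : P →ₗ[R] P') : Bock f 0 0 := by
  simpa using bockRel_map (Φ := Φ) f 0

theorem bockRel_sum {κ : Type*} (s : Finset κ) {f : P →ₗ[R] P'}
    {x : κ → BalTensor (specAct Φ (constantCoeff (R := W))) P}
    {y : κ → BalTensor (specAct Φ (constantCoeff (R := W))) P'} (h : ∀ i ∈ s, Bock f (x i) (y i)) :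
    Bock f (∑ i ∈ s, x i) (∑ i ∈ s, y i) := by
  classical
  induction s using Finset.induction_on with
  | empty => simpa using bockRel_zero f
  | insert i s hi ih =>
    rw [Finset.sum_insert hi, Finset.sum_insert hi]
    exact bockRel_add (h i (Finset.mem_insert_self _ _))
      (ih fun j hj => h j (Finset.mem_insert_of_mem hj))

end Properties

variable {A : CochainComplex (ModuleCat R) ℤ} {S T : Type*} [AddCommGroup S] [Module R S]
    [AddCommGroup T] [Module R T] {par : ℤ → Prop} {N : ℤ} {d : S →ₗ[R] T} {d' : T →ₗ[R] S}

theorem Folding.map_decomp (F : Folding A par N d d') {W' Y : Type*} [Ring W'] [AddCommGroup Y]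
    [Module W' Y] (act : R → Module.End W' Y) (x : BalTensor act T) :
    x = ∑ i ∈ Finset.Icc (-N) N, BalTensor.map act (F.inT i) (BalTensor.map act (F.prT i) x) +
      BalTensor.map act d (BalTensor.map act F.u x) +
      BalTensor.map act F.v (BalTensor.map act d' x) := by
  conv_lhs => rw [← LinearMap.id_apply (R := W') x, ← BalTensor.map_id act, ← F.decomp]
  simp only [BalTensor.map_add, BalTensor.map_sum, LinearMap.add_apply, LinearMap.sum_apply,
    BalTensor.map_map]

/-- The cohomology of the Bockstein maps of a complex is killed by powers of `c`. -/
def BockTorsion (A : CochainComplex (ModuleCat R) ℤ) (c : W) : Prop :=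
  ∀ (i : ℤ) (x : BalTensor (specAct Φ (constantCoeff (R := W))) (A.X i)),
    BalTensor.map (specAct Φ (constantCoeff (R := W))) (diff A i (i + 1)) x = 0 →
    BockRel (specAct Φ (constantCoeff (R := W))) (epsAct Φ) (diff A i (i + 1)) x 0 →
    ∃ (N : ℕ) (w : BalTensor (specAct Φ (constantCoeff (R := W))) (A.X (i - 1))),
      BalTensor.map (specAct Φ (constantCoeff (R := W))) (diff A (i - 1) i) w = 0 ∧
      BockRel (specAct Φ (constantCoeff (R := W))) (epsAct Φ) (diff A (i - 1) i) w (c ^ N • x)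

variable {Φ}

/-- Components of a Bockstein cocycle are Bockstein cocycles in each degree, so the hypothesis
applies to them separately. The free summand contributes a boundary, which is Bockstein-related to
0. -/
theorem BockTorsion.folded {c : W} (h : BockTorsion Φ A c) (F : Folding A par N d d')
    {x : BalTensor (specAct Φ (constantCoeff (R := W))) T} (hx : BalTensor.map _ d' x = 0)
    (hx' : BockRel (specAct Φ (constantCoeff (R := W))) (epsAct Φ) d' x 0) :
    ∃ (k : ℕ) (w : BalTensor (specAct Φ (constantCoeff (R := W))) S),
      BalTensor.map _ d w = 0 ∧
      BockRel (specAct Φ (constantCoeff (R := W))) (epsAct Φ) d w (c ^ k • x) := by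
  have key : ∀ i : ℤ, ∃ (k : ℕ) (w : BalTensor (specAct Φ (constantCoeff (R := W))) S),
      BalTensor.map _ d w = 0 ∧
      BockRel (specAct Φ (constantCoeff (R := W))) (epsAct Φ) d w
        (c ^ k • BalTensor.map _ (F.inT i) (BalTensor.map _ (F.prT i) x)) := fun i => by
    obtain ⟨k, w, hw, hw'⟩ := h i (BalTensor.map _ (F.prT i) x)
      (by rw [BalTensor.map_map, ← F.prS_d' i (i + 1) rfl, ← BalTensor.map_map, hx, map_zero])
      (by simpa using bockRel_naturality (F.prS_d' i (i + 1) rfl) hx')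
    refine ⟨k, BalTensor.map _ (F.inS (i - 1)) w, ?_, ?_⟩
    · rw [BalTensor.map_map, F.d_inS (i - 1) i (by ring), ← BalTensor.map_map, hw, map_zero]
    · rw [← map_smul]
      exact bockRel_naturality (F.d_inS (i - 1) i (by ring)).symm hw'
  choose k w hw hw' using key
  -- The sum of the exponents serves as a common upper bound for them.
  set K := ∑ i ∈ Finset.Icc (-N) N, k i
  have hk : ∀ i ∈ Finset.Icc (-N) N, k i ≤ K := fun i hi =>
    Finset.single_le_sum (f := k) (fun _ _ => Nat.zero_le _) hi
  refine ⟨K, ∑ i ∈ Finset.Icc (-N) N, c ^ (K - k i) • w i, ?_, ?_⟩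
  · rw [map_sum]
    exact Finset.sum_eq_zero fun i _ => by rw [map_smul, hw, smul_zero]
  · have h1 := bockRel_sum (Finset.Icc (-N) N) fun i _ => bockRel_smul (c ^ (K - k i)) (hw' i)
    have h2 := bockRel_add h1 (bockRel_smul (c ^ K) (bockRel_map (Φ := Φ) d
      (BalTensor.map _ F.u x)))
    rw [smul_zero, add_zero] at h2
    convert h2 using 1
    conv_lhs => rw [F.map_decomp _ x, hx, map_zero, add_zero, smul_add, Finset.smul_sum]
    congr 1
    refine Finset.sum_congr rfl fun i hi => ?_
    rw [smul_smul, ← pow_add, Nat.sub_add_cancel (hk i hi)]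

/-- The coordinate form of the Bockstein relation carries a sign, which is absorbed into −w and −w₁.
-/
theorem BockTorsion.bockExact [IsDomain W] {ι : Type*} [Fintype ι] [DecidableEq ι] {c : W}
    (hc : c ≠ 0) (h : BockTorsion Φ A c) (F : Folding A par N d d')
    (BS : Module.Basis ι W⟦X⟧ (BalTensor (rowAct Φ) S))
    (BT : Module.Basis ι W⟦X⟧ (BalTensor (rowAct Φ) T)) :
    BockExact (LinearMap.toMatrix BS BT (BalTensor.map _ d))
      (LinearMap.toMatrix BT BS (BalTensor.map _ d')) := by
  intro x hx ⟨x₁, hx₁⟩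
  set y := (specBasis BT (constantCoeff (R := W))).equivFun.symm x with hy
  have hyx : (specBasis BT (constantCoeff (R := W))).equivFun y = x :=
    LinearEquiv.apply_symm_apply _ _
  have h1 : BalTensor.map _ d' y = 0 := by
    refine (specBasis BS (constantCoeff (R := W))).equivFun.injective ?_
    rw [toMatrix_mulVec_equivFun (specBasis BT constantCoeff), specBasis_toMatrix, hyx, hx,
      map_zero]
  obtain ⟨k, w, hw, hw'⟩ := h.folded F h1 ((bockRel_iff_mulVec BT BS d' y 0).2
    ⟨by rw [hyx, hx], x₁, by rw [hyx, hx₁, neg_zero, map_zero]⟩)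
  obtain ⟨hw0, w₁, hw₁⟩ := (bockRel_iff_mulVec BS BT d w _).1 hw'
  refine ⟨c ^ k, -(specBasis BS constantCoeff).equivFun w, -w₁, pow_ne_zero _ hc, ?_, ?_⟩
  · rw [Matrix.mulVec_neg, hw0, neg_zero]
  · rw [Matrix.mulVec_neg, Matrix.mulVec_neg, ← neg_add, ← hw₁, map_smul, hyx]

end FoldedBockstein

/-! ### Cohomology classes killed by X -/

section InvariantClasses

open PowerSeries CategoryTheory

variable {R : Type*} [Ring R] {W Y : Type*} [CommRing W] [AddCommGroup Y] [Module W⟦X⟧ Y]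
  (act : R → Module.End W⟦X⟧ Y) (A : CochainComplex (ModuleCat R) ℤ)

/-- The cohomology of `Y ⊗_R A`. -/
abbrev CohX (i : ℤ) : Type _ :=
  ↥(LinearMap.ker (BalTensor.map act (diff A i (i + 1)))) ⧸
    (LinearMap.range (BalTensor.map act (diff A (i - 1) i))).submoduleOf
      (LinearMap.ker (BalTensor.map act (diff A i (i + 1))))

/-- The classes killed by `X`. -/
def InvX (i : ℤ) : Type _ := ↥(Submodule.torsionBy W⟦X⟧ (CohX act A i) X)

instance (i : ℤ) : AddCommGroup (InvX act A i) :=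
  inferInstanceAs (AddCommGroup ↥(Submodule.torsionBy W⟦X⟧ (CohX act A i) X))

instance (i : ℤ) : Module W⟦X⟧ (InvX act A i) :=
  inferInstanceAs (Module W⟦X⟧ ↥(Submodule.torsionBy W⟦X⟧ (CohX act A i) X))

instance (i : ℤ) : Module W (InvX act A i) := Module.compHom _ (C : W →+* W⟦X⟧)

variable {act A} {i : ℤ}

/-- The class killed by `X` of a cocycle. -/
def invMk (z : BalTensor act (A.X i)) (hz : BalTensor.map act (diff A i (i + 1)) z = 0)
    (hX : ∃ w, BalTensor.map act (diff A (i - 1) i) w = (X : W⟦X⟧) • z) : InvX act A i :=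
  ⟨Submodule.Quotient.mk ⟨z, hz⟩, by
    rw [Submodule.mem_torsionBy_iff, ← Submodule.Quotient.mk_smul, Submodule.Quotient.mk_eq_zero]
    obtain ⟨w, hw⟩ := hX
    exact ⟨w, hw⟩⟩

theorem invMk_eq_zero {z : BalTensor act (A.X i)}
    {hz : BalTensor.map act (diff A i (i + 1)) z = 0}
    {hX : ∃ w, BalTensor.map act (diff A (i - 1) i) w = (X : W⟦X⟧) • z} :
    invMk z hz hX = 0 ↔ ∃ v, BalTensor.map act (diff A (i - 1) i) v = z := by
  refine (Submodule.coe_eq_zero (p := Submodule.torsionBy W⟦X⟧ (CohX act A i) X)).symm.trans ?_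
  change Submodule.Quotient.mk _ = 0 ↔ _
  rw [Submodule.Quotient.mk_eq_zero]
  rfl

theorem exists_eq_invMk (c : InvX act A i) : ∃ z hz hX, c = invMk z hz hX := by
  obtain ⟨c, hc⟩ := c
  obtain ⟨⟨z, hz⟩, rfl⟩ := Submodule.Quotient.mk_surjective _ c
  rw [Submodule.mem_torsionBy_iff, ← Submodule.Quotient.mk_smul,
    Submodule.Quotient.mk_eq_zero] at hc
  obtain ⟨w, hw⟩ := hc
  exact ⟨z, hz, ⟨w, hw⟩, rfl⟩

theorem smul_invMk (a : W) (z : BalTensor act (A.X i)) (hz hX hz' hX') :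
    a • invMk z hz hX = invMk ((C a : W⟦X⟧) • z) hz' hX' := rfl

theorem invMk_congr {z z' : BalTensor act (A.X i)} (h : z = z') {hz hX hz' hX'} :
    invMk z hz hX = invMk z' hz' hX' := by subst h; rfl

theorem subsingleton_invX [Subsingleton (A.X i)] : Subsingleton (InvX act A i) := by
  refine ⟨fun c c' => ?_⟩
  have h : ∀ c : InvX act A i, c = 0 := fun c => by
    obtain ⟨z, hz, hX, rfl⟩ := exists_eq_invMk c
    refine invMk_eq_zero.2 ⟨0, ?_⟩
    rw [map_zero]
    exact (congrFun (congrArg DFunLike.coe (BalTensor.map_id act)) z).symm.trans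
      (by rw [Subsingleton.elim (LinearMap.id : A.X i →ₗ[R] A.X i) 0, BalTensor.map_zero,
        LinearMap.zero_apply]) |>.symm
  rw [h c, h c']

end InvariantClasses

/-! ### Ranks of the classes killed by X in one parity -/

section FoldedRank

open PowerSeries CategoryTheory

variable {R : Type*} [Ring R] {W : Type*} [CommRing W] {m : Type*} [Fintype m] [DecidableEq m]
  {Φ : R →+* Matrix m m W⟦X⟧}
  {A : CochainComplex (ModuleCat R) ℤ} {S T : Type*} [AddCommGroup S] [Module R S]
  [AddCommGroup T] [Module R T] {par : ℤ → Prop} {N : ℤ} {d : S →ₗ[R] T} {d' : T →ₗ[R] S}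
  {ι : Type*} [Fintype ι] [DecidableEq ι]
  (BS : Module.Basis ι W⟦X⟧ (BalTensor (rowAct Φ) S))
  (BT : Module.Basis ι W⟦X⟧ (BalTensor (rowAct Φ) T))

local notation "DM" => LinearMap.toMatrix BS BT (BalTensor.map (rowAct Φ) d)
local notation "DN" => LinearMap.toMatrix BT BS (BalTensor.map (rowAct Φ) d')

theorem map_equivFun_symm (z : ι → W⟦X⟧) :
    BalTensor.map _ d' (BT.equivFun.symm z) = BS.equivFun.symm ((DN).mulVec z) := by
  rw [LinearEquiv.eq_symm_apply, toMatrix_mulVec_equivFun BT BS, LinearEquiv.apply_symm_apply]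

theorem Folding.pr_cocycle (F : Folding A par N d d') {z : ι → W⟦X⟧}
    (hz : z ∈ torsionCocycles (DM) (DN)) (i : ℤ) :
    BalTensor.map (rowAct Φ) (diff A i (i + 1))
      (BalTensor.map _ (F.prT i) (BT.equivFun.symm z)) = 0 ∧
    ∃ w, BalTensor.map (rowAct Φ) (diff A (i - 1) i) w =
      (X : W⟦X⟧) • BalTensor.map _ (F.prT i) (BT.equivFun.symm z) := by
  obtain ⟨hz, w, hw⟩ := hz
  constructor
  · rw [BalTensor.map_map, ← F.prS_d' i (i + 1) rfl, ← BalTensor.map_map, map_equivFun_symm BS BT,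
      hz, map_zero, map_zero]
  · refine ⟨BalTensor.map _ (F.prS (i - 1)) (BS.equivFun.symm w), ?_⟩
    rw [BalTensor.map_map, ← F.prT_d (i - 1) i (by ring), ← BalTensor.map_map,
      map_equivFun_symm BT BS, hw, map_smul, map_smul]

variable (N par) in
/-- The degrees of one parity in a range. -/
abbrev ParityIcc : Type := {i : ℤ // i ∈ Finset.Icc (-N) N ∧ par i}

/-- The classes in each degree of a cocycle of the folded complex. -/
def Folding.classes (F : Folding A par N d d') :
    torsionCocycles (DM) (DN) →+ ∀ i : ParityIcc par N, InvX (rowAct Φ) A i where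
  toFun z i := invMk (BalTensor.map _ (F.prT i) (BT.equivFun.symm z.1))
    (F.pr_cocycle BS BT z.2 i).1 (F.pr_cocycle BS BT z.2 i).2
  map_zero' := funext fun i => invMk_eq_zero.2 ⟨0, by simp⟩
  map_add' z z' := funext fun i => Subtype.ext <| by
    change Submodule.Quotient.mk _ = Submodule.Quotient.mk _ + Submodule.Quotient.mk _
    rw [← Submodule.Quotient.mk_add]
    congr 1
    refine Subtype.ext ?_
    change BalTensor.map _ _ (BT.equivFun.symm ((z : ι → W⟦X⟧) + z')) = _ + _
    rw [map_add, map_add]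

/-- Representatives in the separate degrees, together with their primitives after multiplication by
X, add up to a cocycle of the folded complex. -/
theorem Folding.classes_surjective [Fintype (ParityIcc par N)] (F : Folding A par N d d') :
    Function.Surjective (F.classes (Φ := Φ) BS BT) := by
  intro c
  choose z hz hX hc using fun i => exists_eq_invMk (c i)
  have hX' := hX
  choose w hw using hX'
  set t : BalTensor (rowAct Φ) T := ∑ i : ParityIcc par N, BalTensor.map _ (F.inT i) (z i) with ht
  have ht' : BalTensor.map _ d' t = 0 := by
    rw [ht, map_sum]
    refine Finset.sum_eq_zero fun i _ => ?_
    rw [BalTensor.map_map, F.d'_inT i (i + 1) rfl, ← BalTensor.map_map, hz, map_zero]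
  have hmem : BT.equivFun t ∈ torsionCocycles (DM) (DN) := by
    refine ⟨?_, BS.equivFun (∑ i : ParityIcc par N,
      BalTensor.map _ (F.inS (i - 1)) (w i)), ?_⟩
    · rw [← toMatrix_mulVec_equivFun BT BS, ht', map_zero]
    · rw [← toMatrix_mulVec_equivFun BS BT, ← map_smul]
      congr 1
      rw [ht, map_sum, Finset.smul_sum]
      refine Finset.sum_congr rfl fun i _ => ?_
      rw [BalTensor.map_map, F.d_inS (i - 1) i (by ring), ← BalTensor.map_map, hw, map_smul]
  refine ⟨⟨_, hmem⟩, funext fun i => ?_⟩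
  · rw [hc i]
    refine invMk_congr (hz := (F.pr_cocycle BS BT hmem i).1)
      (hX := (F.pr_cocycle BS BT hmem i).2) ?_
    rw [LinearEquiv.symm_apply_apply, ht, map_sum, Finset.sum_eq_single i]
    · rw [BalTensor.map_map, F.prT_inT i i.2.2, BalTensor.map_id, LinearMap.id_apply]
    · intro j _ hj
      rw [BalTensor.map_map, F.prT_inT_of_ne i j (fun h => hj (Subtype.ext h.symm)),
        BalTensor.map_zero, LinearMap.zero_apply]
    · exact fun h => absurd (Finset.mem_univ i) h

/-- Primitives in the separate degrees add up to one of the folded cocycle; the free summand is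
covered by the term d∘u. -/
theorem Folding.classes_eq_zero (F : Folding A par N d d') {z : torsionCocycles (DM) (DN)}
    (h : F.classes BS BT z = 0) : ∃ v, (z : ι → W⟦X⟧) = (DM).mulVec v := by
  have h1 : ∀ i : ParityIcc par N, ∃ v, BalTensor.map (rowAct Φ) (diff A (i - 1) i) v =
      BalTensor.map _ (F.prT i) (BT.equivFun.symm z.1) := fun i =>
    (invMk_eq_zero (hz := (F.pr_cocycle BS BT z.2 i).1) (hX := (F.pr_cocycle BS BT z.2 i).2)).1
      (congrFun h i)
  choose v hv using h1
  have h2 : ∀ i ∈ Finset.Icc (-N) N, ∃ v, BalTensor.map (rowAct Φ) d v =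
      BalTensor.map _ (F.inT i) (BalTensor.map _ (F.prT i) (BT.equivFun.symm z.1)) := fun i hi => by
    by_cases hp : par i
    · refine ⟨BalTensor.map _ (F.inS (i - 1)) (v ⟨i, hi, hp⟩), ?_⟩
      rw [← hv ⟨i, hi, hp⟩, BalTensor.map_map, F.d_inS (i - 1) i (by ring), ← BalTensor.map_map]
    · exact ⟨0, by rw [F.inT_eq_zero i hp, BalTensor.map_zero, LinearMap.zero_apply, map_zero]⟩
  choose! v' hv' using h2
  refine ⟨BS.equivFun (∑ i ∈ Finset.Icc (-N) N, v' i +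
    BalTensor.map _ F.u (BT.equivFun.symm z.1)), ?_⟩
  rw [← toMatrix_mulVec_equivFun BS BT, ← LinearEquiv.symm_apply_eq, map_add, map_sum,
    Finset.sum_congr rfl hv']
  conv_lhs => rw [F.map_decomp _ (BT.equivFun.symm z.1), map_equivFun_symm (d' := d') BS BT,
    z.2.1, map_zero, map_zero, add_zero]

theorem Folding.classes_smul (F : Folding A par N d d') (a : W) (z : torsionCocycles (DM) (DN))
    (z' : torsionCocycles (DM) (DN)) (h : (z' : ι → W⟦X⟧) = (C a : W⟦X⟧) • (z : ι → W⟦X⟧)) :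
    F.classes BS BT z' = a • F.classes BS BT z := by
  funext i
  rw [Pi.smul_apply]
  obtain ⟨h1, h2⟩ := F.pr_cocycle BS BT z.2 i
  have h3 : BalTensor.map (rowAct Φ) (diff A i (i + 1))
      ((C a : W⟦X⟧) • BalTensor.map _ (F.prT i) (BT.equivFun.symm z.1)) = 0 := by
    rw [map_smul, h1, smul_zero]
  have h4 : ∃ w, BalTensor.map (rowAct Φ) (diff A (i - 1) i) w = (X : W⟦X⟧) •
      (C a : W⟦X⟧) • BalTensor.map _ (F.prT i) (BT.equivFun.symm z.1) := by
    obtain ⟨w, hw⟩ := h2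
    exact ⟨(C a : W⟦X⟧) • w, by rw [map_smul, hw, smul_comm]⟩
  refine (invMk_congr (hz := (F.pr_cocycle BS BT z'.2 i).1)
    (hX := (F.pr_cocycle BS BT z'.2 i).2) (hz' := h3) (hX' := h4) ?_).trans
    (smul_invMk a _ h1 h2 h3 h4).symm
  rw [h, map_smul, map_smul]

theorem Folding.classes_mulVec (F : Folding A par N d d') (z : torsionCocycles (DM) (DN))
    (v : ι → W⟦X⟧) (h : (z : ι → W⟦X⟧) = (DM).mulVec v) : F.classes BS BT z = 0 := by
  funext i
  refine (invMk_eq_zero (hz := (F.pr_cocycle BS BT z.2 i).1)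
    (hX := (F.pr_cocycle BS BT z.2 i).2)).2 ⟨BalTensor.map _ (F.prS (i - 1)) (BS.equivFun.symm v), ?_⟩
  rw [BalTensor.map_map, ← F.prT_d (i - 1) i (by ring), ← BalTensor.map_map,
    map_equivFun_symm BT BS, h]

variable [IsDomain W] {L : Type*} [Field L] [Algebra W L] [IsFractionRing W L]

/-- Folded cocycles map onto the classes, and also to L^ι by z ↦ πz(0). The second map kills
boundaries, and its kernel consists of torsion classes by exactness of the Bockstein maps. So the
rank is the dimension of its span, which is the image of b. -/
theorem Folding.sum_finrank (F : Folding A par N d d') {π π' b : Matrix ι ι L}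
    (hd'd : d' ∘ₗ d = 0) (hdd' : d ∘ₗ d' = 0) (hπδ : π * zeroMat L (DM) = 0)
    (hcycS : ∀ w, (zeroMat L (DM)).mulVec w = 0 →
      ∃ y, w = π'.mulVec w + (zeroMat L (DN)).mulVec y)
    (hcycT : ∀ z, (zeroMat L (DN)).mulVec z = 0 →
      ∃ y, z = π.mulVec z + (zeroMat L (DM)).mulVec y)
    (hδπ' : zeroMat L (DM) * π' = 0) (hbπ' : b * π' = b)
    (hb : b = -(π * ((DM).map (coeff (R := W) 1)).map (algebraMap W L) * π'))
    (hex : BockExact (DN) (DM)) [Fintype (ParityIcc par N)] :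
    ∑ i : ParityIcc par N, Module.finrank L (L ⊗[W] InvX (rowAct Φ) A i) = b.rank := by
  have hDD' : DM * DN = 0 := by
    rw [← LinearMap.toMatrix_comp, ← BalTensor.map_comp, hdd', BalTensor.map_zero, map_zero]
  have hD'D : DN * DM = 0 := by
    rw [← LinearMap.toMatrix_comp, ← BalTensor.map_comp, hd'd, BalTensor.map_zero, map_zero]
  let κ : torsionCocycles (DM) (DN) →+ (ι → L) :=
    (π.mulVecLin.toAddMonoidHom.comp (vecZero ι L)).comp (AddSubgroup.subtype _)
  have hmem : ∀ (a : W) (z : torsionCocycles (DM) (DN)),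
      (C a : W⟦X⟧) • (z : ι → W⟦X⟧) ∈ torsionCocycles (DM) (DN) := by
    rintro a ⟨z, hz, w, hw⟩
    exact ⟨by rw [Matrix.mulVec_smul, hz, smul_zero], (C a : W⟦X⟧) • w, by
      rw [Matrix.mulVec_smul, hw, smul_comm]⟩
  have hsmul : ∀ (a : W) (z : torsionCocycles (DM) (DN)), ∃ z',
      F.classes BS BT z' = a • F.classes BS BT z ∧ κ z' = algebraMap W L a • κ z := by
    intro a z
    refine ⟨⟨_, hmem a z⟩, F.classes_smul BS BT a z _ rfl, ?_⟩
    change π.mulVec (vecMap ι ((algebraMap W L).comp constantCoeff)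
      ((C a : W⟦X⟧) • (z : ι → W⟦X⟧))) =
        algebraMap W L a • π.mulVec (vecMap ι ((algebraMap W L).comp constantCoeff) (z : ι → W⟦X⟧))
    rw [LinearMap.map_smulₛₗ, Matrix.mulVec_smul, RingHom.comp_apply, constantCoeff_C]
  have hker : ∀ z, F.classes BS BT z = 0 → κ z = 0 := by
    intro z hz
    obtain ⟨v, hv⟩ := F.classes_eq_zero BS BT hz
    change π.mulVec (vecZero ι L (z : ι → W⟦X⟧)) = 0
    rw [hv, vecZero_mulVec, Matrix.mulVec_mulVec, hπδ, Matrix.zero_mulVec]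
  have htors : ∀ z, κ z = 0 → ∃ a : W, a ≠ 0 ∧ a • F.classes BS BT z = 0 := by
    intro z hz
    obtain ⟨a, v, ha, hav⟩ := exists_smul_eq_mulVec hDD' hD'D hcycT hex z.2 hz
    refine ⟨a, ha, ?_⟩
    rw [← F.classes_smul BS BT a z ⟨_, hmem a z⟩ rfl]
    exact F.classes_mulVec BS BT _ v hav
  obtain ⟨hfin, h⟩ := finrank_tensor_eq (W := W) (L := L) (F.classes BS BT) κ
    (F.classes_surjective BS BT) hsmul hker htors
  rw [← finrank_tensor_pi, h, Matrix.rank,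
    ← span_range_torsionCocycles hDD' hD'D hπδ hcycS hδπ' hbπ' hb]
  rfl

end FoldedRank

/-! ### Splittings at semisimple representations and the rank formula -/

section Semisimple

open PowerSeries CategoryTheory

variable {ι W L : Type*} [Fintype ι] [DecidableEq ι] [CommRing W] [IsDomain W] [Field L]
  [Algebra W L] [IsFractionRing W L]

/-- The coefficient of `X` of a matrix, over the fraction field. -/
abbrev oneMat (L : Type*) [Field L] [Algebra W L] (D : Matrix ι ι W⟦X⟧) : Matrix ι ι L :=
  (D.map (coeff (R := W) 1)).map (algebraMap W L)

/-- Clearing the denominators of `x` and `x₁` together preserves the linear relation between them.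
-/
theorem BockExact.exists_over_field {D D₂ : Matrix ι ι W⟦X⟧} (h : BockExact D₂ D) {x x₁ : ι → L}
    (hx : (zeroMat L D).mulVec x = 0)
    (hx₁ : (oneMat L D).mulVec x = (zeroMat L D).mulVec x₁) :
    ∃ w w₁ : ι → L, x = (oneMat L D₂).mulVec w + (zeroMat L D₂).mulVec w₁ ∧
      (zeroMat L D₂).mulVec w = 0 := by
  obtain ⟨a, y, ha, hy⟩ := exists_vec_eq_smul W (Sum.elim x x₁)
  have hy0 : vecMap ι (algebraMap W L) (fun i => y (Sum.inl i)) = algebraMap W L a • x :=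
    funext fun i => congrFun hy (Sum.inl i)
  have hy1 : vecMap ι (algebraMap W L) (fun i => y (Sum.inr i)) = algebraMap W L a • x₁ :=
    funext fun i => congrFun hy (Sum.inr i)
  obtain ⟨b, w, w₁, hb, hw, hw₁⟩ := h (fun i => y (Sum.inl i))
    (vecMap_algebraMap_injective (L := L) (by
      rw [vecMap_mulVec, hy0, Matrix.mulVec_smul, hx, smul_zero, map_zero]))
    ⟨-fun i => y (Sum.inr i), vecMap_algebraMap_injective (L := L) (by
      rw [map_add, vecMap_mulVec, vecMap_mulVec, map_neg, hy0, hy1, Matrix.mulVec_smul,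
        Matrix.mulVec_neg, Matrix.mulVec_smul, hx₁, add_neg_cancel, map_zero])⟩
  have hne : ∀ {c : W}, c ≠ 0 → algebraMap W L c ≠ 0 := fun hc h0 =>
    hc (IsFractionRing.injective W L (h0.trans (map_zero _).symm))
  have e1 : algebraMap W L b • algebraMap W L a • x =
      (oneMat L D₂).mulVec (vecMap ι (algebraMap W L) w) +
        (zeroMat L D₂).mulVec (vecMap ι (algebraMap W L) w₁) := by
    rw [← hy0, ← vecMap_mulVec, ← vecMap_mulVec, ← map_add, hw₁, LinearMap.map_smulₛₗ]
  refine ⟨(algebraMap W L b * algebraMap W L a)⁻¹ • vecMap ι (algebraMap W L) w,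
    (algebraMap W L b * algebraMap W L a)⁻¹ • vecMap ι (algebraMap W L) w₁, ?_, ?_⟩
  · rw [Matrix.mulVec_smul, Matrix.mulVec_smul, ← smul_add, ← e1, smul_smul, smul_smul,
      mul_assoc, inv_mul_cancel₀ (mul_ne_zero (hne hb) (hne ha)), one_smul]
  · rw [Matrix.mulVec_smul, ← vecMap_mulVec, hw, map_zero, smul_zero]

theorem offDiag_mulVec (o e : Matrix ι ι L) (x : ι ⊕ ι → L) :
    (offDiag o e).mulVec x = Sum.elim (e.mulVec (x ∘ Sum.inr)) (o.mulVec (x ∘ Sum.inl)) := by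
  rw [offDiag, Matrix.fromBlocks_mulVec, Matrix.zero_mulVec, Matrix.zero_mulVec, zero_add,
    add_zero]

theorem coeff_relations_over_field {D D' : Matrix ι ι W⟦X⟧} (h : D' * D = 0) :
    zeroMat L D' * zeroMat L D = 0 ∧
    zeroMat L D' * oneMat L D + oneMat L D' * zeroMat L D = 0 ∧
    zeroMat L D' * (D.map (coeff (R := W) 2)).map (algebraMap W L) + oneMat L D' * oneMat L D +
      (D'.map (coeff (R := W) 2)).map (algebraMap W L) * zeroMat L D = 0 := by
  obtain ⟨h0, h1, h2⟩ := coeff_relations h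
  refine ⟨?_, ?_, ?_⟩
  · simpa [Matrix.map_mul] using congrArg (fun M : Matrix ι ι W => M.map (algebraMap W L)) h0
  · simpa [Matrix.map_mul, Matrix.map_add] using
      congrArg (fun M : Matrix ι ι W => M.map (algebraMap W L)) h1
  · simpa [Matrix.map_mul, Matrix.map_add] using
      congrArg (fun M : Matrix ι ι W => M.map (algebraMap W L)) h2

theorem exists_splittingRel_of_bockExact {Do De : Matrix ι ι W⟦X⟧} (hoe : De * Do = 0)
    (heo : Do * De = 0) (ho : BockExact De Do) (he : BockExact Do De) :
    ∃ so se πo πe bo be co ce : Matrix ι ι L,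
      SplittingRel (offDiag (zeroMat L Do) (zeroMat L De)) (offDiag so se) (onDiag πo πe)
        (offDiag bo be) (offDiag co ce) ∧
      offDiag bo be = -(onDiag πo πe * offDiag (oneMat L Do) (oneMat L De) * onDiag πo πe) := by
  obtain ⟨h0, h1, h2⟩ := coeff_relations_over_field (L := L) hoe
  obtain ⟨h0', h1', h2'⟩ := coeff_relations_over_field (L := L) heo
  refine exists_splittingRel
    (β₂ := offDiag ((Do.map (coeff (R := W) 2)).map (algebraMap W L))
      ((De.map (coeff (R := W) 2)).map (algebraMap W L))) ?_ ?_ ?_ fun x hx ⟨x₁, hx₁⟩ => ?_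
  · rw [offDiag_mul, onDiag_eq_zero]
    exact ⟨h0, h0'⟩
  · rw [offDiag_mul, offDiag_mul, onDiag_add, onDiag_eq_zero]
    exact ⟨h1, h1'⟩
  · rw [offDiag_mul, offDiag_mul, offDiag_mul, onDiag_add, onDiag_add, onDiag_eq_zero]
    exact ⟨h2, h2'⟩
  · rw [offDiag_mulVec] at hx
    rw [offDiag_mulVec, offDiag_mulVec] at hx₁
    obtain ⟨wo, wo₁, hwo, hwo'⟩ := he.exists_over_field (x := x ∘ Sum.inr) (x₁ := x₁ ∘ Sum.inr)
      (funext fun i => congrFun hx (Sum.inl i)) (funext fun i => congrFun hx₁ (Sum.inl i))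
    obtain ⟨we, we₁, hwe, hwe'⟩ := ho.exists_over_field (x := x ∘ Sum.inl) (x₁ := x₁ ∘ Sum.inl)
      (funext fun i => congrFun hx (Sum.inr i)) (funext fun i => congrFun hx₁ (Sum.inr i))
    refine ⟨Sum.elim wo we, Sum.elim wo₁ we₁, ?_, ?_⟩
    · rw [offDiag_mulVec, offDiag_mulVec]
      ext (i | i)
      · simpa using congrFun hwe i
      · simpa using congrFun hwo i
    · rw [offDiag_mulVec]
      ext (i | i)
      · simpa using congrFun hwe' i
      · simpa using congrFun hwo' i

variable {R : Type*} [Ring R] {m : Type*} [Fintype m] [DecidableEq m]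
  {Φ : R →+* Matrix m m W⟦X⟧} {A : CochainComplex (ModuleCat R) ℤ} {k : ℕ}
  (Bo : Module.Basis ι W⟦X⟧ (BalTensor (rowAct Φ) (OddPart A k)))
  (Be : Module.Basis ι W⟦X⟧ (BalTensor (rowAct Φ) (EvenPart A k)))

theorem rank_mul_of_mul_mul_eq {b c : Matrix ι ι L} (h : b * (c * b) = b) :
    (c * b).rank = b.rank :=
  le_antisymm (Matrix.rank_mul_le_right _ _) (by
    conv_lhs => rw [← h]
    exact Matrix.rank_mul_le_right _ _)

theorem rank_mul_of_mul_mul_eq' {b c : Matrix ι ι L} (h : b * (c * b) = b) :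
    (b * c).rank = b.rank :=
  le_antisymm (Matrix.rank_mul_le_left _ _) (by
    conv_lhs => rw [← h, ← mul_assoc]
    exact Matrix.rank_mul_le_left _ _)

variable (L) in
/-- The alternating sum of the ranks of the groups of classes killed by `X`. -/
def altRank (Φ : R →+* Matrix m m W⟦X⟧) (A : CochainComplex (ModuleCat R) ℤ) : ℤ :=
  ∑ᶠ i : ℤ, (Int.negOnePow (i + 1) : ℤ) *
    (Module.finrank L (L ⊗[W] InvX (rowAct Φ) A (-i)) : ℤ)

/-- The sign depends only on the parity of the degree, so the substitution i ↦ −i is harmless; odd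
degrees count positively. -/
theorem altRank_eq {N : ℤ} (hN : ∀ i, N < |i| → Subsingleton (A.X i))
    [Fintype (ParityIcc Odd N)] [Fintype (ParityIcc Even N)] :
    altRank L Φ A =
      (∑ i : ParityIcc Odd N, Module.finrank L (L ⊗[W] InvX (rowAct Φ) A i) : ℕ) -
      (∑ i : ParityIcc Even N, Module.finrank L (L ⊗[W] InvX (rowAct Φ) A i) : ℕ) := by
  set f : ℤ → ℤ := fun i => (Module.finrank L (L ⊗[W] InvX (rowAct Φ) A i) : ℤ) with hf
  have hzero : ∀ i, N < |i| → f i = 0 := fun i hi => by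
    have := hN i hi
    have := subsingleton_invX (act := rowAct Φ) (A := A) (i := i)
    have : Subsingleton (L ⊗[W] InvX (rowAct Φ) A i) := inferInstance
    exact congrArg Nat.cast Module.finrank_zero_of_subsingleton
  have h1 : altRank L Φ A = ∑ i ∈ Finset.Icc (-N) N, (Int.negOnePow (i + 1) : ℤ) * f i := by
    have e : altRank L Φ A = ∑ᶠ i : ℤ, (Int.negOnePow (i + 1) : ℤ) * f i := by
      rw [altRank,
        ← finsum_comp_equiv (Equiv.neg ℤ) (f := fun i => (Int.negOnePow (i + 1) : ℤ) * f i)]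
      refine finsum_congr fun i => ?_
      rw [Equiv.neg_apply, (Int.negOnePow_eq_iff (i + 1) (-i + 1)).2 ⟨i, by ring⟩]
    rw [e]
    refine finsum_eq_sum_of_support_subset _ fun i hi => ?_
    by_contra hi'
    refine hi ?_
    simp only
    rw [hzero i, mul_zero]
    by_contra hle
    rw [not_lt, abs_le] at hle
    exact hi' (by simpa using hle)
  have h2 : ∀ par : ℤ → Prop, [DecidablePred par] → [Fintype (ParityIcc par N)] →
      ((∑ i : ParityIcc par N, Module.finrank L (L ⊗[W] InvX (rowAct Φ) A i) : ℕ) : ℤ) =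
        ∑ i ∈ Finset.Icc (-N) N with par i, f i := fun par _ _ => by
    rw [Nat.cast_sum, Finset.sum_subtype (p := fun i => i ∈ Finset.Icc (-N) N ∧ par i)]
    intro i
    rw [Finset.mem_filter]
  rw [h1, h2 Odd, h2 Even, ← Finset.sum_filter_add_sum_filter_not _ Odd, sub_eq_add_neg,
    ← Finset.sum_neg_distrib]
  congr 1
  · refine Finset.sum_congr rfl fun i hi => ?_
    rw [Int.negOnePow_even _ ((Finset.mem_filter.1 hi).2.add_one), Units.val_one, one_mul]
  · refine Finset.sum_congr (Finset.filter_congr fun i _ => Int.not_odd_iff_even) fun i hi => ?_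
    rw [Int.negOnePow_odd _ ((Finset.mem_filter.1 hi).2.add_one), Units.val_neg, Units.val_one,
      neg_one_mul]

/-- Classes of odd degree correspond to the image of be, those of even degree to the image of bo. By
bcb = b these ranks equal those of the idempotents co·be and bo·ce, the exponents found in the
determinant. -/
theorem altRank_eq_rank_sub_rank (hA : IsPerfect A)
    (ho : BockExact (LinearMap.toMatrix Be Bo (BalTensor.map _ (dEven A k)))
      (LinearMap.toMatrix Bo Be (BalTensor.map _ (dOdd A k))))
    (he : BockExact (LinearMap.toMatrix Bo Be (BalTensor.map _ (dOdd A k)))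
      (LinearMap.toMatrix Be Bo (BalTensor.map _ (dEven A k))))
    {so se πo πe bo be co ce : Matrix ι ι L}
    (h : SplittingRel
      (offDiag (zeroMat L (LinearMap.toMatrix Bo Be (BalTensor.map _ (dOdd A k))))
        (zeroMat L (LinearMap.toMatrix Be Bo (BalTensor.map _ (dEven A k)))))
      (offDiag so se) (onDiag πo πe) (offDiag bo be) (offDiag co ce))
    (hb : offDiag bo be = -(onDiag πo πe *
      offDiag (oneMat L (LinearMap.toMatrix Bo Be (BalTensor.map _ (dOdd A k))))
        (oneMat L (LinearMap.toMatrix Be Bo (BalTensor.map _ (dEven A k)))) * onDiag πo πe)) :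
    altRank L Φ A = ((co * be).rank : ℤ) - ((bo * ce).rank : ℤ) := by
  classical
  obtain ⟨N, hN⟩ := hA.bounded
  have : Fintype (ParityIcc Odd N) := Fintype.subtype ((Finset.Icc (-N) N).filter Odd) (by simp)
  have : Fintype (ParityIcc Even N) := Fintype.subtype ((Finset.Icc (-N) N).filter Even) (by simp)
  have hδπ := h.δπ
  have hπδ := h.πδ
  have hbπ := h.bπ
  have hbcb := h.bcb
  have hπ := h.π_eq
  have h0 : (0 : Matrix (ι ⊕ ι) (ι ⊕ ι) L) = offDiag 0 0 := by simp [offDiag]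
  simp only [offDiag_mul_onDiag, onDiag_mul_offDiag, offDiag_mul, offDiag_neg, onDiag_add,
    ← onDiag_one, onDiag_sub] at hδπ hπδ hbπ hbcb hπ hb
  rw [h0, offDiag_inj] at hδπ hπδ
  rw [offDiag_inj] at hbπ hbcb hb
  rw [onDiag_inj] at hπ
  have hcyc : ∀ {π a b c d : Matrix ι ι L}, π = 1 - (a * b + c * d) → ∀ w, d.mulVec w = 0 →
      ∃ y, w = π.mulVec w + a.mulVec y := fun {π a b c d} hπ w hw => ⟨b.mulVec w, by
    rw [hπ, Matrix.sub_mulVec, Matrix.add_mulVec, ← Matrix.mulVec_mulVec, ← Matrix.mulVec_mulVec,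
      hw, Matrix.mulVec_zero, add_zero, Matrix.one_mulVec, sub_add_cancel]⟩
  rw [altRank_eq hN, rank_mul_of_mul_mul_eq hbcb.2, rank_mul_of_mul_mul_eq' hbcb.1,
    (oddFolding hN).sum_finrank Be Bo dOdd_comp_dEven dEven_comp_dOdd hπδ.2 (hcyc hπ.2)
      (hcyc hπ.1) hδπ.2 hbπ.2 hb.2 he,
    (evenFolding hN).sum_finrank Bo Be dEven_comp_dOdd dOdd_comp_dEven hπδ.1 (hcyc hπ.1)
      (hcyc hπ.2) hδπ.1 hbπ.1 hb.1 ho]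

end Semisimple

/-! ### Trivialized bases and torsion after specialization -/

section Finiteness

open PowerSeries CategoryTheory

variable {R : Type*} [Ring R] {A : CochainComplex (ModuleCat R) ℤ}

/-- Finite projective modules over a local ring are free. Carrying a basis of the odd part through
`a` makes all matrices square over one index set, and det(g∘a) becomes the determinant of the matrix
of g. -/
theorem exists_folded_bases {W : Type*} [CommRing W] [IsLocalRing W] {m : Type*} [Fintype m]
    [DecidableEq m] (Φ : R →+* Matrix m m W) (hA : IsPerfect A) (a : Trivialization A) :
    ∃ (k : ℕ) (Bo : Module.Basis (Fin k) W (BalTensor (rowAct Φ) (OddPart A a.k)))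
      (Be : Module.Basis (Fin k) W (BalTensor (rowAct Φ) (EvenPart A a.k))),
      LinearMap.toMatrix Bo Be (BalTensor.map _ a.iso.toLinearMap) = 1 := by
  have := finite_oddPart (k := a.k) hA
  have := projective_oddPart (k := a.k) hA
  obtain ⟨hfin, hproj⟩ := BalTensor.finite_projective (P := OddPart A a.k)
    (isRightAction_rowAct Φ)
  have := Module.free_of_flat_of_isLocalRing (R := W)
    (P := BalTensor (rowAct Φ) (OddPart A a.k))
  let Bo := Module.finBasis W (BalTensor (rowAct Φ) (OddPart A a.k))
  refine ⟨_, Bo, Bo.map (BalTensor.congr _ a.iso), ?_⟩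
  ext i j
  rw [LinearMap.toMatrix_apply, Matrix.one_apply, Module.Basis.map_repr, LinearEquiv.trans_apply]
  have : (BalTensor.congr (rowAct Φ) a.iso).symm
      (BalTensor.map (rowAct Φ) a.iso.toLinearMap (Bo j)) = Bo j :=
    (BalTensor.congr (rowAct Φ) a.iso).symm_apply_apply (Bo j)
  rw [this, Module.Basis.repr_self, Finsupp.single_apply]
  simp only [eq_comm]

/-- A cocycle of degree `i` is placed in the folded complex and recovered by the projection, which
also carries the primitive back. -/
theorem Folding.exists_smul_eq {S T : Type*} [AddCommGroup S] [Module R S] [AddCommGroup T]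
    [Module R T] {par : ℤ → Prop} {N : ℤ} {d : S →ₗ[R] T} {d' : T →ₗ[R] S}
    (F : Folding A par N d d') {W Y : Type*} [CommRing W] [AddCommGroup Y] [Module W Y]
    {act : R → Module.End W Y} {c : W}
    (h : ∀ y, BalTensor.map act d' y = 0 → ∃ v, c • y = BalTensor.map act d v) {i : ℤ}
    (hi : par i) {x : BalTensor act (A.X i)} (hx : BalTensor.map act (diff A i (i + 1)) x = 0) :
    ∃ w, BalTensor.map act (diff A (i - 1) i) w = c • x := by
  obtain ⟨v, hv⟩ := h (BalTensor.map act (F.inT i) x) (by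
    rw [BalTensor.map_map, F.d'_inT i (i + 1) rfl, ← BalTensor.map_map, hx, map_zero])
  refine ⟨BalTensor.map act (F.prS (i - 1)) v, ?_⟩
  rw [BalTensor.map_map, ← F.prT_d (i - 1) i (by ring), ← BalTensor.map_map, ← hv, map_smul,
    BalTensor.map_map, F.prT_inT i hi, BalTensor.map_id, LinearMap.id_apply]

/-- A contraction up to the factor `D` over `Λ` makes the cohomology after each specialization
torsion. -/
theorem IsContractionUpTo.exists_smul_eq {W W' : Type*} [CommRing W] [CommRing W'] {m : Type*}
    [Fintype m] [DecidableEq m] {Φ : R →+* Matrix m m W} {k : ℕ} {ι : Type*} [Fintype ι]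
    [DecidableEq ι] (hA : IsPerfect A)
    (Bo : Module.Basis ι W (BalTensor (rowAct Φ) (OddPart A k)))
    (Be : Module.Basis ι W (BalTensor (rowAct Φ) (EvenPart A k))) {D : W} {Xo Xe : Matrix ι ι W}
    (h : IsContractionUpTo D (LinearMap.toMatrix Bo Be (BalTensor.map _ (dOdd A k)))
      (LinearMap.toMatrix Be Bo (BalTensor.map _ (dEven A k))) Xo Xe) (φ : W →+* W') {i : ℤ}
    {x : BalTensor (specAct Φ φ) (A.X i)} (hx : BalTensor.map _ (diff A i (i + 1)) x = 0) :
    ∃ w, BalTensor.map (specAct Φ φ) (diff A (i - 1) i) w = φ D • x := by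
  obtain ⟨N, hN⟩ := hA.bounded
  rcases Int.even_or_odd i with hi | hi
  · refine (evenFolding (k := k) hN).exists_smul_eq (fun y hy => ?_) hi hx
    refine ⟨(specBasis Bo φ).equivFun.symm ((Xe.map φ).mulVec ((specBasis Be φ).equivFun y)), ?_⟩
    refine (specBasis Be φ).equivFun.injective ?_
    have h1 := congrArg (fun M : Matrix ι ι W => M.map φ) h.even
    have h2 := toMatrix_mulVec_equivFun (specBasis Be φ) (specBasis Bo φ)
      (BalTensor.map _ (dEven A k)) y
    rw [hy, map_zero, specBasis_toMatrix] at h2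
    rw [map_smul, toMatrix_mulVec_equivFun (specBasis Bo φ), specBasis_toMatrix,
      LinearEquiv.apply_symm_apply, Matrix.mulVec_mulVec]
    rw [Matrix.map_add φ (map_add φ), Matrix.map_mul, Matrix.map_mul] at h1
    have h3 := congrArg (fun M : Matrix ι ι W' => M.mulVec ((specBasis Be φ).equivFun y)) h1
    simp only [Matrix.add_mulVec] at h3
    rw [← Matrix.mulVec_mulVec _ (Xo.map φ), ← h2, Matrix.mulVec_zero, add_zero] at h3
    rw [h3, Matrix.map_smul' φ D _ (map_mul φ), Matrix.map_one φ (map_zero φ) (map_one φ),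
      Matrix.smul_mulVec, Matrix.one_mulVec]
  · refine (oddFolding (k := k) hN).exists_smul_eq (fun y hy => ?_) hi hx
    refine ⟨(specBasis Be φ).equivFun.symm ((Xo.map φ).mulVec ((specBasis Bo φ).equivFun y)), ?_⟩
    refine (specBasis Bo φ).equivFun.injective ?_
    have h1 := congrArg (fun M : Matrix ι ι W => M.map φ) h.odd
    have h2 := toMatrix_mulVec_equivFun (specBasis Bo φ) (specBasis Be φ)
      (BalTensor.map _ (dOdd A k)) y
    rw [hy, map_zero, specBasis_toMatrix] at h2
    rw [map_smul, toMatrix_mulVec_equivFun (specBasis Be φ), specBasis_toMatrix,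
      LinearEquiv.apply_symm_apply, Matrix.mulVec_mulVec]
    rw [Matrix.map_add φ (map_add φ), Matrix.map_mul, Matrix.map_mul] at h1
    have h3 := congrArg (fun M : Matrix ι ι W' => M.mulVec ((specBasis Bo φ).equivFun y)) h1
    simp only [Matrix.add_mulVec] at h3
    rw [← Matrix.mulVec_mulVec _ (Xe.map φ), ← h2, Matrix.mulVec_zero, add_zero] at h3
    rw [h3, Matrix.map_smul' φ D _ (map_mul φ), Matrix.map_one φ (map_zero φ) (map_one φ),
      Matrix.smul_mulVec, Matrix.one_mulVec]

variable {W L : Type*} [CommRing W] [IsDomain W] [Field L] [Algebra W L] [IsFractionRing W L]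
  {m : Type*} [Fintype m] [DecidableEq m] {Φ : R →+* Matrix m m W⟦X⟧}

/-- A projective module embeds in a free one, where X can be cancelled coefficientwise. -/
theorem eq_of_X_smul_eq {P : Type*} [AddCommGroup P] [Module W⟦X⟧ P] [Module.Projective W⟦X⟧ P]
    {x y : P} (h : (X : W⟦X⟧) • x = (X : W⟦X⟧) • y) : x = y := by
  obtain ⟨s, hs⟩ := (Module.projective_def' (R := W⟦X⟧) (P := P)).1 inferInstance
  have h1 : s x = s y := by
    ext1 q
    have := congrArg (fun z => s z q) h
    simp only [map_smul, Finsupp.smul_apply, smul_eq_mul] at this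
    exact X_mul_cancel this
  have h2 := fun z => LinearMap.congr_fun hs z
  rw [← LinearMap.id_apply (R := W⟦X⟧) x, ← h2, LinearMap.comp_apply, h1, ← LinearMap.comp_apply,
    h2, LinearMap.id_apply]

/-- If the cohomology after the specialization at `X = 0` is torsion, the alternating sum of the
ranks of the groups of classes killed by `X` is zero. -/
theorem altRank_eq_zero (hA : IsPerfect A) {c : W} (hc : c ≠ 0)
    (hfin : ∀ (i : ℤ) (x : BalTensor (specAct Φ (constantCoeff (R := W))) (A.X i)),
      BalTensor.map _ (diff A i (i + 1)) x = 0 →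
      ∃ (N : ℕ) (w : BalTensor (specAct Φ (constantCoeff (R := W))) (A.X (i - 1))),
        BalTensor.map _ (diff A (i - 1) i) w = c ^ N • x) : altRank L Φ A = 0 := by
  have hproj : ∀ i, Module.Projective W⟦X⟧ (BalTensor (rowAct Φ) (A.X i)) := fun i => by
    have := hA.finite i
    have := hA.projective i
    exact (BalTensor.finite_projective (isRightAction_rowAct Φ)).2
  have htors : ∀ (i : ℤ) (n : InvX (rowAct Φ) A i), ∃ N : ℕ, c ^ N • n = 0 := fun i n => by
    obtain ⟨z, hz, ⟨w, hw⟩, rfl⟩ := exists_eq_invMk n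
    -- If dw = Xz, then w(0) is a cocycle in degree i − 1. By finiteness c^N·w − dv = X·u for some v
    -- and u, and cancelling X in c^N·Xz = X·du shows that z is torsion.
    have hw0 : BalTensor.map (specAct Φ (constantCoeff (R := W))) (diff A (i - 1) (i - 1 + 1))
        (redX Φ _ w) = 0 := by
      rw [show i - 1 + 1 = i by ring, ← specMap_map, hw]
      exact redX_smul_X Φ z
    obtain ⟨N, v, hv⟩ := hfin (i - 1) _ hw0
    obtain ⟨v, rfl⟩ := redX_surjective Φ v
    obtain ⟨u, hu⟩ := exists_eq_X_smul Φ
      (t := (C (c ^ N) : W⟦X⟧) • w - BalTensor.map (rowAct Φ) (diff A (i - 1 - 1) (i - 1)) v) (by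
        rw [map_sub, LinearMap.map_smulₛₗ, constantCoeff_C, ← hv, specMap_map, sub_self])
    refine ⟨N, ?_⟩
    have h1 : (C (c ^ N) : W⟦X⟧) • z = BalTensor.map (rowAct Φ) (diff A (i - 1) i) u := by
      have := hproj i
      refine eq_of_X_smul_eq (W := W) ?_
      rw [← map_smul, ← hu, map_sub, map_smul, hw, BalTensor.map_map, diff_comp_diff,
        BalTensor.map_zero, LinearMap.zero_apply, sub_zero, smul_comm]
    have h3 : BalTensor.map (rowAct Φ) (diff A i (i + 1)) ((C (c ^ N) : W⟦X⟧) • z) = 0 := by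
      rw [map_smul, hz, smul_zero]
    have h4 : ∃ w, BalTensor.map (rowAct Φ) (diff A (i - 1) i) w =
        (X : W⟦X⟧) • (C (c ^ N) : W⟦X⟧) • z := ⟨(X : W⟦X⟧) • u, by rw [map_smul, ← h1]⟩
    rw [smul_invMk (c ^ N) z hz ⟨w, hw⟩ h3 h4]
    exact invMk_eq_zero.2 ⟨u, h1.symm⟩
  have hsub : ∀ i : ℤ, Module.finrank L (L ⊗[W] InvX (rowAct Φ) A i) = 0 := fun i => by
    have : Subsingleton (L ⊗[W] InvX (rowAct Φ) A i) := by
      refine subsingleton_of_forall_eq 0 fun t => ?_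
      induction t using TensorProduct.induction_on with
      | zero => rfl
      | tmul x n =>
        obtain ⟨N, hN⟩ := htors i n
        have h0 : algebraMap W L (c ^ N) ≠ 0 := fun h0 => pow_ne_zero N hc
          (IsFractionRing.injective W L (h0.trans (map_zero _).symm))
        have h1 : x = c ^ N • ((algebraMap W L (c ^ N))⁻¹ * x) := by
          rw [Algebra.smul_def, ← mul_assoc, mul_inv_cancel₀ h0, one_mul]
        rw [h1, TensorProduct.smul_tmul, hN, TensorProduct.tmul_zero]
      | add t t' h h' => rw [h, h', add_zero]
    exact Module.finrank_zero_of_subsingleton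
  rw [altRank]
  refine (finsum_congr fun i => ?_).trans finsum_zero
  rw [hsub, Nat.cast_zero, mul_zero]

end Finiteness

/-! ### The ring 𝒪 and the actions attached to ρ -/

section Concrete

open PowerSeries CategoryTheory

universe w

theorem isFractionRing_intRing (L : Type*) [NormedField L] [IsUltrametricDist L] :
    IsFractionRing (IntRing L) L :=
  (Valuation.integer.integers (NormedField.valuation (K := L))).isFractionRing

/-- The non-units are the elements of norm less than 1, which are closed under addition by the
ultrametric inequality. -/
theorem isLocalRing_intRing (L : Type*) [NormedField L] [IsUltrametricDist L] :
    IsLocalRing (IntRing L) := by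
  have hunit : ∀ x : IntRing L, IsUnit x ↔ ‖(x : L)‖ = 1 := fun x => by
    constructor
    · rintro ⟨u, rfl⟩
      refine le_antisymm (norm_intRing_le_one _) ?_
      have h := congrArg (fun y : IntRing L => ‖(y : L)‖) u.mul_inv
      simp only [Subring.coe_mul, norm_mul, Subring.coe_one, norm_one] at h
      rw [← h]
      exact mul_le_of_le_one_right (norm_nonneg _) (norm_intRing_le_one _)
    · intro h
      have h0 : (x : L) ≠ 0 := fun h0 => by simp [h0] at h
      refine IsUnit.of_mul_eq_one (⟨(x : L)⁻¹, ?_⟩ : IntRing L)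
        (Subtype.ext (mul_inv_cancel₀ h0))
      change ‖(x : L)⁻¹‖ ≤ 1
      rw [norm_inv, h, inv_one]
  refine IsLocalRing.of_nonunits_add fun a b ha hb hab => ?_
  rw [mem_nonunits_iff, hunit] at ha hb
  rw [hunit] at hab
  have ha' := lt_of_le_of_ne (norm_intRing_le_one a) ha
  have hb' := lt_of_le_of_ne (norm_intRing_le_one b) hb
  have h := IsUltrametricDist.norm_add_le_max (a : L) (b : L)
  rw [Subring.coe_add] at hab
  exact absurd (h.trans_lt (max_lt ha' hb')) (by rw [hab]; exact lt_irrefl _)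

variable {p : ℕ} [Fact p.Prime] {G : Type*} [Group G] [TopologicalSpace G]
  {H : Subgroup G} [H.Normal] {e : (G ⧸ H) ≃ₜ* Multiplicative ℤ_[p]}
  {L : Type*} [NormedField L] [IsUltrametricDist L] [NormedAlgebra ℚ_[p] L]
  {n : ℕ} {Φ : Lam p G →+* Matrix (Fin n) (Fin n) (IntRing L)⟦X⟧}

section

variable {ρ : G → Matrix (Fin n) (Fin n) (IntRing L)}

theorem IsGammaHom.actGamma_eq (h : IsGammaHom e ρ Φ) : actGamma e ρ = rowAct Φ := by
  funext x
  simp only [actGamma, rowAct, h.lamEval_rhoGamma]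

theorem IsGammaHom.actO_eq (h : IsGammaHom e ρ Φ) :
    actO p ρ = specAct Φ (constantCoeff (R := IntRing L)) := by
  funext x
  simp only [actO, specAct, rowAct, h.lamEval_rho]

theorem IsGammaHom.actOE_eq (h : IsGammaHom e ρ Φ) : actOE e ρ = epsAct Φ := by
  funext x
  simp only [actOE, epsAct, rowAct, h.lamEval_rhoE]

/-- The homomorphism to matrices over `L⟦X⟧`. -/
def fieldHom (Φ : Lam p G →+* Matrix (Fin n) (Fin n) (IntRing L)⟦X⟧) :
    Lam p G →+* Matrix (Fin n) (Fin n) L⟦X⟧ :=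
  (PowerSeries.map (IntRing L).subtype).mapMatrix.comp Φ

theorem IsGammaHom.actL_eq (h : IsGammaHom e ρ Φ) :
    actL p ρ = specAct (fieldHom Φ) (constantCoeff (R := L)) := by
  funext x
  simp only [actL, specAct, rowAct, h.lamEval_rho]
  rfl

theorem IsGammaHom.actLE_eq (h : IsGammaHom e ρ Φ) : actLE e ρ = epsAct (fieldHom Φ) := by
  funext x
  simp only [actLE, epsAct, rowAct, h.lamEval_rhoE]
  congr 1
  ext (i | i) (j | j) <;> rfl

variable {A : CochainComplex (ModuleCat.{w} (Lam p G)) ℤ}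

theorem IsGammaHom.bockTorsion (h : IsGammaHom e ρ Φ) (hss : IsSemisimpleAt e ρ A) :
    BockTorsion Φ A (p : IntRing L) := by
  rw [IsSemisimpleAt, h.actO_eq, h.actOE_eq] at hss
  exact hss

theorem IsGammaHom.rankAt_eq (h : IsGammaHom e ρ Φ) : rankAt e ρ A = altRank L Φ A := by
  have h1 : ∀ i, Module.finrank L (L ⊗[IntRing L] CohGammaInv e ρ A i) =
      Module.finrank L (L ⊗[IntRing L] InvX (actGamma e ρ) A i) := fun i => rfl
  simp only [rankAt, altRank, h1]
  rw [h.actGamma_eq]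

end

variable {A : CochainComplex (ModuleCat.{w} (Lam p G)) ℤ}
  {ρ : G →* Matrix (Fin n) (Fin n) (IntRing L)} {a : Trivialization A} {k : ℕ}
  {Bo : Module.Basis (Fin k) (IntRing L)⟦X⟧ (BalTensor (rowAct Φ) (OddPart A a.k))}
  {Be : Module.Basis (Fin k) (IntRing L)⟦X⟧ (BalTensor (rowAct Φ) (EvenPart A a.k))}

theorem toMatrix_specBasis_eq_one {R W W' : Type*} [Ring R] [CommRing W] [CommRing W'] {m : Type*}
    [Fintype m] [DecidableEq m] {Φ : R →+* Matrix m m W} {P P' : Type*} [AddCommGroup P]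
    [Module R P] [AddCommGroup P'] [Module R P'] {ι : Type*} [Fintype ι] [DecidableEq ι]
    {B : Module.Basis ι W (BalTensor (rowAct Φ) P)}
    {B' : Module.Basis ι W (BalTensor (rowAct Φ) P')} {f : P →ₗ[R] P'}
    (hi : LinearMap.toMatrix B B' (BalTensor.map _ f) = 1) (φ : W →+* W') :
    LinearMap.toMatrix (specBasis B φ) (specBasis B' φ) (BalTensor.map _ f) = 1 := by
  rw [specBasis_toMatrix, hi, Matrix.map_one φ (map_zero φ) (map_one φ)]

theorem Contraction.exists_isContraction {R W Q : Type*} [Ring R] [CommRing W] [Field Q]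
    {m : Type*} [Fintype m] [DecidableEq m] {Φ : R →+* Matrix m m W} {Po Pe : Type*}
    [AddCommGroup Po] [Module R Po] [AddCommGroup Pe] [Module R Pe] {ι : Type*} [Fintype ι]
    [DecidableEq ι] {Bo : Module.Basis ι W (BalTensor (rowAct Φ) Po)}
    {Be : Module.Basis ι W (BalTensor (rowAct Φ) Pe)} {f i : Po →ₗ[R] Pe} {g : Pe →ₗ[R] Po}
    (hi : LinearMap.toMatrix Bo Be (BalTensor.map _ i) = 1) (φ : W →+* Q)
    {Ψ : R →+* Matrix m m Q} (hΨ : ∀ x, Ψ x = (Φ x).map φ)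
    (c : Contraction (BalTensor.map (rowAct Ψ) f) (BalTensor.map (rowAct Ψ) g)) :
    ∃ So Se : Matrix ι ι Q,
      IsContraction ((LinearMap.toMatrix Bo Be (BalTensor.map _ f)).map φ)
        ((LinearMap.toMatrix Be Bo (BalTensor.map _ g)).map φ) So Se ∧
      LinearMap.det ((BalTensor.map (rowAct Ψ) g + c.se) ∘ₗ BalTensor.map (rowAct Ψ) i) =
        ((LinearMap.toMatrix Be Bo (BalTensor.map _ g)).map φ + Se).det := by
  have hact : rowAct Ψ = specAct Φ φ := by
    funext x
    simp only [specAct, rowAct, hΨ]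
  revert c
  rw [hact]
  intro c
  have hC := c.isContraction (specBasis Bo φ) (specBasis Be φ)
  rw [specBasis_toMatrix, specBasis_toMatrix] at hC
  refine ⟨_, _, hC, ?_⟩
  rw [det_comp_eq_det_toMatrix (specBasis Bo φ) (specBasis Be φ) _
    (toMatrix_specBasis_eq_one hi _), map_add, specBasis_toMatrix]

theorem exists_detHom_theta_eq_det {R R' W Q : Type*} [Ring R] [Ring R'] [CommRing W] [Field Q]
    {m : ℕ} {Φ : R →+* Matrix (Fin m) (Fin m) W} {A : CochainComplex (ModuleCat.{w} R) ℤ}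
    {j : R →+* R'} {Ψ : R' →+* Matrix (Fin m) (Fin m) Q} (φ : W →+* Q)
    (hΨ : ∀ x, Ψ (j x) = (Φ x).map φ) (hA : IsPerfect A)
    (hAS : IsAcyclicAfter A (ringAct j)) {a : Trivialization A} {ι : Type*} [Fintype ι]
    [DecidableEq ι] {Bo : Module.Basis ι W (BalTensor (rowAct Φ) (OddPart A a.k))}
    {Be : Module.Basis ι W (BalTensor (rowAct Φ) (EvenPart A a.k))}
    (hi : LinearMap.toMatrix Bo Be (BalTensor.map _ a.iso.toLinearMap) = 1) :
    ∃ So Se : Matrix ι ι Q,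
      IsContraction ((LinearMap.toMatrix Bo Be (BalTensor.map _ (dOdd A a.k))).map φ)
        ((LinearMap.toMatrix Be Bo (BalTensor.map _ (dEven A a.k))).map φ) So Se ∧
      (((KOne.detHom Ψ (theta j a)).toMul : Qˣ) : Q) =
        ((LinearMap.toMatrix Be Bo (BalTensor.map _ (dEven A a.k))).map φ + Se).det := by
  obtain ⟨c, hc⟩ := exists_detHom_theta j Ψ hA hAS a
  obtain ⟨So, Se, hS, hdet⟩ := c.exists_isContraction hi φ hΨ
  exact ⟨So, Se, hS, by rw [hc, hdet]⟩

/-- The characteristic element as a determinant. -/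
theorem IsGammaHom.exists_charElt_eq_det (h : IsGammaHom e ρ Φ) (hρ : Continuous ρ)
    (hA : IsPerfect A) (hAS : IsAcyclicAfter A (ringAct (toLoc (oreSetStar p H))))
    (hi : LinearMap.toMatrix Bo Be (BalTensor.map _ a.iso.toLinearMap) = 1) :
    ∃ So Se : Matrix (Fin k) (Fin k) (QField L),
      IsContraction
        ((LinearMap.toMatrix Bo Be (BalTensor.map _ (dOdd A a.k))).map
          (algebraMap (IntRing L)⟦X⟧ (QField L)))
        ((LinearMap.toMatrix Be Bo (BalTensor.map _ (dEven A a.k))).map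
          (algebraMap (IntRing L)⟦X⟧ (QField L))) So Se ∧
      (charElt e ρ a : QField L) =
        ((LinearMap.toMatrix Be Bo (BalTensor.map _ (dEven A a.k))).map
          (algebraMap (IntRing L)⟦X⟧ (QField L)) + Se).det := by
  have hex : ∃ Ψ : Loc (oreSetStar p H) →+* Matrix (Fin n) (Fin n) (QField L),
      ∀ x, Ψ (toLoc (oreSetStar p H) x) =
        (lamEval p (rhoGamma e ρ) x).map (algebraMap (PowerSeries (IntRing L)) (QField L)) := by
    simp only [h.lamEval_rhoGamma]
    exact h.exists_locHom hρ
  have hch : charElt e ρ a =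
      (KOne.detHom hex.choose (theta (toLoc (oreSetStar p H)) a)).toMul := by
    rw [charElt, rhoStar, dif_pos hex]
  rw [hch]
  exact exists_detHom_theta_eq_det (algebraMap (IntRing L)⟦X⟧ (QField L))
    (fun x => by rw [hex.choose_spec, h.lamEval_rhoGamma]) hA hAS hi

end Concrete

/-! ### The characteristic element and the leading term -/

section LeadingTerm

open PowerSeries CategoryTheory

universe w

theorem IsContraction.map {ι K K' : Type*} [Fintype ι] [DecidableEq ι] [CommRing K] [CommRing K']
    {δo δe so se : Matrix ι ι K} (h : IsContraction δo δe so se) (ν : K →+* K') :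
    IsContraction (δo.map ν) (δe.map ν) (so.map ν) (se.map ν) where
  odd := by
    rw [← Matrix.map_mul, ← Matrix.map_mul, ← Matrix.map_add ν (map_add ν), h.odd,
      Matrix.map_one ν (map_zero ν) (map_one ν)]
  even := by
    rw [← Matrix.map_mul, ← Matrix.map_mul, ← Matrix.map_add ν (map_add ν), h.even,
      Matrix.map_one ν (map_zero ν) (map_one ν)]
  sq_odd := by rw [← Matrix.map_mul, h.sq_odd, Matrix.map_zero ν (map_zero ν)]
  sq_even := by rw [← Matrix.map_mul, h.sq_even, Matrix.map_zero ν (map_zero ν)]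

section Generic

variable {ι W L : Type*} [Fintype ι] [DecidableEq ι] [CommRing W] [IsDomain W] [Field L]
  [Algebra W L] [IsFractionRing W L]

theorem zeroMat_eq (D : Matrix ι ι W⟦X⟧) :
    (D.map (PowerSeries.map (algebraMap W L))).map (constantCoeff (R := L)) = zeroMat L D := by
  ext i j
  simp only [Matrix.map_apply, ← coeff_zero_eq_constantCoeff_apply, PowerSeries.coeff_map]

theorem oneMat_eq (D : Matrix ι ι W⟦X⟧) :
    (D.map (PowerSeries.map (algebraMap W L))).map (coeff (R := L) 1) = oneMat L D := by
  ext i j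
  simp only [Matrix.map_apply, PowerSeries.coeff_map]

/-- The determinant of a contraction, compared with the determinant given by the Bockstein maps. -/
theorem IsContraction.det_leading_fraction {Q K : Type*} [Field Q] [Field K] {α : W⟦X⟧ →+* Q}
    {φ : L⟦X⟧ →+* K} (hφ : Function.Injective φ) {ν : Q →+* K}
    (hν : ∀ x, ν (α x) = φ (PowerSeries.map (algebraMap W L) x))
    {Do De : Matrix ι ι W⟦X⟧} (hoe : De * Do = 0) (heo : Do * De = 0)
    {so se πo πe bo be co ce : Matrix ι ι L}
    (h : SplittingRel (offDiag (zeroMat L Do) (zeroMat L De)) (offDiag so se) (onDiag πo πe)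
      (offDiag bo be) (offDiag co ce))
    (hb : offDiag bo be = -(onDiag πo πe * offDiag (oneMat L Do) (oneMat L De) * onDiag πo πe))
    {So Se : Matrix ι ι Q} (hS : IsContraction (Do.map α) (De.map α) So Se) :
    ∃ U U' : L⟦X⟧, constantCoeff U = 1 ∧ constantCoeff U' = 1 ∧
      ∀ g q : W⟦X⟧, (De.map α + Se).det * α q = α g →
        PowerSeries.map (algebraMap W L) g * (X ^ (bo * ce).rank * U) =
          PowerSeries.map (algebraMap W L) q * (X ^ (co * be).rank *
            C ((-1) ^ ((co * be).rank + (bo * ce).rank) *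
              (zeroMat L De + se + be + ce).det) * U') := by
  have hmap : ∀ D : Matrix ι ι W⟦X⟧,
      (D.map α).map ν = (D.map (PowerSeries.map (algebraMap W L))).map φ := fun D => by
    ext i j
    exact hν _
  have hS' := hS.map ν
  rw [hmap, hmap] at hS'
  have hmul : ∀ {M N : Matrix ι ι W⟦X⟧}, M * N = 0 → M.map (PowerSeries.map (algebraMap W L)) *
      N.map (PowerSeries.map (algebraMap W L)) = 0 := fun {M N} h0 => by
    rw [← Matrix.map_mul, h0, Matrix.map_zero _ (map_zero _)]
  obtain ⟨U, U', hU, hU', hdet⟩ := IsContraction.det_leading φ hφ (hmul hoe) (hmul heo)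
    (by rw [zeroMat_eq, zeroMat_eq]; exact h) (by rw [oneMat_eq, oneMat_eq]; exact hb) hS'
  -- The fraction g/q lives over W and the expansion over L; both are compared in K, and injectivity
  -- of φ returns the identity to L⟦X⟧.
  refine ⟨U, U', hU, hU', fun g q hgq => hφ ?_⟩
  have h1 := congrArg ν hgq
  have h2 : ν (De.map α + Se).det = ((De.map (PowerSeries.map (algebraMap W L))).map φ +
      Se.map ν).det := by
    rw [RingHom.map_det, RingHom.mapMatrix_apply, Matrix.map_add ν (map_add ν), hmap]
  rw [map_mul, hν, hν, h2] at h1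
  rw [map_mul, ← h1, map_mul φ (PowerSeries.map (algebraMap W L) q), mul_right_comm, hdet,
    mul_comm, zeroMat_eq]

variable {R : Type*} [Ring R] {m : Type*} [Fintype m] [DecidableEq m]
  {Φ : R →+* Matrix m m W⟦X⟧} {Po Pe : Type*} [AddCommGroup Po] [Module R Po] [AddCommGroup Pe]
  [Module R Pe] {Bo : Module.Basis ι W⟦X⟧ (BalTensor (rowAct Φ) Po)}
  {Be : Module.Basis ι W⟦X⟧ (BalTensor (rowAct Φ) Pe)} {f i : Po →ₗ[R] Pe} {g : Pe →ₗ[R] Po}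
  {ΦL : R →+* Matrix m m L⟦X⟧}

/-- `leadingTerm` is evaluated on chosen data, so existence alone is not enough: every
`BockSplitting` must come from matrices to which the determinant formula applies. -/
theorem nonempty_bockSplitting_and_det
    (hΦL : ΦL = (PowerSeries.map (algebraMap W L)).mapMatrix.comp Φ) (hoe : g ∘ₗ f = 0)
    (heo : f ∘ₗ g = 0) (hi : LinearMap.toMatrix Bo Be (BalTensor.map _ i) = 1)
    (ho : BockExact (LinearMap.toMatrix Be Bo (BalTensor.map _ g))
      (LinearMap.toMatrix Bo Be (BalTensor.map _ f)))
    (he : BockExact (LinearMap.toMatrix Bo Be (BalTensor.map _ f))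
      (LinearMap.toMatrix Be Bo (BalTensor.map _ g))) :
    Nonempty (BockSplitting (BalTensor.map (specAct ΦL (constantCoeff (R := L))) f)
      (BalTensor.map (specAct ΦL (constantCoeff (R := L))) g)
      (BockRel (specAct ΦL (constantCoeff (R := L))) (epsAct ΦL) f)
      (BockRel (specAct ΦL (constantCoeff (R := L))) (epsAct ΦL) g)) ∧
    ∀ h : BockSplitting (BalTensor.map (specAct ΦL (constantCoeff (R := L))) f)
      (BalTensor.map (specAct ΦL (constantCoeff (R := L))) g)
      (BockRel (specAct ΦL (constantCoeff (R := L))) (epsAct ΦL) f)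
      (BockRel (specAct ΦL (constantCoeff (R := L))) (epsAct ΦL) g),
      ∃ so se πo πe bo be co ce : Matrix ι ι L,
        SplittingRel
          (offDiag (zeroMat L (LinearMap.toMatrix Bo Be (BalTensor.map _ f)))
            (zeroMat L (LinearMap.toMatrix Be Bo (BalTensor.map _ g))))
          (offDiag so se) (onDiag πo πe) (offDiag bo be) (offDiag co ce) ∧
        offDiag bo be = -(onDiag πo πe *
          offDiag (oneMat L (LinearMap.toMatrix Bo Be (BalTensor.map _ f)))
            (oneMat L (LinearMap.toMatrix Be Bo (BalTensor.map _ g))) * onDiag πo πe) ∧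
        LinearMap.det ((BalTensor.map (specAct ΦL (constantCoeff (R := L))) g + h.se + h.be +
            h.ce) ∘ₗ BalTensor.map (specAct ΦL (constantCoeff (R := L))) i) =
          (zeroMat L (LinearMap.toMatrix Be Bo (BalTensor.map _ g)) + se + be + ce).det := by
  subst hΦL
  set ΦL := (PowerSeries.map (algebraMap W L)).mapMatrix.comp Φ
  let BoL : Module.Basis ι L⟦X⟧ (BalTensor (rowAct ΦL) Po) :=
    specBasis Bo (PowerSeries.map (algebraMap W L))
  let BeL : Module.Basis ι L⟦X⟧ (BalTensor (rowAct ΦL) Pe) :=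
    specBasis Be (PowerSeries.map (algebraMap W L))
  have hDo : LinearMap.toMatrix BoL BeL (BalTensor.map _ f) =
      (LinearMap.toMatrix Bo Be (BalTensor.map _ f)).map (PowerSeries.map (algebraMap W L)) :=
    specBasis_toMatrix Bo Be _ f
  have hDe : LinearMap.toMatrix BeL BoL (BalTensor.map _ g) =
      (LinearMap.toMatrix Be Bo (BalTensor.map _ g)).map (PowerSeries.map (algebraMap W L)) :=
    specBasis_toMatrix Be Bo _ g
  have hi' : LinearMap.toMatrix BoL BeL (BalTensor.map _ i) = 1 := toMatrix_specBasis_eq_one hi _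
  constructor
  · obtain ⟨so, se, πo, πe, bo, be, co, ce, h, hb⟩ := exists_splittingRel_of_bockExact (L := L)
      (toMatrix_map_mul_eq_zero Bo Be hoe) (toMatrix_map_mul_eq_zero Be Bo heo) ho he
    refine nonempty_bockSplitting_of_splittingRel BoL BeL hoe heo (so := so) (se := se) (πo := πo)
      (πe := πe) (bo := bo) (be := be) (co := co) (ce := ce) ?_ ?_
    · rw [hDo, hDe, zeroMat_eq, zeroMat_eq]
      exact h
    · rw [hDo, hDe, oneMat_eq, oneMat_eq]
      exact hb
  · intro h
    obtain ⟨so, se, πo, πe, bo, be, co, ce, h1, h2, h3, h4, h5⟩ :=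
      h.matrix_relations BoL BeL hoe heo
    rw [hDo, hDe, zeroMat_eq, zeroMat_eq] at h1
    rw [hDo, hDe, oneMat_eq, oneMat_eq] at h2
    refine ⟨so, se, πo, πe, bo, be, co, ce, h1, h2, ?_⟩
    rw [det_comp_eq_det_toMatrix (specBasis BoL constantCoeff) (specBasis BeL constantCoeff) _
      (toMatrix_specBasis_eq_one hi' _), map_add, map_add, map_add, ← h3, ← h4, ← h5,
      specBasis_toMatrix, hDe, zeroMat_eq]

end Generic

variable {p : ℕ} [Fact p.Prime] {G : Type*} [Group G] [TopologicalSpace G]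
  {H : Subgroup G} [H.Normal] {e : (G ⧸ H) ≃ₜ* Multiplicative ℤ_[p]}
  {L : Type*} [NormedField L] [IsUltrametricDist L] [NormedAlgebra ℚ_[p] L]
  {n : ℕ} {Φ : Lam p G →+* Matrix (Fin n) (Fin n) (IntRing L)⟦X⟧}
  {A : CochainComplex (ModuleCat.{w} (Lam p G)) ℤ}
  {ρ : G →* Matrix (Fin n) (Fin n) (IntRing L)} {a : Trivialization A}

theorem leadingTerm_eq {ρ : G → Matrix (Fin n) (Fin n) (IntRing L)}
    (hne : Nonempty (BockSplitting
      (BalTensor.map (actL p ρ) (dOdd A a.k)) (BalTensor.map (actL p ρ) (dEven A a.k))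
      (BockRel (actL p ρ) (actLE e ρ) (dOdd A a.k))
      (BockRel (actL p ρ) (actLE e ρ) (dEven A a.k)))) :
    leadingTerm e ρ a = (-1) ^ rankAt e ρ A * LinearMap.det
      ((BalTensor.map (actL p ρ) (dEven A a.k) + hne.some.se + hne.some.be + hne.some.ce) ∘ₗ
        BalTensor.map (actL p ρ) a.iso.toLinearMap) := by
  rw [leadingTerm, dif_pos hne]

variable {k : ℕ}
  {Bo : Module.Basis (Fin k) (IntRing L)⟦X⟧ (BalTensor (rowAct Φ) (OddPart A a.k))}
  {Be : Module.Basis (Fin k) (IntRing L)⟦X⟧ (BalTensor (rowAct Φ) (EvenPart A a.k))}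

theorem prime_ne_zero_intRing (p : ℕ) [Fact p.Prime] (L : Type*) [NormedField L]
    [IsUltrametricDist L] [NormedAlgebra ℚ_[p] L] : (p : IntRing L) ≠ 0 := fun h0 =>
  prime_ne_zero p L (by simpa using congrArg (fun x : IntRing L => (x : L)) h0)

set_option maxHeartbeats 2000000 in
theorem exists_leadingTerm_eq_of_bockExact {ρ : G → Matrix (Fin n) (Fin n) (IntRing L)}
    (h : IsGammaHom e ρ Φ)
    (hi : LinearMap.toMatrix Bo Be (BalTensor.map _ a.iso.toLinearMap) = 1)
    (ho : BockExact (LinearMap.toMatrix Be Bo (BalTensor.map _ (dEven A a.k)))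
      (LinearMap.toMatrix Bo Be (BalTensor.map _ (dOdd A a.k))))
    (he : BockExact (LinearMap.toMatrix Bo Be (BalTensor.map _ (dOdd A a.k)))
      (LinearMap.toMatrix Be Bo (BalTensor.map _ (dEven A a.k)))) :
    ∃ so se πo πe bo be co ce : Matrix (Fin k) (Fin k) L,
      SplittingRel
        (offDiag (zeroMat L (LinearMap.toMatrix Bo Be (BalTensor.map _ (dOdd A a.k))))
          (zeroMat L (LinearMap.toMatrix Be Bo (BalTensor.map _ (dEven A a.k)))))
        (offDiag so se) (onDiag πo πe) (offDiag bo be) (offDiag co ce) ∧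
      offDiag bo be = -(onDiag πo πe *
        offDiag (oneMat L (LinearMap.toMatrix Bo Be (BalTensor.map _ (dOdd A a.k))))
          (oneMat L (LinearMap.toMatrix Be Bo (BalTensor.map _ (dEven A a.k)))) *
          onDiag πo πe) ∧
      leadingTerm e ρ a = (-1) ^ rankAt e ρ A *
        (zeroMat L (LinearMap.toMatrix Be Bo (BalTensor.map _ (dEven A a.k))) +
          se + be + ce).det := by
  have := isFractionRing_intRing L
  have key := nonempty_bockSplitting_and_det (L := L) (ΦL := fieldHom Φ) rfl
    dEven_comp_dOdd dOdd_comp_dEven hi ho he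
  rw [← h.actL_eq, ← h.actLE_eq] at key
  obtain ⟨hne, hdet⟩ := key
  obtain ⟨so, se, πo, πe, bo, be, co, ce, hrel, hb, hd⟩ := hdet hne.some
  refine ⟨so, se, πo, πe, bo, be, co, ce, hrel, hb, ?_⟩
  rw [leadingTerm_eq hne, ← hd]

/-- The characteristic element at a semisimple representation: its order of vanishing and its
leading coefficient. -/
theorem IsGammaHom.charElt_leading (h : IsGammaHom e ρ Φ) (hρ : Continuous ρ)
    (hA : IsPerfect A) (hAS : IsAcyclicAfter A (ringAct (toLoc (oreSetStar p H))))
    (hss : IsSemisimpleAt e ρ A) :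
    ∃ (r₁ r₂ : ℕ) (U U' : L⟦X⟧), constantCoeff U = 1 ∧ constantCoeff U' = 1 ∧
      rankAt e ρ A = r₁ - r₂ ∧
      ∀ g q : (IntRing L)⟦X⟧, (charElt e ρ a : QField L) * algebraMap _ (QField L) q =
        algebraMap _ (QField L) g →
        PowerSeries.map (IntRing L).subtype g * (X ^ r₂ * U) =
          PowerSeries.map (IntRing L).subtype q * (X ^ r₁ * C (leadingTerm e ρ a) * U') := by
  have := isFractionRing_intRing L
  have := isLocalRing_intRing L
  obtain ⟨k, Bo, Be, hi⟩ := exists_folded_bases Φ hA a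
  obtain ⟨So, Se, hS, hf⟩ := h.exists_charElt_eq_det hρ hA hAS hi
  have hoe := dEven_comp_dOdd (A := A) (k := a.k)
  have heo := dOdd_comp_dEven (A := A) (k := a.k)
  have hp := prime_ne_zero_intRing p L
  obtain ⟨N, hN⟩ := hA.bounded
  have ho := (h.bockTorsion hss).bockExact hp (oddFolding (k := a.k) hN) Be Bo
  have he := (h.bockTorsion hss).bockExact hp (evenFolding (k := a.k) hN) Bo Be
  obtain ⟨so, se, πo, πe, bo, be, co, ce, hrel, hb, hlead⟩ :=
    exists_leadingTerm_eq_of_bockExact h hi ho he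
  have hrank := altRank_eq_rank_sub_rank (L := L) Bo Be hA ho he hrel hb
  -- Frac L⟦X⟧ contains both Q_𝒪(Γ) and L⟦X⟧.
  let φ := algebraMap L⟦X⟧ (FractionRing L⟦X⟧)
  have hφ : Function.Injective φ := IsFractionRing.injective _ _
  have hinj : Function.Injective (φ.comp (PowerSeries.map (IntRing L).subtype)) := by
    rw [RingHom.coe_comp]
    exact hφ.comp (PowerSeries.map_injective _ Subtype.val_injective)
  obtain ⟨U, U', hU, hU', hfin⟩ := IsContraction.det_leading_fraction (L := L) hφ
    (ν := IsFractionRing.lift (K := QField L) hinj)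
    (fun x => IsFractionRing.lift_algebraMap hinj x)
    (toMatrix_map_mul_eq_zero Bo Be hoe) (toMatrix_map_mul_eq_zero Be Bo heo) hrel hb hS
  refine ⟨(co * be).rank, (bo * ce).rank, U, U', hU, hU', by rw [h.rankAt_eq, hrank],
    fun g q hgq => ?_⟩
  rw [hf] at hgq
  -- The sign in the leading term is the one that arises from the powers of −X and −X⁻¹, since r₁ −
  -- r₂ and r₁ + r₂ have the same parity.
  have hsign : (-1 : L) ^ rankAt e ρ A = (-1) ^ ((co * be).rank + (bo * ce).rank) := by
    rw [h.rankAt_eq, hrank, zpow_sub₀ (neg_ne_zero.2 one_ne_zero), zpow_natCast, zpow_natCast,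
      pow_add, div_eq_mul_inv, ← inv_pow, inv_neg_one]
  rw [hlead, hsign]
  exact hfin g q hgq

end LeadingTerm

/-! ### Values at the twists ρχ^s -/

section Twist

open PowerSeries CategoryTheory

universe w

theorem bockRel_zero_zero {R S : Type*} [Ring R] [CommRing S] {m : Type*}
    (act : R → Module.End S (m → S)) (actE : R → Module.End S (m ⊕ m → S)) {P P' : Type*}
    [AddCommGroup P] [Module R P] [AddCommGroup P'] [Module R P'] (f : P →ₗ[R] P') :
    BockRel act actE f 0 0 :=
  ⟨0, 0, by rw [map_zero, map_zero], map_zero _, by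
    rw [map_zero, map_zero, map_zero, map_zero]⟩

/-- The Bockstein trivialization of an exact complex. -/
theorem IsContraction.nonempty_bockSplitting_and_det {R W K : Type*} [Ring R] [CommRing W]
    [Field K] {m : Type*} [Fintype m] [DecidableEq m] {Φ : R →+* Matrix m m W} {Po Pe : Type*}
    [AddCommGroup Po] [Module R Po] [AddCommGroup Pe] [Module R Pe] {ι : Type*} [Fintype ι]
    [DecidableEq ι] {Bo : Module.Basis ι W (BalTensor (rowAct Φ) Po)}
    {Be : Module.Basis ι W (BalTensor (rowAct Φ) Pe)} {f i : Po →ₗ[R] Pe} {g : Pe →ₗ[R] Po}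
    {φ : W →+* K} {So Se : Matrix ι ι K}
    (h : IsContraction ((LinearMap.toMatrix Bo Be (BalTensor.map _ f)).map φ)
      ((LinearMap.toMatrix Be Bo (BalTensor.map _ g)).map φ) So Se)
    (hoe : g ∘ₗ f = 0) (heo : f ∘ₗ g = 0)
    (hi : LinearMap.toMatrix Bo Be (BalTensor.map _ i) = 1)
    (actE : R → Module.End K (m ⊕ m → K)) :
    Nonempty (BockSplitting (BalTensor.map (specAct Φ φ) f) (BalTensor.map (specAct Φ φ) g)
      (BockRel (specAct Φ φ) actE f) (BockRel (specAct Φ φ) actE g)) ∧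
    ∀ s : BockSplitting (BalTensor.map (specAct Φ φ) f) (BalTensor.map (specAct Φ φ) g)
      (BockRel (specAct Φ φ) actE f) (BockRel (specAct Φ φ) actE g),
      LinearMap.det ((BalTensor.map (specAct Φ φ) g + s.se + s.be + s.ce) ∘ₗ
        BalTensor.map (specAct Φ φ) i) =
          ((LinearMap.toMatrix Be Bo (BalTensor.map _ g)).map φ + Se).det := by
  rw [← specBasis_toMatrix Bo Be, ← specBasis_toMatrix Be Bo] at h
  obtain ⟨c, hc⟩ := exists_contraction_of_isContraction (specBasis Bo φ) (specBasis Be φ) h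
  have hoe' : BalTensor.map (specAct Φ φ) g ∘ₗ BalTensor.map (specAct Φ φ) f = 0 := by
    rw [← BalTensor.map_comp, hoe, BalTensor.map_zero]
  have heo' : BalTensor.map (specAct Φ φ) f ∘ₗ BalTensor.map (specAct Φ φ) g = 0 := by
    rw [← BalTensor.map_comp, heo, BalTensor.map_zero]
  have hi' := toMatrix_specBasis_eq_one hi φ
  refine ⟨c.nonempty_bockSplitting hoe' heo'
    (bockRel_zero_zero _ _ _) (bockRel_zero_zero _ _ _), fun s => ?_⟩
  rw [s.det_eq_of_contraction (specBasis Bo φ) (specBasis Be φ) c hoe' heo' hi',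
    det_comp_eq_det_toMatrix (specBasis Bo φ) (specBasis Be φ) _ hi', map_add, hc,
    specBasis_toMatrix]

variable {p : ℕ} [Fact p.Prime] {G : Type*} [Group G] [TopologicalSpace G]
  {H : Subgroup G} [H.Normal] {e : (G ⧸ H) ≃ₜ* Multiplicative ℤ_[p]}
  {L : Type*} [NormedField L] [IsUltrametricDist L] [NormedAlgebra ℚ_[p] L]
  {n : ℕ}

/-- Two presentations of `f` as a quotient agree after cross-multiplication, so the one chosen in
`evalQ` is immaterial. -/
theorem evalQ_eq [CompleteSpace L] {f : QField L} {g q : (IntRing L)⟦X⟧} {t : L} (ht : ‖t‖ < 1)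
    (hq : evalSeries q t ≠ 0)
    (h : f * algebraMap _ (QField L) q = algebraMap _ (QField L) g) :
    evalQ f t = evalSeries g t / evalSeries q t := by
  have hex : ∃ gh : (IntRing L)⟦X⟧ × (IntRing L)⟦X⟧, evalSeries gh.2 t ≠ 0 ∧
      f * algebraMap _ (QField L) gh.2 = algebraMap _ (QField L) gh.1 := ⟨(g, q), hq, h⟩
  rw [evalQ, dif_pos hex]
  obtain ⟨h1, h2⟩ := hex.choose_spec
  generalize hex.choose = gh at h1 h2
  have h3 : gh.1 * q = g * gh.2 := by
    refine IsFractionRing.injective (IntRing L)⟦X⟧ (QField L) ?_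
    rw [map_mul, map_mul, ← h, ← h2]
    ring
  have h4 := congrArg (evalHom t ht) h3
  rw [map_mul, map_mul] at h4
  rw [div_eq_div_iff h1 hq]
  exact h4

/-- It converts torsion annihilated by D(t) ≠ 0 into p-power torsion. -/
theorem exists_pow_eq_mul {d : IntRing L} (hd : d ≠ 0) :
    ∃ (N : ℕ) (c : IntRing L), (p : IntRing L) ^ N = c * d := by
  have hd' : (d : L) ≠ 0 := fun h0 => hd (Subtype.ext h0)
  have hp : ‖(p : L)‖ < 1 := by
    rw [norm_natCast_prime]
    exact inv_lt_one_of_one_lt₀ (by exact_mod_cast (Fact.out : p.Prime).one_lt)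
  obtain ⟨N, hN⟩ := exists_pow_lt_of_lt_one (norm_pos_iff.2 hd') hp
  refine ⟨N, ⟨(p : L) ^ N / d, ?_⟩, Subtype.ext ?_⟩
  · change ‖(p : L) ^ N / d‖ ≤ 1
    rw [norm_div, norm_pow]
    exact (div_le_one (norm_pos_iff.2 hd')).2 hN.le
  · simp [div_mul_cancel₀ _ hd']

variable {Φ : Lam p G →+* Matrix (Fin n) (Fin n) (IntRing L)⟦X⟧}
  {A : CochainComplex (ModuleCat.{w} (Lam p G)) ℤ}
  {ρ : G →* Matrix (Fin n) (Fin n) (IntRing L)} {a : Trivialization A} {k : ℕ}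
  {Bo : Module.Basis (Fin k) (IntRing L)⟦X⟧ (BalTensor (rowAct Φ) (OddPart A a.k))}
  {Be : Module.Basis (Fin k) (IntRing L)⟦X⟧ (BalTensor (rowAct Φ) (EvenPart A a.k))}
  {χ : (G ⧸ H) →* ℤ_[p]ˣ}

theorem IsGammaHom.actO_twist_eq [CompleteSpace L] (h : IsGammaHom e ρ Φ) (hχ : Continuous χ)
    (s : ℤ_[p]) : actO p (twist e ρ χ s) =
      specAct Φ (evalInt (charPt e L χ s) (norm_charPt_lt_one hχ s)) := by
  funext x
  simp only [actO, specAct, rowAct, h.lamEval_twist hχ]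

theorem IsGammaHom.actL_twist_eq [CompleteSpace L] (h : IsGammaHom e ρ Φ) (hχ : Continuous χ)
    (s : ℤ_[p]) : actL p (twist e ρ χ s) =
      specAct Φ (evalHom (charPt e L χ s) (norm_charPt_lt_one hχ s)) := by
  funext x
  simp only [actL, specAct, rowAct, h.lamEval_twist hχ]
  rfl

theorem IsGammaHom.isFiniteAt_twist [CompleteSpace L] (h : IsGammaHom e ρ Φ) (hχ : Continuous χ)
    (hA : IsPerfect A) {D : (IntRing L)⟦X⟧} {Xo Xe : Matrix (Fin k) (Fin k) (IntRing L)⟦X⟧}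
    (hD : IsContractionUpTo D (LinearMap.toMatrix Bo Be (BalTensor.map _ (dOdd A a.k)))
      (LinearMap.toMatrix Be Bo (BalTensor.map _ (dEven A a.k))) Xo Xe) {s : ℤ_[p]}
    (hs : evalSeries D (charPt e L χ s) ≠ 0) : IsFiniteAt (twist e ρ χ s) A := by
  rw [IsFiniteAt, h.actO_twist_eq hχ]
  intro i x hx
  obtain ⟨w, hw⟩ := hD.exists_smul_eq hA Bo Be
    (evalInt (charPt e L χ s) (norm_charPt_lt_one hχ s)) hx
  obtain ⟨N, c, hc⟩ := exists_pow_eq_mul (p := p)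
    (d := evalInt (charPt e L χ s) (norm_charPt_lt_one hχ s) D)
    (fun h0 => hs (congrArg Subtype.val h0))
  exact ⟨N, c • w, by rw [map_smul, hw, smul_smul, hc]⟩

theorem IsGammaHom.rankAt_eq_zero {ρ : G → Matrix (Fin n) (Fin n) (IntRing L)}
    (h : IsGammaHom e ρ Φ) (hA : IsPerfect A) (hfin : IsFiniteAt ρ A) : rankAt e ρ A = 0 := by
  have := isFractionRing_intRing L
  rw [h.rankAt_eq]
  rw [IsFiniteAt, h.actO_eq] at hfin
  exact altRank_eq_zero hA (prime_ne_zero_intRing p L) hfin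

-- Where D does not vanish the complex over L is exact. The Bockstein part is then empty, the
-- trivialization is given by the specialized contraction, and the rank hypothesis makes the sign
-- trivial.
set_option maxHeartbeats 2000000 in
theorem IsGammaHom.leadingTerm_twist [CompleteSpace L] (h : IsGammaHom e ρ Φ) (hχ : Continuous χ)
    (hi : LinearMap.toMatrix Bo Be (BalTensor.map _ a.iso.toLinearMap) = 1)
    {D : (IntRing L)⟦X⟧} {Xo Xe : Matrix (Fin k) (Fin k) (IntRing L)⟦X⟧}
    (hD : IsContractionUpTo D (LinearMap.toMatrix Bo Be (BalTensor.map _ (dOdd A a.k)))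
      (LinearMap.toMatrix Be Bo (BalTensor.map _ (dEven A a.k))) Xo Xe) {s : ℤ_[p]}
    (hs : evalSeries D (charPt e L χ s) ≠ 0) (hr : rankAt e (twist e ρ χ s) A = 0) :
    leadingTerm e (twist e ρ χ s) a =
      evalSeries (D • LinearMap.toMatrix Be Bo (BalTensor.map _ (dEven A a.k)) + Xe).det
        (charPt e L χ s) / evalSeries (D ^ k) (charPt e L χ s) := by
  obtain ⟨h1, h2⟩ := hD.specialize (evalHom (charPt e L χ s) (norm_charPt_lt_one hχ s)) hs
  have key := h1.nonempty_bockSplitting_and_det dEven_comp_dOdd dOdd_comp_dEven hi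
    (actLE e (twist e ρ χ s))
  rw [← h.actL_twist_eq hχ] at key
  obtain ⟨hne, hdet⟩ := key
  have h3 := hdet hne.some
  have hs' : evalHom (charPt e L χ s) (norm_charPt_lt_one hχ s) (D ^ k) ≠ 0 := by
    rw [map_pow]
    exact pow_ne_zero _ hs
  rw [Fintype.card_fin] at h2
  rw [leadingTerm_eq hne, hr, zpow_zero, one_mul, h3]
  exact eq_div_of_mul_eq hs' h2

/-- At the twists where a denominator does not vanish the complex is finite, and the leading term
is the value of the characteristic element. -/
theorem IsGammaHom.exists_denominator [FiniteDimensional ℚ_[p] L] [CompleteSpace L]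
    (h : IsGammaHom e ρ Φ) (hρ : Continuous ρ) (hχ : Continuous χ) (hA : IsPerfect A)
    (hAS : IsAcyclicAfter A (ringAct (toLoc (oreSetStar p H)))) (a : Trivialization A) :
    ∃ D : (IntRing L)⟦X⟧, D ≠ 0 ∧ ∀ s, evalSeries D (charPt e L χ s) ≠ 0 →
      IsFiniteAt (twist e ρ χ s) A ∧
      leadingTerm e (twist e ρ χ s) a = evalQ (charElt e ρ a : QField L) (charPt e L χ s) := by
  have := isLocalRing_intRing L
  obtain ⟨k, Bo, Be, hi⟩ := exists_folded_bases Φ hA a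
  obtain ⟨So, Se, hS, hf⟩ := h.exists_charElt_eq_det hρ hA hAS hi
  obtain ⟨D, Xo, Xe, hD0, hD, hdet⟩ := hS.exists_denominator
  refine ⟨D, hD0, fun s hs => ?_⟩
  have hfin := h.isFiniteAt_twist hχ hA hD hs
  -- The twist has its own homomorphism Φ', and its rank refers to X = 0 there.
  obtain ⟨Φ', h'⟩ := exists_isGammaHom e (twistHom e ρ χ s) (continuous_twist hχ hρ s)
  have hr : rankAt e (twist e ρ χ s) A = 0 := h'.rankAt_eq_zero hA hfin
  refine ⟨hfin, ?_⟩
  rw [← hf, Fintype.card_fin] at hdet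
  have hs' : evalSeries (D ^ k) (charPt e L χ s) ≠ 0 := by
    rw [← evalHom_apply (ht := norm_charPt_lt_one hχ s), map_pow]
    exact pow_ne_zero _ hs
  rw [h.leadingTerm_twist hχ hi hD hs hr, evalQ_eq (norm_charPt_lt_one hχ s) hs' hdet]

end Twist

/-! ### Continuous characters of `ℤ_p` as analytic functions -/

section PadicExponential

open Filter NormedSpace

variable {p : ℕ} [Fact p.Prime]

theorem inv_norm_natCast_le {k : ℕ} (hk : k ≠ 0) : ‖(k : ℚ_[p])‖⁻¹ ≤ k := by
  have hp : (0 : ℝ) < p := by exact_mod_cast (Fact.out : p.Prime).pos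
  rw [Padic.norm_eq_zpow_neg_valuation (Nat.cast_ne_zero.2 hk), Padic.valuation_natCast, zpow_neg,
    inv_inv, zpow_natCast]
  exact_mod_cast Nat.le_of_dvd (Nat.pos_of_ne_zero hk) pow_padicValNat_dvd

/-- The crude bound v_p(k!) ≤ k suffices for a positive radius of convergence of the exponential. -/
theorem inv_norm_factorial_le (k : ℕ) : ‖((Nat.factorial k : ℕ) : ℚ_[p])‖⁻¹ ≤ (p : ℝ) ^ k := by
  rw [Padic.norm_eq_zpow_neg_valuation (Nat.cast_ne_zero.2 (Nat.factorial_ne_zero k)),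
    Padic.valuation_natCast, zpow_neg, inv_inv, zpow_natCast]
  exact pow_le_pow_right₀ (by exact_mod_cast (Fact.out : p.Prime).one_lt.le)
    (padicValNat_factorial_le p k)

theorem expSeries_padic_radius_pos : 0 < (expSeries ℚ_[p] ℚ_[p]).radius := by
  have hp : (0 : ℝ) < p := by exact_mod_cast (Fact.out : p.Prime).pos
  let r : NNReal := ⟨(p : ℝ)⁻¹, by positivity⟩
  have hr : 0 < r := by
    change (0 : ℝ) < (p : ℝ)⁻¹
    positivity
  refine lt_of_lt_of_le (ENNReal.coe_pos.2 hr)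
    (FormalMultilinearSeries.le_radius_of_bound _ 1 fun k => ?_)
  have h : ‖expSeries ℚ_[p] ℚ_[p] k‖ ≤ (p : ℝ) ^ k := by
    rw [expSeries, norm_smul, norm_inv, ContinuousMultilinearMap.norm_mkPiAlgebraFin, mul_one]
    exact inv_norm_factorial_le k
  calc ‖expSeries ℚ_[p] ℚ_[p] k‖ * (r : ℝ) ^ k ≤ (p : ℝ) ^ k * ((p : ℝ)⁻¹) ^ k := by
        gcongr
        exact le_rfl
    _ = 1 := by rw [← mul_pow, mul_inv_cancel₀ hp.ne', one_pow]

theorem eventually_exp_natCast_mul :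
    ∀ᶠ x : ℚ_[p] in 𝓝 0, ∀ k : ℕ, exp ((k : ℚ_[p]) * x) = exp x ^ k := by
  filter_upwards [Metric.eball_mem_nhds 0 (expSeries_padic_radius_pos (p := p))] with x hx k
  have hmem : ∀ k : ℕ, (k : ℚ_[p]) * x ∈ Metric.eball 0 (expSeries ℚ_[p] ℚ_[p]).radius := by
    intro k
    refine Metric.mem_eball.2 (lt_of_le_of_lt ?_ (Metric.mem_eball.1 hx))
    rw [edist_zero_right, edist_zero_right]
    refine enorm_le_iff_norm_le.2 ?_
    rw [norm_mul]
    exact mul_le_of_le_one_left (norm_nonneg _) (Padic.norm_int_le_one (k : ℤ))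
  induction k with
  | zero => simp
  | succ k ih => rw [Nat.cast_succ, add_mul, one_mul, exp_add_of_mem_ball (hmem k) hx, ih, pow_succ]

/-- With y = v − 1 one has v^p − 1 = py + wy² for an integral w, and |y| < 1/p makes the linear term
dominate. -/
theorem norm_pow_prime_sub_one {v : ℚ_[p]} (hv : ‖v - 1‖ < (p : ℝ)⁻¹) :
    ‖v ^ p - 1‖ = (p : ℝ)⁻¹ * ‖v - 1‖ := by
  have hp1 : (p : ℝ)⁻¹ < 1 :=
    inv_lt_one_of_one_lt₀ (by exact_mod_cast (Fact.out : p.Prime).one_lt)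
  by_cases h0 : v - 1 = 0
  · rw [sub_eq_zero.1 h0]; simp
  let y : ℤ_[p] := ⟨v - 1, (hv.trans hp1).le⟩
  obtain ⟨w, hw⟩ := Polynomial.powAddExpansion 1 y p
  have hw' : v ^ p - 1 = p * (v - 1) + w * (v - 1) ^ 2 := by
    have h := congrArg (fun z : ℤ_[p] => (z : ℚ_[p])) hw
    simp only [one_pow, mul_one] at h
    push_cast at h
    have hy : ((y : ℤ_[p]) : ℚ_[p]) = v - 1 := rfl
    rw [hy, add_sub_cancel] at h
    rw [h]
    ring
  have h1 : ‖(p : ℚ_[p]) * (v - 1)‖ = (p : ℝ)⁻¹ * ‖v - 1‖ := by rw [norm_mul, Padic.norm_p]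
  have h2 : ‖(w : ℚ_[p]) * (v - 1) ^ 2‖ < (p : ℝ)⁻¹ * ‖v - 1‖ := by
    rw [norm_mul, norm_pow, sq]
    refine lt_of_le_of_lt (mul_le_of_le_one_left (by positivity) w.2) ?_
    exact mul_lt_mul_of_pos_right hv (norm_pos_iff.2 h0)
  rw [hw', IsUltrametricDist.norm_add_eq_max_of_norm_ne_norm (by rw [h1]; exact h2.ne'), h1,
    max_eq_left h2.le]

theorem norm_pow_prime_pow_sub_one {v : ℚ_[p]} (hv : ‖v - 1‖ < (p : ℝ)⁻¹) (m : ℕ) :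
    ‖v ^ p ^ m - 1‖ = (p : ℝ)⁻¹ ^ m * ‖v - 1‖ := by
  have hp1 : (p : ℝ)⁻¹ ≤ 1 :=
    (inv_lt_one_of_one_lt₀ (by exact_mod_cast (Fact.out : p.Prime).one_lt)).le
  induction m with
  | zero => simp
  | succ m ih =>
    have h : ‖v ^ p ^ m - 1‖ < (p : ℝ)⁻¹ := by
      rw [ih]
      exact lt_of_le_of_lt (mul_le_of_le_one_left (norm_nonneg _)
        (pow_le_one₀ (by positivity) hp1)) hv
    rw [pow_succ, pow_mul, norm_pow_prime_sub_one h, ih, pow_succ]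
    ring

/-- A function with derivative zero at `0` that is compatible with multiplication by natural
numbers as a homomorphism is trivial near `0`. -/
theorem eventually_eq_one_of_hasDerivAt {ψ : ℚ_[p] → ℚ_[p]} (hψ0 : ψ 0 = 1)
    (hd : HasDerivAt ψ 0 0) (hpow : ∀ᶠ s in 𝓝 0, ∀ k : ℕ, ψ ((k : ℚ_[p]) * s) = ψ s ^ k) :
    ∀ᶠ s in 𝓝 0, ψ s = 1 := by
  have hp : (0 : ℝ) < p := by exact_mod_cast (Fact.out : p.Prime).pos
  have hc : ∀ᶠ s in 𝓝 0, ‖ψ s - 1‖ < (p : ℝ)⁻¹ := by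
    have h : Tendsto (fun s => ‖ψ s - 1‖) (𝓝 0) (𝓝 0) := by
      have := (hd.continuousAt.tendsto.sub_const 1).norm
      rwa [hψ0, sub_self, norm_zero] at this
    exact h.eventually_lt_const (by positivity)
  filter_upwards [hpow, hc] with s hs hs'
  have hlim : Tendsto (fun m : ℕ => (((p ^ m : ℕ) : ℚ_[p]) * s)) atTop (𝓝 0) := by
    have h := (tendsto_pow_atTop_nhds_zero_of_norm_lt_one (Padic.norm_p_lt_one (p := p))).mul_const s
    rw [zero_mul] at h
    simpa only [Nat.cast_pow] using h
  have ho := (hasDerivAt_iff_isLittleO.1 hd).comp_tendsto hlim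
  simp only [Function.comp_def, sub_zero, smul_zero, hψ0] at ho
  by_contra hne
  have hpos : 0 < ‖ψ s - 1‖ := norm_pos_iff.2 (sub_ne_zero.2 hne)
  have hs0 : 0 < ‖s‖ := by
    refine norm_pos_iff.2 fun h => hne ?_
    rw [h, hψ0]
  -- Along p^m·s the distance of ψ from 1 is exactly p^(−m)·|ψ(s) − 1|, which decays only linearly.
  -- The constant is chosen so that the little-o bound would be half of this.
  obtain ⟨m, hm⟩ := (ho.def (c := ‖ψ s - 1‖ / (2 * ‖s‖)) (by positivity)).exists
  rw [hs, norm_pow_prime_pow_sub_one hs', Nat.cast_pow, norm_mul, norm_pow, Padic.norm_p] at hm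
  have h2 : ‖ψ s - 1‖ / (2 * ‖s‖) * ((p : ℝ)⁻¹ ^ m * ‖s‖) = (p : ℝ)⁻¹ ^ m * ‖ψ s - 1‖ / 2 := by
    field_simp
  rw [h2] at hm
  have h3 : 0 < (p : ℝ)⁻¹ ^ m * ‖ψ s - 1‖ := by positivity
  linarith

end PadicExponential

/-! ### Derivative and analyticity of a character at 0 -/

section PadicCharacters

open Filter NormedSpace PowerSeries

variable {p : ℕ} [Fact p.Prime]

/-- The identity on `ℤ_p`, extended by zero to `ℚ_p`. -/
def clampInt (s : ℚ_[p]) : ℤ_[p] := if h : ‖s‖ ≤ 1 then ⟨s, h⟩ else 0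

theorem clampInt_of_norm_le_one {s : ℚ_[p]} (h : ‖s‖ ≤ 1) : clampInt s = ⟨s, h⟩ := dif_pos h

theorem coe_clampInt {s : ℚ_[p]} (h : ‖s‖ ≤ 1) : (clampInt s : ℚ_[p]) = s := by
  rw [clampInt_of_norm_le_one h]

@[simp]
theorem clampInt_coe (z : ℤ_[p]) : clampInt (z : ℚ_[p]) = z := clampInt_of_norm_le_one z.2

@[simp]
theorem clampInt_zero : clampInt (0 : ℚ_[p]) = 0 := clampInt_coe 0

theorem eventually_norm_le_one : ∀ᶠ s : ℚ_[p] in 𝓝 0, ‖s‖ ≤ 1 := by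
  filter_upwards [Metric.ball_mem_nhds (0 : ℚ_[p]) one_pos] with s hs
  exact (mem_ball_zero_iff.1 hs).le

theorem continuousAt_clampInt : ContinuousAt (clampInt (p := p)) 0 := by
  rw [ContinuousAt, clampInt_zero, tendsto_zero_iff_norm_tendsto_zero]
  refine squeeze_zero' (Eventually.of_forall fun _ => norm_nonneg _) ?_
    (tendsto_norm_zero (E := ℚ_[p]))
  filter_upwards [eventually_norm_le_one] with s hs
  rw [clampInt_of_norm_le_one hs]
  exact le_rfl

/-- A homomorphism `ℤ_p → ℤ_p^×` as a function on a neighbourhood of `0` in `ℚ_p`. -/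
def charFun (ψ : Multiplicative ℤ_[p] →* ℤ_[p]ˣ) (s : ℚ_[p]) : ℚ_[p] :=
  ((ψ (Multiplicative.ofAdd (clampInt s)) : ℤ_[p]ˣ) : ℤ_[p])

variable {ψ : Multiplicative ℤ_[p] →* ℤ_[p]ˣ}

theorem charFun_zero : charFun ψ 0 = 1 := by simp [charFun]

theorem eventually_charFun_natCast_mul :
    ∀ᶠ s : ℚ_[p] in 𝓝 0, ∀ k : ℕ, charFun ψ ((k : ℚ_[p]) * s) = charFun ψ s ^ k := by
  filter_upwards [eventually_norm_le_one] with s hs k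
  have h : (k : ℚ_[p]) * s = (((k : ℤ_[p]) * clampInt s : ℤ_[p]) : ℚ_[p]) := by
    rw [PadicInt.coe_mul, PadicInt.coe_natCast, coe_clampInt hs]
  rw [charFun, charFun, h, clampInt_coe, ← nsmul_eq_mul, ofAdd_nsmul, map_pow,
    Units.val_pow_eq_pow_val, PadicInt.coe_pow]

theorem succ_mul_choose_succ (z : ℤ_[p]) (k : ℕ) :
    ((k : ℤ_[p]) + 1) * Ring.choose z (k + 1) = z * Ring.choose (z - 1) k := by
  have h := Ring.choose_smul_choose z (Nat.le_add_left 1 k)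
  rw [Nat.choose_one_right, nsmul_eq_mul, Ring.choose_one_right, Nat.cast_one,
    Nat.add_sub_cancel] at h
  exact_mod_cast h

theorem choose_neg_one (k : ℕ) : Ring.choose (-1 : ℤ_[p]) k = (-1) ^ k := by
  rw [Ring.choose_neg', Ring.multichoose_one, Int.negOnePow_def, Units.smul_def]
  simp

/-- The difference quotient of a character at `0`, as a function on `ℤ_p`. -/
def charSlope (x : ℚ_[p]) (z : ℤ_[p]) : ℚ_[p] :=
  ∑' k : ℕ, (Ring.choose (z - 1) k : ℤ_[p]) * x ^ (k + 1) / ((k : ℚ_[p]) + 1)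

theorem norm_charSlope_term_le (x : ℚ_[p]) (w : ℤ_[p]) (k : ℕ) :
    ‖(w : ℚ_[p]) * x ^ (k + 1) / ((k : ℚ_[p]) + 1)‖ ≤ ((k + 1 : ℕ) : ℝ) * ‖x‖ ^ (k + 1) := by
  rw [norm_div, norm_mul, norm_pow, div_eq_mul_inv, mul_comm]
  have h := inv_norm_natCast_le (p := p) k.succ_ne_zero
  rw [Nat.succ_eq_add_one, Nat.cast_succ] at h
  exact mul_le_mul h (mul_le_of_le_one_left (pow_nonneg (norm_nonneg _) _) w.2)
    (mul_nonneg (norm_nonneg _) (pow_nonneg (norm_nonneg _) _)) (by positivity)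

theorem summable_charSlope_bound {x : ℚ_[p]} (hx : ‖x‖ < 1) :
    Summable fun k : ℕ => ((k + 1 : ℕ) : ℝ) * ‖x‖ ^ (k + 1) := by
  have h := summable_pow_mul_geometric_of_norm_lt_one 1 (r := ‖x‖) (by rwa [norm_norm])
  have h' := (summable_nat_add_iff 1).2 h
  simpa using h'

theorem continuous_charSlope {x : ℚ_[p]} (hx : ‖x‖ < 1) : Continuous (charSlope x) := by
  refine continuous_tsum (fun k => ?_) (summable_charSlope_bound hx)
    (fun k z => norm_charSlope_term_le x _ k)
  exact ((continuous_padicInt_coe.comp ((PadicInt.continuous_choose k).comp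
    (continuous_id.sub continuous_const))).mul continuous_const).div_const _

theorem charSlope_zero (u : ℤ_[p]) : charSlope ((u : ℚ_[p]) - 1) 0 = padicLog u := by
  rw [charSlope, padicLog]
  refine tsum_congr fun k => ?_
  rw [zero_sub, choose_neg_one, PadicInt.coe_pow, PadicInt.coe_neg, PadicInt.coe_one]

/-- In the expansion ψ(z) = ∑ C(z,k)x^k with x = ψ(1) − 1, the identity (k+1)·C(z,k+1) = z·C(z−1,k)
extracts a factor z. At z = 0 the remaining sum is the logarithm, as C(−1,k) = (−1)^k. -/
theorem char_sub_one_eq (hψ : Continuous ψ) (z : ℤ_[p]) :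
    (((ψ (Multiplicative.ofAdd z) : ℤ_[p]ˣ) : ℤ_[p]) : ℚ_[p]) - 1 =
      z * charSlope ((((ψ (Multiplicative.ofAdd 1) : ℤ_[p]ˣ) : ℤ_[p]) : ℚ_[p]) - 1) z := by
  set x : ℚ_[p] := (((ψ (Multiplicative.ofAdd 1) : ℤ_[p]ˣ) : ℤ_[p]) : ℚ_[p]) - 1 with hx
  have hx1 : ‖x‖ < 1 := by
    have h := norm_char_sub_one_lt_one ψ hψ (Multiplicative.ofAdd 1)
    rw [PadicInt.norm_def] at h
    exact_mod_cast h
  have h1 := evalSeries_binomialSeries (L := ℚ_[p]) ψ hψ hx1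
    (by rw [hx, add_sub_cancel]; rfl) z
  have h2 := (summable_norm_evalSeries (binomialSeries (IntRing ℚ_[p]) z) hx1).of_norm
  rw [evalSeries, h2.tsum_eq_zero_add] at h1
  have h3 : ∀ k, ((coeff k (binomialSeries (IntRing ℚ_[p]) z) : IntRing ℚ_[p]) : ℚ_[p]) =
      (Ring.choose z k : ℤ_[p]) := fun k => by
    rw [binomialSeries_coeff, ← Algebra.algebraMap_eq_smul_one]
    rfl
  simp only [h3, Ring.choose_zero_right, PadicInt.coe_one, pow_zero, mul_one] at h1
  have h1' : (((ψ (Multiplicative.ofAdd z) : ℤ_[p]ˣ) : ℤ_[p]) : ℚ_[p]) - 1 =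
      ∑' k : ℕ, ((Ring.choose z (k + 1) : ℤ_[p]) : ℚ_[p]) * x ^ (k + 1) :=
    sub_eq_iff_eq_add'.2 h1.symm
  rw [h1', charSlope, ← tsum_mul_left]
  refine tsum_congr fun k => ?_
  have hk : ((k : ℚ_[p]) + 1) ≠ 0 := Nat.cast_add_one_ne_zero k
  have h4 : ((k : ℚ_[p]) + 1) * (Ring.choose z (k + 1) : ℤ_[p]) =
      z * (Ring.choose (z - 1) k : ℤ_[p]) := by
    have h := congrArg PadicInt.Coe.ringHom (succ_mul_choose_succ z k)
    rwa [map_mul, map_mul, map_add, map_natCast, map_one] at h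
  rw [eq_comm, mul_div_assoc', div_eq_iff hk, ← mul_assoc, ← h4]
  ring

theorem hasDerivAt_charFun (hψ : Continuous ψ) :
    HasDerivAt (charFun ψ) (padicLog ((ψ (Multiplicative.ofAdd 1) : ℤ_[p]ˣ) : ℤ_[p])) 0 := by
  rw [hasDerivAt_iff_tendsto_slope_zero, ← charSlope_zero]
  set x : ℚ_[p] := (((ψ (Multiplicative.ofAdd 1) : ℤ_[p]ˣ) : ℤ_[p]) : ℚ_[p]) - 1 with hx
  have hx1 : ‖x‖ < 1 := by
    have h := norm_char_sub_one_lt_one ψ hψ (Multiplicative.ofAdd 1)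
    rw [PadicInt.norm_def] at h
    exact_mod_cast h
  have h : Tendsto (fun s => charSlope x (clampInt s)) (𝓝 0) (𝓝 (charSlope x 0)) := by
    have := ((continuous_charSlope hx1).tendsto (clampInt 0)).comp continuousAt_clampInt
    rwa [clampInt_zero] at this
  refine (h.mono_left nhdsWithin_le_nhds).congr' ?_
  filter_upwards [self_mem_nhdsWithin, nhdsWithin_le_nhds eventually_norm_le_one] with s hs hs1
  rw [zero_add, charFun_zero, charFun, char_sub_one_eq hψ, coe_clampInt hs1, smul_eq_mul,
    inv_mul_cancel_left₀ hs]

/-- The product ψ(s)·exp(−cs) is compatible with natural multiples of s near 0 and has derivative 0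
there, so it is 1 near 0. -/
theorem charFun_eventuallyEq (hψ : Continuous ψ) :
    charFun ψ =ᶠ[𝓝 0] fun s =>
      (exp (-(padicLog ((ψ (Multiplicative.ofAdd 1) : ℤ_[p]ˣ) : ℤ_[p])) * s))⁻¹ := by
  set c := padicLog ((ψ (Multiplicative.ofAdd 1) : ℤ_[p]ˣ) : ℤ_[p]) with hc
  have he : HasDerivAt (fun s : ℚ_[p] => exp (-c * s)) (-c) 0 := by
    have h1 : HasDerivAt (exp : ℚ_[p] → ℚ_[p]) 1 (-c * 0) := by
      rw [mul_zero]
      exact hasDerivAt_exp_zero_of_radius_pos expSeries_padic_radius_pos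
    have h2 := h1.comp (0 : ℚ_[p]) ((hasDerivAt_id (0 : ℚ_[p])).const_mul (-c))
    rwa [mul_one, one_mul] at h2
  have hd : HasDerivAt (fun s => charFun ψ s * exp (-c * s)) 0 0 := by
    have h := (hasDerivAt_charFun hψ).mul he
    rw [mul_zero, exp_zero, charFun_zero, mul_one, one_mul, add_neg_cancel] at h
    exact h
  have hlim : Tendsto (fun s : ℚ_[p] => -c * s) (𝓝 0) (𝓝 0) := by
    have := (continuous_const_mul (-c)).tendsto (0 : ℚ_[p])
    rwa [mul_zero] at this
  have key := eventually_eq_one_of_hasDerivAt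
    (by rw [charFun_zero, mul_zero, exp_zero, one_mul]) hd (by
      filter_upwards [eventually_charFun_natCast_mul (ψ := ψ),
        hlim.eventually eventually_exp_natCast_mul] with s h1 h2 k
      rw [h1, mul_pow, ← h2, mul_left_comm])
  filter_upwards [key] with s hs
  exact eq_inv_of_mul_eq_one_left hs

theorem analyticAt_charFun (hψ : Continuous ψ) : AnalyticAt ℚ_[p] (charFun ψ) 0 := by
  refine AnalyticAt.congr ?_ (charFun_eventuallyEq hψ).symm
  refine AnalyticAt.inv (AnalyticAt.comp' ?_ (analyticAt_const.mul analyticAt_id)) ?_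
  · simp only [id, mul_zero]
    exact (hasFPowerSeriesAt_exp_zero_of_radius_pos expSeries_padic_radius_pos).analyticAt
  · rw [mul_zero, exp_zero]
    exact one_ne_zero

/-- If the logarithm vanished, ψ would be 1 near 0, hence on p^m ℤ_p for some m, and then ψ^(p^m) =
1. -/
theorem padicLog_ne_zero (hψ : Continuous ψ) (hinf : ∀ m : ℕ, 0 < m → ψ ^ m ≠ 1) :
    padicLog ((ψ (Multiplicative.ofAdd 1) : ℤ_[p]ˣ) : ℤ_[p]) ≠ 0 := by
  intro h0
  have h := charFun_eventuallyEq hψ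
  rw [h0] at h
  simp only [neg_zero, zero_mul, exp_zero, inv_one] at h
  obtain ⟨ε, hε, hball⟩ := Metric.eventually_nhds_iff_ball.1 h
  obtain ⟨m, hm⟩ := exists_pow_lt_of_lt_one hε (Padic.norm_p_lt_one (p := p))
  refine hinf (p ^ m) (pow_pos (Fact.out : p.Prime).pos m) (MonoidHom.ext fun z => ?_)
  have hz := hball (((p : ℤ_[p]) ^ m * z.toAdd : ℤ_[p]) : ℚ_[p]) (by
    rw [mem_ball_zero_iff, PadicInt.coe_mul, norm_mul, PadicInt.coe_pow, PadicInt.coe_natCast,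
      norm_pow]
    exact lt_of_le_of_lt (mul_le_of_le_one_right (by positivity) z.toAdd.2) hm)
  rw [charFun, clampInt_coe, ← Nat.cast_pow, ← nsmul_eq_mul, ofAdd_nsmul, map_pow] at hz
  refine Units.ext (Subtype.ext ?_)
  exact hz

end PadicCharacters

/-! ### Leading coefficients of functions of the form `s ↦ f(χ(γ)^s - 1)` -/

section EvaluationNearZero

open Filter PowerSeries

variable {p : ℕ} [Fact p.Prime] {L : Type*} [NormedField L] [IsUltrametricDist L]
  [NormedAlgebra ℚ_[p] L]

theorem evalSeries_zero (g : (IntRing L)⟦X⟧) :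
    evalSeries g 0 = ((constantCoeff g : IntRing L) : L) := by
  rw [evalSeries, tsum_eq_single 0]
  · simp
  · intro k hk; simp [hk]

variable (p) in
theorem analyticAt_evalSeries [CompleteSpace L] (g : (IntRing L)⟦X⟧) :
    AnalyticAt ℚ_[p] (evalSeries g) 0 := by
  -- The series is analytic over L; analyticity over ℚ_p follows by restriction of scalars.
  letI : NontriviallyNormedField L :=
    { ‹NormedField L› with
      non_trivial := by
        obtain ⟨x, hx⟩ := NormedField.exists_one_lt_norm ℚ_[p]
        exact ⟨algebraMap ℚ_[p] L x, by rwa [norm_algebraMap']⟩ }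
  have h : HasFPowerSeriesAt (evalSeries g)
      (FormalMultilinearSeries.ofScalars L fun k => ((coeff k g : IntRing L) : L)) 0 := by
    rw [hasFPowerSeriesAt_iff]
    filter_upwards [Metric.ball_mem_nhds (0 : L) one_pos] with t ht
    rw [zero_add]
    simp only [FormalMultilinearSeries.coeff_ofScalars, smul_eq_mul, mul_comm (t ^ _)]
    exact (summable_norm_evalSeries g (mem_ball_zero_iff.1 ht)).of_norm.hasSum
  exact (AnalyticAt.restrictScalars (𝕜 := ℚ_[p]) ⟨_, h⟩)

theorem exists_eq_X_pow_mul {W : Type*} [CommRing W] {g : W⟦X⟧} (hg : g ≠ 0) :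
    ∃ (m : ℕ) (g' : W⟦X⟧), constantCoeff g' ≠ 0 ∧ g = X ^ m * g' := by
  obtain ⟨g', hg'⟩ := X_pow_order_dvd (φ := g)
  have h1 := coeff_order hg
  generalize g.order.toNat = m at h1 hg'
  refine ⟨m, g', fun h => h1 ?_, hg'⟩
  rw [hg', coeff_X_pow_mul', if_pos le_rfl, Nat.sub_self, coeff_zero_eq_constantCoeff_apply, h]

/-- Comparison of X-adic orders and leading coefficients. That ℓ ≠ 0 is a consequence, because the
left side is nonzero. -/
theorem eq_and_constantCoeff_eq {K : Type*} [Field K] {m m' : ℕ} {P V : K⟦X⟧} {ℓ : K}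
    (hP : constantCoeff P ≠ 0) (hV : constantCoeff V ≠ 0)
    (h : X ^ m * P = X ^ m' * (C ℓ * V)) : m = m' ∧ constantCoeff P = ℓ * constantCoeff V := by
  have hℓ : ℓ ≠ 0 := by
    rintro rfl
    rw [map_zero, zero_mul, mul_zero] at h
    have h1 := (mul_eq_zero.1 h).resolve_left (pow_ne_zero _ X_ne_zero)
    exact hP (by rw [h1, map_zero])
  have hQ : constantCoeff (C ℓ * V) ≠ 0 := by
    rw [map_mul, constantCoeff_C]
    exact mul_ne_zero hℓ hV
  have hm : m = m' := by
    rw [← coeff_zero_eq_constantCoeff_apply] at hP hQ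
    have h1 := congrArg (coeff m) h
    have h2 := congrArg (coeff m') h
    rw [coeff_X_pow_mul', coeff_X_pow_mul', if_pos le_rfl, Nat.sub_self] at h1 h2
    refine le_antisymm ?_ ?_
    · by_contra hlt
      rw [if_neg hlt] at h2
      exact hQ h2.symm
    · by_contra hlt
      rw [if_neg hlt] at h1
      exact hP h1
  subst hm
  refine ⟨rfl, ?_⟩
  have h3 := mul_left_cancel₀ (pow_ne_zero m X_ne_zero) h
  rw [h3, map_mul, constantCoeff_C]

theorem evalSeries_X_pow_mul [CompleteSpace L] (m : ℕ) (g : (IntRing L)⟦X⟧) {t : L}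
    (ht : ‖t‖ < 1) : evalSeries (X ^ m * g) t = t ^ m * evalSeries g t := by
  rw [← evalHom_apply t ht, map_mul, map_pow, evalHom_apply, evalHom_apply, evalSeries_X]

/-- In the Leibniz formula only the term with all m derivatives on s^m survives at 0. -/
theorem iteratedDeriv_pow_smul {𝕜 E : Type*} [NontriviallyNormedField 𝕜] [NormedAddCommGroup E]
    [NormedSpace 𝕜 E] [CompleteSpace E] {G : 𝕜 → E} (hG : AnalyticAt 𝕜 G 0) (m : ℕ) :
    iteratedDeriv m (fun s => s ^ m • G s) 0 = (Nat.factorial m : 𝕜) • G 0 := by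
  have h := iteratedDerivWithin_smul (n := m) (Set.mem_univ (0 : 𝕜)) uniqueDiffOn_univ
    (f := fun s : 𝕜 => s ^ m) (g := G) (contDiff_id.pow m).contDiffAt.contDiffWithinAt
    hG.contDiffAt.contDiffWithinAt
  simp only [iteratedDerivWithin_univ, iteratedDeriv_fun_pow_zero] at h
  refine h.trans ?_
  rw [Finset.sum_eq_single m]
  · simp
  · intro i hi hne
    simp [hne]
  · intro h; simp at h

variable {t : ℚ_[p] → L} {c : L}

/-- An analytic function `t` with `t(0) = 0` is `s` times an analytic function with value `t'(0)`. -/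
theorem exists_eq_smul_of_hasDerivAt (ht : AnalyticAt ℚ_[p] t 0) (ht0 : t 0 = 0)
    (hd : HasDerivAt t c 0) :
    ∃ τ : ℚ_[p] → L, AnalyticAt ℚ_[p] τ 0 ∧ τ 0 = c ∧ ∀ᶠ s in 𝓝 0, t s = s • τ s := by
  have h1 : ((1 : ℕ) : ℕ∞) ≤ analyticOrderAt t 0 := by
    rw [Nat.cast_one, ENat.one_le_iff_ne_zero, Ne, analyticOrderAt_eq_zero]
    rintro (h | h)
    · exact h ht
    · exact h ht0
  obtain ⟨τ, hτ, h⟩ := (natCast_le_analyticOrderAt ht).1 h1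
  simp only [sub_zero, pow_one] at h
  refine ⟨τ, hτ, ?_, h⟩
  have hd' : HasDerivAt (fun s : ℚ_[p] => s • τ s) (τ 0) 0 := by
    have := (hasDerivAt_id (0 : ℚ_[p])).smul hτ.differentiableAt.hasDerivAt
    rw [id, zero_smul, one_smul, zero_add] at this
    exact this
  exact (hd'.congr_of_eventuallyEq h).unique hd

theorem eventually_ne_zero_of_hasDerivAt (ht : AnalyticAt ℚ_[p] t 0) (ht0 : t 0 = 0)
    (hd : HasDerivAt t c 0) (hc : c ≠ 0) : ∀ᶠ s in 𝓝[≠] 0, t s ≠ 0 := by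
  obtain ⟨τ, hτ, hτ0, h⟩ := exists_eq_smul_of_hasDerivAt ht ht0 hd
  have h1 := hτ.continuousAt.eventually_ne (hτ0 ▸ hc)
  filter_upwards [nhdsWithin_le_nhds h, nhdsWithin_le_nhds h1, self_mem_nhdsWithin] with s h2 h3 h4
  rw [h2]
  exact smul_ne_zero h4 h3

theorem eventually_evalSeries_ne_zero [CompleteSpace L] (ht : AnalyticAt ℚ_[p] t 0) (ht0 : t 0 = 0)
    {g : (IntRing L)⟦X⟧} (hg : constantCoeff g ≠ 0) : ∀ᶠ s in 𝓝 0, evalSeries g (t s) ≠ 0 := by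
  have h : AnalyticAt ℚ_[p] (fun s => evalSeries g (t s)) 0 :=
    AnalyticAt.comp' (by rw [ht0]; exact analyticAt_evalSeries p g) ht
  refine h.continuousAt.eventually_ne ?_
  rw [ht0, evalSeries_zero]
  exact fun h => hg (Subtype.ext h)

theorem eventually_evalSeries_ne_zero_of_ne_zero [CompleteSpace L] (ht : AnalyticAt ℚ_[p] t 0)
    (ht0 : t 0 = 0) (hd : HasDerivAt t c 0) (hc : c ≠ 0) {g : (IntRing L)⟦X⟧} (hg : g ≠ 0) :
    ∀ᶠ s in 𝓝[≠] 0, evalSeries g (t s) ≠ 0 := by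
  obtain ⟨m, g', hg', rfl⟩ := exists_eq_X_pow_mul hg
  have hn : ∀ᶠ s in 𝓝 0, ‖t s‖ < 1 := by
    have h := ht.continuousAt.norm
    rw [ContinuousAt, ht0, norm_zero] at h
    exact h.eventually_lt_const one_pos
  filter_upwards [nhdsWithin_le_nhds (eventually_evalSeries_ne_zero ht ht0 hg'),
    nhdsWithin_le_nhds hn, eventually_ne_zero_of_hasDerivAt ht ht0 hd hc] with s h1 h2 h3
  rw [evalSeries_X_pow_mul m g' h2]
  exact mul_ne_zero (pow_ne_zero _ h3) h1

variable [CompleteSpace L] {f : QField L} {m m' : ℕ} {g q : (IntRing L)⟦X⟧} {ℓ : L}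

/-- If `f = X^m g / X^{m'} q` with `q(0) ≠ 0`, then `f(t(s)) = s^{m - m'} G(s)` for an analytic
function `G` with `G(0) = t'(0)^{m - m'} g(0)/q(0)`. -/
theorem exists_evalQ_eq_zpow_smul (ht : AnalyticAt ℚ_[p] t 0) (ht0 : t 0 = 0)
    (hd : HasDerivAt t c 0) (hc : c ≠ 0) (hq : constantCoeff q ≠ 0)
    (hℓ : ((constantCoeff g : IntRing L) : L) = ℓ * ((constantCoeff q : IntRing L) : L))
    (hf : f * algebraMap _ (QField L) (X ^ m' * q) = algebraMap _ (QField L) (X ^ m * g)) :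
    ∃ G : ℚ_[p] → L, AnalyticAt ℚ_[p] G 0 ∧ G 0 = c ^ ((m : ℤ) - m') * ℓ ∧
      (∀ᶠ s in 𝓝[≠] 0, evalQ f (t s) = s ^ ((m : ℤ) - m') • G s) ∧
      ∀ k : ℕ, m = m' + k → ∀ᶠ s in 𝓝 0, evalQ f (t s) = s ^ k • G s := by
  obtain ⟨τ, hτ, hτ0, hts⟩ := exists_eq_smul_of_hasDerivAt ht ht0 hd
  have hev : ∀ g : (IntRing L)⟦X⟧, AnalyticAt ℚ_[p] (fun s => evalSeries g (t s)) 0 := fun g =>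
    AnalyticAt.comp' (by rw [ht0]; exact analyticAt_evalSeries p g) ht
  have hq' : evalSeries q (t 0) ≠ 0 := by
    rw [ht0, evalSeries_zero]
    exact fun h => hq (Subtype.ext h)
  have hn : ∀ᶠ s in 𝓝 0, ‖t s‖ < 1 := by
    have h := ht.continuousAt.norm
    rw [ContinuousAt, ht0, norm_zero] at h
    exact h.eventually_lt_const one_pos
  have hqs := eventually_evalSeries_ne_zero ht ht0 hq
  refine ⟨fun s => τ s ^ ((m : ℤ) - m') * (evalSeries g (t s) / evalSeries q (t s)),
    (hτ.zpow (hτ0 ▸ hc)).mul ((hev g).div (hev q) hq'), ?_, ?_, ?_⟩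
  · beta_reduce
    rw [hτ0, ht0, evalSeries_zero, evalSeries_zero, hℓ, mul_div_cancel_right₀]
    exact fun h => hq (Subtype.ext h)
  · filter_upwards [nhdsWithin_le_nhds hn, nhdsWithin_le_nhds hqs, nhdsWithin_le_nhds hts,
      self_mem_nhdsWithin, eventually_ne_zero_of_hasDerivAt ht ht0 hd hc] with s h1 h2 h3 h4 h5
    have h6 : evalSeries (X ^ m' * q) (t s) ≠ 0 := by
      rw [evalSeries_X_pow_mul m' q h1]
      exact mul_ne_zero (pow_ne_zero _ h5) h2
    rw [evalQ_eq h1 h6 hf, evalSeries_X_pow_mul m' q h1, evalSeries_X_pow_mul m g h1,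
      mul_div_mul_comm, ← zpow_natCast (t s), ← zpow_natCast (t s), ← zpow_sub₀ h5,
      Algebra.smul_def, ← mul_assoc, map_zpow₀, ← mul_zpow, ← Algebra.smul_def, ← h3]
  -- For a nonnegative order the identity must also hold at s = 0, where X^m'·q may vanish.
  -- Cancelling X^m' gives a presentation whose denominator is nonzero there.
  · rintro k rfl
    have hf' : f * algebraMap _ (QField L) q = algebraMap _ (QField L) (X ^ k * g) := by
      have hX : algebraMap (IntRing L)⟦X⟧ (QField L) (X ^ m') ≠ 0 := by
        rw [Ne, FaithfulSMul.algebraMap_eq_zero_iff]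
        exact pow_ne_zero _ X_ne_zero
      refine mul_left_cancel₀ hX ?_
      rw [← map_mul, ← mul_assoc (X ^ m') (X ^ k), ← pow_add, ← hf, map_mul]
      ring
    filter_upwards [hn, hqs, hts] with s h1 h2 h3
    have h4 : ((m' + k : ℕ) : ℤ) - m' = k := by push_cast; ring
    rw [evalQ_eq h1 h2 hf', evalSeries_X_pow_mul k g h1, h4, zpow_natCast, Algebra.smul_def,
      ← mul_assoc, map_pow, ← mul_pow, ← Algebra.smul_def, ← h3, mul_div_assoc]

end EvaluationNearZero

/-! ### From the X-expansion of f_ρ to the function of s -/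

section MainResult

open Filter PowerSeries

universe w

variable {p : ℕ} [Fact p.Prime] {G : Type*} [Group G] [TopologicalSpace G]
  {H : Subgroup G} [H.Normal] {e : (G ⧸ H) ≃ₜ* Multiplicative ℤ_[p]}
  {L : Type*} [NormedField L] [IsUltrametricDist L] [NormedAlgebra ℚ_[p] L]
  {n : ℕ} {χ : (G ⧸ H) →* ℤ_[p]ˣ}

theorem charPt_clampInt (s : ℚ_[p]) : charPt e L χ (clampInt s) =
    algebraMap ℚ_[p] L (charFun (χ.comp e.symm.toMulEquiv.toMonoidHom) s) - 1 := rfl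

theorem charPt_clampInt_zero : charPt e L χ (clampInt 0) = 0 := by
  rw [charPt_clampInt, charFun_zero, map_one, sub_self]

theorem continuous_comp_symm (hχ : Continuous χ) :
    Continuous (χ.comp e.symm.toMulEquiv.toMonoidHom) :=
  hχ.comp e.symm.continuous

theorem analyticAt_charPt (hχ : Continuous χ) :
    AnalyticAt ℚ_[p] (fun s => charPt e L χ (clampInt s)) 0 := by
  simp only [charPt_clampInt]
  exact AnalyticAt.sub (((algebraMapCLM ℚ_[p] L).analyticAt _).comp
    (analyticAt_charFun (continuous_comp_symm hχ))) analyticAt_const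

theorem hasDerivAt_charPt (hχ : Continuous χ) :
    HasDerivAt (fun s => charPt e L χ (clampInt s))
      (algebraMap ℚ_[p] L (padicLog ((charGammaPow e χ 1 : ℤ_[p]ˣ) : ℤ_[p]))) 0 := by
  simp only [charPt_clampInt]
  exact ((algebraMapCLM ℚ_[p] L).hasFDerivAt.comp_hasDerivAt _
    (hasDerivAt_charFun (continuous_comp_symm (e := e) hχ))).sub_const 1

theorem padicLog_charGammaPow_ne_zero (hχ : Continuous χ)
    (hinf : ∀ m : ℕ, 0 < m → χ ^ m ≠ 1) :
    algebraMap ℚ_[p] L (padicLog ((charGammaPow e χ 1 : ℤ_[p]ˣ) : ℤ_[p])) ≠ 0 := by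
  have key := padicLog_ne_zero (continuous_comp_symm (e := e) hχ) fun m hm h => hinf m hm (by
    refine MonoidHom.ext fun x => ?_
    have h' : χ (e.symm (e x)) ^ m = 1 := DFunLike.congr_fun h (e x)
    rw [ContinuousMulEquiv.symm_apply_apply] at h'
    exact h')
  exact (map_ne_zero (algebraMap ℚ_[p] L)).2 key

theorem tendsto_padicInt_coe_nhdsNE :
    Tendsto (fun z : ℤ_[p] => (z : ℚ_[p])) (𝓝[≠] 0) (𝓝[≠] 0) := by
  refine tendsto_nhdsWithin_of_tendsto_nhds_of_eventually_within _ ?_ ?_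
  · exact (continuous_padicInt_coe.tendsto' 0 0 rfl).mono_left nhdsWithin_le_nhds
  · filter_upwards [self_mem_nhdsWithin] with z hz h
    exact hz (Subtype.ext h)

variable {Φ : Lam p G →+* Matrix (Fin n) (Fin n) (IntRing L)⟦X⟧}
  {A : CochainComplex (ModuleCat.{w} (Lam p G)) ℤ}
  {ρ : G →* Matrix (Fin n) (Fin n) (IntRing L)} {a : Trivialization A}

theorem fL_eq {s : ℚ_[p]} (hs : ‖s‖ ≤ 1) :
    fL e ρ χ a s = evalQ (charElt e ρ a : QField L) (charPt e L χ (clampInt s)) := by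
  rw [fL, dif_pos hs, clampInt_of_norm_le_one hs]
  rfl

theorem IsGammaHom.eventually_isFiniteAt [FiniteDimensional ℚ_[p] L] [CompleteSpace L]
    (h : IsGammaHom e ρ Φ) (hρ : Continuous ρ) (hχ : Continuous χ)
    (hinf : ∀ m : ℕ, 0 < m → χ ^ m ≠ 1) (hA : IsPerfect A)
    (hAS : IsAcyclicAfter A (ringAct (toLoc (oreSetStar p H)))) (a : Trivialization A) :
    ∀ᶠ s : ℤ_[p] in 𝓝[≠] 0, IsFiniteAt (twist e ρ χ s) A ∧
      leadingTerm e (twist e ρ χ s) a = fL e ρ χ a s := by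
  obtain ⟨D, hD, hs⟩ := h.exists_denominator hρ hχ hA hAS a
  have h1 := eventually_evalSeries_ne_zero_of_ne_zero (analyticAt_charPt (e := e) (L := L) hχ)
    charPt_clampInt_zero (hasDerivAt_charPt hχ) (padicLog_charGammaPow_ne_zero hχ hinf) hD
  filter_upwards [tendsto_padicInt_coe_nhdsNE.eventually h1] with s h2
  rw [clampInt_coe] at h2
  rw [fL_eq s.2, clampInt_coe]
  exact hs s h2

/-- Powers of X are split off the numerator and denominator of f_ρ over 𝒪⟦X⟧, and the rest is
compared with the expansion over L⟦X⟧. The factors with constant term 1 affect neither order nor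
leading coefficient. -/
theorem IsGammaHom.exists_charElt_eq (h : IsGammaHom e ρ Φ) (hρ : Continuous ρ)
    [FiniteDimensional ℚ_[p] L] (hA : IsPerfect A)
    (hAS : IsAcyclicAfter A (ringAct (toLoc (oreSetStar p H)))) (hss : IsSemisimpleAt e ρ A)
    (a : Trivialization A) :
    ∃ (m m' : ℕ) (g q : (IntRing L)⟦X⟧), constantCoeff g ≠ 0 ∧ constantCoeff q ≠ 0 ∧
      rankAt e ρ A = (m : ℤ) - m' ∧ ((constantCoeff g : IntRing L) : L) =
        leadingTerm e ρ a * ((constantCoeff q : IntRing L) : L) ∧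
      (charElt e ρ a : QField L) * algebraMap _ (QField L) (X ^ m' * q) =
        algebraMap _ (QField L) (X ^ m * g) := by
  obtain ⟨r₁, r₂, U, U', hU, hU', hr, hgq⟩ := h.charElt_leading (a := a) hρ hA hAS hss
  obtain ⟨⟨g₀, q₀⟩, hf⟩ := IsLocalization.surj (nonZeroDivisors (IntRing L)⟦X⟧)
    (charElt e ρ a : QField L)
  simp only at hf
  have hq₀ : (q₀ : (IntRing L)⟦X⟧) ≠ 0 := nonZeroDivisors.coe_ne_zero q₀
  have hg₀ : g₀ ≠ 0 := by
    rintro rfl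
    rw [map_zero, mul_eq_zero, FaithfulSMul.algebraMap_eq_zero_iff] at hf
    exact hf.elim (charElt e ρ a).ne_zero hq₀
  generalize (q₀ : (IntRing L)⟦X⟧) = q₁ at hf hq₀
  obtain ⟨m, g, hg, rfl⟩ := exists_eq_X_pow_mul hg₀
  obtain ⟨m', q, hq, rfl⟩ := exists_eq_X_pow_mul hq₀
  have hmap : ∀ g : (IntRing L)⟦X⟧, constantCoeff (PowerSeries.map (IntRing L).subtype g) =
      ((constantCoeff g : IntRing L) : L) := fun g => by
    rw [← coeff_zero_eq_constantCoeff_apply, coeff_map, coeff_zero_eq_constantCoeff_apply]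
    rfl
  have key := hgq _ _ hf
  rw [map_mul, map_mul, map_pow, map_pow, map_X] at key
  have key' : X ^ (m + r₂) * (PowerSeries.map (IntRing L).subtype g * U) =
      X ^ (m' + r₁) * (C (leadingTerm e ρ a) * (PowerSeries.map (IntRing L).subtype q * U')) := by
    rw [pow_add, pow_add]
    linear_combination key
  obtain ⟨h1, h2⟩ := eq_and_constantCoeff_eq
    (by rw [map_mul, hU, mul_one, hmap]; exact fun h => hg (Subtype.ext h))
    (by rw [map_mul, hU', mul_one, hmap]; exact fun h => hq (Subtype.ext h)) key'
  rw [map_mul, map_mul, hU, hU', mul_one, mul_one, hmap, hmap] at h2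
  exact ⟨m, m', g, q, hg, hq, by rw [hr]; omega, h2, hf⟩

/-- The punctured identity suffices for the meromorphic order; the one that includes s = 0 is needed
for analyticity and derivatives. F(0) ≠ 0 because g(0) ≠ 0 forces the leading term to be nonzero. -/
theorem IsGammaHom.exists_fL_eq [FiniteDimensional ℚ_[p] L] [CompleteSpace L]
    (h : IsGammaHom e ρ Φ) (hρ : Continuous ρ) (hχ : Continuous χ)
    (hinf : ∀ m : ℕ, 0 < m → χ ^ m ≠ 1) (hA : IsPerfect A)
    (hAS : IsAcyclicAfter A (ringAct (toLoc (oreSetStar p H)))) (hss : IsSemisimpleAt e ρ A)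
    (a : Trivialization A) :
    ∃ F : ℚ_[p] → L, AnalyticAt ℚ_[p] F 0 ∧ F 0 ≠ 0 ∧
      F 0 = algebraMap ℚ_[p] L (padicLog ((charGammaPow e χ 1 : ℤ_[p]ˣ) : ℤ_[p])) ^ rankAt e ρ A *
        leadingTerm e ρ a ∧
      (∀ᶠ s in 𝓝[≠] 0, fL e ρ χ a s = s ^ rankAt e ρ A • F s) ∧
      (0 ≤ rankAt e ρ A → ∀ᶠ s in 𝓝 0, fL e ρ χ a s = s ^ (rankAt e ρ A).toNat • F s) := by
  obtain ⟨m, m', g, q, hg, hq, hr, hℓ, hf⟩ := h.exists_charElt_eq hρ hA hAS hss a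
  have hc := padicLog_charGammaPow_ne_zero (e := e) (L := L) hχ hinf
  obtain ⟨F, hF, hF0, hF1, hF2⟩ := exists_evalQ_eq_zpow_smul (analyticAt_charPt (e := e) (L := L) hχ)
    charPt_clampInt_zero (hasDerivAt_charPt hχ) hc hq hℓ hf
  rw [← hr] at hF0 hF1
  refine ⟨F, hF, ?_, hF0, ?_, fun h0 => ?_⟩
  · rw [hF0]
    refine mul_ne_zero (zpow_ne_zero _ hc) fun h0 => hg (Subtype.ext ?_)
    rw [hℓ, h0, zero_mul]
    rfl
  · filter_upwards [hF1, nhdsWithin_le_nhds eventually_norm_le_one] with s h1 h2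
    rw [fL_eq h2, h1]
  · filter_upwards [hF2 _ (show m = m' + (rankAt e ρ A).toNat by omega),
      eventually_norm_le_one] with s h1 h2
    rw [fL_eq h2, h1]

end MainResult

theorem order_and_trailingCoeff {𝕜 E : Type*} [NontriviallyNormedField 𝕜] [NormedAddCommGroup E]
    [NormedSpace 𝕜 E] {f F : 𝕜 → E} {r : ℤ} (hF : AnalyticAt 𝕜 F 0) (hF0 : F 0 ≠ 0)
    (h : ∀ᶠ s in 𝓝[≠] 0, f s = s ^ r • F s) :
    MeromorphicAt f 0 ∧ meromorphicOrderAt f 0 = (r : WithTop ℤ) ∧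
      meromorphicTrailingCoeffAt f 0 = F 0 := by
  have h' : f =ᶠ[𝓝[≠] 0] fun s => (s - 0) ^ r • F s := by
    simp only [sub_zero]
    exact h
  have hm : MeromorphicAt f 0 := by
    rw [MeromorphicAt.meromorphicAt_congr h']
    fun_prop
  exact ⟨hm, (meromorphicOrderAt_eq_int_iff hm).2 ⟨F, hF, hF0, h'⟩,
    hF.meromorphicTrailingCoeffAt_of_ne_zero_of_eq_nhdsNE hF0 h'⟩

end IwasawaDescent

end

theorem mainTheorem8 (p : ℕ) [Fact p.Prime]
    -- a compact `p`-adic Lie group `G`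
    {d : ℕ} {G : Type*} [Group G] [TopologicalSpace G] [IsTopologicalGroup G] [CompactSpace G]
    [ChartedSpace (Fin d → ℚ_[p]) G] [LieGroup 𝓘(ℚ_[p], Fin d → ℚ_[p]) ω G]
    -- `Γ = G/H ≅ ℤ_p`; the isomorphism `e` is the choice of the topological generator `γ = e⁻¹(1)`
    (H : Subgroup G) [H.Normal] (hH : IsClosed (H : Set G))
    (e : (G ⧸ H) ≃ₜ* Multiplicative ℤ_[p])
    -- a continuous character `χ : G → Γ → ℤ_p^×` of infinite order
    (χ : (G ⧸ H) →* ℤ_[p]ˣ) (hχ : Continuous χ) (hχ_inf : ∀ m : ℕ, 0 < m → χ ^ m ≠ 1)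
    -- a finite extension `L` of `ℚ_p` and a continuous representation `ρ : G → GL_n(O_L)`
    {L : Type*} [NormedField L] [IsUltrametricDist L] [NormedAlgebra ℚ_[p] L]
    [FiniteDimensional ℚ_[p] L] {n : ℕ}
    (ρ : G →* Matrix.GeneralLinearGroup (Fin n) (IwasawaDescent.IntRing L)) (hρ : Continuous ρ)
    -- a complex `A` in `Σ_{S^*}` and a morphism `a : 1 → d(A)`
    (A : CochainComplex (ModuleCat (IwasawaDescent.Lam p G)) ℤ) (hA : IwasawaDescent.IsPerfect A)
    (hAS : IwasawaDescent.IsAcyclicAfter A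
      (IwasawaDescent.ringAct (IwasawaDescent.toLoc (IwasawaDescent.oreSetStar p H))))
    (a : IwasawaDescent.Trivialization A) :
    let ρM : G → Matrix (Fin n) (Fin n) (IwasawaDescent.IntRing L) := fun g => (ρ g).1
    let F : ℚ_[p] → L := IwasawaDescent.fL e ρM χ a
    let r : ℤ := IwasawaDescent.rankAt e ρM A
    let c : L := algebraMap ℚ_[p] L
      (IwasawaDescent.padicLog ((IwasawaDescent.charGammaPow e χ 1 : ℤ_[p]ˣ) : ℤ_[p]))
    -- (i)
    (∀ᶠ s : ℤ_[p] in 𝓝[≠] 0,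
      IwasawaDescent.IsFiniteAt (IwasawaDescent.twist e ρM χ s) A ∧
      IwasawaDescent.leadingTerm e (IwasawaDescent.twist e ρM χ s) a = F s) ∧
    (IwasawaDescent.IsSemisimpleAt e ρM A →
      -- (ii)
      (MeromorphicAt F 0 ∧ meromorphicOrderAt F 0 = (r : WithTop ℤ) ∧
        meromorphicTrailingCoeffAt F 0 = c ^ r * IwasawaDescent.leadingTerm e ρM a) ∧
      -- (iii)
      (0 ≤ r → AnalyticAt ℚ_[p] F 0 ∧
        c ^ r * IwasawaDescent.leadingTerm e ρM a =
          ((Nat.factorial r.toNat : ℕ) : L)⁻¹ * iteratedDeriv r.toNat F 0)) := by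
  have := FiniteDimensional.complete ℚ_[p] L
  intro ρM F r c
  have hρ' : Continuous ((Units.coeHom _).comp ρ) := Units.continuous_val.comp hρ
  obtain ⟨Φ, h⟩ := IwasawaDescent.exists_isGammaHom e ((Units.coeHom _).comp ρ) hρ'
  refine ⟨h.eventually_isFiniteAt hρ' hχ hχ_inf hA hAS a, fun hss => ?_⟩
  obtain ⟨E, hE, hE0, hEval, hne, hnonneg⟩ := h.exists_fL_eq hρ' hχ hχ_inf hA hAS hss a
  obtain ⟨h1, h2, h3⟩ := IwasawaDescent.order_and_trailingCoeff hE hE0 hne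
  refine ⟨⟨h1, h2, h3.trans hEval⟩, fun hr => ?_⟩
  have hF := hnonneg hr
  refine ⟨((analyticAt_id.pow _).smul hE).congr (Filter.EventuallyEq.symm hF), ?_⟩
  -- Near 0, including 0 itself, F(s) = s^r·E(s), so the r-th derivative at 0 is r!·E(0).
  have hd : iteratedDeriv r.toNat F 0 = ((Nat.factorial r.toNat : ℕ) : ℚ_[p]) • E 0 :=
    (Filter.EventuallyEq.iteratedDeriv_eq _ hF).trans
      (IwasawaDescent.iteratedDeriv_pow_smul hE r.toNat)
  have hchar : CharZero L := charZero_of_injective_algebraMap (algebraMap ℚ_[p] L).injective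
  rw [hd, Algebra.smul_def, map_natCast,
    inv_mul_cancel_left₀ (Nat.cast_ne_zero.2 (Nat.factorial_ne_zero _))]
  exact hEval.symm
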